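/- **Setting.** Let $k\ge 3$ and let $\varphi = Q_1x_1\in X_1\,Q_2x_2\in X_2\cdots Q_kx_k\in X_k\;\psi(x_1,\dots,x_k)$ be a fixed first-order graph property: $Q_j\in\{\exists,\forall\}$ and $\psi$ is a quantifier-free formula over the atoms $E(x_a,x_b)$ and $x_a=x_b$. An input consists of a finite simple graph $G$ on the vertices $0,\dots,n-1$ with $m$ edges, given by a list of its edges, and of vertex sets $X_1,\dots,X_k$. Let $Q_1,\dots,Q_i$ be the maximal leading block of existential quantifiers. The search problem $R_\varphi$ asks for a tuple $(a_1,\dots,a_i)\in X_1\times\cdots\times X_i$ such that $Q_{i+1}x_{i+1}\in X_{i+1}\cdots Q_kx_k\in X_k\;\psi(a_1,\dots,a_i,x_{i+1},\dots,x_k)$ holds in $G$. A $(t_1,t_2)$ pseudo-deterministic proof for a search problem $R$ with canonization function $c$ consists of a randomized verifier $V$ with output in $\{\text{solutions}\}\cup\{\bot\}$ and a randomized honest prover $P$ that exchange words, where $V$ runs in time $t_1$ (against every prover) and $P$ in time $t_2$, and: for every input $x$ that has a solution, $(x,c(x))\in R$, $V$ interacting with $P$ outputs $c(x)$ with probability at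 least $2/3$, and $V$ interacting with any (computationally unbounded) prover outputs $c(x)$ or $\bot$ with probability at least $2/3$; for every input $x$ without a solution, $V$ interacting with any prover outputs something other than $\bot$ with probability at most $1/3$. Time is counted on a word RAM with words of $O(\log(n+m))$ bits. **Theorem.** Suppose that $Q_1=\exists$ (so that there is a leading block of existential quantifiers) and that the quantifier prefix is not of the form $\exists^{k-1}\forall$. Then, on graphs with $m\ge1$ and $n=O(m)$ (for instance graphs without isolated vertices), there is an $(O(m^{k-2}),O(m^{k-1}))$ pseudo-deterministic proof for finding a setting $(a_1,\dots,a_i)$ to the leading existential quantifiers of $\varphi$, whose canonical solution $c(x)$ is the lexicographically first one. The two programs, the function $c$ and the constant in the word length depend only on $\varphi$; for every $K$, the constants in the time bounds on the graphs with $m\ge 1$ and $n\le Km$ depend only on $\varphi$ and $K$. -/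

import Mathlib

/-! ### Word RAM programs with coins and communication -/

/-- The binary operations of the word RAM. -/
inductive RamOp where
  | add | sub | mul | div | mod | lt | eq

/-- Arithmetic on words, which are the natural numbers below `M`: addition and multiplication wrap
around, subtraction is truncated at `0`, `div` and `mod` are integer division and remainder (with
`a div 0 = 0`, `a mod 0 = a`), and the comparisons return `0` or `1`. -/
def RamOp.eval (M : ℕ) : RamOp → ℕ → ℕ → ℕ
  | .add, a, b => (a + b) % M
  | .sub, a, b => a - b
  | .mul, a, b => (a * b) % M
  | .div, a, b => a / b
  | .mod, a, b => a % b
  | .lt, a, b => (if a < b then 1 else 0) % M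
  | .eq, a, b => (if a = b then 1 else 0) % M

/-- Programs of an interactive randomized word RAM. Registers and memory cells hold one word each;
a program mentions only finitely many registers. -/
inductive Cmd where
  /-- do nothing -/
  | skip
  /-- `R[r] := v` -/
  | const (r v : ℕ)
  /-- `R[r] := R[a] o R[b]` -/
  | op (o : RamOp) (r a b : ℕ)
  /-- `R[r] := Mem[R[a]]` -/
  | load (r a : ℕ)
  /-- `Mem[R[a]] := R[r]` -/
  | store (a r : ℕ)
  /-- `R[r]` becomes the next (private) coin toss, `0` or `1` -/
  | flip (r : ℕ)
  /-- send the word `R[r]` to the other party -/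
  | send (r : ℕ)
  /-- receive a word from the other party into `R[r]` -/
  | recv (r : ℕ)
  /-- sequential composition -/
  | seq (p q : Cmd)
  /-- if `R[r] ≠ 0` then `p` else `q` -/
  | ite (r : ℕ) (p q : Cmd)
  /-- while `R[r] ≠ 0` do `p` -/
  | while (r : ℕ) (p : Cmd)

/-- A communicated word, seen from one of the two parties. -/
inductive Msg where
  /-- a word that this party sent -/
  | sent (v : ℕ)
  /-- a word that this party received -/
  | got (v : ℕ)

/-- The words sent by this party, in order. -/
def sentWords (h : List Msg) : List ℕ :=
  h.filterMap fun
    | .sent v => some v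
    | .got _ => none

/-- The words received by this party, in order. -/
def gotWords (h : List Msg) : List ℕ :=
  h.filterMap fun
    | .sent _ => none
    | .got v => some v

/-- A configuration of the machine. -/
structure Config where
  /-- the commands still to be executed, the first one next -/
  code : List Cmd
  reg : ℕ → ℕ
  mem : ℕ → ℕ
  /-- the words exchanged so far, in chronological order -/
  hist : List Msg
  /-- the number of coins tossed so far -/
  coins : ℕ

/-- The initial configuration: the input stands in memory from address `0` on, and every other
cell and every register is `0`. -/
def Config.init (p : Cmd) (input : List ℕ) : Config where
  code := [p]
  reg := fun _ => 0
  mem := fun a => input.getD a 0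
  hist := []
  coins := 0

/-- One step of the machine with words below `M`. The other party is represented by `env`, which
maps the communication so far to the next word to be received, or to `none` if there is none (and
then a `recv` waits, which leaves the configuration unchanged); `coin` is the sequence of coin
tosses. A configuration without remaining commands has halted. -/
def Config.step (M : ℕ) (env : List Msg → Option ℕ) (coin : ℕ → Bool) (s : Config) : Config :=
  match s.code with
  | [] => s
  | .skip :: K => { s with code := K }
  | .const r v :: K => { s with code := K, reg := Function.update s.reg r (v % M) }
  | .op o r a b :: K =>
      { s with code := K, reg := Function.update s.reg r (o.eval M (s.reg a) (s.reg b)) }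
  | .load r a :: K => { s with code := K, reg := Function.update s.reg r (s.mem (s.reg a)) }
  | .store a r :: K => { s with code := K, mem := Function.update s.mem (s.reg a) (s.reg r) }
  | .flip r :: K =>
      { s with
        code := K
        reg := Function.update s.reg r ((if coin s.coins then 1 else 0) % M)
        coins := s.coins + 1 }
  | .send r :: K => { s with code := K, hist := s.hist ++ [.sent (s.reg r)] }
  | .recv r :: K =>
      match env s.hist with
      | none => s
      | some v =>
          { s with
            code := K
            reg := Function.update s.reg r (v % M)
            hist := s.hist ++ [.got (v % M)] }
  | .seq p q :: K => { s with code := p :: q :: K }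
  | .ite r p q :: K => { s with code := (if s.reg r = 0 then q else p) :: K }
  | .while r p :: K => { s with code := if s.reg r = 0 then K else p :: .while r p :: K }

/-- All commands have been executed. -/
def Config.Halted (s : Config) : Prop := s.code = []

/-- The machine is waiting for a word that `env` does not provide. -/
def Config.Waiting (env : List Msg → Option ℕ) (s : Config) : Prop :=
  ∃ r K, s.code = .recv r :: K ∧ env s.hist = none

/-- The output of a verifier: `⊥` (here `none`) if `R[0] = 0`, and the list `R[1], …, R[ℓ]` if
`R[0] = ℓ + 1`. A run that has not halted gives no output at all; such runs do not occur below,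
because of the time bounds. -/
def Config.output (s : Config) : Option (List ℕ) :=
  match s.reg 0 with
  | 0 => none
  | l + 1 => some ((List.range l).map fun j => s.reg (j + 1))

/-! ### Pseudo-deterministic proofs -/

/-- An arbitrary, computationally unbounded, prover: the next word that it sends, as a function of
the communication so far as seen by the verifier. -/
abbrev Strategy := List Msg → ℕ

/-- The sequence of coin tosses that starts with `r`. -/
def tape {t : ℕ} (r : Fin t → Bool) (i : ℕ) : Bool :=
  if h : i < t then r ⟨i, h⟩ else false

/-- The configuration of the verifier `V` after `t` steps on the given input, when it interacts
with the prover `σ` and uses the coins `r`. -/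
def runVerifier (M : ℕ) (V : Cmd) (input : List ℕ) (σ : Strategy) (r : ℕ → Bool) (t : ℕ) :
    Config :=
  (Config.step M (fun h => some (σ h)) r)^[t] (Config.init V input)

/-- The prover's environment in which the words sent by the verifier (so far) are `q`. -/
def queueEnv (q : List ℕ) : List Msg → Option ℕ :=
  fun h => q[(gotWords h).length]?

/-- The configuration of the prover program `P` after `t` steps on the given input, when the
verifier has sent the words `q` and the prover uses the coins `ρ`. -/
def runProver (M : ℕ) (P : Cmd) (input : List ℕ) (q : List ℕ) (ρ : ℕ → Bool) (t : ℕ) : Config :=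
  (Config.step M (queueEnv q) ρ)^[t] (Config.init P input)

/-- The prover computed by the program `P`, run for `t` steps: if the communication so far consists
of the verifier's words `q` and of `i` words of the prover, its next word is the word with index
`i` among those that `P` sends when it is given `q` (and `0` if there is none). -/
def programStrategy (M : ℕ) (P : Cmd) (input : List ℕ) (ρ : ℕ → Bool) (t : ℕ) : Strategy :=
  fun h => (sentWords (runProver M P input (sentWords h) ρ t).hist).getD (gotWords h).length 0

/-- The probability of an event under the uniform distribution on a finite set. -/
noncomputable def prob {Ω : Type} [Fintype Ω] (E : Ω → Prop) : ℝ :=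
  (Nat.card {ω // E ω} : ℝ) / (Fintype.card Ω : ℝ)

/-- `(V, P)` is a `(t₁, t₂)` pseudo-deterministic proof with canonization function `c` for the
search problem `R` on the inputs in `S`. The input `x` is given as the list `enc x` of words, and
words have `w x` bits. The verifier's time bound holds against every prover, and the time bound of
the honest prover (up to its halting, or its waiting for a further word of the verifier) holds
whatever words it receives. A machine that runs for `t` steps tosses at most `t` coins. -/
structure IsPseudoDetProof {X : Type} (enc : X → List ℕ) (w : X → ℕ) (S : Set X)
    (R : X → List ℕ → Prop) (c : X → List ℕ) (V P : Cmd) (t₁ t₂ : X → ℕ) : Prop where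
  /-- the canonical solution is a solution -/
  canonical : ∀ x ∈ S, (∃ y, R x y) → R x (c x)
  /-- the verifier runs in time `t₁` -/
  verifier_time : ∀ x ∈ S, ∀ (σ : Strategy) (r : ℕ → Bool),
    (runVerifier (2 ^ w x) V (enc x) σ r (t₁ x)).Halted
  /-- the honest prover runs in time `t₂` -/
  prover_time : ∀ x ∈ S, ∀ (q : List ℕ) (ρ : ℕ → Bool),
    (runProver (2 ^ w x) P (enc x) q ρ (t₂ x)).Halted ∨
      (runProver (2 ^ w x) P (enc x) q ρ (t₂ x)).Waiting (queueEnv q)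
  /-- canonical completeness -/
  completeness : ∀ x ∈ S, (∃ y, R x y) →
    2 / 3 ≤ prob fun (z : (Fin (t₁ x) → Bool) × (Fin (t₂ x) → Bool)) =>
      (runVerifier (2 ^ w x) V (enc x)
        (programStrategy (2 ^ w x) P (enc x) (tape z.2) (t₂ x)) (tape z.1) (t₁ x)).output
        = some (c x)
  /-- canonical soundness -/
  soundness : ∀ x ∈ S, (∃ y, R x y) → ∀ σ : Strategy,
    2 / 3 ≤ prob fun (r : Fin (t₁ x) → Bool) =>
      (runVerifier (2 ^ w x) V (enc x) σ (tape r) (t₁ x)).output = some (c x) ∨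
        (runVerifier (2 ^ w x) V (enc x) σ (tape r) (t₁ x)).output = none
  /-- standard soundness -/
  standard_soundness : ∀ x ∈ S, (¬ ∃ y, R x y) → ∀ σ : Strategy,
    prob (fun (r : Fin (t₁ x) → Bool) =>
      (runVerifier (2 ^ w x) V (enc x) σ (tape r) (t₁ x)).output ≠ none) ≤ 1 / 3

/-! ### First-order graph properties -/

/-- A quantifier symbol. -/
inductive Quant where
  | ex | all

/-- A graph property `Q₁ x₁ ∈ X₁ ⋯ Q_k x_k ∈ X_k ψ(x₁, …, x_k)`: the quantifiers, and a
quantifier-free first-order formula `ψ` in the language of graphs (so over the atoms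
`E(x_i, x_j)` and `x_i = x_j`). -/
structure GraphProperty (k : ℕ) where
  quant : Fin k → Quant
  body : FirstOrder.Language.graph.Formula (Fin k)
  body_qf : body.IsQF

/-- The quantifier prefix has the form `∃^{k-1} ∀`. -/
def GraphProperty.IsExistsForall {k : ℕ} (φ : GraphProperty k) : Prop :=
  ∀ j : Fin k, φ.quant j = if (j : ℕ) + 1 = k then Quant.all else Quant.ex

/-- The truth of `Q₁ x₁ ∈ X₁ ⋯ Q_k x_k ∈ X_k ψ(x₁, …, x_k)`. -/
def Quantified {A : Type} : (k : ℕ) → (Fin k → Quant) → (Fin k → Finset A) →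
    ((Fin k → A) → Prop) → Prop
  | 0, _, _, ψ => ψ Fin.elim0
  | k + 1, Q, X, ψ =>
    match Q 0 with
    | .ex => ∃ a ∈ X 0, Quantified k (Fin.tail Q) (Fin.tail X) fun v => ψ (Fin.cons a v)
    | .all => ∀ a ∈ X 0, Quantified k (Fin.tail Q) (Fin.tail X) fun v => ψ (Fin.cons a v)

/-- `l = [a₁, …, a_i]` is a setting to the first set of existential quantifiers of
`Q₁ x₁ ∈ X₁ ⋯ Q_k x_k ∈ X_k ψ(x₁, …, x_k)`: here `i` is the number of leading existential
quantifiers, `a_j ∈ X_j`, and `Q_{i+1} x_{i+1} ⋯ Q_k x_k ψ(a₁, …, a_i, x_{i+1}, …, x_k)`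
is true. -/
def IsSetting {A : Type} : (k : ℕ) → (Fin k → Quant) → (Fin k → Finset A) →
    ((Fin k → A) → Prop) → List A → Prop
  | 0, _, _, ψ, l => l = [] ∧ ψ Fin.elim0
  | k + 1, Q, X, ψ, l =>
    match Q 0 with
    | .ex => ∃ a ∈ X 0, ∃ l', l = a :: l' ∧
        IsSetting k (Fin.tail Q) (Fin.tail X) (fun v => ψ (Fin.cons a v)) l'
    | .all => l = [] ∧ Quantified (k + 1) Q X ψ

/-- An input: a finite simple graph with vertices `0, …, n - 1`, given by a list of its edges (in
any order, each edge once, smaller vertex first), with the domains `X₁, …, X_k`. -/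
structure GraphInput (k : ℕ) where
  n : ℕ
  graph : SimpleGraph (Fin n)
  edges : List (Fin n × Fin n)
  edges_nodup : edges.Nodup
  mem_edges : ∀ u v, (u, v) ∈ edges ↔ u < v ∧ graph.Adj u v
  dom : Fin k → Finset (Fin n)

/-- The number of edges. -/
noncomputable def GraphInput.m {k : ℕ} (x : GraphInput k) : ℕ := x.graph.edgeSet.ncard

/-- The input as a list of words: `n`, the number of edges, the end points of the edges, and the
characteristic vectors of `X₁, …, X_k`. -/
def GraphInput.encode {k : ℕ} (x : GraphInput k) : List ℕ :=
  [x.n, x.edges.length] ++ x.edges.flatMap (fun e => [(e.1 : ℕ), (e.2 : ℕ)]) ++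
    (List.finRange k).flatMap fun j =>
      (List.finRange x.n).map fun v => if v ∈ x.dom j then 1 else 0

/-- The quantifier-free part of `φ` as a predicate on the vertices of `G`. -/
def GraphProperty.bodyHolds {k : ℕ} (φ : GraphProperty k) {A : Type} (G : SimpleGraph A)
    (v : Fin k → A) : Prop :=
  @FirstOrder.Language.Formula.Realize _ _ G.structure _ φ.body v

/-- The search problem: find a setting to the first set of existential quantifiers of `φ`.
Solutions are lists of vertex numbers. -/
def GraphProperty.search {k : ℕ} (φ : GraphProperty k) (x : GraphInput k) (y : List ℕ) : Prop :=
  ∃ l : List (Fin x.n), y = l.map (fun a => (a : ℕ)) ∧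
    IsSetting k φ.quant x.dom (φ.bodyHolds x.graph) l

/-! Write k = K + 3, and let i be the number of leading existential quantifiers. The prover sends
the lexicographically first solution g. The verifier evaluates the remaining quantifiers to see that
g is a solution, and has to be convinced that no solution is smaller. A smaller solution agrees with
g before some j < i and is smaller at j. So minimality is the conjunction of i statements `NoSol`:
with the domains before j shrunk to the components of g and the domain j cut below g j (`restr`), no
choice of the leading variables makes the rest of the formula true. Conversely, if a candidate is a
solution but not the first one, then at the first difference j the first solution lies in the
restricted domains, and the statement for j is false (`Leading.not_noSol`). It remains to prove
`NoSol` interactively with K + 1 nested loops of length O(n + m) for the verifier and K + 2 for the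
prover; this is the structure `Protocol`.

The tool that saves loops is counting through sparse relations. The quantifier-free part is replaced
by a list of patterns, each of which prescribes for every pair of variables whether the values are
equal, adjacent or neither; a satisfying assignment matches exactly one of them (`Covers`). The sums
over all y in a given relation to t can be computed for all t together in time O(n + m): neighbours
come from the edge list, equality is a single term, and the third relation is obtained by
subtraction (`relSum_spec`). In particular, the values of the last variable that fit both t and a
vertex depending on t are counted for all t at once (`cntProg_spec`), so the last two quantifiers
cost one linear pass instead of a double loop (`evalBase_spec`).

If i ≤ K, the next quantifier is universal. For each of the n^i tuples the prover sends a
counterexample to it, and the verifier evaluates the other quantifiers. If i = K + 1, then for each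
assignment to the first K variables the prover sends an array with one counterexample for every
value t of the variable K, and a single count checks the whole array. Both protocols are
deterministic. The case i = K + 2 is the excluded prefix.

If i = K + 3, the absence of suitable triples has to be shown for each assignment v to the first K
variables. Triangles cannot be counted in linear time in this way, but open paths x, y, z, x' can.
Give the vertex u the weight lagr(r, u), the product of r - j over all j < n other than u, and sum
the weight of x times the weight of x' over the paths of each pattern. This is a polynomial in r of
degree less than 2 n (`detect`), which can be evaluated at one point in linear time. At a vertex r =
u only the weight of u survives, both ends of the path coincide, and the value is a square of a unit
times the number of solutions in which the variable K has the value u. Hence there is no solution if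
and only if the polynomial vanishes at 0, ..., n - 1. By Newton's formula (`newton`) it is then, up
to the factor (2 n)!, a combination of the falling factorials of degrees n, ..., 2 n - 1, and the
prover sends the n coefficients. Every such combination vanishes at 0, ..., n - 1, whatever its
coefficients are; so if there is a solution, the two sides are different polynomials and agree in at
most 2 n points. The verifier compares them at a random r among 2^τ > 6 n values. The computation is
modulo q^2 for a prime q between 12 n and 24 n: such a q is found and checked by trial division
within the time bounds, differences of sample points are units, and the counts, being at most n^2,
do not vanish modulo q^2 unless they are zero (`detect_ne_zero`, `eq_zero_of_isUnit_sub`).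

On the machine side, the programs are written in a language of counted loops and compiled.
`Stmt.simulate` transfers their semantics to the word RAM, and `Stmt.cost_le` bounds the time by the
nesting depth of the loops. The verifier never sends a word, so the words of any prover form a
sequence that is independent of the coins, and soundness is a union over the tosses for a fixed
sequence (`verifier_sound`). -/

/-! ### A language of bounded loops and its compilation to the word RAM -/

namespace LoopLang

/-- Scalar variables: scratch variables, the quantified variables `x j`, the components `a j` of
the solution, and the flags `f j`. -/
inductive Var where
  | out | ok | t | y | e | n | r | tot | acc | pt | val | res | hit | g | fac | i | j | pow | d
  | x (l : ℕ) | a (l : ℕ) | f (l : ℕ)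

/-- The code 0 of `out` places this variable in the register `R[0]`, which decides between an answer
and ⊥. The residues modulo 4 separate the indexed families from each other and from the scratch
variables. -/
def Var.code : Var → ℕ
  | .out => 0 | .ok => 4 | .t => 8 | .y => 12 | .e => 16 | .n => 20 | .r => 24 | .tot => 28
  | .acc => 32 | .pt => 36 | .val => 40 | .res => 44 | .hit => 48 | .g => 52 | .fac => 56
  | .i => 60 | .j => 64 | .pow => 68 | .d => 72
  | .x l => 4 * l + 1 | .a l => 4 * l + 2 | .f l => 4 * l + 3

theorem Var.code_injective {v w : Var} (h : v.code = w.code) : v = w := by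
  cases v <;> cases w <;> simp only [Var.code] at h <;> first | rfl | omega | (congr 1; omega)

instance : DecidableEq Var := fun v w =>
  decidable_of_iff (v.code = w.code) ⟨Var.code_injective, congrArg _⟩

/-- Arrays: the relation matrix, scratch arrays, and the current domains. -/
inductive Arr where
  | rel | lam | p | q | u | v | w | cnt | wit | val | gam
  | dom (l : ℕ)

/-- There are 11 fixed arrays, followed by the domains. With K + 3 domains this makes K + 14 arrays,
the number that appears in all the later conditions on `na`. -/
def Arr.code : Arr → ℕ
  | .rel => 0 | .lam => 1 | .p => 2 | .q => 3 | .u => 4 | .v => 5 | .w => 6 | .cnt => 7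
  | .wit => 8 | .val => 9 | .gam => 10 | .dom j => j + 11

theorem Arr.code_injective {A B : Arr} (h : A.code = B.code) : A = B := by
  cases A <;> cases B <;> simp only [Arr.code] at h <;> first | rfl | omega | (congr 1; omega)

instance : DecidableEq Arr := fun A B =>
  decidable_of_iff (A.code = B.code) ⟨Arr.code_injective, congrArg _⟩

/-- Read-only parameters: the numbers of vertices and edges, `2 n`, `12 n`, two moduli, the length
of the input, the size of arrays, and the length of the output plus one. -/
inductive Par where
  | n | m | dbl | big | W | N | base | bd | ell

def Par.code : Par → ℕ
  | .n => 0 | .m => 1 | .dbl => 2 | .big => 3 | .W => 4 | .N => 5 | .base => 6 | .bd => 7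
  | .ell => 8

/-- `W` is so large that index computations modulo `W` never wrap around. `N` is the modulus of the
algebra; in the second phase of the programs it is the square of the number received or found in the
first. -/
inductive Modulus where
  | W | N

def Modulus.par : Modulus → Par
  | .W => .W
  | .N => .N

inductive BinOp where
  | sub | mod | lt | eq

def BinOp.eval : BinOp → ℕ → ℕ → ℕ
  | .sub, a, b => a - b
  | .mod, a, b => a % b
  | .lt, a, b => if a < b then 1 else 0
  | .eq, a, b => if a = b then 1 else 0

def BinOp.toRam : BinOp → RamOp
  | .sub => .sub
  | .mod => .mod
  | .lt => .lt
  | .eq => .eq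

/-! ### Syntax and semantics of the loop language. -/

inductive Expr where
  | var (v : Var)
  | par (p : Par)
  | const (c : Fin 3)
  | add (P : Modulus) (a b : Expr)
  | mul (P : Modulus) (a b : Expr)
  | bin (o : BinOp) (a b : Expr)
  | get (A : Arr) (e : Expr)
  | inp (e : Expr)

/-- The only loops are counted ones, and their lengths are read-only parameters. So every program
halts within a bound that does not depend on the words received. -/
inductive Stmt where
  | skip
  | set (v : Var) (e : Expr)
  | put (A : Arr) (i e : Expr)
  | recv (v : Var)
  | send (e : Expr)
  | flip (v : Var)
  | seq (p q : Stmt)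
  | ite (e : Expr) (p q : Stmt)
  | loop (v : Var) (p : Par) (body : Stmt)

/-- The read-only part of the machine. -/
structure Env where
  par : Par → ℕ
  inp : ℕ → ℕ
  word : ℕ → ℕ
  coin : ℕ → Bool

@[ext] structure Store where
  var : Var → ℕ
  arr : Arr → ℕ → ℕ
  pos : ℕ
  coins : ℕ
  out : List ℕ

def Store.zero : Store := ⟨fun _ => 0, fun _ _ => 0, 0, 0, []⟩

def Store.setv (s : Store) (v : Var) (a : ℕ) : Store := { s with var := Function.update s.var v a }

def Store.seta (s : Store) (A : Arr) (i a : ℕ) : Store :=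
  { s with arr := Function.update s.arr A (Function.update (s.arr A) i a) }

def Expr.eval (Γ : Env) (s : Store) : Expr → ℕ
  | .var v => s.var v
  | .par p => Γ.par p
  | .const c => c
  | .add P a b => (a.eval Γ s + b.eval Γ s) % Γ.par P.par
  | .mul P a b => (a.eval Γ s * b.eval Γ s) % Γ.par P.par
  | .bin o a b => o.eval (a.eval Γ s) (b.eval Γ s)
  | .get A e => s.arr A (e.eval Γ s)
  | .inp e => Γ.inp (e.eval Γ s)

/-- `iter f v p s` runs the body `f` for `v = 0, …, p - 1`. -/
def iter (f : Store → Store) (v : Var) : ℕ → Store → Store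
  | 0, s => s
  | i + 1, s => f ((iter f v i s).setv v i)

/-- A write beyond the bound `bd` has no effect. The compiled code has the same guard, which
prevents an array from running into the next one. -/
def Stmt.run (Γ : Env) : Stmt → Store → Store
  | .skip, s => s
  | .set v e, s => s.setv v (e.eval Γ s)
  | .put A i e, s =>
      if i.eval Γ s < Γ.par .bd then s.seta A (i.eval Γ s) (e.eval Γ s) else s
  | .recv v, s => { s.setv v (Γ.word s.pos) with pos := s.pos + 1 }
  | .send e, s => { s with out := s.out ++ [e.eval Γ s] }
  | .flip v, s => { s.setv v (if Γ.coin s.coins then 1 else 0) with coins := s.coins + 1 }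
  | .seq p q, s => q.run Γ (p.run Γ s)
  | .ite e p q, s => if e.eval Γ s = 0 then q.run Γ s else p.run Γ s
  | .loop v p body, s => iter (body.run Γ) v (Γ.par p) s

/-- The residues modulo 3 separate variables, parameters and temporaries. -/
def vreg (v : Var) : ℕ := 3 * v.code
def preg (p : Par) : ℕ := 3 * p.code + 1
def treg (d : ℕ) : ℕ := 3 * d + 2

/-- There is no move instruction; subtracting zero replaces it, as long as the two registers are
different. -/
def mv (dst src : ℕ) : Cmd := .seq (.const dst 0) (.op .sub dst src dst)

/-- The temporaries from `d` on serve as a stack, with the result in `treg d`. Operands are reduced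
before the machine adds or multiplies, because a received word may be arbitrary and the wraparound
modulo the word size would falsify the residue. -/
def Expr.code : Expr → ℕ → Cmd
  | .var v, d => mv (treg d) (vreg v)
  | .par p, d => mv (treg d) (preg p)
  | .const c, d => .const (treg d) c
  | .add P a b, d => .seq (a.code d) <| .seq (b.code (d + 1)) <|
      .seq (.op .mod (treg d) (treg d) (preg P.par)) <|
      .seq (.op .mod (treg (d + 1)) (treg (d + 1)) (preg P.par)) <|
      .seq (.op .add (treg d) (treg d) (treg (d + 1))) (.op .mod (treg d) (treg d) (preg P.par))
  | .mul P a b, d => .seq (a.code d) <| .seq (b.code (d + 1)) <|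
      .seq (.op .mod (treg d) (treg d) (preg P.par)) <|
      .seq (.op .mod (treg (d + 1)) (treg (d + 1)) (preg P.par)) <|
      .seq (.op .mul (treg d) (treg d) (treg (d + 1))) (.op .mod (treg d) (treg d) (preg P.par))
  | .bin o a b, d => .seq (a.code d) <| .seq (b.code (d + 1)) <|
      .op o.toRam (treg d) (treg d) (treg (d + 1))
  | .get A e, d => .seq (e.code d) <|
      .seq (.op .lt (treg (d + 1)) (treg d) (preg .bd)) <|
      .ite (treg (d + 1))
        (.seq (.const (treg (d + 1)) A.code) <|
         .seq (.op .mul (treg (d + 1)) (treg (d + 1)) (preg .bd)) <|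
         .seq (.op .add (treg d) (treg d) (treg (d + 1))) <|
         .seq (.op .add (treg d) (treg d) (preg .base)) (.load (treg d) (treg d)))
        (.const (treg d) 0)
  | .inp e, d => .seq (e.code d) <|
      .seq (.op .lt (treg (d + 1)) (treg d) (preg .base)) <|
      .ite (treg (d + 1)) (.load (treg d) (treg d)) (.const (treg d) 0)

/-- The counter and the test of a loop live in the temporaries `d` and `d + 1`, and the body is
compiled from `d + 2` on. Hence a body may overwrite the loop variable without affecting the number
of rounds. -/
def Stmt.code : Stmt → ℕ → Cmd
  | .skip, _ => .skip
  | .set v e, d => .seq (e.code d) (mv (vreg v) (treg d))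
  | .put A i e, d => .seq (i.code d) <| .seq (e.code (d + 1)) <|
      .seq (.op .lt (treg (d + 2)) (treg d) (preg .bd)) <|
      .ite (treg (d + 2))
        (.seq (.const (treg (d + 2)) A.code) <|
         .seq (.op .mul (treg (d + 2)) (treg (d + 2)) (preg .bd)) <|
         .seq (.op .add (treg d) (treg d) (treg (d + 2))) <|
         .seq (.op .add (treg d) (treg d) (preg .base)) (.store (treg d) (treg (d + 1))))
        .skip
  | .recv v, _ => .recv (vreg v)
  | .send e, d => .seq (e.code d) (.send (treg d))
  | .flip v, _ => .flip (vreg v)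
  | .seq p q, d => .seq (p.code d) (q.code d)
  | .ite e p q, d => .seq (e.code d) (.ite (treg d) (p.code d) (q.code d))
  | .loop v p body, d => .seq (.const (treg d) 0) <|
      .seq (.op .lt (treg (d + 1)) (treg d) (preg p)) <|
      .while (treg (d + 1)) <| .seq (mv (vreg v) (treg d)) <| .seq (body.code (d + 2)) <|
        .seq (.const (treg (d + 2)) 1) <| .seq (.op .add (treg d) (treg d) (treg (d + 2))) <|
        .op .lt (treg (d + 1)) (treg d) (preg p)

/-! ### The running time of compiled code. -/

/-- A bound for the running time of the compiled expression. -/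
def Expr.cost : Expr → ℕ
  | .var _ | .par _ | .const _ => 3
  | .add _ a b | .mul _ a b => a.cost + b.cost + 9
  | .bin _ a b => a.cost + b.cost + 3
  | .get _ e | .inp e => e.cost + 14

/-- A bound for the running time of the compiled statement. -/
def Stmt.cost (Γ : Env) : Stmt → ℕ
  | .skip => 1
  | .set _ e => e.cost + 4
  | .put _ i e => i.cost + e.cost + 14
  | .recv _ | .flip _ => 1
  | .send e => e.cost + 2
  | .seq p q => p.cost Γ + q.cost Γ + 1
  | .ite e p q => e.cost + p.cost Γ + q.cost Γ + 2
  | .loop _ p body => Γ.par p * (body.cost Γ + 12) + 5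

/-- The time bound without its dependence on the lengths of the loops. -/
def Stmt.coef : Stmt → ℕ
  | .skip => 1
  | .set _ e => e.cost + 4
  | .put _ i e => i.cost + e.cost + 14
  | .recv _ | .flip _ => 1
  | .send e => e.cost + 2
  | .seq p q => p.coef + q.coef + 1
  | .ite e p q => e.cost + p.coef + q.coef + 2
  | .loop _ _ body => body.coef + 17

/-- The parameters that may bound a loop. -/
def Par.IsLength : Par → Prop
  | .n | .m | .dbl | .big => True
  | _ => False

inductive Role where
  | verifier | prover

def Expr.UsesBelow (na : ℕ) : Expr → Prop
  | .var _ | .par _ | .const _ => True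
  | .add _ a b | .mul _ a b | .bin _ a b => a.UsesBelow na ∧ b.UsesBelow na
  | .get A e => A.code < na ∧ e.UsesBelow na
  | .inp e => e.UsesBelow na

/-- The loops of the statement are nested at most to depth `d`, it uses only the first `na` arrays,
and it communicates only in the direction that its role permits. -/
def Stmt.Fits (role : Role) (na : ℕ) : ℕ → Stmt → Prop
  | _, .skip => True
  | _, .set _ e => e.UsesBelow na
  | _, .put A i e => A.code < na ∧ i.UsesBelow na ∧ e.UsesBelow na
  | _, .recv _ => role = .verifier
  | _, .flip _ => True
  | _, .send e => role = .prover ∧ e.UsesBelow na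
  | d, .seq p q => p.Fits role na d ∧ q.Fits role na d
  | d, .ite e p q => e.UsesBelow na ∧ p.Fits role na d ∧ q.Fits role na d
  | 0, .loop _ _ _ => False
  | d + 1, .loop _ p body => p.IsLength ∧ body.Fits role na d

/-- Each level of nesting contributes one factor `S`, so the exponents in the final time bounds are
nesting depths, and the constants depend on the program text only. -/
theorem Stmt.cost_le {role : Role} {na : ℕ} {Γ : Env} {S : ℕ} (hS : 1 ≤ S)
    (hp : ∀ p : Par, p.IsLength → Γ.par p ≤ S) :
    ∀ (c : Stmt) (d : ℕ), c.Fits role na d → c.cost Γ ≤ c.coef * S ^ d := by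
  intro c
  induction c with
  | seq p q ihp ihq =>
    intro d h
    have h1 := ihp d h.1
    have h2 := ihq d h.2
    have h3 : 1 ≤ S ^ d := Nat.one_le_pow _ _ hS
    simp only [Stmt.cost, Stmt.coef]
    nlinarith
  | ite e p q ihp ihq =>
    intro d h
    have h1 := ihp d h.2.1
    have h2 := ihq d h.2.2
    have h3 : 1 ≤ S ^ d := Nat.one_le_pow _ _ hS
    simp only [Stmt.cost, Stmt.coef]
    nlinarith [Nat.zero_le e.cost]
  | loop v p body ih =>
    intro d h
    cases d with
    | zero => exact h.elim
    | succ d =>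
      have h1 := ih d h.2
      have h2 := hp p h.1
      have h3 : 1 ≤ S ^ d := Nat.one_le_pow _ _ hS
      simp only [Stmt.cost, Stmt.coef]
      calc Γ.par p * (body.cost Γ + 12) + 5
          ≤ S * (body.coef * S ^ d + 12 * S ^ d) + 5 * (S * S ^ d) := by
            gcongr
            · omega
            · nlinarith
        _ = (body.coef + 17) * S ^ (d + 1) := by ring
  | _ =>
    intro d _
    exact Nat.le_mul_of_pos_right _ (by positivity)

theorem Stmt.Fits.mono {role : Role} {na : ℕ} : ∀ {c : Stmt} {d d' : ℕ}, d ≤ d' →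
    c.Fits role na d → c.Fits role na d' := by
  intro c
  induction c with
  | seq p q ihp ihq => exact fun h hc => ⟨ihp h hc.1, ihq h hc.2⟩
  | ite e p q ihp ihq => exact fun h hc => ⟨hc.1, ihp h hc.2.1, ihq h hc.2.2⟩
  | loop v p body ih =>
    intro d d' h hc
    cases d with
    | zero => exact hc.elim
    | succ d =>
      cases d' with
      | zero => omega
      | succ d' => exact ⟨hc.1, ih (by omega) hc.2⟩
  | _ => intro d d' _ hc; simp only [Stmt.Fits] at hc ⊢ <;> exact hc

/-! ### Simulation -/

/-- The configuration `s` reaches `s'` in at most `B` steps. -/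
def Reaches (M : ℕ) (env : List Msg → Option ℕ) (coin : ℕ → Bool) (B : ℕ) (s s' : Config) : Prop :=
  ∃ t ≤ B, (Config.step M env coin)^[t] s = s'

section
variable {M : ℕ} {env : List Msg → Option ℕ} {coin : ℕ → Bool}

theorem Reaches.trans {B C : ℕ} {s s' s'' : Config} (h : Reaches M env coin B s s')
    (h' : Reaches M env coin C s' s'') : Reaches M env coin (B + C) s s'' := by
  obtain ⟨t, ht, rfl⟩ := h
  obtain ⟨t', ht', rfl⟩ := h'
  exact ⟨t' + t, by omega, Function.iterate_add_apply _ _ _ _⟩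

theorem Reaches.mono {B C : ℕ} {s s' : Config} (h : Reaches M env coin B s s') (hB : B ≤ C) :
    Reaches M env coin C s s' := by
  obtain ⟨t, ht, rfl⟩ := h
  exact ⟨t, by omega, rfl⟩

theorem Reaches.refl (s : Config) : Reaches M env coin 0 s s := ⟨0, le_rfl, rfl⟩

theorem Reaches.step (s : Config) {s' : Config} (h : Config.step M env coin s = s') :
    Reaches M env coin 1 s s' := ⟨1, le_rfl, h⟩

/-- Append one machine step in front of a run. -/
theorem Reaches.head {B : ℕ} {s s' : Config} (h : Reaches M env coin B (Config.step M env coin s) s') :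
    Reaches M env coin (B + 1) s s' := by
  obtain ⟨t, ht, rfl⟩ := h
  exact ⟨t + 1, by omega, Function.iterate_succ_apply _ _ _⟩

/-- The registers and the memory represent the store `s`; `na` arrays are available. -/
structure Represents (Γ : Env) (na : ℕ) (s : Store) (reg mem : ℕ → ℕ) : Prop where
  var : ∀ v, reg (vreg v) = s.var v
  par : ∀ p, reg (preg p) = Γ.par p
  inp : ∀ a < Γ.par .base, mem a = Γ.inp a
  arr : ∀ (A : Arr) (i : ℕ), A.code < na → i < Γ.par .bd →
    mem (i + A.code * Γ.par .bd + Γ.par .base) = s.arr A i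
  arr_zero : ∀ (A : Arr) (i : ℕ), Γ.par .bd ≤ i → s.arr A i = 0

/-- The word length suffices for the parameters. -/
structure Env.Small (Γ : Env) (M na : ℕ) : Prop where
  two_lt : 2 < M
  add_le : ∀ P : Modulus, Γ.par P.par + Γ.par P.par ≤ M
  mul_le : ∀ P : Modulus, Γ.par P.par * Γ.par P.par ≤ M
  pos : ∀ P : Modulus, 0 < Γ.par P.par
  mem_le : Γ.par .base + na * Γ.par .bd ≤ M
  bd_pos : 0 < Γ.par .bd
  len_lt : ∀ p : Par, p.IsLength → Γ.par p < M
  inp_zero : ∀ a, Γ.par .base ≤ a → Γ.inp a = 0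

theorem Represents.congr {Γ : Env} {na : ℕ} {s : Store} {reg reg' mem : ℕ → ℕ}
    (h : Represents Γ na s reg mem) (d : ℕ)
    (h' : ∀ x, (∀ d' ≥ d, x ≠ treg d') → reg' x = reg x) : Represents Γ na s reg' mem where
  var v := by rw [h' _ (fun d' _ => by simp only [vreg, treg]; omega), h.var]
  par p := by rw [h' _ (fun d' _ => by simp only [preg, treg]; omega), h.par]
  inp := h.inp
  arr := h.arr
  arr_zero := h.arr_zero

theorem reaches_mv {dst src : ℕ} (hne : dst ≠ src) (k : List Cmd) (reg mem : ℕ → ℕ)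
    (hist : List Msg) (c : ℕ) : Reaches M env coin 3 ⟨mv dst src :: k, reg, mem, hist, c⟩
      ⟨k, Function.update reg dst (reg src), mem, hist, c⟩ := by
  refine ⟨3, le_rfl, ?_⟩
  simp [mv, Config.step, Function.update_of_ne hne.symm, RamOp.eval]

theorem treg_inj {a b : ℕ} : treg a = treg b ↔ a = b := by simp [treg]
theorem preg_ne_treg (p : Par) (d : ℕ) : preg p ≠ treg d := by simp only [preg, treg]; omega
theorem vreg_ne_treg (p : Var) (d : ℕ) : vreg p ≠ treg d := by simp only [vreg, treg]; omega

theorem mod_lt_of_add {M a b P : ℕ} (hP : 0 < P) (h : P + P ≤ M) :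
    (a % P + b % P) % M % P = (a + b) % P := by
  have h1 := Nat.mod_lt a hP
  have h2 := Nat.mod_lt b hP
  rw [Nat.mod_eq_of_lt (a := a % P + b % P) (by omega), ← Nat.add_mod]

theorem mod_lt_of_mul {M a b P : ℕ} (hP : 0 < P) (h : P * P ≤ M) :
    (a % P * (b % P)) % M % P = (a * b) % P := by
  have h1 := Nat.mod_lt a hP
  have h2 := Nat.mod_lt b hP
  rw [Nat.mod_eq_of_lt (a := a % P * (b % P))
    ((Nat.mul_lt_mul'' h1 h2).trans_le h), ← Nat.mul_mod]

theorem BinOp.eval_toRam (hM : 2 < M) (o : BinOp) (a b : ℕ) :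
    o.toRam.eval M a b = o.eval a b := by
  cases o <;> simp only [BinOp.toRam, BinOp.eval, RamOp.eval] <;> split_ifs <;>
    first | rfl | exact Nat.mod_eq_of_lt (by omega)

/-- The arrays lie one after the other behind the input, and `mem_le` says that all of them fit
below `M`. So none of the machine operations that form an address wraps around. -/
theorem address_eq {Γ : Env} {na : ℕ} (hΓ : Γ.Small M na) {A : Arr} (hA : A.code < na) {i : ℕ}
    (hi : i < Γ.par .bd) :
    ((i + (A.code % M * Γ.par .bd) % M) % M + Γ.par .base) % M =
      i + A.code * Γ.par .bd + Γ.par .base ∧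
      i + A.code * Γ.par .bd + Γ.par .base < M := by
  have h := hΓ.mem_le
  have hb := hΓ.bd_pos
  have h1 : (A.code + 1) * Γ.par .bd ≤ na * Γ.par .bd := Nat.mul_le_mul_right _ hA
  have h2 : A.code ≤ A.code * Γ.par .bd := Nat.le_mul_of_pos_right _ hb
  rw [add_mul, one_mul] at h1
  rw [Nat.mod_eq_of_lt (a := A.code) (by omega), Nat.mod_eq_of_lt (a := A.code * _) (by omega),
    Nat.mod_eq_of_lt (a := i + _) (by omega), Nat.mod_eq_of_lt (by omega)]
  exact ⟨rfl, by omega⟩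

/-- Only temporaries from `d` on change. This makes the induction work: the left operand survives
the evaluation of the right one, and the representation of the store is not disturbed. -/
theorem Expr.simulate {Γ : Env} {na : ℕ} {s : Store} (hΓ : Γ.Small M na) (e : Expr) :
    ∀ (d : ℕ) (k : List Cmd) (reg mem : ℕ → ℕ) (hist : List Msg) (c : ℕ), e.UsesBelow na →
      Represents Γ na s reg mem →
      ∃ reg', Reaches M env coin e.cost ⟨e.code d :: k, reg, mem, hist, c⟩
          ⟨k, reg', mem, hist, c⟩ ∧ reg' (treg d) = e.eval Γ s ∧
        ∀ x, (∀ d' ≥ d, x ≠ treg d') → reg' x = reg x := by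
  -- The part that is common to the three constructors with two operands: evaluate both, then
  -- continue with some command `r`.
  have hbin : ∀ (a b : Expr), 
      (∀ (d : ℕ) (k : List Cmd) (reg mem : ℕ → ℕ) (hist : List Msg) (c : ℕ), a.UsesBelow na →
        Represents Γ na s reg mem →
        ∃ reg', Reaches M env coin a.cost ⟨a.code d :: k, reg, mem, hist, c⟩
          ⟨k, reg', mem, hist, c⟩ ∧ reg' (treg d) = a.eval Γ s ∧
          ∀ x, (∀ d' ≥ d, x ≠ treg d') → reg' x = reg x) →
      (∀ (d : ℕ) (k : List Cmd) (reg mem : ℕ → ℕ) (hist : List Msg) (c : ℕ), b.UsesBelow na →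
        Represents Γ na s reg mem →
        ∃ reg', Reaches M env coin b.cost ⟨b.code d :: k, reg, mem, hist, c⟩
          ⟨k, reg', mem, hist, c⟩ ∧ reg' (treg d) = b.eval Γ s ∧
          ∀ x, (∀ d' ≥ d, x ≠ treg d') → reg' x = reg x) →
      ∀ (d : ℕ) (r : Cmd) (k : List Cmd) (reg mem : ℕ → ℕ) (hist : List Msg) (c : ℕ),
        a.UsesBelow na → b.UsesBelow na → Represents Γ na s reg mem →
        ∃ reg', Reaches M env coin (a.cost + b.cost + 2)
          ⟨.seq (a.code d) (.seq (b.code (d + 1)) r) :: k, reg, mem, hist, c⟩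
          ⟨r :: k, reg', mem, hist, c⟩ ∧ reg' (treg d) = a.eval Γ s ∧
          reg' (treg (d + 1)) = b.eval Γ s ∧
          ∀ x, (∀ d' ≥ d, x ≠ treg d') → reg' x = reg x := by
    intro a b iha ihb d r k reg mem hist c ha hb hrep
    obtain ⟨reg1, h1, e1, f1⟩ := iha d (.seq (b.code (d + 1)) r :: k) reg mem hist c ha hrep
    obtain ⟨reg2, h2, e2, f2⟩ := ihb (d + 1) (r :: k) reg1 mem hist c hb (hrep.congr d f1)
    refine ⟨reg2, ?_, ?_, e2, ?_⟩
    · have := (Reaches.head (s := ⟨.seq (a.code d) (.seq (b.code (d + 1)) r) :: k, reg, mem, hist, c⟩)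
        h1).trans (Reaches.head (s := ⟨.seq (b.code (d + 1)) r :: k, reg1, mem, hist, c⟩) h2)
      exact this.mono (by omega)
    · rw [f2 _ (fun d' hd' => by simp only [ne_eq, treg_inj]; omega), e1]
    · intro x hx
      rw [f2 _ (fun d' hd' => hx d' (by omega)), f1 x hx]
  induction e with
  | var v =>
    intro d k reg mem hist c _ hrep
    refine ⟨_, reaches_mv (vreg_ne_treg v d).symm k reg mem hist c, ?_, ?_⟩
    · simp [Expr.eval, hrep.var]
    · intro x hx; exact Function.update_of_ne (hx d le_rfl) _ _
  | par p =>
    intro d k reg mem hist c _ hrep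
    refine ⟨_, reaches_mv (preg_ne_treg p d).symm k reg mem hist c, ?_, ?_⟩
    · simp [Expr.eval, hrep.par]
    · intro x hx; exact Function.update_of_ne (hx d le_rfl) _ _
  | const a =>
    intro d k reg mem hist c _ hrep
    refine ⟨Function.update reg (treg d) (a % M), (Reaches.step _ rfl).mono (by simp [Expr.cost]),
      ?_, ?_⟩
    · have := hΓ.two_lt
      simp only [Expr.eval, Function.update_self]
      exact Nat.mod_eq_of_lt (by omega)
    · intro x hx; exact Function.update_of_ne (hx d le_rfl) _ _
  | add P a b iha ihb =>
    intro d k reg mem hist c hu hrep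
    obtain ⟨reg1, h1, e1, e2, f1⟩ := hbin a b iha ihb d
      (.seq (.op .mod (treg d) (treg d) (preg P.par)) <|
      .seq (.op .mod (treg (d + 1)) (treg (d + 1)) (preg P.par)) <|
      .seq (.op .add (treg d) (treg d) (treg (d + 1))) (.op .mod (treg d) (treg d) (preg P.par)))
      k reg mem hist c hu.1 hu.2 hrep
    have hp := (hrep.congr d f1).par P.par
    refine ⟨_, (h1.trans ⟨7, le_rfl, rfl⟩).mono (by simp only [Expr.cost]; omega), ?_, ?_⟩
    · simp [Config.step, treg_inj, preg_ne_treg, RamOp.eval, e1, e2, hp,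
        Expr.eval]
      exact mod_lt_of_add (hΓ.pos P) (hΓ.add_le P)
    · intro x hx
      have g1 := hx d le_rfl
      have g2 := hx (d + 1) (by omega)
      simp [Config.step, Function.update_apply, g1, g2, f1 x hx]
  | mul P a b iha ihb =>
    intro d k reg mem hist c hu hrep
    obtain ⟨reg1, h1, e1, e2, f1⟩ := hbin a b iha ihb d
      (.seq (.op .mod (treg d) (treg d) (preg P.par)) <|
      .seq (.op .mod (treg (d + 1)) (treg (d + 1)) (preg P.par)) <|
      .seq (.op .mul (treg d) (treg d) (treg (d + 1))) (.op .mod (treg d) (treg d) (preg P.par)))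
      k reg mem hist c hu.1 hu.2 hrep
    have hp := (hrep.congr d f1).par P.par
    refine ⟨_, (h1.trans ⟨7, le_rfl, rfl⟩).mono (by simp only [Expr.cost]; omega), ?_, ?_⟩
    · simp [Config.step, treg_inj, preg_ne_treg, RamOp.eval, e1, e2, hp,
        Expr.eval]
      exact mod_lt_of_mul (hΓ.pos P) (hΓ.mul_le P)
    · intro x hx
      have g1 := hx d le_rfl
      have g2 := hx (d + 1) (by omega)
      simp [Config.step, Function.update_apply, g1, g2, f1 x hx]
  | bin o a b iha ihb =>
    intro d k reg mem hist c hu hrep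
    obtain ⟨reg1, h1, e1, e2, f1⟩ := hbin a b iha ihb d
      (.op o.toRam (treg d) (treg d) (treg (d + 1))) k reg mem hist c hu.1 hu.2 hrep
    refine ⟨_, (h1.trans (Reaches.step _ rfl)).mono (by simp only [Expr.cost]; omega), ?_, ?_⟩
    · simp [e1, e2, Expr.eval, BinOp.eval_toRam hΓ.two_lt]
    · intro x hx
      exact (Function.update_of_ne (hx d le_rfl) _ _).trans (f1 x hx)
  | get A e ih =>
    intro d k reg mem hist c hu hrep
    obtain ⟨reg1, h1, e1, f1⟩ := ih d
      (.seq (.op .lt (treg (d + 1)) (treg d) (preg .bd)) (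
      .ite (treg (d + 1))
        (.seq (.const (treg (d + 1)) A.code) <|
         .seq (.op .mul (treg (d + 1)) (treg (d + 1)) (preg .bd)) <|
         .seq (.op .add (treg d) (treg d) (treg (d + 1))) <|
         .seq (.op .add (treg d) (treg d) (preg .base)) (.load (treg d) (treg d)))
        (.const (treg d) 0)) :: k) reg mem hist c hu.2 hrep
    have hrep1 := hrep.congr d f1
    have hp := hrep1.par .bd
    have hp' := hrep1.par .base
    have hM := hΓ.two_lt
    have hM1 : 1 % M = 1 := Nat.mod_eq_of_lt (by omega)
    have hh := Reaches.head (s := ⟨(Expr.get A e).code d :: k, reg, mem, hist, c⟩) h1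
    by_cases hlt : e.eval Γ s < Γ.par .bd
    · have hstep : (Config.step M env coin)^[3]
          ⟨.seq (.op .lt (treg (d + 1)) (treg d) (preg .bd)) (
      .ite (treg (d + 1))
        (.seq (.const (treg (d + 1)) A.code) <|
         .seq (.op .mul (treg (d + 1)) (treg (d + 1)) (preg .bd)) <|
         .seq (.op .add (treg d) (treg d) (treg (d + 1))) <|
         .seq (.op .add (treg d) (treg d) (preg .base)) (.load (treg d) (treg d)))
        (.const (treg d) 0)) :: k, reg1, mem, hist, c⟩ = 
        ⟨(.seq (.const (treg (d + 1)) A.code) <|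
         .seq (.op .mul (treg (d + 1)) (treg (d + 1)) (preg .bd)) <|
         .seq (.op .add (treg d) (treg d) (treg (d + 1))) <|
         .seq (.op .add (treg d) (treg d) (preg .base)) (.load (treg d) (treg d))) :: k,
         Function.update reg1 (treg (d + 1)) 1, mem, hist, c⟩ := by
        simp [Config.step, RamOp.eval, e1, hp, hlt, hM1]
      refine ⟨_, ((hh.trans ⟨3, le_rfl, hstep⟩).trans ⟨9, le_rfl, rfl⟩).mono ?_, ?_, ?_⟩
      · simp only [Expr.cost]; omega
      · have := address_eq (M := M) hΓ hu.1 hlt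
        simp [Config.step, treg_inj, preg_ne_treg, RamOp.eval, e1, hp, hp',
          Expr.eval]
        rw [← Nat.add_mod_mod, ← Nat.mod_add_mod, ← hrep1.arr A _ hu.1 hlt]
        simpa using congrArg mem this.1
      · intro x hx
        have g1 := hx d le_rfl
        have g2 := hx (d + 1) (by omega)
        simp [Config.step, Function.update_apply, g1, g2, f1 x hx]
    -- Out of range the code delivers 0, in accordance with `arr_zero`.
    · refine ⟨Function.update (Function.update reg1 (treg (d + 1)) 0) (treg d) 0,
        (hh.trans ⟨4, le_rfl, ?_⟩).mono ?_, ?_, ?_⟩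
      · simp [Config.step, RamOp.eval, e1, hp, hlt]
      · simp only [Expr.cost]; omega
      · simp only [Function.update_self, Expr.eval]
        exact (hrep1.arr_zero A _ (by omega)).symm
      · intro x hx
        have g1 := hx d le_rfl
        have g2 := hx (d + 1) (by omega)
        simp [g1, g2, f1 x hx]
  | inp e ih =>
    intro d k reg mem hist c hu hrep
    obtain ⟨reg1, h1, e1, f1⟩ := ih d
      (.seq (.op .lt (treg (d + 1)) (treg d) (preg .base)) (
      .ite (treg (d + 1)) (.load (treg d) (treg d)) (.const (treg d) 0)) :: k)
      reg mem hist c hu hrep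
    have hrep1 := hrep.congr d f1
    have hp' := hrep1.par .base
    have hM := hΓ.two_lt
    have hM1 : 1 % M = 1 := Nat.mod_eq_of_lt (by omega)
    have hh := Reaches.head (s := ⟨(Expr.inp e).code d :: k, reg, mem, hist, c⟩) h1
    by_cases hlt : e.eval Γ s < Γ.par .base
    · refine ⟨Function.update (Function.update reg1 (treg (d + 1)) 1) (treg d) (Γ.inp (e.eval Γ s)),
        (hh.trans ⟨4, le_rfl, ?_⟩).mono ?_, ?_, ?_⟩
      · simp [Config.step, RamOp.eval, e1, hp', hlt, hM1, treg_inj,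
          hrep1.inp _ hlt]
      · simp only [Expr.cost]; omega
      · simp only [Function.update_self, Expr.eval]
      · intro x hx
        have g1 := hx d le_rfl
        have g2 := hx (d + 1) (by omega)
        simp [g1, g2, f1 x hx]
    · refine ⟨Function.update (Function.update reg1 (treg (d + 1)) 0) (treg d) 0,
        (hh.trans ⟨4, le_rfl, ?_⟩).mono ?_, ?_, ?_⟩
      · simp [Config.step, RamOp.eval, e1, hp', hlt]
      · simp only [Expr.cost]; omega
      · simp only [Function.update_self, Expr.eval]
        exact (hΓ.inp_zero _ (by omega)).symm
      · intro x hx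
        have g1 := hx d le_rfl
        have g2 := hx (d + 1) (by omega)
        simp [g1, g2, f1 x hx]

end

/-- The communication so far, as it is seen by a machine in the given role. -/
def History (Γ : Env) (role : Role) (s : Store) (hist : List Msg) : Prop :=
  match role with
  | .verifier => hist = (List.range s.pos).map (fun i => .got (Γ.word i)) ∧ s.out = []
  | .prover => hist = s.out.map .sent ∧ s.pos = 0

/-- The other party sends the words `Γ.word` to a machine in the role of the verifier. -/
def Provides (Γ : Env) (M : ℕ) (env : List Msg → Option ℕ) (role : Role) : Prop :=
  match role with
  | .verifier => ∀ p, ∃ v, env ((List.range p).map (fun i => .got (Γ.word i))) = some v ∧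
      v % M = Γ.word p
  | .prover => True

section
variable {M : ℕ} {env : List Msg → Option ℕ}

theorem Represents.setv {Γ : Env} {na : ℕ} {s : Store} {reg reg' mem : ℕ → ℕ} {v : Var} {a : ℕ}
    (h : Represents Γ na s reg mem) (d : ℕ) (hv : reg' (vreg v) = a)
    (h' : ∀ x, (∀ d' ≥ d, x ≠ treg d') → x ≠ vreg v → reg' x = reg x) :
    Represents Γ na (s.setv v a) reg' mem where
  var w := by
    by_cases hw : w = v
    · subst hw; simp [Store.setv, hv]
    · have h1 : vreg w ≠ vreg v := fun h => hw (Var.code_injective (by simp only [vreg] at h; omega))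
      rw [h' _ (fun d' _ => vreg_ne_treg _ _) h1, h.var]
      simp [Store.setv, hw]
  par p := by
    rw [h' _ (fun d' _ => preg_ne_treg _ _) (by simp only [preg, vreg]; omega), h.par]
  inp := h.inp
  arr := h.arr
  arr_zero := h.arr_zero

theorem Represents.seta {Γ : Env} {na : ℕ} {s : Store} {reg mem : ℕ → ℕ} {A : Arr} {i a : ℕ}
    (h : Represents Γ na s reg mem) (hi : i < Γ.par .bd) :
    Represents Γ na (s.seta A i a) reg
      (Function.update mem (i + A.code * Γ.par .bd + Γ.par .base) a) where
  var := h.var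
  par := h.par
  inp b hb := by rw [Function.update_of_ne (by omega), h.inp b hb]
  arr A' j hA' hj := by
    -- An address determines its array and index by division with remainder by `bd`.
    have key : j + A'.code * Γ.par .bd + Γ.par .base = i + A.code * Γ.par .bd + Γ.par .base →
        A' = A ∧ j = i := by
      intro heq
      have heq' : j + A'.code * Γ.par .bd = i + A.code * Γ.par .bd := by omega
      have h1 : j = i := by
        have := congrArg (· % Γ.par .bd) heq'
        simpa [Nat.mod_eq_of_lt hi, Nat.mod_eq_of_lt hj] using this
      subst h1
      exact ⟨Arr.code_injective (Nat.eq_of_mul_eq_mul_right (Nat.zero_lt_of_lt hi)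
        (Nat.add_left_cancel heq')), rfl⟩
    rw [Function.update_apply]
    split_ifs with hc
    · obtain ⟨rfl, rfl⟩ := key hc
      simp [Store.seta]
    · rw [h.arr A' j hA' hj]
      by_cases hAA : A' = A
      · subst hAA
        have : j ≠ i := fun h => hc (by rw [h])
        simp [Store.seta, this]
      · simp [Store.seta, hAA]
  arr_zero A' j hj := by
    by_cases hAA : A' = A
    · subst hAA
      have : j ≠ i := by omega
      simp [Store.seta, this, h.arr_zero _ j hj]
    · simp [Store.seta, hAA, h.arr_zero _ j hj]

/-- A verifier only receives and a prover only sends, so the history of the machine is determined by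
`pos` in the one case and by `out` in the other. This is what `History` records and what permits one
simulation for both roles. -/
theorem Stmt.simulate {Γ : Env} {na : ℕ} {role : Role} (hΓ : Γ.Small M na)
    (henv : Provides Γ M env role) (c : Stmt) :
    ∀ (depth d : ℕ) (k : List Cmd) (s : Store) (reg mem : ℕ → ℕ) (hist : List Msg),
      c.Fits role na depth → Represents Γ na s reg mem → History Γ role s hist →
      ∃ reg' mem' hist', Reaches M env Γ.coin (c.cost Γ)
          ⟨c.code d :: k, reg, mem, hist, s.coins⟩ ⟨k, reg', mem', hist', (c.run Γ s).coins⟩ ∧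
        Represents Γ na (c.run Γ s) reg' mem' ∧ History Γ role (c.run Γ s) hist' ∧
        ∀ d' < d, reg' (treg d') = reg (treg d') := by
  have hM := hΓ.two_lt
  have hM1 : 1 % M = 1 := Nat.mod_eq_of_lt (by omega)
  induction c with
  | skip =>
    intro depth d k s reg mem hist hf hrep hh
    exact ⟨reg, mem, hist, Reaches.step _ rfl, hrep, hh, fun _ _ => rfl⟩
  | set v e =>
    intro depth d k s reg mem hist hf hrep hh
    obtain ⟨reg1, h1, e1, f1⟩ := e.simulate (env := env) (coin := Γ.coin) hΓ d
      (mv (vreg v) (treg d) :: k) reg mem hist s.coins hf hrep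
    refine ⟨_, mem, hist, (Reaches.head (h1.trans
      (reaches_mv (vreg_ne_treg v d) k reg1 mem hist s.coins))).mono
      (by simp only [Stmt.cost]; omega), ?_, hh, ?_⟩
    · refine hrep.setv d (by simp [e1]) ?_
      intro x hx hxv
      rw [Function.update_of_ne hxv, f1 x hx]
    · intro d' hd'
      rw [Function.update_of_ne (vreg_ne_treg v d').symm,
        f1 _ (fun d'' hd'' => by simp only [ne_eq, treg_inj]; omega)]
  | put A i e =>
    intro depth d k s reg mem hist hf hrep hh
    set K : Cmd := .seq (.op .lt (treg (d + 2)) (treg d) (preg .bd)) <|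
      .ite (treg (d + 2))
        (.seq (.const (treg (d + 2)) A.code) <|
         .seq (.op .mul (treg (d + 2)) (treg (d + 2)) (preg .bd)) <|
         .seq (.op .add (treg d) (treg d) (treg (d + 2))) <|
         .seq (.op .add (treg d) (treg d) (preg .base)) (.store (treg d) (treg (d + 1))))
        .skip with hK
    obtain ⟨reg1, h1, e1, f1⟩ := i.simulate (env := env) (coin := Γ.coin) hΓ d
      (.seq (e.code (d + 1)) K :: k) reg mem hist s.coins hf.2.1 hrep
    obtain ⟨reg2, h2, e2, f2⟩ := e.simulate (env := env) (coin := Γ.coin) hΓ (d + 1)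
      (K :: k) reg1 mem hist s.coins hf.2.2 (hrep.congr d f1)
    have hrep2 := (hrep.congr d f1).congr (d + 1) f2
    have e1' : reg2 (treg d) = i.eval Γ s := by
      rw [f2 _ (fun d' hd' => by simp only [ne_eq, treg_inj]; omega), e1]
    have f12 : ∀ x, (∀ d' ≥ d, x ≠ treg d') → reg2 x = reg x := fun x hx => by
      rw [f2 x (fun d' hd' => hx d' (by omega)), f1 x hx]
    have hp := hrep2.par .bd
    have hp' := hrep2.par .base
    have hreach := Reaches.head (s := ⟨(Stmt.put A i e).code d :: k, reg, mem, hist, s.coins⟩)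
      (h1.trans (Reaches.head (s := ⟨.seq (e.code (d + 1)) K :: k, reg1, mem, hist, s.coins⟩) h2))
    by_cases hlt : i.eval Γ s < Γ.par .bd
    · have hstep : (Config.step M env Γ.coin)^[3] ⟨K :: k, reg2, mem, hist, s.coins⟩ =
          ⟨(.seq (.const (treg (d + 2)) A.code) <|
         .seq (.op .mul (treg (d + 2)) (treg (d + 2)) (preg .bd)) <|
         .seq (.op .add (treg d) (treg d) (treg (d + 2))) <|
         .seq (.op .add (treg d) (treg d) (preg .base)) (.store (treg d) (treg (d + 1)))) :: k,
         Function.update reg2 (treg (d + 2)) 1, mem, hist, s.coins⟩ := by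
        simp [hK, Config.step, RamOp.eval, e1', hp, hlt, hM1]
      have haddr := address_eq (M := M) hΓ hf.1 hlt
      have hrun : (Stmt.put A i e).run Γ s = s.seta A (i.eval Γ s) (e.eval Γ s) := by
        simp [Stmt.run, hlt]
      rw [hrun]
      refine ⟨Function.update (Function.update (Function.update (Function.update (Function.update reg2
        (treg (d + 2)) 1) (treg (d + 2)) (A.code % M)) (treg (d + 2)) (A.code % M * Γ.par .bd % M))
        (treg d) ((i.eval Γ s + A.code % M * Γ.par .bd % M) % M)) (treg d)
        (i.eval Γ s + A.code * Γ.par .bd + Γ.par .base), _, hist,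
        ((hreach.trans ⟨3, le_rfl, hstep⟩).trans ⟨9, le_rfl, ?_⟩).mono ?_,
        (hrep2.congr d ?_).seta (A := A) (a := e.eval Γ s) hlt, hh, ?_⟩
      · simp [Config.step, RamOp.eval, e1', e2, hp, hp', treg_inj,
          preg_ne_treg, Store.seta]
        refine ⟨?_, ?_⟩
        · rw [← haddr.1]; simp
        · rw [← haddr.1]; simp
      · simp only [Stmt.cost]; omega
      · intro x hx
        have g1 := hx d le_rfl
        have g2 := hx (d + 2) (by omega)
        simp [g1, g2]
      · intro d' hd'
        have g1 : d' ≠ d := by omega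
        have g2 : d' ≠ d + 2 := by omega
        simp [treg_inj, g1, g2]
        exact f12 _ (fun d'' hd'' => by simp only [ne_eq, treg_inj]; omega)
    · have hrun : (Stmt.put A i e).run Γ s = s := by simp [Stmt.run, hlt]
      rw [hrun]
      refine ⟨Function.update reg2 (treg (d + 2)) 0, mem, hist,
        (hreach.trans ⟨4, le_rfl, ?_⟩).mono ?_, hrep2.congr d ?_, hh, ?_⟩
      · simp [hK, Config.step, RamOp.eval, e1', hp, hlt]
      · simp only [Stmt.cost]; omega
      · intro x hx
        rw [Function.update_of_ne (hx (d + 2) (by omega))]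
      · intro d' hd'
        rw [Function.update_of_ne (by simp only [ne_eq, treg_inj]; omega)]
        exact f12 _ (fun d'' hd'' => by simp only [ne_eq, treg_inj]; omega)
  | recv v =>
    intro depth d k s reg mem hist hf hrep hh
    simp only [Stmt.Fits] at hf
    subst hf
    obtain ⟨w, hw, hwM⟩ := henv s.pos
    have hh' := hh
    obtain ⟨rfl, ho⟩ := hh
    refine ⟨Function.update reg (vreg v) (Γ.word s.pos), mem,
      (List.range s.pos).map (fun i => .got (Γ.word i)) ++ [.got (Γ.word s.pos)],
      Reaches.step _ ?_, ?_, ?_, ?_⟩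
    · simp [Stmt.code, Config.step, hw, hwM, Stmt.run, Store.setv]
    · have := hrep.setv (v := v) (a := Γ.word s.pos) (reg' := Function.update reg (vreg v)
        (Γ.word s.pos)) d (by simp) (fun x _ hx => by simp [hx])
      exact ⟨this.var, this.par, this.inp, this.arr, this.arr_zero⟩
    · simp [History, Stmt.run, List.range_succ, Store.setv, ho]
    · intro d' _
      rw [Function.update_of_ne (vreg_ne_treg v d').symm]
  | send e =>
    intro depth d k s reg mem hist hf hrep hh
    obtain ⟨hr, hu⟩ := hf
    subst hr
    obtain ⟨reg1, h1, e1, f1⟩ := e.simulate (env := env) (coin := Γ.coin) hΓ d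
      (.send (treg d) :: k) reg mem hist s.coins hu hrep
    refine ⟨reg1, mem, hist ++ [.sent (e.eval Γ s)], (Reaches.head (h1.trans
      (Reaches.step _ ?_))).mono (by simp only [Stmt.cost]; omega), ?_, ?_, ?_⟩
    · simp [Config.step, e1, Stmt.run]
    · have := hrep.congr d f1
      exact ⟨this.var, this.par, this.inp, this.arr, this.arr_zero⟩
    · obtain ⟨rfl, hp⟩ := hh
      simp [History, Stmt.run, hp]
    · intro d' hd'
      exact f1 _ (fun d'' hd'' => by simp only [ne_eq, treg_inj]; omega)
  | flip v =>
    intro depth d k s reg mem hist hf hrep hh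
    refine ⟨Function.update reg (vreg v) (if Γ.coin s.coins then 1 else 0), mem, hist,
      Reaches.step _ ?_, ?_, ?_, ?_⟩
    · simp only [Stmt.code, Config.step, Stmt.run]
      congr 2
      split_ifs <;> simp [hM1]
    · have := hrep.setv (v := v) (a := if Γ.coin s.coins then 1 else 0)
        (reg' := Function.update reg (vreg v) (if Γ.coin s.coins then 1 else 0)) d
        (by simp) (fun x _ hx => by simp [hx])
      exact ⟨this.var, this.par, this.inp, this.arr, this.arr_zero⟩
    · cases role <;> exact hh
    · intro d' _
      rw [Function.update_of_ne (vreg_ne_treg v d').symm]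
  | seq p q ihp ihq =>
    intro depth d k s reg mem hist hf hrep hh
    obtain ⟨reg1, mem1, hist1, h1, r1, hh1, f1⟩ := ihp depth d (q.code d :: k) s reg mem hist
      hf.1 hrep hh
    obtain ⟨reg2, mem2, hist2, h2, r2, hh2, f2⟩ := ihq depth d k (p.run Γ s) reg1 mem1 hist1
      hf.2 r1 hh1
    refine ⟨reg2, mem2, hist2, (Reaches.head (h1.trans h2)).mono (by simp only [Stmt.cost]; omega),
      r2, hh2, fun d' hd' => by rw [f2 d' hd', f1 d' hd']⟩
  | ite e p q ihp ihq =>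
    intro depth d k s reg mem hist hf hrep hh
    obtain ⟨reg1, h1, e1, f1⟩ := e.simulate (env := env) (coin := Γ.coin) hΓ d
      (.ite (treg d) (p.code d) (q.code d) :: k) reg mem hist s.coins hf.1 hrep
    have f1' : ∀ d' < d, reg1 (treg d') = reg (treg d') := fun d' hd' =>
      f1 _ (fun d'' hd'' => by simp only [ne_eq, treg_inj]; omega)
    have h1' := Reaches.head (s := ⟨(Stmt.ite e p q).code d :: k, reg, mem, hist, s.coins⟩) h1
    by_cases h0 : e.eval Γ s = 0
    · obtain ⟨reg2, mem2, hist2, h2, r2, hh2, f2⟩ := ihq depth d k s reg1 mem hist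
        hf.2.2 (hrep.congr d f1) hh
      have hrun : (Stmt.ite e p q).run Γ s = q.run Γ s := by simp [Stmt.run, h0]
      rw [hrun]
      refine ⟨reg2, mem2, hist2, ((h1'.trans (Reaches.step _ ?_)).trans h2).mono
        (by simp only [Stmt.cost]; omega), r2, hh2, fun d' hd' => by rw [f2 d' hd', f1' d' hd']⟩
      simp [Config.step, e1, h0]
    · obtain ⟨reg2, mem2, hist2, h2, r2, hh2, f2⟩ := ihp depth d k s reg1 mem hist
        hf.2.1 (hrep.congr d f1) hh
      have hrun : (Stmt.ite e p q).run Γ s = p.run Γ s := by simp [Stmt.run, h0]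
      rw [hrun]
      refine ⟨reg2, mem2, hist2, ((h1'.trans (Reaches.step _ ?_)).trans h2).mono
        (by simp only [Stmt.cost]; omega), r2, hh2, fun d' hd' => by rw [f2 d' hd', f1' d' hd']⟩
      simp [Config.step, e1, h0]
  | loop v p body ih =>
    intro depth d k s reg mem hist hf hrep hh
    cases depth with
    | zero => exact hf.elim
    | succ depth =>
    set W : Cmd := .while (treg (d + 1)) (.seq (mv (vreg v) (treg d)) <| .seq (body.code (d + 2)) <|
        .seq (.const (treg (d + 2)) 1) <| .seq (.op .add (treg d) (treg d) (treg (d + 2))) <|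
        .op .lt (treg (d + 1)) (treg d) (preg p)) with hW
    have hpM := hΓ.len_lt p hf.1
    -- The state after `i` rounds with control back at the `while`; the temporary `d + 1` already
    -- holds the outcome of the next test.
    have key : ∀ i ≤ Γ.par p, ∃ reg' mem' hist', Reaches M env Γ.coin (i * (body.cost Γ + 12) + 4)
          ⟨(Stmt.loop v p body).code d :: k, reg, mem, hist, s.coins⟩
          ⟨W :: k, reg', mem', hist', (iter (body.run Γ) v i s).coins⟩ ∧
        Represents Γ na (iter (body.run Γ) v i s) reg' mem' ∧
        History Γ role (iter (body.run Γ) v i s) hist' ∧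
        reg' (treg d) = i ∧ reg' (treg (d + 1)) = (if i < Γ.par p then 1 else 0) ∧
        ∀ d' < d, reg' (treg d') = reg (treg d') := by
      intro i
      induction i with
      | zero =>
        intro _
        refine ⟨Function.update (Function.update reg (treg d) 0) (treg (d + 1))
          (if 0 < Γ.par p then 1 else 0), mem, hist, ⟨4, by omega, ?_⟩, hrep.congr d ?_, hh, ?_, ?_, ?_⟩
        · simp only [Stmt.code, Config.step, Function.iterate_succ, Function.iterate_zero,
            Function.comp_apply, id, ← hW, iter, RamOp.eval]
          congr 2
          simp only [Nat.zero_mod, Function.update_self,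
            Function.update_of_ne (preg_ne_treg p d), hrep.par]
          split_ifs <;> simp [hM1]
        · intro x hx
          rw [Function.update_of_ne (hx (d + 1) (by omega)), Function.update_of_ne (hx d le_rfl)]
        · simp [treg_inj]
        · simp
        · intro d' hd'
          rw [Function.update_of_ne (by simp only [ne_eq, treg_inj]; omega),
            Function.update_of_ne (by simp only [ne_eq, treg_inj]; omega)]
      | succ i ihi =>
        intro hi
        obtain ⟨reg1, mem1, hist1, h1, r1, hh1, c1, c2, f1⟩ := ihi (by omega)
        have hi' : i < Γ.par p := by omega
        rw [if_pos hi'] at c2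
        have hh1' : History Γ role ((iter (body.run Γ) v i s).setv v i) hist1 := by
          cases role <;> exact hh1
        have r1' : Represents Γ na ((iter (body.run Γ) v i s).setv v i)
            (Function.update reg1 (vreg v) i) mem1 :=
          r1.setv d (by simp) (fun x _ hx => by simp [hx])
        set R : Cmd := .seq (.const (treg (d + 2)) 1) <|
          .seq (.op .add (treg d) (treg d) (treg (d + 2))) <|
          .op .lt (treg (d + 1)) (treg d) (preg p) with hR
        obtain ⟨reg2, mem2, hist2, h2, r2, hh2, f2⟩ := ih depth (d + 2) (R :: W :: k)
          ((iter (body.run Γ) v i s).setv v i) _ mem1 hist1 hf.2 r1' hh1'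
        have hd2 : reg2 (treg d) = i := by
          rw [f2 d (by omega), Function.update_of_ne (vreg_ne_treg v d).symm, c1]
        have g1 : Reaches M env Γ.coin 2
            ⟨W :: k, reg1, mem1, hist1, (iter (body.run Γ) v i s).coins⟩
            ⟨mv (vreg v) (treg d) :: .seq (body.code (d + 2)) R :: W :: k, reg1, mem1, hist1,
              (iter (body.run Γ) v i s).coins⟩ :=
          ⟨2, le_rfl, by simp [Config.step, hW, hR, c2]⟩
        have g2 := reaches_mv (M := M) (env := env) (coin := Γ.coin) (vreg_ne_treg v d)
          (.seq (body.code (d + 2)) R :: W :: k) reg1 mem1 hist1 (iter (body.run Γ) v i s).coins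
        rw [c1] at g2
        have g3 := Reaches.head (s := ⟨.seq (body.code (d + 2)) R :: W :: k,
          Function.update reg1 (vreg v) i, mem1, hist1, (iter (body.run Γ) v i s).coins⟩) h2
        refine ⟨Function.update (Function.update (Function.update reg2 (treg (d + 2)) 1) (treg d)
          (i + 1)) (treg (d + 1)) (if i + 1 < Γ.par p then 1 else 0), mem2, hist2,
          ((((h1.trans g1).trans g2).trans g3).trans ⟨5, le_rfl, ?_⟩).mono ?_,
          r2.congr d ?_, hh2, ?_, ?_, ?_⟩
        · have hi1 : (i + 1) % M = i + 1 := Nat.mod_eq_of_lt (by omega)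
          have n1 : treg d ≠ treg (d + 2) := by simp [treg_inj]
          simp only [Config.step, Function.iterate_succ, Function.iterate_zero, hR,
            Function.comp_apply, id, iter, RamOp.eval]
          simp only [Function.update_self, Function.update_of_ne n1,
            Function.update_of_ne (preg_ne_treg p _), r2.par, hd2, hM1, hi1]
          congr 2
          split_ifs <;> simp [hM1]
        · rw [add_mul]; omega
        · intro x hx
          rw [Function.update_of_ne (hx (d + 1) (by omega)), Function.update_of_ne (hx d le_rfl),
            Function.update_of_ne (hx (d + 2) (by omega))]
        · simp [treg_inj]
        · simp
        · intro d' hd'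
          rw [Function.update_of_ne (by simp only [ne_eq, treg_inj]; omega),
            Function.update_of_ne (by simp only [ne_eq, treg_inj]; omega),
            Function.update_of_ne (by simp only [ne_eq, treg_inj]; omega), f2 d' (by omega),
            Function.update_of_ne (vreg_ne_treg v d').symm, f1 d' hd']
    obtain ⟨reg1, mem1, hist1, h1, r1, hh1, c1, c2, f1⟩ := key (Γ.par p) le_rfl
    rw [if_neg (lt_irrefl _)] at c2
    refine ⟨reg1, mem1, hist1, (h1.trans (Reaches.step _ ?_)).mono (by simp only [Stmt.cost]; omega),
      r1, hh1, f1⟩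
    simp [Config.step, hW, c2, Stmt.run]

end

/-! ### Frames and loop invariants -/

/-- A syntactic upper bound for what can change. For a concrete program `simp` decides it, and
`run_var`, `run_arr` and `run_quiet` then give everything that stays the same without a look at the
semantics. -/
def Stmt.WritesVar : Stmt → Var → Prop
  | .skip, _ | .put _ _ _, _ | .send _, _ => False
  | .set v _, w | .recv v, w | .flip v, w => w = v
  | .seq p q, w | .ite _ p q, w => p.WritesVar w ∨ q.WritesVar w
  | .loop v _ body, w => w = v ∨ body.WritesVar w

def Stmt.WritesArr : Stmt → Arr → Prop
  | .put A _ _, B => B = A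
  | .seq p q, B | .ite _ p q, B => p.WritesArr B ∨ q.WritesArr B
  | .loop _ _ body, B => body.WritesArr B
  | _, _ => False

/-- The statement neither communicates nor tosses coins. -/
def Stmt.Quiet : Stmt → Prop
  | .recv _ | .send _ | .flip _ => False
  | .seq p q | .ite _ p q => p.Quiet ∧ q.Quiet
  | .loop _ _ body => body.Quiet
  | _ => True

def Expr.ReadsVar : Expr → Var → Prop
  | .var v, w => w = v
  | .par _, _ | .const _, _ => False
  | .add _ a b, w | .mul _ a b, w | .bin _ a b, w => a.ReadsVar w ∨ b.ReadsVar w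
  | .get _ e, w | .inp e, w => e.ReadsVar w

def Expr.ReadsArr : Expr → Arr → Prop
  | .var _, _ | .par _, _ | .const _, _ => False
  | .add _ a b, B | .mul _ a b, B | .bin _ a b, B => a.ReadsArr B ∨ b.ReadsArr B
  | .get A e, B => B = A ∨ e.ReadsArr B
  | .inp e, B => e.ReadsArr B

section
variable {Γ : Env}

theorem Store.setv_var (s : Store) (v w : Var) (a : ℕ) :
    (s.setv v a).var w = if w = v then a else s.var w := by
  simp [Store.setv, Function.update_apply]

@[simp] theorem Store.setv_self (s : Store) (v : Var) (a : ℕ) : (s.setv v a).var v = a := by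
  simp [Store.setv]

theorem Store.setv_ne (s : Store) {v w : Var} (a : ℕ) (h : w ≠ v) :
    (s.setv v a).var w = s.var w := by
  simp [Store.setv, h]

@[simp] theorem Store.setv_arr (s : Store) (v : Var) (a : ℕ) : (s.setv v a).arr = s.arr := rfl
@[simp] theorem Store.setv_pos (s : Store) (v : Var) (a : ℕ) : (s.setv v a).pos = s.pos := rfl
@[simp] theorem Store.setv_coins (s : Store) (v : Var) (a : ℕ) : (s.setv v a).coins = s.coins := rfl
@[simp] theorem Store.setv_out (s : Store) (v : Var) (a : ℕ) : (s.setv v a).out = s.out := rfl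
@[simp] theorem Store.seta_var (s : Store) (A : Arr) (i a : ℕ) : (s.seta A i a).var = s.var := rfl
@[simp] theorem Store.seta_pos (s : Store) (A : Arr) (i a : ℕ) : (s.seta A i a).pos = s.pos := rfl
@[simp] theorem Store.seta_coins (s : Store) (A : Arr) (i a : ℕ) :
    (s.seta A i a).coins = s.coins := rfl
@[simp] theorem Store.seta_out (s : Store) (A : Arr) (i a : ℕ) : (s.seta A i a).out = s.out := rfl

theorem Store.seta_arr (s : Store) (A B : Arr) (i j a : ℕ) :
    (s.seta A i a).arr B j = if B = A ∧ j = i then a else s.arr B j := by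
  by_cases h : B = A
  · subst h; simp [Store.seta, Function.update_apply]
  · simp [Store.seta, h]

theorem Store.seta_ne (s : Store) {A B : Arr} (i a : ℕ) (h : B ≠ A) :
    (s.seta A i a).arr B = s.arr B := by
  simp [Store.seta, h]

theorem Expr.eval_congr {s s' : Store} : ∀ {e : Expr}, (∀ v, e.ReadsVar v → s'.var v = s.var v) →
    (∀ A, e.ReadsArr A → s'.arr A = s.arr A) → e.eval Γ s' = e.eval Γ s := by
  intro e
  induction e with
  | var v => intro h _; exact h v rfl
  | par p => intros; rfl
  | const c => intros; rfl
  | add P a b iha ihb | mul P a b iha ihb | bin o a b iha ihb =>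
    intro hv hA
    simp only [Expr.eval]
    rw [iha (fun v h => hv v (.inl h)) (fun A h => hA A (.inl h)),
      ihb (fun v h => hv v (.inr h)) (fun A h => hA A (.inr h))]
  | get A e ih =>
    intro hv hA
    simp only [Expr.eval]
    rw [ih hv (fun A h => hA A (.inr h)), hA A (.inl rfl)]
  | inp e ih =>
    intro hv hA
    simp only [Expr.eval]
    rw [ih hv hA]

theorem run_var : ∀ {c : Stmt} (s : Store) {v : Var}, ¬ c.WritesVar v →
    (c.run Γ s).var v = s.var v := by
  intro c
  induction c with
  | skip | send e => intros; rfl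
  | put A i e => intro s v _; simp only [Stmt.run]; split_ifs <;> simp
  | set w e | recv w | flip w => intro s v h; exact s.setv_ne _ h
  | seq p q ihp ihq =>
    intro s v h
    simp only [Stmt.WritesVar, not_or] at h
    simp only [Stmt.run]
    rw [ihq _ h.2, ihp _ h.1]
  | ite e p q ihp ihq =>
    intro s v h
    simp only [Stmt.WritesVar, not_or] at h
    simp only [Stmt.run]
    split_ifs
    · exact ihq _ h.2
    · exact ihp _ h.1
  | loop w p body ih =>
    intro s v h
    simp only [Stmt.WritesVar, not_or] at h
    simp only [Stmt.run]
    induction Γ.par p with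
    | zero => rfl
    | succ i ihi => rw [iter, ih _ h.2, Store.setv_ne _ _ h.1, ihi]

theorem run_arr : ∀ {c : Stmt} (s : Store) {A : Arr}, ¬ c.WritesArr A →
    (c.run Γ s).arr A = s.arr A := by
  intro c
  induction c with
  | skip | send e | set w e | recv w | flip w => intros; rfl
  | put B i e =>
    intro s A h
    simp only [Stmt.run]
    split_ifs
    · exact s.seta_ne _ _ h
    · rfl
  | seq p q ihp ihq =>
    intro s u h
    simp only [Stmt.WritesArr, not_or] at h
    simp only [Stmt.run]
    rw [ihq _ h.2, ihp _ h.1]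
  | ite e p q ihp ihq =>
    intro s u h
    simp only [Stmt.WritesArr, not_or] at h
    simp only [Stmt.run]
    split_ifs
    · exact ihq _ h.2
    · exact ihp _ h.1
  | loop w p body ih =>
    intro s u h
    simp only [Stmt.WritesArr] at h
    simp only [Stmt.run]
    induction Γ.par p with
    | zero => rfl
    | succ i ihi => rw [iter, ih _ h, Store.setv_arr, ihi]

theorem run_quiet : ∀ {c : Stmt} (s : Store), c.Quiet → (c.run Γ s).pos = s.pos ∧
    (c.run Γ s).coins = s.coins ∧ (c.run Γ s).out = s.out := by
  intro c
  induction c with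
  | skip | set w e => intros; exact ⟨rfl, rfl, rfl⟩
  | send e | recv w | flip w => intro s h; exact h.elim
  | put B i e => intro s _; simp only [Stmt.run]; split_ifs <;> simp
  | seq p q ihp ihq =>
    intro s h
    obtain ⟨h1, h2, h3⟩ := ihp s h.1
    obtain ⟨h4, h5, h6⟩ := ihq (p.run Γ s) h.2
    exact ⟨h4.trans h1, h5.trans h2, h6.trans h3⟩
  | ite e p q ihp ihq =>
    intro s h
    simp only [Stmt.run]
    split_ifs
    · exact ihq _ h.2
    · exact ihp _ h.1
  | loop w p body ih =>
    intro s h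
    simp only [Stmt.run]
    induction Γ.par p with
    | zero => exact ⟨rfl, rfl, rfl⟩
    | succ i ihi =>
      obtain ⟨h1, h2, h3⟩ := ih ((iter (body.run Γ) w i s).setv w i) h
      exact ⟨h1.trans ihi.1, h2.trans ihi.2.1, h3.trans ihi.2.2⟩

/-- `s'` differs from `s` only in what the statement `c` writes. -/
structure Frame (c : Stmt) (s s' : Store) : Prop where
  var : ∀ v, ¬ c.WritesVar v → s'.var v = s.var v
  arr : ∀ A, ¬ c.WritesArr A → s'.arr A = s.arr A
  quiet : c.Quiet → s'.pos = s.pos ∧ s'.coins = s.coins ∧ s'.out = s.out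

theorem run_frame (c : Stmt) (s : Store) : Frame c s (c.run Γ s) :=
  ⟨fun _ => run_var s, fun _ => run_arr s, run_quiet s⟩

/-- The step also receives the frame condition relative to the store before the loop. So invariants
mention only what the loop changes. -/
theorem loop_inv {v : Var} {p : Par} {body : Stmt} (I : ℕ → Store → Prop) {s : Store} (h0 : I 0 s)
    (hs : ∀ i < Γ.par p, ∀ s', Frame (.loop v p body) s s' → I i s' →
      I (i + 1) (body.run Γ (s'.setv v i))) :
    I (Γ.par p) ((Stmt.loop v p body).run Γ s) := by
  have key : ∀ i ≤ Γ.par p, I i (iter (body.run Γ) v i s) := by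
    intro i
    induction i with
    | zero => exact fun _ => h0
    | succ i ih =>
      intro hi
      refine hs i (by omega) _ ?_ (ih (by omega))
      have : ∀ i, Frame (.loop v p body) s (iter (body.run Γ) v i s) := by
        intro i
        induction i with
        | zero => exact ⟨fun _ _ => rfl, fun _ _ => rfl, fun _ => ⟨rfl, rfl, rfl⟩⟩
        | succ i ih =>
          refine ⟨fun w hw => ?_, fun A hA => ?_, fun hq => ?_⟩
          · have hw' := hw
            simp only [Stmt.WritesVar, not_or] at hw
            rw [iter, run_var _ hw.2, Store.setv_ne _ _ hw.1, ih.var w hw']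
          · rw [iter, run_arr (c := body) _ hA, Store.setv_arr, ih.arr A hA]
          · obtain ⟨h1, h2, h3⟩ := run_quiet (Γ := Γ) (c := body) ((iter (body.run Γ) v i s).setv v i) hq
            obtain ⟨h4, h5, h6⟩ := ih.quiet hq
            exact ⟨h1.trans h4, h2.trans h5, h3.trans h6⟩
      exact this i
  exact key _ le_rfl

/-! ### Sequences, array assignments and sums. -/

/-- The sequential composition of a list of statements. -/
def seqL : List Stmt → Stmt
  | [] => .skip
  | c :: l => .seq c (seqL l)

theorem seqL_writesVar {l : List Stmt} {v : Var} :
    (seqL l).WritesVar v ↔ ∃ c ∈ l, c.WritesVar v := by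
  induction l with
  | nil => simp [seqL, Stmt.WritesVar]
  | cons c l ih => simp [seqL, Stmt.WritesVar, ih]

theorem seqL_writesArr {l : List Stmt} {A : Arr} :
    (seqL l).WritesArr A ↔ ∃ c ∈ l, c.WritesArr A := by
  induction l with
  | nil => simp [seqL, Stmt.WritesArr]
  | cons c l ih => simp [seqL, Stmt.WritesArr, ih]

theorem seqL_quiet {l : List Stmt} : (seqL l).Quiet ↔ ∀ c ∈ l, c.Quiet := by
  induction l with
  | nil => simp [seqL, Stmt.Quiet]
  | cons c l ih => simp [seqL, Stmt.Quiet, ih]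

theorem seqL_fits {l : List Stmt} {role : Role} {na d : ℕ} :
    (seqL l).Fits role na d ↔ ∀ c ∈ l, c.Fits role na d := by
  induction l with
  | nil => simp [seqL, Stmt.Fits]
  | cons c l ih => simp [seqL, Stmt.Fits, ih]

/-- `A[t] := e` for all vertices `t`. -/
def fill (A : Arr) (e : Expr) : Stmt := .loop .t .n (.put A (.var .t) e)

/-- The expression may read the entry that is about to be overwritten, since the entries from `i` on
still have their old values in round `i`. Accumulating counters and shrinking domains need this. -/
theorem fill_inplace {A : Arr} {e : Expr} {s : Store} {f : ℕ → ℕ} (hbd : Γ.par .n ≤ Γ.par .bd)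
    (he : ∀ i < Γ.par .n, ∀ s', s'.var .t = i → (∀ v, v ≠ .t → s'.var v = s.var v) →
      (∀ B, B ≠ A → s'.arr B = s.arr B) → (∀ j, i ≤ j → s'.arr A j = s.arr A j) →
      e.eval Γ s' = f i) :
    ∀ i < Γ.par .n, ((fill A e).run Γ s).arr A i = f i := by
  have := loop_inv (Γ := Γ) (v := .t) (p := .n) (body := .put A (.var .t) e) (s := s)
    (fun i s' => (∀ j < i, s'.arr A j = f j) ∧ ∀ j, i ≤ j → s'.arr A j = s.arr A j)
    ⟨fun j hj => by omega, fun j _ => rfl⟩ (by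
      intro i hi s' hF hI
      have hev : e.eval Γ (s'.setv .t i) = f i := by
        refine he i hi _ (by simp) (fun v hv => ?_) (fun B hB => ?_) (fun j hj => ?_)
        · rw [Store.setv_ne _ _ hv]
          exact hF.var v (by simp [Stmt.WritesVar, hv])
        · exact hF.arr B (by simp [Stmt.WritesArr, hB])
        · exact hI.2 j hj
      simp only [Stmt.run, Expr.eval, Store.setv_self, if_pos (hi.trans_le hbd), Store.seta_arr, hev,
        true_and, Store.setv_arr]
      refine ⟨fun j hj => ?_, fun j hj => ?_⟩
      · split_ifs with h
        · rw [h]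
        · exact hI.1 j (by omega)
      · rw [if_neg (by omega)]
        exact hI.2 j (by omega))
  exact this.1

theorem fill_spec {A : Arr} {e : Expr} (s : Store) (hbd : Γ.par .n ≤ Γ.par .bd)
    (hA : ¬ e.ReadsArr A) :
    ∀ i < Γ.par .n, ((fill A e).run Γ s).arr A i = e.eval Γ (s.setv .t i) := by
  refine fill_inplace hbd fun i hi s' ht hv hB _ => Expr.eval_congr (fun v _ => ?_) (fun B h => ?_)
  · by_cases hvt : v = .t
    · subst hvt; simp [ht]
    · rw [hv v hvt, Store.setv_ne _ _ hvt]
  · exact hB B (fun h' => hA (h' ▸ h))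

/-- `v := ∑ e` over all vertices `t`, modulo `N`. -/
def sumN (v : Var) (e : Expr) : Stmt :=
  .seq (.set v (.const 0)) (.loop .t .n (.set v (.add .N (.var v) e)))

theorem sumN_spec {v : Var} {e : Expr} (s : Store) (hv : ¬ e.ReadsVar v) (hvt : v ≠ .t) :
    (((sumN v e).run Γ s).var v : ZMod (Γ.par .N)) =
      ∑ i ∈ Finset.range (Γ.par .n), (e.eval Γ (s.setv .t i) : ZMod (Γ.par .N)) := by
  refine loop_inv (Γ := Γ) (v := .t) (p := .n) (body := .set v (.add .N (.var v) e))
    (s := s.setv v 0) (fun i s' => (s'.var v : ZMod (Γ.par .N)) =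
      ∑ i ∈ Finset.range i, (e.eval Γ (s.setv .t i) : ZMod (Γ.par .N))) (by simp) ?_
  intro i hi s' hF hI
  have hev : e.eval Γ (s'.setv .t i) = e.eval Γ (s.setv .t i) := by
    refine Expr.eval_congr (fun w hw => ?_) (fun B _ => ?_)
    · have hwv : w ≠ v := fun h => hv (h ▸ hw)
      rw [Store.setv_var, Store.setv_var]
      split_ifs with h
      · rfl
      · rw [hF.var w (by simp [Stmt.WritesVar, h, hwv]), Store.setv_ne _ _ hwv]
    · exact hF.arr B (by simp [Stmt.WritesArr])
  simp only [Stmt.run, Expr.eval, Store.setv_self, Modulus.par, ZMod.natCast_mod, Nat.cast_add,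
    hev, Store.setv_ne _ _ hvt, hI, Finset.sum_range_succ]

end

/-! ### Indicators -/

/-- The indicator of a proposition. -/
noncomputable def ind (p : Prop) : ℕ := @ite _ p (Classical.propDecidable p) 1 0

theorem ind_pos {p : Prop} (h : p) : ind p = 1 := by simp [ind, h]
theorem ind_neg {p : Prop} (h : ¬ p) : ind p = 0 := by simp [ind, h]
theorem ind_eq_ite (p : Prop) [Decidable p] : ind p = if p then 1 else 0 := by
  by_cases h : p <;> simp [ind, h]
theorem ind_le_one (p : Prop) : ind p ≤ 1 := by by_cases h : p <;> simp [ind, h]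
@[simp] theorem ind_eq_zero {p : Prop} : ind p = 0 ↔ ¬ p := by by_cases h : p <;> simp [ind, h]
theorem ind_ne_zero {p : Prop} : ind p ≠ 0 ↔ p := by simp
@[simp] theorem ind_eq_one {p : Prop} : ind p = 1 ↔ p := by by_cases h : p <;> simp [ind, h]
theorem ind_and {p q : Prop} : ind (p ∧ q) = ind p * ind q := by
  by_cases h : p <;> by_cases h' : q <;> simp [ind, h, h']
theorem ind_congr {p q : Prop} (h : p ↔ q) : ind p = ind q := by rw [propext h]

/-! ### Basic expressions -/

def idxE (a b : Expr) : Expr := .add .W (.mul .W a (.par .n)) b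
def relE (a b : Expr) : Expr := .get .rel (idxE a b)
def isRel (a b : Expr) (c : Fin 3) : Expr := .bin .eq (relE a b) (.const c)
def domE (j : ℕ) (a : Expr) : Expr := .get (.dom j) a
def andL (l : List Expr) : Expr := l.foldr (.mul .W) (.const 1)
def addN (a b : Expr) : Expr := .add .N a b
def mulN (a b : Expr) : Expr := .mul .N a b
/-- Subtraction modulo `N`. -/
def subN (a b : Expr) : Expr := .add .N a (.bin .sub (.par .N) (.bin .mod b (.par .N)))
def notE (a : Expr) : Expr := .bin .eq a (.const 0)

section
variable {Γ : Env} {s : Store}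

theorem eval_addN (a b : Expr) : ((addN a b).eval Γ s : ZMod (Γ.par .N)) =
    a.eval Γ s + b.eval Γ s := by
  simp [addN, Expr.eval, Modulus.par]

theorem eval_mulN (a b : Expr) : ((mulN a b).eval Γ s : ZMod (Γ.par .N)) =
    a.eval Γ s * b.eval Γ s := by
  simp [mulN, Expr.eval, Modulus.par]

theorem eval_subN (hN : 0 < Γ.par .N) (a b : Expr) : ((subN a b).eval Γ s : ZMod (Γ.par .N)) =
    a.eval Γ s - b.eval Γ s := by
  simp only [subN, Expr.eval, Modulus.par, BinOp.eval, ZMod.natCast_mod, Nat.cast_add]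
  rw [Nat.cast_sub (Nat.mod_lt _ hN).le]
  simp [sub_eq_add_neg]

theorem eval_notE (a : Expr) : (notE a).eval Γ s = ind (a.eval Γ s = 0) := by
  by_cases h : a.eval Γ s = 0 <;> simp [notE, Expr.eval, BinOp.eval, ind, h]

theorem eval_andL (hW : 1 < Γ.par .W) {l : List Expr} (h : ∀ e ∈ l, e.eval Γ s ≤ 1) :
    (andL l).eval Γ s = ind (∀ e ∈ l, e.eval Γ s ≠ 0) := by
  induction l with
  | nil => simp [andL, Expr.eval, ind]
  | cons e l ih =>
    have h1 := ih (fun e he => h e (List.mem_cons_of_mem _ he))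
    have h2 := h e List.mem_cons_self
    have h3 : (andL (e :: l)).eval Γ s = (e.eval Γ s * (andL l).eval Γ s) % Γ.par .W := rfl
    have h4 : e.eval Γ s = ind (e.eval Γ s ≠ 0) := by
      by_cases h : e.eval Γ s = 0
      · simp [h, ind]
      · rw [ind_pos h]; omega
    rw [h3, h1, h4, ← ind_and, Nat.mod_eq_of_lt ((ind_le_one _).trans_lt hW)]
    exact ind_congr (by simp)

theorem eval_idxE {a b : Expr} (hW : Γ.par .n * Γ.par .n + Γ.par .n ≤ Γ.par .W)
    (ha : a.eval Γ s < Γ.par .n) (hb : b.eval Γ s < Γ.par .n) :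
    (idxE a b).eval Γ s = a.eval Γ s * Γ.par .n + b.eval Γ s := by
  have : a.eval Γ s * Γ.par .n + Γ.par .n ≤ Γ.par .n * Γ.par .n := by
    have := Nat.mul_le_mul_right (Γ.par .n) (Nat.succ_le_of_lt ha)
    rwa [Nat.succ_mul] at this
  simp only [idxE, Expr.eval, Modulus.par]
  rw [Nat.mod_eq_of_lt (a := _ * _) (by omega), Nat.mod_eq_of_lt (by omega)]

end

attribute [simp] Stmt.WritesVar Stmt.WritesArr Stmt.Quiet Expr.ReadsVar Expr.ReadsArr Stmt.Fits
  Expr.UsesBelow Par.IsLength seqL_writesVar seqL_writesArr seqL_quiet seqL_fits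

/-- The environment describes a graph on `0, …, n - 1`, where `rl u v` is `2` if `u = v`, `1` if
`u` and `v` are adjacent, and `0` otherwise, and its parameters are large enough. -/
structure Graphical (Γ : Env) (rl : ℕ → ℕ → Fin 3) : Prop where
  n_pos : 0 < Γ.par .n
  N_pos : 0 < Γ.par .N
  W_idx : Γ.par .n * Γ.par .n + Γ.par .n ≤ Γ.par .W
  W_addr : 2 * Γ.par .m + 4 ≤ Γ.par .W
  bd_sq : Γ.par .n * Γ.par .n ≤ Γ.par .bd
  diag : ∀ u v, rl u v = 2 ↔ u = v
  symm : ∀ u v, rl u v = rl v u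
  edge_lt : ∀ e < Γ.par .m, Γ.inp (2 * e + 2) < Γ.par .n ∧ Γ.inp (2 * e + 3) < Γ.par .n
  sum_edges : ∀ (g : ℕ → ℕ), ∀ t < Γ.par .n, ∑ e ∈ Finset.range (Γ.par .m),
    (ind (Γ.inp (2 * e + 2) = t) * g (Γ.inp (2 * e + 3)) +
      ind (Γ.inp (2 * e + 3) = t) * g (Γ.inp (2 * e + 2))) =
    ∑ y ∈ Finset.range (Γ.par .n), ind (rl t y = 1) * g y

namespace Graphical
variable {Γ : Env} {rl : ℕ → ℕ → Fin 3} (h : Graphical Γ rl)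
include h

theorem n_le_bd : Γ.par .n ≤ Γ.par .bd :=
  (Nat.le_mul_of_pos_right _ h.n_pos).trans h.bd_sq

theorem one_lt_W : 1 < Γ.par .W := by have := h.W_addr; omega

end Graphical

/-- The store contains the relation matrix, the domains `dom`, and the values of the first `J`
quantified variables. -/
structure Good (Γ : Env) (rl : ℕ → ℕ → Fin 3) (k : ℕ) (dom : ℕ → ℕ → Prop) (J : ℕ) (v : ℕ → ℕ)
    (s : Store) : Prop where
  rel : ∀ a < Γ.par .n, ∀ b < Γ.par .n, s.arr .rel (a * Γ.par .n + b) = rl a b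
  dom : ∀ j < k, ∀ a < Γ.par .n, s.arr (.dom j) a = ind (dom j a)
  x : ∀ j < J, s.var (.x j) = v j
  lt : ∀ j < J, v j < Γ.par .n

section
variable {Γ : Env} {rl : ℕ → ℕ → Fin 3} {k J : ℕ} {dom : ℕ → ℕ → Prop} {v : ℕ → ℕ} {s s' : Store}

theorem Good.congr (h : Good Γ rl k dom J v s) (hr : s'.arr .rel = s.arr .rel)
    (hd : ∀ j < k, s'.arr (.dom j) = s.arr (.dom j)) (hx : ∀ j < J, s'.var (.x j) = s.var (.x j)) :
    Good Γ rl k dom J v s' where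
  rel a ha b hb := by rw [hr, h.rel a ha b hb]
  dom j hj a ha := by rw [hd j hj, h.dom j hj a ha]
  x j hj := by rw [hx j hj, h.x j hj]
  lt := h.lt

theorem Good.frame (h : Good Γ rl k dom J v s) {c : Stmt} (hF : Frame c s s')
    (hr : ¬ c.WritesArr .rel) (hd : ∀ j, ¬ c.WritesArr (.dom j))
    (hx : ∀ j < J, ¬ c.WritesVar (.x j)) : Good Γ rl k dom J v s' :=
  h.congr (hF.arr _ hr) (fun j _ => hF.arr _ (hd j)) (fun j hj => hF.var _ (hx j hj))

theorem Good.run (h : Good Γ rl k dom J v s) {c : Stmt} (hr : ¬ c.WritesArr .rel)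
    (hd : ∀ j, ¬ c.WritesArr (.dom j)) (hx : ∀ j < J, ¬ c.WritesVar (.x j)) :
    Good Γ rl k dom J v (c.run Γ s) :=
  h.frame (run_frame c s) hr hd hx

theorem Good.setv (h : Good Γ rl k dom J v s) {w : Var} {a : ℕ} (hw : ∀ j < J, .x j ≠ w) :
    Good Γ rl k dom J v (s.setv w a) :=
  h.congr rfl (fun _ _ => rfl) fun j hj => s.setv_ne a (hw j hj)

theorem Good.set_x (h : Good Γ rl k dom J v s) {a : ℕ} (ha : a < Γ.par .n) :
    Good Γ rl k dom (J + 1) (Function.update v J a) (s.setv (.x J) a) where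
  rel := h.rel
  dom := h.dom
  x j hj := by
    rcases Nat.lt_succ_iff_lt_or_eq.1 hj with hj | rfl
    · rw [Store.setv_ne _ _ (by simp; omega), Function.update_of_ne (by omega), h.x j hj]
    · simp
  lt j hj := by
    rcases Nat.lt_succ_iff_lt_or_eq.1 hj with hj | rfl
    · rw [Function.update_of_ne (by omega)]; exact h.lt j hj
    · simpa using ha

theorem Good.mono (h : Good Γ rl k dom J v s) {J' : ℕ} (hJ : J' ≤ J) : Good Γ rl k dom J' v s :=
  ⟨h.rel, h.dom, fun j hj => h.x j (by omega), fun j hj => h.lt j (by omega)⟩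

theorem Good.eval_relE (hG : Graphical Γ rl) (h : Good Γ rl k dom J v s) {a b : Expr}
    (ha : a.eval Γ s < Γ.par .n) (hb : b.eval Γ s < Γ.par .n) :
    (relE a b).eval Γ s = rl (a.eval Γ s) (b.eval Γ s) := by
  simp only [relE, Expr.eval]
  rw [eval_idxE hG.W_idx ha hb, h.rel _ ha _ hb]

theorem Good.eval_isRel (hG : Graphical Γ rl) (h : Good Γ rl k dom J v s) {a b : Expr} (c : Fin 3)
    (ha : a.eval Γ s < Γ.par .n) (hb : b.eval Γ s < Γ.par .n) :
    (isRel a b c).eval Γ s = ind (rl (a.eval Γ s) (b.eval Γ s) = c) := by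
  have := h.eval_relE hG ha hb
  simp only [isRel, Expr.eval, BinOp.eval, this, ind_eq_ite, Fin.val_inj]

/-- The expressions of the list have values `0` or `1`, and all are `1` if and only if `P`. -/
def Checks (Γ : Env) (s : Store) (l : List Expr) (P : Prop) : Prop :=
  (∀ e ∈ l, e.eval Γ s ≤ 1) ∧ ((∀ e ∈ l, e.eval Γ s ≠ 0) ↔ P)

theorem Checks.eval (hG : Graphical Γ rl) {l : List Expr} {P : Prop} (h : Checks Γ s l P) :
    (andL l).eval Γ s = ind P := by
  rw [eval_andL hG.one_lt_W h.1, propext h.2]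

theorem Checks.nil : Checks Γ s [] True := by simp [Checks]

theorem Checks.cons {e : Expr} {l : List Expr} {P Q : Prop} (he : e.eval Γ s = ind P)
    (h : Checks Γ s l Q) : Checks Γ s (e :: l) (P ∧ Q) := by
  simp only [Checks, List.mem_cons, forall_eq_or_imp, he, ind_le_one, ind_ne_zero, true_and]
  exact ⟨h.1, and_congr_right fun _ => h.2⟩

theorem Checks.append {l l' : List Expr} {P Q : Prop} (h : Checks Γ s l P)
    (h' : Checks Γ s l' Q) : Checks Γ s (l ++ l') (P ∧ Q) := by
  simp only [Checks, List.mem_append, or_imp, forall_and]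
  exact ⟨⟨h.1, h'.1⟩, and_congr h.2 h'.2⟩

theorem Checks.map {f : ℕ → Expr} {P : ℕ → Prop} (K : ℕ)
    (h : ∀ i < K, (f i).eval Γ s = ind (P i)) :
    Checks Γ s ((List.range K).map f) (∀ i < K, P i) := by
  simp only [Checks, List.mem_map, List.mem_range, forall_exists_index, and_imp,
    forall_apply_eq_imp_iff₂]
  refine ⟨fun i hi => by rw [h i hi]; exact ind_le_one _, forall₂_congr fun i hi => ?_⟩
  rw [h i hi, ind_ne_zero]

theorem Checks.flatMap {f : ℕ → List Expr} {P : ℕ → Prop} (K : ℕ)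
    (h : ∀ i < K, Checks Γ s (f i) (P i)) :
    Checks Γ s ((List.range K).flatMap f) (∀ i < K, P i) := by
  simp only [Checks, List.mem_flatMap, List.mem_range, forall_exists_index, and_imp]
  refine ⟨fun e i hi he => (h i hi).1 e he, ⟨fun H i hi => (h i hi).2.1 fun e he => H e i hi he,
    fun H e i hi he => (h i hi).2.2 (H i hi) e he⟩⟩

/-! ### Patterns -/

/-- `a` has the prescribed relations to the first `K` variables. -/
def Fitting (rl : ℕ → ℕ → Fin 3) (K : ℕ) (π : ℕ → ℕ → Fin 3) (v : ℕ → ℕ) (j a : ℕ) : Prop :=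
  ∀ i < K, rl (v i) a = π i j

/-- The first `K` variables have the relations prescribed by the pattern `π`. -/
def Matches (rl : ℕ → ℕ → Fin 3) (K : ℕ) (π : ℕ → ℕ → Fin 3) (v : ℕ → ℕ) : Prop :=
  ∀ j < K, Fitting rl j π v j (v j)

def fitE (K : ℕ) (π : ℕ → ℕ → Fin 3) (j : ℕ) (a : Expr) : List Expr :=
  (List.range K).map fun i => isRel (.var (.x i)) a (π i j)

def matchE (K : ℕ) (π : ℕ → ℕ → Fin 3) : List Expr :=
  (List.range K).flatMap fun j => fitE j π j (.var (.x j))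

def domL (K : ℕ) : List Expr := (List.range K).map fun i => domE i (.var (.x i))

/-- Membership in the domain `j` and the relations to the first `K` variables. -/
def filterE (K : ℕ) (π : ℕ → ℕ → Fin 3) (j : ℕ) (a : Expr) : Expr :=
  andL (domE j a :: fitE K π j a)

theorem Good.fitE (hG : Graphical Γ rl) (h : Good Γ rl k dom J v s) {K : ℕ} (hK : K ≤ J)
    (π : ℕ → ℕ → Fin 3) (j : ℕ) {a : Expr} (ha : a.eval Γ s < Γ.par .n) :
    Checks Γ s (fitE K π j a) (Fitting rl K π v j (a.eval Γ s)) := by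
  refine Checks.map K fun i hi => ?_
  have hx := h.x i (by omega)
  have := h.eval_isRel hG (a := .var (.x i)) (b := a) (π i j)
    (by simpa only [Expr.eval, hx] using h.lt i (by omega)) ha
  rw [this]
  simp only [Expr.eval, hx]

theorem Good.matchE (hG : Graphical Γ rl) (h : Good Γ rl k dom J v s) {K : ℕ} (hK : K ≤ J)
    (π : ℕ → ℕ → Fin 3) : Checks Γ s (matchE K π) (Matches rl K π v) := by
  refine Checks.flatMap K fun j hj => ?_
  have hx := h.x j (by omega)
  have := h.fitE hG (K := j) (by omega) π j (a := .var (.x j))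
    (by simpa only [Expr.eval, hx] using h.lt j (by omega))
  simpa only [Expr.eval, hx] using this

theorem Good.domL (h : Good Γ rl k dom J v s) {K : ℕ} (hK : K ≤ J) (hk : K ≤ k) :
    Checks Γ s (domL K) (∀ i < K, dom i (v i)) := by
  refine Checks.map K fun i hi => ?_
  have hx := h.x i (by omega)
  simp only [domE, Expr.eval, hx, h.dom i (by omega) _ (h.lt i (by omega))]

theorem Good.eval_domE (h : Good Γ rl k dom J v s) {j : ℕ} (hj : j < k) {a : Expr}
    (ha : a.eval Γ s < Γ.par .n) : (domE j a).eval Γ s = ind (dom j (a.eval Γ s)) := by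
  simp only [domE, Expr.eval, h.dom j hj _ ha]

theorem Good.eval_filterE (hG : Graphical Γ rl) (h : Good Γ rl k dom J v s) {K : ℕ} (hK : K ≤ J)
    (π : ℕ → ℕ → Fin 3) {j : ℕ} (hj : j < k) {a : Expr} (ha : a.eval Γ s < Γ.par .n) :
    (filterE K π j a).eval Γ s =
      ind (dom j (a.eval Γ s) ∧ Fitting rl K π v j (a.eval Γ s)) :=
  (Checks.cons (h.eval_domE hj ha) (h.fitE hG hK π j ha)).eval hG

end

theorem isRel_readsVar {a b : Expr} {c : Fin 3} {v : Var} :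
    (isRel a b c).ReadsVar v ↔ a.ReadsVar v ∨ b.ReadsVar v := by
  simp [isRel, relE, idxE]

theorem isRel_readsArr {a b : Expr} {c : Fin 3} {A : Arr} :
    (isRel a b c).ReadsArr A ↔ A = .rel ∨ a.ReadsArr A ∨ b.ReadsArr A := by
  simp [isRel, relE, idxE]

theorem andL_readsVar {l : List Expr} {v : Var} :
    (andL l).ReadsVar v ↔ ∃ e ∈ l, e.ReadsVar v := by
  induction l with
  | nil => simp [andL]
  | cons e l ih => simpa [andL] using or_congr_right ih

theorem andL_readsArr {l : List Expr} {A : Arr} :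
    (andL l).ReadsArr A ↔ ∃ e ∈ l, e.ReadsArr A := by
  induction l with
  | nil => simp [andL]
  | cons e l ih => simpa [andL] using or_congr_right ih

theorem andL_usesBelow {l : List Expr} {na : ℕ} :
    (andL l).UsesBelow na ↔ ∀ e ∈ l, e.UsesBelow na := by
  induction l with
  | nil => simp [andL]
  | cons e l ih => simpa [andL] using and_congr_right fun _ => ih

attribute [simp] isRel_readsVar isRel_readsArr andL_readsVar andL_readsArr andL_usesBelow
attribute [simp] domE addN mulN subN notE

theorem filterE_readsVar {K j : ℕ} {π : ℕ → ℕ → Fin 3} {a : Expr} {v : Var} :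
    (filterE K π j a).ReadsVar v → (∃ i < K, v = .x i) ∨ a.ReadsVar v := by
  simp only [filterE, fitE, andL_readsVar, List.mem_cons, List.mem_map, List.mem_range,
    exists_eq_or_imp, domE, Expr.ReadsVar]
  rintro (h | ⟨e, ⟨i, hi, rfl⟩, h⟩)
  · exact .inr h
  · rcases isRel_readsVar.1 h with h | h
    · exact .inl ⟨i, hi, h⟩
    · exact .inr h

theorem filterE_readsArr {K j : ℕ} {π : ℕ → ℕ → Fin 3} {a : Expr} {A : Arr} :
    (filterE K π j a).ReadsArr A → A = .rel ∨ A = .dom j ∨ a.ReadsArr A := by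
  simp only [filterE, fitE, andL_readsArr, List.mem_cons, List.mem_map, List.mem_range,
    exists_eq_or_imp, domE, Expr.ReadsArr]
  rintro (h | ⟨e, ⟨i, hi, rfl⟩, h⟩)
  · tauto
  · rcases isRel_readsArr.1 h with h | h | h
    · exact .inl h
    · exact h.elim
    · tauto

/-! ### Sums over neighbourhoods -/

def edgeFst : Expr := .inp (.add .W (.add .W (.var .e) (.var .e)) (.const 2))
def edgeSnd : Expr := .inp (.add .W (.add .W (.add .W (.var .e) (.var .e)) (.const 2)) (.const 1))

/-- `O[t] := ∑ W(t, y)` over the neighbours `y` of `t`, modulo `N`. -/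
def adjSum (w : Expr) (O : Arr) : Stmt :=
  .seq (fill O (.const 0)) <| .loop .e .m <|
    .seq (.set .t edgeFst) <| .seq (.set .y edgeSnd) <|
    .seq (.put O (.var .t) (addN (.get O (.var .t)) w)) <|
    .seq (.set .t edgeSnd) <| .seq (.set .y edgeFst) <|
    .put O (.var .t) (addN (.get O (.var .t)) w)

/-- `O[t] := e` for all vertices `t`, where in addition the variable `y` has the value `t`. -/
def fillDiag (O : Arr) (e : Expr) : Stmt :=
  .loop .t .n (.seq (.set .y (.var .t)) (.put O (.var .t) e))

/-- `O[t] := ∑ W(t, y)` over the vertices `y` in relation `α` to `t`, modulo `N`; here `full` is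
the sum over all `y`. -/
def relSum (α : Fin 3) (w full : Expr) (O : Arr) : Stmt :=
  if α = 1 then adjSum w O
  else if α = 2 then fillDiag O w
  else .seq (adjSum w O) (fillDiag O (subN (subN full (.get O (.var .t))) w))

section
variable {Γ : Env} {rl : ℕ → ℕ → Fin 3} {s : Store}

@[simp] theorem fill_writesVar {A : Arr} {e : Expr} {v : Var} : (fill A e).WritesVar v ↔ v = .t := by
  simp [fill]
@[simp] theorem fill_writesArr {A B : Arr} {e : Expr} : (fill A e).WritesArr B ↔ B = A := by
  simp [fill]
@[simp] theorem fill_quiet {A : Arr} {e : Expr} : (fill A e).Quiet := by simp [fill]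
@[simp] theorem fill_fits {A : Arr} {e : Expr} {role : Role} {na d : ℕ} :
    (fill A e).Fits role na (d + 1) ↔ A.code < na ∧ e.UsesBelow na := by
  simp [fill]
@[simp] theorem sumN_writesVar {w : Var} {e : Expr} {v : Var} :
    (sumN w e).WritesVar v ↔ v = w ∨ v = .t := by
  simp [sumN]; tauto
@[simp] theorem sumN_writesArr {w : Var} {B : Arr} {e : Expr} : ¬ (sumN w e).WritesArr B := by
  simp [sumN]
@[simp] theorem sumN_quiet {w : Var} {e : Expr} : (sumN w e).Quiet := by simp [sumN]
@[simp] theorem sumN_fits {w : Var} {e : Expr} {role : Role} {na d : ℕ} :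
    (sumN w e).Fits role na (d + 1) ↔ e.UsesBelow na := by
  simp [sumN]
@[simp] theorem relSum_writesVar {α : Fin 3} {w full : Expr} {O : Arr} {v : Var} :
    (relSum α w full O).WritesVar v → v = .t ∨ v = .y ∨ v = .e := by
  unfold relSum
  split_ifs <;> simp [adjSum, fillDiag] <;> tauto
@[simp] theorem relSum_writesArr {α : Fin 3} {w full : Expr} {O B : Arr} :
    (relSum α w full O).WritesArr B ↔ B = O := by
  unfold relSum
  split_ifs <;> simp [adjSum, fillDiag]
@[simp] theorem relSum_quiet {α : Fin 3} {w full : Expr} {O : Arr} :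
    (relSum α w full O).Quiet := by
  unfold relSum
  split_ifs <;> simp [adjSum, fillDiag]
theorem relSum_fits {α : Fin 3} {w full : Expr} {O : Arr} {role : Role} {na d : ℕ}
    (hO : O.code < na) (hw : w.UsesBelow na) (hf : full.UsesBelow na) :
    (relSum α w full O).Fits role na (d + 1) := by
  unfold relSum
  split_ifs <;> simp [adjSum, fillDiag, hO, hw, hf, edgeFst, edgeSnd]

theorem eval_edge (hG : Graphical Γ rl) (he : s.var .e < Γ.par .m) :
    edgeFst.eval Γ s = Γ.inp (2 * s.var .e + 2) ∧ edgeSnd.eval Γ s = Γ.inp (2 * s.var .e + 3) := by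
  have := hG.W_addr
  simp only [edgeFst, edgeSnd, Expr.eval, Modulus.par]
  have h1 : (s.var .e + s.var .e) % Γ.par .W = s.var .e + s.var .e := Nat.mod_eq_of_lt (by omega)
  have h2 : (s.var .e + s.var .e + 2) % Γ.par .W = s.var .e + s.var .e + 2 :=
    Nat.mod_eq_of_lt (by omega)
  have h3 : (s.var .e + s.var .e + 2 + 1) % Γ.par .W = s.var .e + s.var .e + 2 + 1 :=
    Nat.mod_eq_of_lt (by omega)
  have e2 : ((2 : Fin 3) : ℕ) = 2 := rfl
  have e1 : ((1 : Fin 3) : ℕ) = 1 := rfl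
  rw [e2, e1, h1, h2, h3]
  exact ⟨congrArg _ (by omega), congrArg _ (by omega)⟩

theorem eval_set_ty {w : Expr} {O : Arr} (hO : ¬ w.ReadsArr O) (he : ¬ w.ReadsVar .e) {s s' : Store}
    (hv : ∀ v, v ≠ .t → v ≠ .y → v ≠ .e → s'.var v = s.var v) (hA : ∀ A, A ≠ O → s'.arr A = s.arr A) :
    w.eval Γ s' = w.eval Γ ((s.setv .t (s'.var .t)).setv .y (s'.var .y)) := by
  refine Expr.eval_congr (fun v h => ?_) (fun A h => hA A fun h' => hO (h' ▸ h))
  by_cases h1 : v = .y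
  · subst h1; simp
  by_cases h2 : v = .t
  · subst h2; rw [Store.setv_ne _ _ h1]; simp
  rw [Store.setv_ne _ _ h1, Store.setv_ne _ _ h2, hv v h2 h1 fun h' => he (h' ▸ h)]

/-- One pass over the edge list, in which each edge contributes to both of its ends with the roles
of `t` and `y` exchanged; `sum_edges` turns the result into a sum over neighbours. This is linear in
m for all `t` together. -/
theorem adjSum_spec (hG : Graphical Γ rl) {w : Expr} {O : Arr} (hO : ¬ w.ReadsArr O)
    (he : ¬ w.ReadsVar .e) (s : Store) :
    ∀ i < Γ.par .n, (((adjSum w O).run Γ s).arr O i : ZMod (Γ.par .N)) =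
      ∑ j ∈ Finset.range (Γ.par .n), (ind (rl i j = 1) : ZMod (Γ.par .N)) *
        (w.eval Γ ((s.setv .t i).setv .y j) : ZMod (Γ.par .N)) := by
  set f : ℕ → ℕ → ℕ := fun i j => w.eval Γ ((s.setv .t i).setv .y j) with hf
  have h0 := fill_spec (Γ := Γ) (A := O) (e := .const 0) s hG.n_le_bd (by simp)
  have := loop_inv (Γ := Γ) (v := .e) (p := .m) (body := .seq (.set .t edgeFst) <|
    .seq (.set .y edgeSnd) <| .seq (.put O (.var .t) (addN (.get O (.var .t)) w)) <|
    .seq (.set .t edgeSnd) <| .seq (.set .y edgeFst) <|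
    .put O (.var .t) (addN (.get O (.var .t)) w)) (s := (fill O (.const 0)).run Γ s)
    (fun e s' => ∀ i < Γ.par .n, (s'.arr O i : ZMod (Γ.par .N)) = ((∑ e' ∈ Finset.range e,
      (ind (Γ.inp (2 * e' + 2) = i) * f i (Γ.inp (2 * e' + 3)) +
      ind (Γ.inp (2 * e' + 3) = i) * f i (Γ.inp (2 * e' + 2))) : ℕ) : ZMod (Γ.par .N)))
    (by intro i hi; rw [h0 i hi]; simp [Expr.eval]) (by
      intro e hem s' hF hI
      obtain ⟨hu, hv⟩ := hG.edge_lt e hem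
      set u := Γ.inp (2 * e + 2) with hu'
      set v := Γ.inp (2 * e + 3) with hv'
      have hbd := hG.n_le_bd
      have hvar : ∀ x, x ≠ .t → x ≠ .y → x ≠ .e → s'.var x = s.var x := fun x h1 h2 h3 => by
        rw [hF.var x (by simp [h1, h2, h3]), run_var _ (by simp [h1])]
      have harr : ∀ A, A ≠ O → s'.arr A = s.arr A := fun A h => by
        rw [hF.arr A (by simp [h]), run_arr _ (by simp [h])]
      have e1 := eval_edge (Γ := Γ) (s := s'.setv .e e) hG (by simpa using hem)
      have e2 := eval_edge (Γ := Γ) (s := (s'.setv .e e).setv .t u) hG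
        (by simpa [Store.setv_var] using hem)
      set s1 := ((s'.setv .e e).setv .t u).setv .y v with hs1
      have w1 : w.eval Γ s1 = f u v := by
        rw [eval_set_ty (s := s) hO he (s' := s1) (fun x h1 h2 h3 => by
          simp [hs1, Store.setv_var, h1, h2, h3, hvar]) (fun A h => by simp [hs1, harr A h])]
        simp [hs1, Store.setv_var, hf]
      set c1 := (s'.arr O u + f u v) % Γ.par .N with hc1
      set s2 := s1.seta O u c1 with hs2
      have e3 := eval_edge (Γ := Γ) (s := s2) hG (by simpa [hs2, hs1, Store.setv_var] using hem)
      have e4 := eval_edge (Γ := Γ) (s := s2.setv .t v) hG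
        (by simpa [hs2, hs1, Store.setv_var] using hem)
      set s3 := (s2.setv .t v).setv .y u with hs3
      have w3 : w.eval Γ s3 = f v u := by
        rw [eval_set_ty (s := s) hO he (s' := s3) (fun x h1 h2 h3 => by
          simp [hs3, hs2, hs1, Store.setv_var, h1, h2, h3, hvar]) (fun A h => by
            simp [hs3, hs2, hs1, Store.seta_ne _ _ _ h, harr A h])]
        simp only [hf, hs3]
        refine Expr.eval_congr (fun x _ => ?_) (fun A _ => ?_) <;> simp [Store.setv_var]
      have hrun : (Stmt.run Γ (.seq (.set .t edgeFst) <|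
          .seq (.set .y edgeSnd) <| .seq (.put O (.var .t) (addN (.get O (.var .t)) w)) <|
          .seq (.set .t edgeSnd) <| .seq (.set .y edgeFst) <|
          .put O (.var .t) (addN (.get O (.var .t)) w)) (s'.setv .e e)) =
          s3.seta O v ((s2.arr O v + f v u) % Γ.par .N) := by
        have g1 : (s'.setv .e e).setv .t (edgeFst.eval Γ (s'.setv .e e)) = (s'.setv .e e).setv .t u := by
          rw [e1.1]; simp [hu']
        have g2 : ((s'.setv .e e).setv .t u).setv .y (edgeSnd.eval Γ ((s'.setv .e e).setv .t u)) = s1 := by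
          rw [e2.2]; simp [Store.setv_var, hs1, hv']
        have g3 : (Stmt.put O (.var .t) (addN (.get O (.var .t)) w)).run Γ s1 = s2 := by
          have : s1.var .t = u := by simp [hs1, Store.setv_var]
          have h' : s1.arr O u = s'.arr O u := by simp [hs1]
          simp only [Stmt.run, Expr.eval, this, addN, w1, Modulus.par, h', if_pos (hu.trans_le hbd), hs2, hc1]
        have g4 : s2.setv .t (edgeSnd.eval Γ s2) = s2.setv .t v := by
          rw [e3.2]; simp [hs2, hs1, Store.setv_var, hv']
        have g5 : (s2.setv .t v).setv .y (edgeFst.eval Γ (s2.setv .t v)) = s3 := by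
          rw [e4.1]; simp [hs2, hs1, hs3, Store.setv_var, hu']
        have g6 : (Stmt.put O (.var .t) (addN (.get O (.var .t)) w)).run Γ s3 =
            s3.seta O v ((s2.arr O v + f v u) % Γ.par .N) := by
          have : s3.var .t = v := by simp [hs3, Store.setv_var]
          have h' : s3.arr O v = s2.arr O v := by simp [hs3]
          simp only [Stmt.run, Expr.eval, this, addN, w3, Modulus.par, h', if_pos (hv.trans_le hbd)]
        rw [← g6, ← g5, ← g4, ← g3, ← g2, ← g1]
        rfl
      intro i hi
      rw [hrun, Finset.sum_range_succ, Nat.cast_add, ← hI i hi, ← hu', ← hv']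
      have h2 : (s2.arr O i : ZMod (Γ.par .N)) = s'.arr O i + ind (u = i) * f i v := by
        rw [hs2, Store.seta_arr]
        by_cases h : i = u
        · subst h; simp [hc1, ind_pos]
        · simp [h, ind_neg (Ne.symm h), hs1]
      rw [Store.seta_arr]
      by_cases h : i = v
      · rw [if_pos ⟨rfl, h⟩, h, ind_pos rfl, ZMod.natCast_mod]
        rw [h] at h2
        push_cast
        rw [h2]; ring
      · rw [if_neg (fun h' => h h'.2), ind_neg (Ne.symm h)]
        simp only [hs3, Store.setv_arr]
        push_cast
        rw [h2]; ring)
  intro i hi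
  have h1 := this i hi
  rw [hG.sum_edges (f i) i hi] at h1
  rw [adjSum, Stmt.run, h1]
  push_cast
  rfl

theorem cast_sub_mod {N : ℕ} (hN : 0 < N) (a b : ℕ) :
    (((a + (N - b % N)) % N : ℕ) : ZMod N) = a - b := by
  rw [ZMod.natCast_mod, Nat.cast_add, Nat.cast_sub (Nat.mod_lt _ hN).le]
  simp [sub_eq_add_neg]

theorem fillDiag_inplace {A : Arr} {e : Expr} {f : ℕ → ℕ} (hbd : Γ.par .n ≤ Γ.par .bd)
    (he : ∀ i < Γ.par .n, ∀ s', s'.var .t = i → s'.var .y = i →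
      (∀ v, v ≠ .t → v ≠ .y → s'.var v = s.var v) →
      (∀ B, B ≠ A → s'.arr B = s.arr B) → (∀ j, i ≤ j → s'.arr A j = s.arr A j) →
      e.eval Γ s' = f i) :
    ∀ i < Γ.par .n, ((fillDiag A e).run Γ s).arr A i = f i := by
  have := loop_inv (Γ := Γ) (v := .t) (p := .n)
    (body := .seq (.set .y (.var .t)) (.put A (.var .t) e)) (s := s)
    (fun i s' => (∀ j < i, s'.arr A j = f j) ∧ ∀ j, i ≤ j → s'.arr A j = s.arr A j)
    ⟨fun j hj => by omega, fun j _ => rfl⟩ (by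
      intro i hi s' hF hI
      have hev : e.eval Γ ((s'.setv .t i).setv .y i) = f i := by
        refine he i hi _ (by simp [Store.setv_var]) (by simp) (fun v hv hv' => ?_) (fun B hB => ?_)
          (fun j hj => ?_)
        · rw [Store.setv_ne _ _ hv', Store.setv_ne _ _ hv]
          exact hF.var v (by simp [hv, hv'])
        · exact hF.arr B (by simp [hB])
        · exact hI.2 j hj
      have hty : ((s'.setv .t i).setv .y i).var .t = i := by simp [Store.setv_var]
      simp only [Stmt.run, Expr.eval, Store.setv_self, hty, if_pos (hi.trans_le hbd), Store.seta_arr,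
        hev, true_and, Store.setv_arr]
      refine ⟨fun j hj => ?_, fun j hj => ?_⟩
      · split_ifs with h
        · rw [h]
        · exact hI.1 j (by omega)
      · rw [if_neg (by omega)]
        exact hI.2 j (by omega))
  exact this.1

/-- The relation of being distinct and non-adjacent is dense, but its sum is the full sum minus the
sum over the neighbours minus the diagonal term. So all three relations are handled in linear time,
provided that the full sums are already known. -/
theorem relSum_spec (hG : Graphical Γ rl) (α : Fin 3) {w full : Expr} {O : Arr}
    (hO : ¬ w.ReadsArr O) (he : ¬ w.ReadsVar .e) (hfO : ¬ full.ReadsArr O)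
    (hfe : ¬ full.ReadsVar .e) (hfy : ¬ full.ReadsVar .y) (s : Store)
    (hfull : ∀ i < Γ.par .n, (full.eval Γ (s.setv .t i) : ZMod (Γ.par .N)) =
      ∑ j ∈ Finset.range (Γ.par .n), (w.eval Γ ((s.setv .t i).setv .y j) : ZMod (Γ.par .N))) :
    ∀ i < Γ.par .n, (((relSum α w full O).run Γ s).arr O i : ZMod (Γ.par .N)) =
      ∑ j ∈ Finset.range (Γ.par .n), (ind (rl i j = α) : ZMod (Γ.par .N)) *
        (w.eval Γ ((s.setv .t i).setv .y j) : ZMod (Γ.par .N)) := by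
  intro i hi
  have hbd := hG.n_le_bd
  unfold relSum
  split_ifs with h1 h2
  · subst h1; exact adjSum_spec hG hO he s i hi
  · subst h2
    rw [fillDiag_inplace (f := fun i => w.eval Γ ((s.setv .t i).setv .y i)) hbd
      (fun i hi s' ht hy hv hA _ => by
        rw [eval_set_ty (s := s) hO he (fun v h1 h2 _ => hv v h1 h2) hA, ht, hy]) i hi,
      Finset.sum_eq_single i]
    · rw [ind_pos ((hG.diag i i).2 rfl)]; simp
    · intro j _ hj
      rw [ind_neg fun h => hj ((hG.diag i j).1 h).symm]; simp
    · intro h; simp [hi] at h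
  · have h0 : α = 0 := by omega
    subst h0
    set s1 := (adjSum w O).run Γ s with hs1
    have hadj := adjSum_spec hG hO he s i hi
    have v1 : ∀ v, v ≠ .t → v ≠ .y → v ≠ .e → s1.var v = s.var v := fun v a b c =>
      run_var _ (by simp [adjSum, a, b, c])
    have a1 : ∀ A, A ≠ O → s1.arr A = s.arr A := fun A h => run_arr _ (by simp [adjSum, h])
    rw [Stmt.run, ← hs1]
    rw [fillDiag_inplace (s := s1) (f := fun i => ((full.eval Γ (s.setv .t i) +
        (Γ.par .N - s1.arr O i % Γ.par .N)) % Γ.par .N +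
        (Γ.par .N - w.eval Γ ((s.setv .t i).setv .y i) % Γ.par .N)) % Γ.par .N) hbd ?_ i hi]
    · rw [cast_sub_mod hG.N_pos, cast_sub_mod hG.N_pos, hfull i hi, hadj, sub_sub, sub_eq_iff_eq_add]
      -- Exactly one of the three relations holds. The indicator of equality is written as `j = i`,
      -- so that its sum collapses to one term.
      have hsplit : ∀ j, (w.eval Γ ((s.setv .t i).setv .y j) : ZMod (Γ.par .N)) =
          ind (rl i j = 0) * w.eval Γ ((s.setv .t i).setv .y j) +
          (ind (rl i j = 1) * w.eval Γ ((s.setv .t i).setv .y j) +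
          ind (j = i) * w.eval Γ ((s.setv .t i).setv .y j)) := fun j => by
        have h2 : (j = i) ↔ rl i j = 2 := by rw [hG.diag]; exact eq_comm
        rw [ind_congr h2]
        generalize rl i j = c
        fin_cases c <;> simp [ind]
      rw [Finset.sum_congr rfl fun j _ => hsplit j, Finset.sum_add_distrib, Finset.sum_add_distrib,
        Finset.sum_eq_single (f := fun j => (ind (j = i) : ZMod (Γ.par .N)) *
          w.eval Γ ((s.setv .t i).setv .y j)) i]
      · rw [ind_pos rfl]; simp
      · intro j _ hj; rw [ind_neg hj]; simp
      · intro h; simp [hi] at h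
    · intro i hi s' ht hy hv hA hj
      have e1 : full.eval Γ s' = full.eval Γ (s.setv .t i) := by
        refine Expr.eval_congr (fun v h => ?_) (fun A h => ?_)
        · by_cases h1 : v = .t
          · subst h1; simp [ht]
          · have h2 : v ≠ .y := fun h' => hfy (h' ▸ h)
            rw [Store.setv_ne _ _ h1, hv v h1 h2, v1 v h1 h2 fun h' => hfe (h' ▸ h)]
        · have h1 : A ≠ O := fun h' => hfO (h' ▸ h)
          rw [hA A h1, a1 A h1]; rfl
      have e2 : w.eval Γ s' = w.eval Γ ((s.setv .t i).setv .y i) := by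
        rw [eval_set_ty (s := s) hO he (fun v h1 h2 h3 => (hv v h1 h2).trans (v1 v h1 h2 h3))
          (fun A h => (hA A h).trans (a1 A h)), ht, hy]
      simp only [subN, Expr.eval, BinOp.eval, Modulus.par, e1, e2, ht, hj i le_rfl]

end

/-! ### Sums over pairs and triples of vertices -/

/-- `O[t] := ∑ P[y]` over the vertices `y` in relation `α` to `t`, modulo `N`. -/
def conv (α : Fin 3) (P O : Arr) : Stmt :=
  .seq (sumN .tot (.get P (.var .t))) (relSum α (.get P (.var .y)) (.var .tot) O)

section
variable {Γ : Env} {rl : ℕ → ℕ → Fin 3} {k J : ℕ} {dom : ℕ → ℕ → Prop} {v : ℕ → ℕ} {s : Store}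

@[simp] theorem relSum_not_writesVar {α : Fin 3} {w full : Expr} {O : Arr} {v : Var} (h1 : v ≠ .t)
    (h2 : v ≠ .y) (h3 : v ≠ .e) : ¬ (relSum α w full O).WritesVar v := fun h => by
  have := relSum_writesVar h
  tauto

@[simp] theorem conv_not_writesVar {α : Fin 3} {P O : Arr} {v : Var} (h1 : v ≠ .t)
    (h2 : v ≠ .y) (h3 : v ≠ .e) (h4 : v ≠ .tot) : ¬ (conv α P O).WritesVar v := by
  simp [conv, h1, h2, h3, h4]

@[simp] theorem conv_writesArr {α : Fin 3} {P O B : Arr} :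
    (conv α P O).WritesArr B ↔ B = O := by
  simp [conv]

@[simp] theorem conv_quiet {α : Fin 3} {P O : Arr} : (conv α P O).Quiet := by
  simp [conv]

theorem conv_fits {α : Fin 3} {P O : Arr} {role : Role} {na d : ℕ} (hP : P.code < na)
    (hO : O.code < na) : (conv α P O).Fits role na (d + 1) :=
  ⟨by simp [hP], relSum_fits hO (by simp [hP]) (by simp)⟩

theorem conv_spec (hG : Graphical Γ rl) (α : Fin 3) {P O : Arr} (hPO : P ≠ O) (s : Store) :
    ∀ i < Γ.par .n, (((conv α P O).run Γ s).arr O i : ZMod (Γ.par .N)) =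
      ∑ j ∈ Finset.range (Γ.par .n), (ind (rl i j = α) : ZMod (Γ.par .N)) * s.arr P j := by
  intro i hi
  have h1 := sumN_spec (Γ := Γ) (v := .tot) (e := .get P (.var .t)) s (by simp) (by simp)
  have a1 : ((sumN .tot (.get P (.var .t))).run Γ s).arr P = s.arr P := run_arr _ (by simp)
  have := relSum_spec hG α (w := .get P (.var .y)) (full := .var .tot) (O := O)
    (by simpa using hPO.symm) (by simp) (by simp) (by simp) (by simp)
    ((sumN .tot (.get P (.var .t))).run Γ s) (by
      intro i _
      simp only [Expr.eval, Store.setv_arr, Store.setv_self] at h1 ⊢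
      rw [Store.setv_ne _ _ (by simp), h1, a1]) i hi
  simp only [Expr.eval, Store.setv_arr, Store.setv_self, a1] at this
  exact this

end

/-- The unary conditions on a vertex `a` as the value of the variable `j`. -/
def Unary (rl : ℕ → ℕ → Fin 3) (dom : ℕ → ℕ → Prop) (K : ℕ) (π : ℕ → ℕ → Fin 3) (v : ℕ → ℕ)
    (j a : ℕ) : Prop :=
  dom j a ∧ Fitting rl K π v j a

/-- The sum of `lam x * lam x'` over all `x, x', y, z` such that `x, y` and `x', z` and `y, z`
have the prescribed relations. -/
noncomputable def patVal {R : Type*} [CommSemiring R] (n : ℕ) (rl : ℕ → ℕ → Fin 3)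
    (dom : ℕ → ℕ → Prop) (K : ℕ) (v : ℕ → ℕ) (lam : ℕ → R) (π : ℕ → ℕ → Fin 3) : R :=
  (∑ z ∈ Finset.range n,
    (∑ x ∈ Finset.range n, (ind (rl z x = π K (K + 2)) : R) *
      (lam x * (ind (Unary rl dom K π v K x) : R))) *
    (∑ y ∈ Finset.range n, (ind (rl z y = π (K + 1) (K + 2)) : R) *
      ((∑ x ∈ Finset.range n, (ind (rl y x = π K (K + 1)) : R) *
        (lam x * (ind (Unary rl dom K π v K x) : R))) *
        (ind (Unary rl dom K π v (K + 1) y) : R))) *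
    (ind (Unary rl dom K π v (K + 2) z) : R)) *
  (ind (Matches rl K π v ∧ ∀ i < K, dom i (v i)) : R)

/-- Add the value of one pattern to `acc`. -/
def patProg (K : ℕ) (π : ℕ → ℕ → Fin 3) : Stmt :=
  seqL [fill .p (mulN (.get .lam (.var .t)) (filterE K π K (.var .t))),
    conv (π K (K + 1)) .p .u,
    conv (π K (K + 2)) .p .v,
    fill .q (mulN (.get .u (.var .t)) (filterE K π (K + 1) (.var .t))),
    conv (π (K + 1) (K + 2)) .q .w,
    sumN .pt (mulN (mulN (.get .v (.var .t)) (.get .w (.var .t))) (filterE K π (K + 2) (.var .t))),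
    .set .acc (addN (.var .acc) (mulN (.var .pt) (andL (matchE K π ++ domL K))))]

/-- Compute in `acc` the sum of the values of the patterns in `S`. -/
def valProg (K : ℕ) (S : List (ℕ → ℕ → Fin 3)) : Stmt :=
  .seq (.set .acc (.const 0)) (seqL (S.map (patProg K)))

theorem filterE_not_readsArr {K j : ℕ} {π : ℕ → ℕ → Fin 3} {v : Var} {A : Arr} (h : A ≠ .rel)
    (h' : A ≠ .dom j) : ¬ (filterE K π j (.var v)).ReadsArr A := fun h1 => by
  rcases filterE_readsArr h1 with h1 | h1 | h1
  · exact h h1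
  · exact h' h1
  · exact h1

theorem filterE_not_readsVar {K j : ℕ} {π : ℕ → ℕ → Fin 3} {v w : Var} (h : ∀ i, w ≠ .x i)
    (h' : w ≠ v) : ¬ (filterE K π j (.var v)).ReadsVar w := fun h1 => by
  rcases filterE_readsVar h1 with ⟨i, _, h1⟩ | h1
  · exact h i h1
  · exact h' h1

attribute [simp] filterE_not_readsArr filterE_not_readsVar

section
variable {Γ : Env} {rl : ℕ → ℕ → Fin 3} {k J K : ℕ} {dom : ℕ → ℕ → Prop} {v : ℕ → ℕ} {s : Store}
  {role : Role} {na d : ℕ}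

theorem isRel_usesBelow {a b : Expr} {c : Fin 3} (h : 0 < na) (ha : a.UsesBelow na)
    (hb : b.UsesBelow na) : (isRel a b c).UsesBelow na := by
  simp [isRel, relE, idxE, Arr.code, h, ha, hb]

theorem fitE_usesBelow {π : ℕ → ℕ → Fin 3} {j : ℕ} {a : Expr} (h : 0 < na)
    (ha : a.UsesBelow na) : ∀ e ∈ fitE K π j a, e.UsesBelow na := by
  simp only [fitE, List.mem_map, List.mem_range, forall_exists_index, and_imp,
    forall_apply_eq_imp_iff₂]
  exact fun i _ => isRel_usesBelow h (by simp) ha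

theorem matchE_usesBelow {π : ℕ → ℕ → Fin 3} (h : 0 < na) :
    ∀ e ∈ matchE K π, e.UsesBelow na := by
  simp only [matchE, List.mem_flatMap, List.mem_range, forall_exists_index, and_imp]
  exact fun e j _ he => fitE_usesBelow h (by simp) e he

theorem domL_usesBelow (h : K + 11 ≤ na) : ∀ e ∈ domL K, e.UsesBelow na := by
  simp only [domL, List.mem_map, List.mem_range, forall_exists_index, and_imp,
    forall_apply_eq_imp_iff₂, domE, Expr.UsesBelow, and_true, Arr.code]
  intro i hi; omega

theorem filterE_usesBelow {π : ℕ → ℕ → Fin 3} {j : ℕ} {a : Expr} (h : j + 11 < na)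
    (ha : a.UsesBelow na) : (filterE K π j a).UsesBelow na := by
  simp only [filterE, andL_usesBelow, List.mem_cons, forall_eq_or_imp, domE, Expr.UsesBelow,
    Arr.code]
  exact ⟨⟨h, ha⟩, fitE_usesBelow (by omega) ha⟩

@[simp] theorem patProg_not_writesVar {π : ℕ → ℕ → Fin 3} {v : Var} (h1 : v ≠ .t)
    (h2 : v ≠ .y) (h3 : v ≠ .e) (h4 : v ≠ .tot) (h5 : v ≠ .pt) (h6 : v ≠ .acc) :
    ¬ (patProg K π).WritesVar v := by
  simp [patProg, h1, h2, h3, h4, h5, h6]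

@[simp] theorem patProg_writesArr {π : ℕ → ℕ → Fin 3} {A : Arr} :
    (patProg K π).WritesArr A ↔ A = .p ∨ A = .u ∨ A = .v ∨ A = .q ∨ A = .w := by
  simp [patProg]

theorem patProg_fits {π : ℕ → ℕ → Fin 3} (h : K + 14 ≤ na) :
    (patProg K π).Fits role na (d + 1) := by
  have h1 : ∀ e ∈ matchE K π ++ domL K, e.UsesBelow na := by
    intro e he
    rcases List.mem_append.1 he with he | he
    · exact matchE_usesBelow (by omega) e he
    · exact domL_usesBelow (by omega) e he
  have h2 : (andL (matchE K π ++ domL K)).UsesBelow na := andL_usesBelow.2 h1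
  have h3 : ∀ j, j ≤ K + 2 → (filterE K π j (.var .t)).UsesBelow na := fun j hj =>
    filterE_usesBelow (by omega) (by simp)
  have h4 : ∀ c, c < 11 → c < na := fun c hc => by omega
  simp only [patProg, seqL_fits, List.mem_cons, forall_eq_or_imp, List.not_mem_nil, false_imp_iff,
    fill_fits, sumN_fits, mulN, addN, Expr.UsesBelow, Stmt.Fits, Arr.code, h2, h3 K (by omega),
    h3 (K + 1) (by omega), h3 (K + 2) le_rfl, and_true]
  refine ⟨?_, ?_, ?_, ?_, ?_, ?_⟩ <;> first | (refine conv_fits ?_ ?_ <;> exact h4 _ (by decide)) |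
    simp [h4]

@[simp] theorem patProg_quiet {π : ℕ → ℕ → Fin 3} : (patProg K π).Quiet := by
  simp [patProg]

/-- `patVal` opens the triangle x, y, z at x by using two copies of x. The resulting sum over paths
factors through z and then through y, hence it takes three passes of `conv`. The conditions on the
first `K` variables alone form a common factor that is multiplied at the end. -/
theorem patProg_spec (hG : Graphical Γ rl) (π : ℕ → ℕ → Fin 3)
    (h : Good Γ rl (K + 3) dom J v s) (hJ : K ≤ J) :
    (((patProg K π).run Γ s).var .acc : ZMod (Γ.par .N)) =
      s.var .acc + patVal (Γ.par .n) rl dom K v (fun u => (s.arr .lam u : ZMod (Γ.par .N))) π := by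
  have hbd := hG.n_le_bd
  set s1 := (fill .p (mulN (.get .lam (.var .t)) (filterE K π K (.var .t)))).run Γ s with hs1
  set s2 := (conv (π K (K + 1)) .p .u).run Γ s1 with hs2
  set s3 := (conv (π K (K + 2)) .p .v).run Γ s2 with hs3
  set s4 := (fill .q (mulN (.get .u (.var .t)) (filterE K π (K + 1) (.var .t)))).run Γ s3 with hs4
  set s5 := (conv (π (K + 1) (K + 2)) .q .w).run Γ s4 with hs5
  set s6 := (sumN .pt (mulN (mulN (.get .v (.var .t)) (.get .w (.var .t)))
    (filterE K π (K + 2) (.var .t)))).run Γ s5 with hs6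
  have hrun : (patProg K π).run Γ s = s6.setv .acc
      ((addN (.var .acc) (mulN (.var .pt) (andL (matchE K π ++ domL K)))).eval Γ s6) := rfl
  have g1 : Good Γ rl (K + 3) dom J v s1 := h.run (by simp) (by simp) (by simp)
  have g2 : Good Γ rl (K + 3) dom J v s2 := g1.run (by simp) (by simp) (by simp)
  have g3 : Good Γ rl (K + 3) dom J v s3 := g2.run (by simp) (by simp) (by simp)
  have g4 : Good Γ rl (K + 3) dom J v s4 := g3.run (by simp) (by simp) (by simp)
  have g5 : Good Γ rl (K + 3) dom J v s5 := g4.run (by simp) (by simp) (by simp)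
  have g6 : Good Γ rl (K + 3) dom J v s6 := g5.run (by simp) (by simp) (by simp)
  have filt : ∀ {s' : Store} (_ : Good Γ rl (K + 3) dom J v s') (j i : ℕ), j ≤ K + 2 →
      i < Γ.par .n → (filterE K π j (.var .t)).eval Γ (s'.setv .t i) =
        ind (Unary rl dom K π v j i) := by
    intro s' g j i hj hi
    have := (g.setv (w := .t) (a := i) (by simp)).eval_filterE hG hJ π (j := j) (a := .var .t)
      (by omega) (by simpa [Expr.eval] using hi)
    simpa [Expr.eval, Unary] using this
  have a1 : ∀ i < Γ.par .n, (s1.arr .p i : ZMod (Γ.par .N)) =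
      s.arr .lam i * ind (Unary rl dom K π v K i) := by
    intro i hi
    rw [hs1, fill_spec s hbd (by simp) i hi, eval_mulN, filt h K i (by omega) hi]
    simp [Expr.eval]
  have a2 : ∀ i < Γ.par .n, (s2.arr .u i : ZMod (Γ.par .N)) = ∑ x ∈ Finset.range (Γ.par .n),
      (ind (rl i x = π K (K + 1)) : ZMod (Γ.par .N)) *
        (s.arr .lam x * ind (Unary rl dom K π v K x)) := by
    intro i hi
    rw [hs2, conv_spec hG _ (by simp) s1 i hi]
    exact Finset.sum_congr rfl fun x hx => by rw [a1 x (Finset.mem_range.1 hx)]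
  have a3 : ∀ i < Γ.par .n, (s3.arr .v i : ZMod (Γ.par .N)) = ∑ x ∈ Finset.range (Γ.par .n),
      (ind (rl i x = π K (K + 2)) : ZMod (Γ.par .N)) *
        (s.arr .lam x * ind (Unary rl dom K π v K x)) := by
    intro i hi
    rw [hs3, conv_spec hG _ (by simp) s2 i hi]
    have : s2.arr .p = s1.arr .p := run_arr _ (by simp)
    exact Finset.sum_congr rfl fun x hx => by rw [this, a1 x (Finset.mem_range.1 hx)]
  have a4 : ∀ i < Γ.par .n, (s4.arr .q i : ZMod (Γ.par .N)) = (∑ x ∈ Finset.range (Γ.par .n),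
      (ind (rl i x = π K (K + 1)) : ZMod (Γ.par .N)) *
        (s.arr .lam x * ind (Unary rl dom K π v K x))) * ind (Unary rl dom K π v (K + 1) i) := by
    intro i hi
    have : s3.arr .u = s2.arr .u := run_arr _ (by simp)
    rw [hs4, fill_spec s3 hbd (by simp) i hi, eval_mulN, filt g3 (K + 1) i (by omega) hi]
    simp only [Expr.eval, Store.setv_arr, Store.setv_self, this]
    rw [a2 i hi]
  have a5 := conv_spec hG (π (K + 1) (K + 2)) (P := .q) (O := .w) (by simp) s4
  rw [← hs5] at a5
  have a5v : s5.arr .v = s3.arr .v := by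
    rw [hs5, run_arr _ (by simp), hs4, run_arr _ (by simp)]
  have a6 : (s6.var .pt : ZMod (Γ.par .N)) = ∑ z ∈ Finset.range (Γ.par .n),
      (s5.arr .v z : ZMod (Γ.par .N)) * s5.arr .w z * ind (Unary rl dom K π v (K + 2) z) := by
    rw [hs6, sumN_spec s5 (by simp) (by simp)]
    refine Finset.sum_congr rfl fun z hz => ?_
    rw [eval_mulN, eval_mulN, filt g5 (K + 2) z le_rfl (Finset.mem_range.1 hz)]
    simp [Expr.eval]
  have hacc : s6.var .acc = s.var .acc := by
    rw [hs6, run_var _ (by simp), hs5, run_var _ (by simp), hs4, run_var _ (by simp), hs3,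
      run_var _ (by simp), hs2, run_var _ (by simp), hs1, run_var _ (by simp)]
  rw [hrun, Store.setv_self, eval_addN, eval_mulN,
    ((g6.matchE hG hJ π).append (g6.domL hJ (by omega))).eval hG]
  simp only [Expr.eval, hacc, a6, patVal]
  congr 2
  refine Finset.sum_congr rfl fun z hz => ?_
  rw [a5v, a3 z (Finset.mem_range.1 hz), a5 z (Finset.mem_range.1 hz)]
  congr 2
  exact Finset.sum_congr rfl fun y hy => by rw [a4 y (Finset.mem_range.1 hy)]

@[simp] theorem valProg_not_writesVar {S : List (ℕ → ℕ → Fin 3)} {v : Var} (h1 : v ≠ .t)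
    (h2 : v ≠ .y) (h3 : v ≠ .e) (h4 : v ≠ .tot) (h5 : v ≠ .pt) (h6 : v ≠ .acc) :
    ¬ (valProg K S).WritesVar v := by
  simp [valProg, h1, h2, h3, h4, h5, h6]

theorem valProg_writesArr {S : List (ℕ → ℕ → Fin 3)} {A : Arr} :
    (valProg K S).WritesArr A → A = .p ∨ A = .u ∨ A = .v ∨ A = .q ∨ A = .w := by
  simp only [valProg, Stmt.WritesArr, seqL_writesArr, List.mem_map, false_or]
  rintro ⟨c, ⟨π, _, rfl⟩, h⟩
  exact patProg_writesArr.1 h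

@[simp] theorem valProg_not_writesArr {S : List (ℕ → ℕ → Fin 3)} {A : Arr} (h1 : A ≠ .p)
    (h2 : A ≠ .u) (h3 : A ≠ .v) (h4 : A ≠ .q) (h5 : A ≠ .w) : ¬ (valProg K S).WritesArr A :=
  fun h => by
    have := valProg_writesArr h
    tauto

@[simp] theorem valProg_quiet {S : List (ℕ → ℕ → Fin 3)} : (valProg K S).Quiet := by
  simp [valProg]

theorem valProg_fits {S : List (ℕ → ℕ → Fin 3)} (h : K + 14 ≤ na) :
    (valProg K S).Fits role na (d + 1) := by
  simp [valProg, patProg_fits h]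

theorem valProg_spec (hG : Graphical Γ rl) (S : List (ℕ → ℕ → Fin 3))
    (h : Good Γ rl (K + 3) dom J v s) (hJ : K ≤ J) :
    (((valProg K S).run Γ s).var .acc : ZMod (Γ.par .N)) =
      (S.map (patVal (Γ.par .n) rl dom K v (fun u => (s.arr .lam u : ZMod (Γ.par .N))))).sum := by
  have key : ∀ (S : List (ℕ → ℕ → Fin 3)) (s' : Store), Good Γ rl (K + 3) dom J v s' →
      s'.arr .lam = s.arr .lam →
      (((seqL (S.map (patProg K))).run Γ s').var .acc : ZMod (Γ.par .N)) = s'.var .acc +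
      (S.map (patVal (Γ.par .n) rl dom K v (fun u => (s.arr .lam u : ZMod (Γ.par .N))))).sum := by
    intro S
    induction S with
    | nil => intro s' _ _; simp [seqL, Stmt.run]
    | cons π S ih =>
      intro s' g hl
      simp only [List.map_cons, seqL, Stmt.run, List.sum_cons]
      rw [ih _ (g.run (by simp) (by simp) (by simp)) ((run_arr _ (by simp)).trans hl),
        patProg_spec hG π g hJ, hl, add_assoc]
  have := key S (s.setv .acc 0) (h.setv (by simp)) rfl
  simpa [valProg, Stmt.run, Expr.eval] using this

end

/-! ### Counting the values of the last variable -/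

/-- The assignment `v` with the variables `K`, `K + 1`, `K + 2` replaced. -/
def trip (v : ℕ → ℕ) (K a b c : ℕ) : ℕ → ℕ :=
  Function.update (Function.update (Function.update v K a) (K + 1) b) (K + 2) c

section
variable {rl : ℕ → ℕ → Fin 3} {K : ℕ} {π : ℕ → ℕ → Fin 3} {v v' : ℕ → ℕ}

theorem fitting_succ {j a : ℕ} :
    Fitting rl (K + 1) π v j a ↔ Fitting rl K π v j a ∧ rl (v K) a = π K j := by
  simp only [Fitting, Nat.lt_succ_iff_lt_or_eq, or_imp, forall_and, forall_eq]

theorem matches_succ : Matches rl (K + 1) π v ↔ Matches rl K π v ∧ Fitting rl K π v K (v K) := by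
  simp only [Matches, Nat.lt_succ_iff_lt_or_eq, or_imp, forall_and, forall_eq]

theorem fitting_congr {j a : ℕ} (h : ∀ i < K, v i = v' i) :
    Fitting rl K π v j a ↔ Fitting rl K π v' j a :=
  forall₂_congr fun i hi => by rw [h i hi]

theorem matches_congr (h : ∀ i < K, v i = v' i) : Matches rl K π v ↔ Matches rl K π v' :=
  forall₂_congr fun j hj => by rw [h j hj, fitting_congr fun i hi => h i (by omega)]

theorem trip_lt {a b c i : ℕ} (h : i < K) : trip v K a b c i = v i := by
  simp only [trip]
  rw [Function.update_of_ne (by omega), Function.update_of_ne (by omega),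
    Function.update_of_ne (by omega)]

theorem trip_zero {a b c : ℕ} : trip v K a b c K = a := by simp [trip]
theorem trip_one {a b c : ℕ} : trip v K a b c (K + 1) = b := by simp [trip]
theorem trip_two {a b c : ℕ} : trip v K a b c (K + 2) = c := by simp [trip]

theorem trip_bound {n a b c : ℕ} (hv : ∀ i < K, v i < n) (ha : a < n) (hb : b < n) (hc : c < n) :
    ∀ i < K + 3, trip v K a b c i < n := by
  intro i hi
  rcases lt_or_ge i K with h | h
  · rw [trip_lt h]; exact hv i h
  · obtain rfl | rfl | rfl : i = K ∨ i = K + 1 ∨ i = K + 2 := by omega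
    · rwa [trip_zero]
    · rwa [trip_one]
    · rwa [trip_two]

/-- Separates the conditions that do not involve the last variable from those that do: the former
are a factor of the count, the latter are the summation condition. -/
theorem matches_trip {a b c : ℕ} : Matches rl (K + 3) π (trip v K a b c) ↔
    (Matches rl K π v ∧ Fitting rl K π v K a ∧ Fitting rl K π v (K + 1) b ∧
      rl a b = π K (K + 1)) ∧ Fitting rl K π v (K + 2) c ∧ rl a c = π K (K + 2) ∧
      rl b c = π (K + 1) (K + 2) := by
  have h : ∀ i < K, trip v K a b c i = v i := fun i hi => trip_lt hi
  rw [matches_succ, matches_succ, matches_succ, fitting_succ, fitting_succ, fitting_succ,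
    matches_congr h, fitting_congr h, fitting_congr h, fitting_congr h, trip_zero, trip_one,
    trip_two]
  tauto

end

/-- The value of the variable `K`, if one of the variables `K` and `K + 1` is `t` and the other one
is the entry of the array `wit` at `t`. -/
def entA (swap : Bool) : Expr := if swap then .var .t else .get .wit (.var .t)
def entB (swap : Bool) : Expr := if swap then .get .wit (.var .t) else .var .t

/-- Here `pw` is the variable whose value is `wit t`, and `pt` the one whose value is `t`. The last
variable y is related to both. `relSum` sums over the y in the right relation to `t`, and the
relation to `wit t` enters the weight as a look-up in the matrix. The full sum that `relSum` needs
does not involve the relation to `t`, so it is the entry of a single convolution `u` at `wit t`. -/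
def cntPat (K : ℕ) (swap : Bool) (π : ℕ → ℕ → Fin 3) : Stmt :=
  let pw := if swap then K + 1 else K
  let pt := if swap then K else K + 1
  seqL [fill .p (filterE K π (K + 2) (.var .t)),
    conv (π pw (K + 2)) .p .u,
    relSum (π pt (K + 2)) (mulN (.get .p (.var .y)) (isRel (.get .wit (.var .t)) (.var .y)
      (π pw (K + 2)))) (.get .u (.get .wit (.var .t))) .v,
    fill .cnt (addN (.get .cnt (.var .t)) (mulN (.get .v (.var .t))
      (andL (matchE K π ++ (fitE K π K (entA swap) ++ (fitE K π (K + 1) (entB swap) ++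
        [isRel (entA swap) (entB swap) (π K (K + 1))]))))))]

/-- `cnt[t]` becomes the number of values of the last variable for which a pattern in `S` holds. -/
def cntProg (K : ℕ) (swap : Bool) (S : List (ℕ → ℕ → Fin 3)) : Stmt :=
  .seq (fill .cnt (.const 0)) (seqL (S.map (cntPat K swap)))

section
variable {Γ : Env} {rl : ℕ → ℕ → Fin 3} {k J K : ℕ} {dom : ℕ → ℕ → Prop} {v : ℕ → ℕ} {s : Store}
  {role : Role} {na d : ℕ} {swap : Bool}

@[simp] theorem entA_usesBelow : 8 < na → (entA swap).UsesBelow na := by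
  cases swap <;> simp [entA, Arr.code]
@[simp] theorem entB_usesBelow : 8 < na → (entB swap).UsesBelow na := by
  cases swap <;> simp [entB, Arr.code]

@[simp] theorem cntPat_not_writesVar {π : ℕ → ℕ → Fin 3} {v : Var} (h1 : v ≠ .t)
    (h2 : v ≠ .y) (h3 : v ≠ .e) (h4 : v ≠ .tot) : ¬ (cntPat K swap π).WritesVar v := by
  simp [cntPat, h1, h2, h3, h4]

@[simp] theorem cntPat_writesArr {π : ℕ → ℕ → Fin 3} {A : Arr} :
    (cntPat K swap π).WritesArr A ↔ A = .p ∨ A = .u ∨ A = .v ∨ A = .cnt := by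
  simp [cntPat]

@[simp] theorem cntPat_quiet {π : ℕ → ℕ → Fin 3} : (cntPat K swap π).Quiet := by
  simp [cntPat]

theorem cntPat_fits {π : ℕ → ℕ → Fin 3} (h : K + 14 ≤ na) :
    (cntPat K swap π).Fits role na (d + 1) := by
  have hA : (entA swap).UsesBelow na := entA_usesBelow (by omega)
  have hB : (entB swap).UsesBelow na := entB_usesBelow (by omega)
  have h1 : ∀ e ∈ matchE K π ++ (fitE K π K (entA swap) ++ (fitE K π (K + 1) (entB swap) ++
        [isRel (entA swap) (entB swap) (π K (K + 1))])), e.UsesBelow na := by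
    intro e he
    simp only [List.mem_append, List.mem_singleton] at he
    rcases he with he | he | he | rfl
    · exact matchE_usesBelow (by omega) e he
    · exact fitE_usesBelow (by omega) hA e he
    · exact fitE_usesBelow (by omega) hB e he
    · exact isRel_usesBelow (by omega) hA hB
  have h4 : ∀ c, c < 11 → c < na := fun c hc => by omega
  simp only [cntPat, seqL_fits, List.mem_cons, forall_eq_or_imp, List.not_mem_nil, false_imp_iff,
    fill_fits, implies_true, and_true]
  refine ⟨⟨h4 _ (by decide), filterE_usesBelow (by omega) (by simp)⟩,
    conv_fits (h4 _ (by decide)) (h4 _ (by decide)), relSum_fits (h4 _ (by decide)) ?_ ?_,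
    h4 _ (by decide), ⟨h4 _ (by decide), trivial⟩, ⟨h4 _ (by decide), trivial⟩,
    andL_usesBelow.2 h1⟩
  · exact ⟨⟨h4 _ (by decide), trivial⟩, isRel_usesBelow (by omega) ⟨h4 _ (by decide), trivial⟩
      trivial⟩
  · exact ⟨h4 _ (by decide), h4 _ (by decide), trivial⟩

/-- The value of the variable `K` for a given entry `w` of the array `wit` at `t`. -/
def valA (swap : Bool) (t w : ℕ) : ℕ := if swap then t else w
def valB (swap : Bool) (t w : ℕ) : ℕ := if swap then w else t

theorem cntPat_spec (hG : Graphical Γ rl) (π : ℕ → ℕ → Fin 3)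
    (h : Good Γ rl (K + 3) dom J v s) (hJ : K ≤ J)
    (hw : ∀ t < Γ.par .n, s.arr .wit t < Γ.par .n) :
    ∀ t < Γ.par .n, ((cntPat K swap π).run Γ s).arr .cnt t < Γ.par .N ∧
    (((cntPat K swap π).run Γ s).arr .cnt t : ZMod (Γ.par .N)) =
      s.arr .cnt t + ∑ y ∈ Finset.range (Γ.par .n), (ind (dom (K + 2) y) : ZMod (Γ.par .N)) *
        ind (Matches rl (K + 3) π (trip v K (valA swap t (s.arr .wit t))
          (valB swap t (s.arr .wit t)) y)) := by
  intro t ht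
  have hbd := hG.n_le_bd
  set pw := if swap then K + 1 else K with hpw
  set pt := if swap then K else K + 1 with hpt
  set s1 := (fill .p (filterE K π (K + 2) (.var .t))).run Γ s with hs1
  set s2 := (conv (π pw (K + 2)) .p .u).run Γ s1 with hs2
  set s3 := (relSum (π pt (K + 2)) (mulN (.get .p (.var .y)) (isRel (.get .wit (.var .t)) (.var .y)
      (π pw (K + 2)))) (.get .u (.get .wit (.var .t))) .v).run Γ s2 with hs3
  have hrun : (cntPat K swap π).run Γ s = (fill .cnt (addN (.get .cnt (.var .t))
      (mulN (.get .v (.var .t)) (andL (matchE K π ++ (fitE K π K (entA swap) ++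
        (fitE K π (K + 1) (entB swap) ++
        [isRel (entA swap) (entB swap) (π K (K + 1))]))))))).run Γ s3 := rfl
  have g1 : Good Γ rl (K + 3) dom J v s1 := h.run (by simp) (by simp) (by simp)
  have g2 : Good Γ rl (K + 3) dom J v s2 := g1.run (by simp) (by simp) (by simp)
  have g3 : Good Γ rl (K + 3) dom J v s3 := g2.run (by simp) (by simp) (by simp)
  have w1 : s1.arr .wit = s.arr .wit := run_arr _ (by simp)
  have w2 : s2.arr .wit = s.arr .wit := (run_arr _ (by simp)).trans w1
  have w3 : s3.arr .wit = s.arr .wit := (run_arr _ (by simp)).trans w2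
  have c3 : s3.arr .cnt = s.arr .cnt := by
    rw [hs3, run_arr _ (by simp), hs2, run_arr _ (by simp), hs1, run_arr _ (by simp)]
  have p2 : s2.arr .p = s1.arr .p := run_arr _ (by simp)
  have a1 : ∀ i < Γ.par .n, s1.arr .p i = ind (Unary rl dom K π v (K + 2) i) := by
    intro i hi
    rw [hs1, fill_spec s hbd (by simp) i hi]
    have := (h.setv (w := .t) (a := i) (by simp)).eval_filterE hG hJ π (j := K + 2) (a := .var .t)
      (by omega) (by simpa [Expr.eval] using hi)
    simpa [Expr.eval, Unary] using this
  have a2 : ∀ i < Γ.par .n, (s2.arr .u i : ZMod (Γ.par .N)) = ∑ y ∈ Finset.range (Γ.par .n),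
      (ind (rl i y = π pw (K + 2)) : ZMod (Γ.par .N)) * ind (Unary rl dom K π v (K + 2) y) := by
    intro i hi
    rw [hs2, conv_spec hG _ (by simp) s1 i hi]
    exact Finset.sum_congr rfl fun x hx => by rw [a1 x (Finset.mem_range.1 hx)]
  have hev : ∀ i < Γ.par .n, ∀ y < Γ.par .n, ((mulN (.get .p (.var .y))
      (isRel (.get .wit (.var .t)) (.var .y) (π pw (K + 2)))).eval Γ ((s2.setv .t i).setv .y y) :
      ZMod (Γ.par .N)) = (ind (rl (s.arr .wit i) y = π pw (K + 2)) : ZMod (Γ.par .N)) *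
        ind (Unary rl dom K π v (K + 2) y) := by
    intro i hi y hy
    have gg : Good Γ rl (K + 3) dom J v ((s2.setv .t i).setv .y y) :=
      (g2.setv (by simp)).setv (by simp)
    have e1 : (Expr.get .wit (.var .t)).eval Γ ((s2.setv .t i).setv .y y) = s.arr .wit i := by
      simp [Expr.eval, Store.setv_var, w2]
    have e2 : (Expr.var .y).eval Γ ((s2.setv .t i).setv .y y) = y := by simp [Expr.eval]
    have := gg.eval_isRel hG (π pw (K + 2)) (a := .get .wit (.var .t)) (b := .var .y)
      (by rw [e1]; exact hw i hi) (by rw [e2]; exact hy)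
    rw [eval_mulN, this, e1, e2, mul_comm]
    congr 2
    simp [Expr.eval, p2, a1 y hy]
  have a3 := relSum_spec hG (π pt (K + 2)) (w := mulN (.get .p (.var .y))
    (isRel (.get .wit (.var .t)) (.var .y) (π pw (K + 2)))) (full := .get .u (.get .wit (.var .t)))
    (O := .v) (by simp) (by simp) (by simp) (by simp) (by simp) s2 (by
      intro i hi
      rw [Finset.sum_congr rfl fun y hy => hev i hi y (Finset.mem_range.1 hy), ← a2 _ (hw i hi)]
      simp [Expr.eval, w2])
  rw [← hs3] at a3
  set E : Expr := andL (matchE K π ++ (fitE K π K (entA swap) ++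
        (fitE K π (K + 1) (entB swap) ++
        [isRel (entA swap) (entB swap) (π K (K + 1))]))) with hE
  have hEv : ∀ i < Γ.par .n, ∀ s' : Store, s'.var .t = i → (∀ v, v ≠ .t → s'.var v = s3.var v) →
      (∀ B, B ≠ .cnt → s'.arr B = s3.arr B) → E.eval Γ s' = ind (Matches rl K π v ∧
        Fitting rl K π v K (valA swap i (s.arr .wit i)) ∧
        Fitting rl K π v (K + 1) (valB swap i (s.arr .wit i)) ∧
        rl (valA swap i (s.arr .wit i)) (valB swap i (s.arr .wit i)) = π K (K + 1)) := by
    intro i hi s' hst hsv hsA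
    have gg : Good Γ rl (K + 3) dom J v s' :=
      g3.congr (hsA _ (by simp)) (fun j _ => hsA _ (by simp)) fun j _ => hsv _ (by simp)
    have eA : (entA swap).eval Γ s' = valA swap i (s.arr .wit i) := by
      cases swap <;> simp [entA, valA, Expr.eval, hst, hsA, w3]
    have eB : (entB swap).eval Γ s' = valB swap i (s.arr .wit i) := by
      cases swap <;> simp [entB, valB, Expr.eval, hst, hsA, w3]
    have lA : valA swap i (s.arr .wit i) < Γ.par .n := by
      have := hw i hi
      cases swap <;> simpa [valA]
    have lB : valB swap i (s.arr .wit i) < Γ.par .n := by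
      have := hw i hi
      cases swap <;> simpa [valB]
    have h1 := gg.matchE hG hJ π
    have h2 := gg.fitE hG hJ π K (a := entA swap) (by rwa [eA])
    have h3 := gg.fitE hG hJ π (K + 1) (a := entB swap) (by rwa [eB])
    have h4 := gg.eval_isRel hG (π K (K + 1)) (a := entA swap) (b := entB swap) (by rwa [eA])
      (by rwa [eB])
    rw [hE, (h1.append (h2.append (h3.append (Checks.cons h4 .nil)))).eval hG, eA, eB]
    exact ind_congr (by simp)
  have hfin := fill_inplace (Γ := Γ) (A := .cnt) (e := addN (.get .cnt (.var .t))
    (mulN (.get .v (.var .t)) E)) (s := s3) (f := fun i => (s.arr .cnt i + (s3.arr .v i *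
      ind (Matches rl K π v ∧
        Fitting rl K π v K (valA swap i (s.arr .wit i)) ∧
        Fitting rl K π v (K + 1) (valB swap i (s.arr .wit i)) ∧
        rl (valA swap i (s.arr .wit i)) (valB swap i (s.arr .wit i)) = π K (K + 1))) % Γ.par .N)
        % Γ.par .N) hbd (by
      intro i hi s' hst hsv hsA hsc
      have h1 := hEv i hi s' hst hsv hsA
      have h2 := hsc i le_rfl
      have h3 := hsA .v (by simp)
      simp only [addN, mulN, Expr.eval, Modulus.par, h1, hst, h2, h3, c3]) t ht
  rw [hrun, hfin]
  refine ⟨Nat.mod_lt _ hG.N_pos, ?_⟩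
  rw [ZMod.natCast_mod, Nat.cast_add, ZMod.natCast_mod, Nat.cast_mul, a3 t ht]
  congr 1
  rw [Finset.sum_mul]
  refine Finset.sum_congr rfl fun y hy => ?_
  rw [hev t ht y (Finset.mem_range.1 hy)]
  simp only [← Nat.cast_mul, ← ind_and]
  refine congrArg _ (ind_congr ?_)
  rw [matches_trip]
  simp only [Unary, hpw, hpt]
  cases swap <;> simp only [valA, valB, if_true, Bool.false_eq_true, if_false] <;> tauto

@[simp] theorem cntProg_not_writesVar {S : List (ℕ → ℕ → Fin 3)} {v : Var} (h1 : v ≠ .t)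
    (h2 : v ≠ .y) (h3 : v ≠ .e) (h4 : v ≠ .tot) : ¬ (cntProg K swap S).WritesVar v := by
  simp [cntProg, h1, h2, h3, h4]

@[simp] theorem cntProg_not_writesArr {S : List (ℕ → ℕ → Fin 3)} {A : Arr} (h1 : A ≠ .p)
    (h2 : A ≠ .u) (h3 : A ≠ .v) (h4 : A ≠ .cnt) : ¬ (cntProg K swap S).WritesArr A := by
  simp [cntProg, h1, h2, h3, h4]

@[simp] theorem cntProg_quiet {S : List (ℕ → ℕ → Fin 3)} : (cntProg K swap S).Quiet := by
  simp [cntProg]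

theorem cntProg_fits {S : List (ℕ → ℕ → Fin 3)} (h : K + 14 ≤ na) :
    (cntProg K swap S).Fits role na (d + 1) := by
  have : 7 < na := by omega
  simp [cntProg, cntPat_fits h, Arr.code, this]

theorem cntProg_spec (hG : Graphical Γ rl) (hN : Γ.par .n < Γ.par .N) {S : List (ℕ → ℕ → Fin 3)}
    {Ψ : (ℕ → ℕ) → Prop} (hS : ∀ v, (∀ i < K + 3, v i < Γ.par .n) →
      (S.map fun π => ind (Matches rl (K + 3) π v)).sum = ind (Ψ v))
    (h : Good Γ rl (K + 3) dom J v s) (hJ : K ≤ J)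
    (hw : ∀ t < Γ.par .n, s.arr .wit t < Γ.par .n) :
    ∀ t < Γ.par .n, ((cntProg K swap S).run Γ s).arr .cnt t =
      ∑ y ∈ Finset.range (Γ.par .n), ind (dom (K + 2) y ∧
        Ψ (trip v K (valA swap t (s.arr .wit t)) (valB swap t (s.arr .wit t)) y)) := by
  have key : ∀ (S : List (ℕ → ℕ → Fin 3)) (s' : Store), Good Γ rl (K + 3) dom J v s' →
      s'.arr .wit = s.arr .wit → (∀ t < Γ.par .n, s'.arr .cnt t < Γ.par .N) → ∀ t < Γ.par .n,
      ((seqL (S.map (cntPat K swap))).run Γ s').arr .cnt t < Γ.par .N ∧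
      (((seqL (S.map (cntPat K swap))).run Γ s').arr .cnt t : ZMod (Γ.par .N)) =
        s'.arr .cnt t + ∑ y ∈ Finset.range (Γ.par .n), (ind (dom (K + 2) y) : ZMod (Γ.par .N)) *
        ((S.map fun π => ind (Matches rl (K + 3) π (trip v K (valA swap t (s.arr .wit t))
          (valB swap t (s.arr .wit t)) y))).sum : ℕ) := by
    intro S
    induction S with
    | nil => intro s' _ _ hc t ht; simp [seqL, Stmt.run, hc t ht]
    | cons π S ih =>
      intro s' g hl hc t ht
      have hsp := cntPat_spec (swap := swap) hG π g hJ (by rwa [hl])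
      have := ih ((cntPat K swap π).run Γ s') (g.run (by simp) (by simp) (by simp))
        ((run_arr _ (by simp)).trans hl) (fun t ht => (hsp t ht).1) t ht
      simp only [List.map_cons, seqL, Stmt.run, List.sum_cons]
      refine ⟨this.1, ?_⟩
      rw [this.2, (hsp t ht).2, hl, add_assoc, ← Finset.sum_add_distrib]
      congr 1
      exact Finset.sum_congr rfl fun y _ => by push_cast; ring
  intro t ht
  have hf := fill_spec (Γ := Γ) (A := .cnt) (e := .const 0) s hG.n_le_bd (by simp)
  have := key S ((fill .cnt (.const 0)).run Γ s) (h.run (by simp) (by simp) (by simp))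
    (run_arr _ (by simp)) (fun t ht => by rw [hf t ht]; exact hG.N_pos) t ht
  have lA : valA swap t (s.arr .wit t) < Γ.par .n := by
    have := hw t ht
    cases swap <;> simpa [valA]
  have lB : valB swap t (s.arr .wit t) < Γ.par .n := by
    have := hw t ht
    cases swap <;> simpa [valB]
  have hsum : ∀ y ∈ Finset.range (Γ.par .n), (ind (dom (K + 2) y) : ZMod (Γ.par .N)) *
        ((S.map fun π => ind (Matches rl (K + 3) π (trip v K (valA swap t (s.arr .wit t))
          (valB swap t (s.arr .wit t)) y))).sum : ℕ) = (ind (dom (K + 2) y ∧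
        Ψ (trip v K (valA swap t (s.arr .wit t)) (valB swap t (s.arr .wit t)) y)) : ℕ) := by
    intro y hy
    rw [hS _ (trip_bound (fun i hi => h.lt i (by omega)) lA lB (Finset.mem_range.1 hy)), ind_and,
      Nat.cast_mul]
  rw [Finset.sum_congr rfl hsum, hf t ht, ← Nat.cast_sum] at this
  -- The count is at most n, which is less than the modulus, so its residue determines it.
  have h2 : ∑ y ∈ Finset.range (Γ.par .n), ind (dom (K + 2) y ∧
        Ψ (trip v K (valA swap t (s.arr .wit t)) (valB swap t (s.arr .wit t)) y)) < Γ.par .N := by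
    refine (Finset.sum_le_card_nsmul _ _ 1 fun y _ => ind_le_one _).trans_lt ?_
    simpa using hN
  have e0 : (Expr.const 0).eval Γ (s.setv .t t) = 0 := rfl
  rw [e0, Nat.cast_zero, zero_add] at this
  have h3 := (ZMod.natCast_eq_natCast_iff' _ _ (Γ.par .N)).1 this.2
  rw [Nat.mod_eq_of_lt this.1, Nat.mod_eq_of_lt h2] at h3
  exact h3

end

/-! ### Evaluating quantifiers -/

/-- One quantifier, over the elements of `D` below `n`. -/
def QStep (q : Quant) (n : ℕ) (D P : ℕ → Prop) : Prop :=
  match q with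
  | .ex => ∃ a < n, D a ∧ P a
  | .all => ∀ a < n, D a → P a

/-- The truth of the formula with the quantifiers `j, …, j + r - 1`, where `v` assigns values to
the other variables. -/
def QT (n : ℕ) (Q : ℕ → Quant) (dom : ℕ → ℕ → Prop) (Ψ : (ℕ → ℕ) → Prop) :
    ℕ → ℕ → (ℕ → ℕ) → Prop
  | 0, _, v => Ψ v
  | r + 1, j, v => QStep (Q j) n (dom j) fun a => QT n Q dom Ψ r (j + 1) (Function.update v j a)

theorem QT_congr_dom {n : ℕ} {Q : ℕ → Quant} {dom dom' : ℕ → ℕ → Prop} {Ψ : (ℕ → ℕ) → Prop} :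
    ∀ {r j : ℕ} {v : ℕ → ℕ}, (∀ l, j ≤ l → dom l = dom' l) →
      (QT n Q dom Ψ r j v ↔ QT n Q dom' Ψ r j v) := by
  intro r
  induction r with
  | zero => intros; rfl
  | succ r ih =>
    intro j v h
    simp only [QT, h j le_rfl]
    have : (fun a => QT n Q dom Ψ r (j + 1) (Function.update v j a)) =
        fun a => QT n Q dom' Ψ r (j + 1) (Function.update v j a) :=
      funext fun a => propext (ih fun l hl => h l (by omega))
    rw [this]

/-- On assignments below `n`, exactly one pattern of `S` matches if `Ψ` holds, and none does if
it does not hold. -/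
def Covers (n : ℕ) (rl : ℕ → ℕ → Fin 3) (k : ℕ) (S : List (ℕ → ℕ → Fin 3))
    (Ψ : (ℕ → ℕ) → Prop) : Prop :=
  ∀ v, (∀ i < k, v i < n) → (S.map fun π => ind (Matches rl k π v)).sum = ind (Ψ v)

/-- Both quantifiers search for an element whose truth value is this bit, a witness for ∃ and a
counterexample for ∀. The quantified statement is true if and only if the flag for success equals
the same bit. -/
def qbit : Quant → Fin 3
  | .ex => 1
  | .all => 0

/-- Evaluates the quantifier `j`: the body computes in `cond` the truth of the rest of the formula
for the value of `v`. The result is in `res`. -/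
def quantLoop (v flag : Var) (j : ℕ) (q : Quant) (body : Stmt) (cond : Expr) : Stmt :=
  .seq (.set flag (.const 0)) <| .seq (.loop v .n (.seq body
    (.ite (andL [domE j (.var v), .bin .eq cond (.const (qbit q))]) (.set flag (.const 1)) .skip)))
    (.set .res (.bin .eq (.var flag) (.const (qbit q))))

/-- Tests whether some pattern in `S` matches. -/
def matchProg (k : ℕ) (S : List (ℕ → ℕ → Fin 3)) : Stmt :=
  .seq (.set .res (.const 0)) <|
    seqL (S.map fun π => .ite (andL (matchE k π)) (.set .res (.const 1)) .skip)

/-- The list of patterns to be counted for the innermost quantifier. -/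
def selS (q : Quant) (S S' : List (ℕ → ℕ → Fin 3)) : List (ℕ → ℕ → Fin 3) :=
  match q with
  | .ex => S
  | .all => S'

/-- The truth of the innermost quantifier, for the value `t` of the last but one variable. -/
def cntBit (q : Quant) : Expr :=
  match q with
  | .ex => notE (notE (.get .cnt (.var .t)))
  | .all => notE (.get .cnt (.var .t))

/-- Evaluates the last two quantifiers. -/
def evalBase (K : ℕ) (Q : ℕ → Quant) (S S' : List (ℕ → ℕ → Fin 3)) : Stmt :=
  .seq (fill .wit (.var (.x K))) <| .seq (cntProg K false (selS (Q (K + 2)) S S')) <|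
    quantLoop .t .hit (K + 1) (Q (K + 1)) .skip (cntBit (Q (K + 2)))

def evalL (Q : ℕ → Quant) (base : Stmt) : ℕ → ℕ → Stmt
  | 0, _ => base
  | r + 1, j => quantLoop (.x j) (.f j) j (Q j) (evalL Q base r (j + 1)) (.var .res)

/-- Evaluates the quantifiers from `j` on; the number of quantifiers is `K + 3`. -/
def evalAt (K : ℕ) (Q : ℕ → Quant) (S S' : List (ℕ → ℕ → Fin 3)) (j : ℕ) : Stmt :=
  if j ≤ K + 1 then evalL Q (evalBase K Q S S') (K + 1 - j) j
  else evalL Q (matchProg (K + 3) S) (K + 3 - j) j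

section
variable {Γ : Env} {rl : ℕ → ℕ → Fin 3} {k J K : ℕ} {dom : ℕ → ℕ → Prop} {v : ℕ → ℕ} {s : Store}
  {role : Role} {na d : ℕ} {Q : ℕ → Quant} {S S' : List (ℕ → ℕ → Fin 3)} {Ψ : (ℕ → ℕ) → Prop}

theorem run_ite_pos {e : Expr} {p q : Stmt} {P : Prop} (h : e.eval Γ s = ind P) (hP : P) :
    (Stmt.ite e p q).run Γ s = p.run Γ s := by
  simp only [Stmt.run, h, ind_pos hP, one_ne_zero, if_false]

theorem run_ite_neg {e : Expr} {p q : Stmt} {P : Prop} (h : e.eval Γ s = ind P) (hP : ¬ P) :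
    (Stmt.ite e p q).run Γ s = q.run Γ s := by
  simp only [Stmt.run, h, ind_neg hP, if_true]

theorem quantLoop_spec {x flag : Var} {j : ℕ} {q : Quant} {body : Stmt} {cond : Expr}
    {D P : ℕ → Prop} (hW : 1 < Γ.par .W) (hxf : x ≠ flag) (hbx : ¬ body.WritesVar x)
    (hbf : ¬ body.WritesVar flag) (hbd : ¬ body.WritesArr (.dom j))
    (hD : ∀ a < Γ.par .n, s.arr (.dom j) a = ind (D a))
    (hb : ∀ a < Γ.par .n, ∀ s' : Store, (∀ w, w ≠ x → w ≠ flag → ¬ body.WritesVar w → s'.var w = s.var w) →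
      (∀ A, ¬ body.WritesArr A → s'.arr A = s.arr A) →
      cond.eval Γ (body.run Γ (s'.setv x a)) = ind (P a)) :
    ((quantLoop x flag j q body cond).run Γ s).var .res = ind (QStep q (Γ.par .n) D P) := by
  have := loop_inv (Γ := Γ) (v := x) (p := .n) (body := .seq body
    (.ite (andL [domE j (.var x), .bin .eq cond (.const (qbit q))]) (.set flag (.const 1)) .skip))
    (s := s.setv flag 0) (fun i s' => s'.var flag = ind (∃ a < i, D a ∧ ind (P a) = qbit q))
    (by simp [ind]) (by
      intro a ha s' hF hI
      have h1 := hb a ha s' (fun w h1 h2 h3 => by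
        rw [hF.var w (by simp [h1, h2, h3]), Store.setv_ne _ _ h2]) (fun A h => by
        rw [hF.arr A (by simp [h])]; rfl)
      set s1 := body.run Γ (s'.setv x a) with hs1
      have hx : s1.var x = a := by rw [hs1, run_var _ hbx, Store.setv_self]
      have hf : s1.var flag = s'.var flag := by
        rw [hs1, run_var _ hbf, Store.setv_ne _ _ hxf.symm]
      have hd : s1.arr (.dom j) a = ind (D a) := by
        rw [hs1, run_arr _ hbd, Store.setv_arr, hF.arr _ (by simp [hbd]), Store.setv_arr, hD a ha]
      have hc : (andL [domE j (.var x), .bin .eq cond (.const (qbit q))]).eval Γ s1 =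
          ind (D a ∧ ind (P a) = qbit q) := by
        rw [eval_andL hW]
        · refine ind_congr ?_
          simp [Expr.eval, BinOp.eval, hx, hd, h1]
        · simp only [List.mem_cons, List.not_mem_nil, or_false, forall_eq_or_imp, forall_eq, domE,
            Expr.eval, hx, hd, BinOp.eval]
          exact ⟨ind_le_one _, by rw [h1]; exact (ind_eq_ite _).symm.trans_le (ind_le_one _)⟩
      change (Stmt.run Γ (.ite _ _ _) s1).var flag = _
      have hsucc : (∃ b < a + 1, D b ∧ ind (P b) = qbit q) ↔
          (∃ b < a, D b ∧ ind (P b) = qbit q) ∨ (D a ∧ ind (P a) = qbit q) := by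
        simp only [Nat.lt_succ_iff_lt_or_eq, or_and_right, exists_or, exists_eq_left]
      rw [ind_congr hsucc]
      by_cases hh : D a ∧ ind (P a) = qbit q
      · rw [run_ite_pos hc hh, ind_pos (.inr hh)]; simp [Stmt.run, Expr.eval]
      · rw [run_ite_neg hc hh, ind_congr (or_iff_left hh), ← hI, ← hf]; rfl)
  set s1 := (Stmt.loop x .n (.seq body (.ite (andL [domE j (.var x), .bin .eq cond
    (.const (qbit q))]) (.set flag (.const 1)) .skip))).run Γ (s.setv flag 0) with hs1
  have : ((quantLoop x flag j q body cond).run Γ s).var .res =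
      ind (s1.var flag = qbit q) := by
    rw [ind_eq_ite]
    exact (Store.setv_self _ _ _)
  rw [this, ‹s1.var flag = _›]
  refine ind_congr ?_
  cases q with
  | ex => simp [qbit, QStep]
  | all => simp [qbit, QStep]

@[simp] theorem quantLoop_writesVar {x flag w : Var} {j : ℕ} {q : Quant} {body : Stmt}
    {cond : Expr} : (quantLoop x flag j q body cond).WritesVar w ↔
      w = flag ∨ w = x ∨ body.WritesVar w ∨ w = .res := by
  simp [quantLoop]; tauto

@[simp] theorem quantLoop_writesArr {x flag : Var} {j : ℕ} {q : Quant} {body : Stmt} {A : Arr}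
    {cond : Expr} : (quantLoop x flag j q body cond).WritesArr A ↔ body.WritesArr A := by
  simp [quantLoop]

@[simp] theorem quantLoop_quiet {x flag : Var} {j : ℕ} {q : Quant} {body : Stmt}
    {cond : Expr} : (quantLoop x flag j q body cond).Quiet ↔ body.Quiet := by
  simp [quantLoop]

theorem quantLoop_fits {x flag : Var} {j : ℕ} {q : Quant} {body : Stmt} {cond : Expr}
    (hj : j + 11 < na) (hc : cond.UsesBelow na) (hb : body.Fits role na d) :
    (quantLoop x flag j q body cond).Fits role na (d + 1) := by
  simp [quantLoop, Arr.code, hj, hc, hb]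

theorem Covers.exists (h : Covers (Γ.par .n) rl k S Ψ) (hv : ∀ i < k, v i < Γ.par .n) :
    (∃ π ∈ S, Matches rl k π v) ↔ Ψ v := by
  have := h v hv
  rw [← ind_ne_zero (p := Ψ v), ← this, Ne, List.sum_eq_zero_iff]
  simp

theorem matchProg_spec (hG : Graphical Γ rl) (h : Good Γ rl k dom k v s)
    (hS : Covers (Γ.par .n) rl k S Ψ) :
    ((matchProg k S).run Γ s).var .res = ind (Ψ v) := by
  have key : ∀ (S : List (ℕ → ℕ → Fin 3)) (s' : Store), Good Γ rl k dom k v s' →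
      s'.var .res ≤ 1 → ((seqL (S.map fun π => .ite (andL (matchE k π)) (.set .res (.const 1))
        .skip)).run Γ s').var .res = ind (s'.var .res = 1 ∨ ∃ π ∈ S, Matches rl k π v) := by
    intro S
    induction S with
    | nil =>
      intro s' _ h1
      simp only [List.map_nil, seqL, Stmt.run, List.not_mem_nil, false_and, exists_false, or_false]
      obtain h | h : s'.var .res = 0 ∨ s'.var .res = 1 := by omega
      · simp [h, ind]
      · simp [h, ind]
    | cons π S ih =>
      intro s' g h1
      have he := (g.matchE hG le_rfl π).eval hG
      simp only [List.map_cons, seqL]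
      rw [Stmt.run]
      by_cases hm : Matches rl k π v
      · rw [run_ite_pos he hm, Stmt.run, ih _ (g.setv (by simp)) (by simp [Expr.eval])]
        rw [ind_pos (.inl (by simp [Expr.eval])), ind_pos (.inr ⟨π, by simp, hm⟩)]
      · rw [run_ite_neg he hm, Stmt.run, ih _ g h1]
        exact ind_congr (by simp [hm])
  have := key S (s.setv .res 0) (h.setv (by simp)) (by simp)
  simp only [matchProg, Stmt.run, Expr.eval]
  refine this.trans (ind_congr ?_)
  rw [← hS.exists h.lt]
  simp

@[simp] theorem matchProg_writesVar {w : Var} (h : w ≠ .res) : ¬ (matchProg k S).WritesVar w := by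
  simp [matchProg, h]

@[simp] theorem matchProg_writesArr {A : Arr} : ¬ (matchProg k S).WritesArr A := by
  simp [matchProg]

@[simp] theorem matchProg_quiet : (matchProg k S).Quiet := by
  simp [matchProg]

theorem matchProg_fits (h : 0 < na) : (matchProg k S).Fits role na d := by
  simp only [matchProg, Stmt.Fits, Expr.UsesBelow, seqL_fits, List.mem_map, forall_exists_index,
    and_imp, forall_apply_eq_imp_iff₂, andL_usesBelow, and_true, true_and]
  exact fun π _ => matchE_usesBelow h

theorem sum_ind_ne_zero {n : ℕ} {P : ℕ → Prop} :
    ∑ y ∈ Finset.range n, ind (P y) ≠ 0 ↔ ∃ y < n, P y := by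
  simp [Finset.sum_eq_zero_iff]

/-- The number of values of the last variable decides the innermost quantifier. -/
theorem QStep_count {q : Quant} {n : ℕ} {D P : ℕ → Prop} :
    QStep q n D P ↔ match q with
      | .ex => ∑ y ∈ Finset.range n, ind (D y ∧ P y) ≠ 0
      | .all => ∑ y ∈ Finset.range n, ind (D y ∧ ¬ P y) = 0 := by
  cases q with
  | ex => simp only [QStep, sum_ind_ne_zero]
  | all => simp [QStep, Finset.sum_eq_zero_iff]

/-- After counting, the counts decide the innermost quantifier. -/
theorem cntBit_spec (hG : Graphical Γ rl) (hN : Γ.par .n < Γ.par .N) {swap : Bool}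
    (hS : Covers (Γ.par .n) rl (K + 3) S Ψ)
    (hS' : Covers (Γ.par .n) rl (K + 3) S' fun v => ¬ Ψ v) (h : Good Γ rl (K + 3) dom J v s)
    (hJ : K ≤ J) (hw : ∀ t < Γ.par .n, s.arr .wit t < Γ.par .n) {s' : Store} {t : ℕ}
    (ht : t < Γ.par .n) (hs't : s'.var .t = t)
    (hs' : s'.arr .cnt = ((cntProg K swap (selS (Q (K + 2)) S S')).run Γ s).arr .cnt) :
    (cntBit (Q (K + 2))).eval Γ s' = ind (QT (Γ.par .n) Q dom Ψ 1 (K + 2)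
      (Function.update (Function.update v K (valA swap t (s.arr .wit t))) (K + 1)
        (valB swap t (s.arr .wit t)))) := by
  simp only [QT]
  rw [ind_congr QStep_count]
  cases hq : Q (K + 2) with
  | ex =>
    rw [hq] at hs'
    have := cntProg_spec (swap := swap) hG hN hS h hJ hw t ht
    rw [cntBit, eval_notE, eval_notE]
    refine ind_congr ?_
    simp only [Expr.eval, hs't, hs', ind_eq_zero]
    rw [selS, this]; rfl
  | all =>
    rw [hq] at hs'
    have := cntProg_spec (swap := swap) hG hN hS' h hJ hw t ht
    rw [cntBit, eval_notE]
    refine ind_congr ?_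
    simp only [Expr.eval, hs't, hs']
    rw [selS, this]; rfl

theorem cntBit_usesBelow {q : Quant} (h : 7 < na) : (cntBit q).UsesBelow na := by
  cases q <;> simp [cntBit, Arr.code, h]

/-- The array `wit` is filled with the constant value of the variable `K`, so one count yields for
all values `t` of the variable `K + 1` the truth of the innermost quantifier; a single loop over `t`
remains. -/
theorem evalBase_spec (hG : Graphical Γ rl) (hN : Γ.par .n < Γ.par .N)
    (hS : Covers (Γ.par .n) rl (K + 3) S Ψ)
    (hS' : Covers (Γ.par .n) rl (K + 3) S' fun v => ¬ Ψ v)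
    (h : Good Γ rl (K + 3) dom (K + 1) v s) :
    ((evalBase K Q S S').run Γ s).var .res = ind (QT (Γ.par .n) Q dom Ψ 2 (K + 1) v) := by
  set s1 := (fill .wit (.var (.x K))).run Γ s with hs1
  have g1 : Good Γ rl (K + 3) dom (K + 1) v s1 := h.run (by simp) (by simp) (by simp)
  set s2 := (cntProg K false (selS (Q (K + 2)) S S')).run Γ s1 with hs2
  have g2 : Good Γ rl (K + 3) dom (K + 1) v s2 := g1.run (by simp) (by simp) (by simp)
  have hwit : ∀ t < Γ.par .n, s1.arr .wit t = v K := by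
    intro t ht
    rw [hs1, fill_spec s hG.n_le_bd (by simp) t ht]
    simp [Expr.eval, Store.setv_ne, h.x K (by omega)]
  have hlt : v K < Γ.par .n := h.lt K (by omega)
  refine (quantLoop_spec (s := s2) hG.one_lt_W (by simp) (by simp) (by simp) (by simp)
    (g2.dom (K + 1) (by omega)) (P := fun t => QT (Γ.par .n) Q dom Ψ 1 (K + 2)
      (Function.update v (K + 1) t)) ?_).trans rfl
  intro t ht s' _ hA
  have := cntBit_spec (Q := Q) (swap := false) hG hN hS hS' g1 (by omega)
    (fun t ht => by rw [hwit t ht]; exact hlt) (s' := s'.setv .t t) ht (by simp)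
    (by rw [Store.setv_arr, hA _ (by simp)])
  simp only [Stmt.run]
  rw [this]
  simp [valA, valB, hwit t ht]

@[simp] theorem evalBase_not_writesVar {w : Var} (h1 : w ≠ .t) (h2 : w ≠ .y) (h3 : w ≠ .e)
    (h4 : w ≠ .tot) (h5 : w ≠ .res) (h6 : w ≠ .hit) : ¬ (evalBase K Q S S').WritesVar w := by
  simp [evalBase, h1, h2, h3, h4, h5, h6]

@[simp] theorem evalBase_not_writesArr {A : Arr} (h1 : A ≠ .p) (h2 : A ≠ .u) (h3 : A ≠ .v)
    (h4 : A ≠ .cnt) (h5 : A ≠ .wit) : ¬ (evalBase K Q S S').WritesArr A := by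
  simp [evalBase, h1, h2, h3, h4, h5]

@[simp] theorem evalBase_quiet : (evalBase K Q S S').Quiet := by
  simp [evalBase]

theorem evalBase_fits (h : K + 14 ≤ na) : (evalBase K Q S S').Fits role na (d + 1) := by
  refine ⟨?_, cntProg_fits h, quantLoop_fits (by omega) (cntBit_usesBelow (by omega)) trivial⟩
  have : 8 < na := by omega
  simp [Arr.code, this]

theorem evalL_fits {base : Stmt} (hb : base.Fits role na d) : ∀ (r j : ℕ), j + r + 11 ≤ na →
    (evalL Q base r j).Fits role na (d + r) := by
  intro r
  induction r with
  | zero => exact fun j _ => hb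
  | succ r ih =>
    intro j hj
    exact quantLoop_fits (by omega) (by simp) (ih (j + 1) (by omega))

theorem evalL_quiet {base : Stmt} (hb : base.Quiet) : ∀ (r j : ℕ), (evalL Q base r j).Quiet := by
  intro r
  induction r with
  | zero => exact fun j => hb
  | succ r ih => exact fun j => by simpa [evalL] using ih (j + 1)

theorem evalL_not_writesVar {base : Stmt} {w : Var} (hb : ¬ base.WritesVar w) (hr : w ≠ .res) :
    ∀ (r j : ℕ), (∀ l, j ≤ l → w ≠ .x l ∧ w ≠ .f l) → ¬ (evalL Q base r j).WritesVar w := by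
  intro r
  induction r with
  | zero => exact fun j _ => hb
  | succ r ih =>
    intro j h
    have := h j le_rfl
    simp [evalL, this, hr, ih (j + 1) fun l hl => h l (by omega)]

theorem evalL_writesArr {base : Stmt} {A : Arr} :
    ∀ (r j : ℕ), (evalL Q base r j).WritesArr A ↔ base.WritesArr A := by
  intro r
  induction r with
  | zero => exact fun j => Iff.rfl
  | succ r ih => exact fun j => by simp [evalL, ih (j + 1)]

theorem evalL_spec {base : Stmt} {r₀ j₀ : ℕ} (hW : 1 < Γ.par .W) (hj₀ : j₀ ≤ k)
    (hx : ∀ l < j₀, ¬ base.WritesVar (.x l) ∧ ¬ base.WritesVar (.f l))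
    (hr : ¬ base.WritesArr .rel) (hd : ∀ j, ¬ base.WritesArr (.dom j))
    (hbase : ∀ v s, Good Γ rl k dom j₀ v s →
      (base.run Γ s).var .res = ind (QT (Γ.par .n) Q dom Ψ r₀ j₀ v)) :
    ∀ (r j : ℕ) (v : ℕ → ℕ) (s : Store), j + r = j₀ → Good Γ rl k dom j v s →
      ((evalL Q base r j).run Γ s).var .res = ind (QT (Γ.par .n) Q dom Ψ (r + r₀) j v) := by
  intro r
  induction r with
  | zero =>
    rintro j v s rfl h
    rw [zero_add]
    exact hbase v s h
  | succ r ih =>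
    intro j v s hj h
    have hw : ∀ l ≤ j, ¬ (evalL Q base r (j + 1)).WritesVar (.x l) ∧
        ¬ (evalL Q base r (j + 1)).WritesVar (.f l) := fun l hl =>
      ⟨evalL_not_writesVar (hx l (by omega)).1 (by simp) _ _ fun l hl => ⟨by simp; omega, by simp⟩,
        evalL_not_writesVar (hx l (by omega)).2 (by simp) _ _ fun l hl => ⟨by simp, by simp; omega⟩⟩
    rw [Nat.succ_add, QT]
    refine quantLoop_spec hW (by simp) (hw j le_rfl).1 (hw j le_rfl).2
      (by rw [evalL_writesArr]; exact hd j) (h.dom j (by omega)) ?_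
    intro a ha s' hv hA
    refine ih (j + 1) _ _ (by omega) (Good.set_x ?_ ha)
    exact h.congr (hA _ (by rwa [evalL_writesArr])) (fun l _ => hA _ (by
      rw [evalL_writesArr]; exact hd l)) fun l hl => hv _ (by simp; omega) (by simp)
        (hw l hl.le).1

theorem evalAt_spec (hG : Graphical Γ rl) (hN : Γ.par .n < Γ.par .N)
    (hS : Covers (Γ.par .n) rl (K + 3) S Ψ)
    (hS' : Covers (Γ.par .n) rl (K + 3) S' fun v => ¬ Ψ v) {j : ℕ} (hj : j ≤ K + 3)
    (h : Good Γ rl (K + 3) dom j v s) :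
    ((evalAt K Q S S' j).run Γ s).var .res = ind (QT (Γ.par .n) Q dom Ψ (K + 3 - j) j v) := by
  unfold evalAt
  split_ifs with h1
  · have := evalL_spec (Q := Q) (base := evalBase K Q S S') (Ψ := Ψ) (dom := dom) (rl := rl)
      (k := K + 3) hG.one_lt_W (j₀ := K + 1) (r₀ := 2) (by omega) (by simp) (by simp) (by simp)
      (fun v s g => evalBase_spec hG hN hS hS' g) (K + 1 - j) j v s (by omega) h
    rwa [show K + 1 - j + 2 = K + 3 - j by omega] at this
  · exact evalL_spec (Q := Q) (base := matchProg (K + 3) S) (Ψ := Ψ) (dom := dom) (rl := rl)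
      (k := K + 3) hG.one_lt_W (j₀ := K + 3) (r₀ := 0) (by omega) (by simp) (by simp) (by simp)
      (fun v s g => matchProg_spec hG g hS) (K + 3 - j) j v s (by omega) h

@[simp] theorem evalAt_quiet {j : ℕ} : (evalAt K Q S S' j).Quiet := by
  unfold evalAt
  split_ifs <;> exact evalL_quiet (by simp) _ _

@[simp] theorem evalAt_not_writesVar {j : ℕ} {w : Var} (h1 : w ≠ .t) (h2 : w ≠ .y) (h3 : w ≠ .e)
    (h4 : w ≠ .tot) (h5 : w ≠ .res) (h6 : w ≠ .hit) (h7 : ∀ l, j ≤ l → w ≠ .x l)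
    (h8 : ∀ l, w ≠ .f l) : ¬ (evalAt K Q S S' j).WritesVar w := by
  unfold evalAt
  split_ifs <;> exact evalL_not_writesVar (by simp [*]) h5 _ _ fun l hl => ⟨h7 l hl, h8 l⟩

theorem evalAt_not_writesX {j l : ℕ} (h : l < j) : ¬ (evalAt K Q S S' j).WritesVar (.x l) :=
  evalAt_not_writesVar (by simp) (by simp) (by simp) (by simp) (by simp) (by simp)
    (fun l' h' => by simp; omega) (by simp)

@[simp] theorem evalAt_not_writesArr {j : ℕ} {A : Arr} (h1 : A ≠ .p) (h2 : A ≠ .u) (h3 : A ≠ .v)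
    (h4 : A ≠ .cnt) (h5 : A ≠ .wit) : ¬ (evalAt K Q S S' j).WritesArr A := by
  unfold evalAt
  split_ifs <;> simp [evalL_writesArr, *]

/-- Counting saves one loop whenever at least two quantifiers remain. For `j ≥ K + 2` at most one
remains, and enumerating its values costs at most one loop. -/
theorem evalAt_fits {j : ℕ} (hj : j ≤ K + 3) (h : K + 14 ≤ na) :
    (evalAt K Q S S' j).Fits role na (if j ≤ K + 1 then K + 2 - j else K + 3 - j) := by
  unfold evalAt
  split_ifs with h1
  · have := evalL_fits (role := role) (Q := Q) (evalBase_fits (role := role) (d := 0) (Q := Q)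
      (S := S) (S' := S') h) (K + 1 - j) j (by omega)
    exact this.mono (by omega)
  · have := evalL_fits (role := role) (Q := Q) (matchProg_fits (role := role) (d := 0) (k := K + 3)
      (S := S) (na := na) (by omega)) (K + 3 - j) j (by omega)
    exact this.mono (by omega)

end

/-! ### Interactive checks that a subproblem has no solution -/

/-- The environment describes a graph with relation `rl`, and the lists `S` and `S'` describe the
formula `Ψ` and its negation. -/
structure Setup (Γ : Env) (rl : ℕ → ℕ → Fin 3) (K : ℕ) (S S' : List (ℕ → ℕ → Fin 3))
    (Ψ : (ℕ → ℕ) → Prop) : Prop where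
  graph : Graphical Γ rl
  n_lt_N : Γ.par .n < Γ.par .N
  dbl : Γ.par .dbl = 2 * Γ.par .n
  dbl_le : Γ.par .dbl ≤ Γ.par .bd
  pos : Covers (Γ.par .n) rl (K + 3) S Ψ
  neg : Covers (Γ.par .n) rl (K + 3) S' fun v => ¬ Ψ v

/-- There is no way to choose the first `i` variables in the domains such that the rest of the
formula holds. -/
def NoSol (n : ℕ) (Q : ℕ → Quant) (dom : ℕ → ℕ → Prop) (Ψ : (ℕ → ℕ) → Prop) (K i : ℕ) : Prop :=
  ∀ v : ℕ → ℕ, (∀ l < i, v l < n) → (∀ l < i, dom l (v l)) → ¬ QT n Q dom Ψ (K + 3 - i) i v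

/-- The words in `L` are sent from position `p` on. -/
def Serves (ω : ℕ → ℕ) (p : ℕ) (L : List ℕ) : Prop := ∀ i (h : i < L.length), ω (p + i) = L[i]

theorem Serves.append {ω : ℕ → ℕ} {p : ℕ} {L L' : List ℕ} :
    Serves ω p (L ++ L') ↔ Serves ω p L ∧ Serves ω (p + L.length) L' := by
  constructor
  · intro h
    refine ⟨fun i hi => ?_, fun i hi => ?_⟩
    · rw [h i (by simp; omega), List.getElem_append_left hi]
    · rw [add_assoc, h (L.length + i) (by simp; omega), List.getElem_append_right (by omega)]
      simp
  · rintro ⟨h1, h2⟩ i hi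
    rcases lt_or_ge i L.length with h | h
    · rw [h1 i h, List.getElem_append_left h]
    · rw [List.getElem_append_right h, ← h2 (i - L.length) (by simp at hi; omega)]
      congr 1; omega

theorem Serves.singleton {ω : ℕ → ℕ} {p a : ℕ} : Serves ω p [a] ↔ ω p = a := by
  simp [Serves]

/-- All tuples of values of `r` variables starting with the variable `l` are accepted, where the
words for each tuple form a block of length `sz` of the communication. -/
def AllAcc (n sz : ℕ) (Acc : (ℕ → ℕ) → ℕ → Prop) : ℕ → ℕ → (ℕ → ℕ) → ℕ → Prop
  | 0, _, v, p => Acc v p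
  | r + 1, l, v, p => ∀ a < n, AllAcc n sz Acc r (l + 1) (Function.update v l a) (p + a * (sz * n ^ r))

theorem AllAcc.mono {n sz : ℕ} {Acc Acc' : (ℕ → ℕ) → ℕ → Prop} (h : ∀ v p, Acc v p → Acc' v p) :
    ∀ {r l : ℕ} {v : ℕ → ℕ} {p : ℕ}, AllAcc n sz Acc r l v p → AllAcc n sz Acc' r l v p := by
  intro r
  induction r with
  | zero => exact fun h' => h _ _ h'
  | succ r ih => exact fun h' a ha => ih (h' a ha)

/-- The block of the communication that belongs to the tuple `v` is determined before the predicate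
is. In the soundness proof one position therefore serves all random choices `r`. -/
theorem AllAcc.position {n sz : ℕ} {v : ℕ → ℕ} : ∀ {r l : ℕ} (p : ℕ),
    (∀ i, l ≤ i → i < l + r → v i < n) →
    ∃ p', ∀ Acc : (ℕ → ℕ) → ℕ → Prop, AllAcc n sz Acc r l v p → Acc v p' := by
  intro r
  induction r with
  | zero => exact fun p _ => ⟨p, fun _ h => h⟩
  | succ r ih =>
    intro l p hv
    obtain ⟨p', h⟩ := ih (l := l + 1) (p + v l * (sz * n ^ r)) fun i h1 h2 => hv i (by omega) (by omega)
    refine ⟨p', fun Acc hA => h Acc ?_⟩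
    have := hA (v l) (hv l le_rfl (by omega))
    rwa [Function.update_eq_self] at this

/-- Runs the body for all values of `r` variables, starting with the variable `l`. -/
def nest (body : Stmt) : ℕ → ℕ → Stmt
  | 0, _ => body
  | r + 1, l => .loop (.x l) .n (nest body r (l + 1))

/-- `ok := ok ∧ e` -/
def require (e : Expr) : Stmt := .set .ok (andL [.var .ok, e])

attribute [simp] require

section
variable {Γ : Env} {rl : ℕ → ℕ → Fin 3} {k J K L : ℕ} {dom : ℕ → ℕ → Prop} {v : ℕ → ℕ} {s : Store}
  {role : Role} {na d : ℕ} {Q : ℕ → Quant} {S S' : List (ℕ → ℕ → Fin 3)} {Ψ : (ℕ → ℕ) → Prop}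

theorem require_spec {e : Expr} {A : Prop} (hW : 1 < Γ.par .W) (hok : s.var .ok ≤ 1)
    (he : e.eval Γ s = ind A) :
    (andL [.var .ok, e]).eval Γ s = ind (s.var .ok = 1 ∧ A) := by
  rw [eval_andL hW]
  · refine ind_congr ?_
    simp only [List.mem_cons, List.not_mem_nil, or_false, forall_eq_or_imp, forall_eq, he,
      ind_ne_zero, Expr.eval]
    refine and_congr_left fun _ => ?_
    omega
  · simp only [List.mem_cons, List.not_mem_nil, or_false, forall_eq_or_imp, forall_eq, he,
      Expr.eval]
    exact ⟨hok, ind_le_one _⟩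

theorem require_loop {x : Var} {p : Par} {e : Expr} {A : ℕ → Prop} (hW : 1 < Γ.par .W)
    (hok : s.var .ok ≤ 1) (hx : x ≠ .ok)
    (he : ∀ a < Γ.par p, ∀ s' : Store, (∀ w, w ≠ x → w ≠ .ok → s'.var w = s.var w) →
      s'.arr = s.arr → s'.var x = a → e.eval Γ s' = ind (A a)) :
    ((Stmt.loop x p (require e)).run Γ s).var .ok =
      ind (s.var .ok = 1 ∧ ∀ a < Γ.par p, A a) := by
  refine loop_inv (Γ := Γ) (v := x) (p := p) (body := require e)
    (fun i s' => s'.var .ok = ind (s.var .ok = 1 ∧ ∀ a < i, A a)) ?_ ?_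
  · obtain h | h : s.var .ok = 0 ∨ s.var .ok = 1 := by omega
    · simp [h, ind]
    · simp [h, ind]
  · intro a ha s' hF hI
    have hev := he a ha (s'.setv x a) (fun w h1 h2 => by
      rw [Store.setv_ne _ _ h1, hF.var w (by simp [h1, h2])])
      (funext fun A => hF.arr A (by simp)) (by simp)
    have hok' : (s'.setv x a).var .ok = s'.var .ok := Store.setv_ne _ _ hx.symm
    have := require_spec hW (s := s'.setv x a) (by rw [hok', hI]; exact ind_le_one _) hev
    simp only [require, Stmt.run, Store.setv_self, this, hok', hI, ind_eq_one]
    refine ind_congr ?_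
    simp only [Nat.lt_succ_iff_lt_or_eq, or_imp, forall_and, forall_eq, and_assoc]

theorem nest_writesVar {body : Stmt} {w : Var} : ∀ (r l : ℕ), (nest body r l).WritesVar w →
    (∃ j, l ≤ j ∧ j < l + r ∧ w = .x j) ∨ body.WritesVar w := by
  intro r
  induction r with
  | zero => exact fun l h => .inr h
  | succ r ih =>
    rintro l (h | h)
    · exact .inl ⟨l, le_rfl, by omega, h⟩
    · rcases ih (l + 1) h with ⟨j, h1, h2, h3⟩ | h
      · exact .inl ⟨j, by omega, by omega, h3⟩
      · exact .inr h

theorem nest_writesArr {body : Stmt} {A : Arr} : ∀ (r l : ℕ),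
    (nest body r l).WritesArr A ↔ body.WritesArr A := by
  intro r
  induction r with
  | zero => exact fun l => Iff.rfl
  | succ r ih => exact fun l => ih (l + 1)

theorem nest_fits {body : Stmt} (h : body.Fits role na d) : ∀ (r l : ℕ),
    (nest body r l).Fits role na (d + r) := by
  intro r
  induction r with
  | zero => exact fun l => h
  | succ r ih => exact fun l => ⟨trivial, ih (l + 1)⟩

/-- The body never writes `r`. Fixing its value as `c` lets `Acc` depend on the random number, which
is the same for all tuples. -/
theorem nest_verify {body : Stmt} {sz : ℕ} {Acc : (ℕ → ℕ) → ℕ → Prop} {c : ℕ}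
    (hx : ∀ l < L, ¬ body.WritesVar (.x l)) (hr : ¬ body.WritesArr .rel)
    (hd : ∀ j, ¬ body.WritesArr (.dom j)) (hvr : ¬ body.WritesVar .r)
    (hbody : ∀ v s, Good Γ rl k dom L v s → s.var .ok ≤ 1 → s.var .r = c →
      (body.run Γ s).pos = s.pos + sz ∧ (body.run Γ s).var .ok = ind (s.var .ok = 1 ∧ Acc v s.pos)) :
    ∀ (r l : ℕ) (v : ℕ → ℕ) (s : Store), l + r = L → Good Γ rl k dom l v s → s.var .ok ≤ 1 →
      s.var .r = c → ((nest body r l).run Γ s).pos = s.pos + sz * Γ.par .n ^ r ∧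
      ((nest body r l).run Γ s).var .ok =
        ind (s.var .ok = 1 ∧ AllAcc (Γ.par .n) sz Acc r l v s.pos) := by
  intro r
  induction r with
  | zero =>
    rintro l v s rfl h hok hc
    rw [pow_zero, mul_one]
    exact hbody v s h hok hc
  | succ r ih =>
    intro l v s hl h hok hc
    have := loop_inv (Γ := Γ) (v := .x l) (p := .n) (body := nest body r (l + 1)) (s := s)
      (fun i s' => s'.pos = s.pos + i * (sz * Γ.par .n ^ r) ∧ s'.var .ok = ind (s.var .ok = 1 ∧
        ∀ a < i, AllAcc (Γ.par .n) sz Acc r (l + 1) (Function.update v l a)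
          (s.pos + a * (sz * Γ.par .n ^ r)))) (by
      obtain h | h : s.var .ok = 0 ∨ s.var .ok = 1 := by omega
      · simp [h, ind]
      · simp [h, ind]) (by
      intro a ha s' hF hI
      have g : Good Γ rl k dom l v s' := by
        refine h.frame hF (by simpa [nest_writesArr]) (by simpa [nest_writesArr]) ?_
        rintro j hj (h' | h')
        · simp at h'; omega
        · rcases nest_writesVar _ _ h' with ⟨j', h1, h2, h3⟩ | h'
          · simp at h3; omega
          · exact hx j (by omega) h'
      have hcr : (s'.setv (.x l) a).var .r = c := by
        rw [Store.setv_ne _ _ (by simp), hF.var _ ?_, hc]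
        rintro (h' | h')
        · simp at h'
        · rcases nest_writesVar _ _ h' with ⟨j', h1, h2, h3⟩ | h'
          · simp at h3
          · exact hvr h'
      have hok' : (s'.setv (.x l) a).var .ok = s'.var .ok := Store.setv_ne _ _ (by simp)
      obtain ⟨h1, h2⟩ := ih (l + 1) _ (s'.setv (.x l) a) (by omega) (g.set_x ha)
        (by rw [hok', hI.2]; exact ind_le_one _) hcr
      refine ⟨by rw [h1, Store.setv_pos, hI.1]; ring, ?_⟩
      rw [h2, hok', hI.2, Store.setv_pos, hI.1, ind_eq_one]
      refine ind_congr ?_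
      simp only [Nat.lt_succ_iff_lt_or_eq, or_imp, forall_and, forall_eq, and_assoc])
    refine ⟨?_, this.2⟩
    rw [nest, this.1]; ring

/-- The blocks are required to be accepted at every position and inside every sequence that contains
them there, so that they can be concatenated. -/
theorem nest_prove {body : Stmt} {sz : ℕ} {Acc : (ℕ → ℕ) → (ℕ → ℕ) → ℕ → Prop}
    (hx : ∀ l < L, ¬ body.WritesVar (.x l)) (hr : ¬ body.WritesArr .rel)
    (hd : ∀ j, ¬ body.WritesArr (.dom j))
    (hbody : ∀ v s, Good Γ rl k dom L v s → ∃ blk, (body.run Γ s).out = s.out ++ blk ∧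
      blk.length = sz ∧ ∀ ω p, Serves ω p blk → Acc ω v p) :
    ∀ (r l : ℕ) (v : ℕ → ℕ) (s : Store), l + r = L → Good Γ rl k dom l v s →
      ∃ blk, ((nest body r l).run Γ s).out = s.out ++ blk ∧ blk.length = sz * Γ.par .n ^ r ∧
        ∀ ω p, Serves ω p blk → AllAcc (Γ.par .n) sz (Acc ω) r l v p := by
  intro r
  induction r with
  | zero =>
    rintro l v s rfl h
    rw [pow_zero, mul_one]
    exact hbody v s h
  | succ r ih =>
    intro l v s hl h
    have := loop_inv (Γ := Γ) (v := .x l) (p := .n) (body := nest body r (l + 1)) (s := s)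
      (fun i s' => ∃ blk, s'.out = s.out ++ blk ∧ blk.length = i * (sz * Γ.par .n ^ r) ∧
        ∀ ω p, Serves ω p blk → ∀ a < i, AllAcc (Γ.par .n) sz (Acc ω) r (l + 1)
          (Function.update v l a) (p + a * (sz * Γ.par .n ^ r))) ⟨[], by simp⟩ (by
      rintro a ha s' hF ⟨blk, hI1, hI2, hI3⟩
      have g : Good Γ rl k dom l v s' := by
        refine h.frame hF (by simpa [nest_writesArr]) (by simpa [nest_writesArr]) ?_
        rintro j hj (h' | h')
        · simp at h'; omega
        · rcases nest_writesVar _ _ h' with ⟨j', h1, h2, h3⟩ | h'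
          · simp at h3; omega
          · exact hx j (by omega) h'
      obtain ⟨blk', h1, h2, h3⟩ := ih (l + 1) _ (s'.setv (.x l) a) (by omega) (g.set_x ha)
      refine ⟨blk ++ blk', by rw [h1, Store.setv_out, hI1, List.append_assoc],
        by rw [List.length_append, hI2, h2]; ring, fun ω p hS b hb => ?_⟩
      rw [Serves.append, hI2] at hS
      rcases Nat.lt_succ_iff_lt_or_eq.1 hb with hb | rfl
      · exact hI3 ω p hS.1 b hb
      · exact h3 ω _ hS.2)
    obtain ⟨blk, h1, h2, h3⟩ := this
    exact ⟨blk, h1, by rw [h2]; ring, h3⟩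

end

/-- A protocol by which a prover convinces a verifier that `NoSol` holds for the current domains.
`Acc` says that the verifier, which has chosen the random number `r`, accepts the words sent from
position `p` on. -/
structure Protocol (K i : ℕ) (Q : ℕ → Quant) (S S' : List (ℕ → ℕ → Fin 3)) where
  chk : Stmt
  prv : Stmt
  len : ℕ → ℕ
  Acc (n N r : ℕ) (rl : ℕ → ℕ → Fin 3) (dom : ℕ → ℕ → Prop) (Ψ : (ℕ → ℕ) → Prop) (ω : ℕ → ℕ)
    (p : ℕ) : Prop
  chk_fits : ∀ {na : ℕ}, K + 14 ≤ na → chk.Fits .verifier na (K + 1)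
  prv_fits : ∀ {na : ℕ}, K + 14 ≤ na → prv.Fits .prover na (K + 2)
  chk_var : ∀ {w}, w = .r ∨ w = .out ∨ (∃ l, w = .a l) → ¬ chk.WritesVar w
  prv_var : ∀ {w}, w = .out ∨ (∃ l, w = .a l) → ¬ prv.WritesVar w
  chk_arr : ∀ {A}, A = .rel ∨ (∃ l, A = .dom l) → ¬ chk.WritesArr A
  prv_arr : ∀ {A}, A = .rel ∨ (∃ l, A = .dom l) → ¬ prv.WritesArr A
  chk_spec : ∀ {Γ rl dom v s Ψ}, Setup Γ rl K S S' Ψ → Good Γ rl (K + 3) dom 0 v s →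
    s.var .ok ≤ 1 → (chk.run Γ s).pos = s.pos + len (Γ.par .n) ∧
      (chk.run Γ s).var .ok = ind (s.var .ok = 1 ∧
        Acc (Γ.par .n) (Γ.par .N) (s.var .r) rl dom Ψ Γ.word s.pos)
  prv_spec : ∀ {Γ rl dom v s Ψ}, Setup Γ rl K S S' Ψ → Good Γ rl (K + 3) dom 0 v s →
    NoSol (Γ.par .n) Q dom Ψ K i → ∃ blk, (prv.run Γ s).out = s.out ++ blk ∧
      blk.length = len (Γ.par .n) ∧ ∀ ω r p, Serves ω p blk →
        Acc (Γ.par .n) (Γ.par .N) r rl dom Ψ ω p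
  sound : ∀ {n q rl dom Ψ}, 0 < n → q.Prime → 12 * n < q → (∀ a b, rl a b = rl b a) → Covers n rl (K + 3) S Ψ →
    ¬ NoSol n Q dom Ψ K i → ∀ ω p, ∃ bad : Finset ℕ, bad.card < 2 * n + 1 ∧
      ∀ r < 12 * n, Acc n (q ^ 2) r rl dom Ψ ω p → r ∈ bad

/-! ### Protocols with a universal quantifier after the leading block -/

/-- Receives a counterexample to the universal quantifier `i` and checks it. -/
def checkWitness (K i : ℕ) (Q : ℕ → Quant) (S S' : List (ℕ → ℕ → Fin 3)) : Stmt :=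
  .seq (.recv (.x i)) <| .seq (.set (.x i) (.bin .mod (.var (.x i)) (.par .n))) <|
  .seq (evalAt K Q S S' (i + 1)) <| require (notE (andL (domL i ++
    [notE (andL [domE i (.var (.x i)), notE (.var .res)])])))

/-- Finds a counterexample to the universal quantifier `i` and sends it. -/
def sendWitness (K i : ℕ) (Q : ℕ → Quant) (S S' : List (ℕ → ℕ → Fin 3)) : Stmt :=
  .seq (.set .g (.const 0)) <| .seq (.loop .i .n (.seq (.set (.x i) (.var .i)) <|
    .seq (evalAt K Q S S' (i + 1)) <|
    .ite (andL [domE i (.var .i), notE (.var .res)]) (.set .g (.var .i)) .skip)) <| .send (.var .g)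

/-- A tuple outside the domains needs no counterexample and is accepted with any word. Received
words are reduced modulo n so that each of them names a vertex. -/
def AccWitness (n : ℕ) (Q : ℕ → Quant) (dom : ℕ → ℕ → Prop) (Ψ : (ℕ → ℕ) → Prop) (K i : ℕ)
    (ω : ℕ → ℕ) (v : ℕ → ℕ) (p : ℕ) : Prop :=
  ¬ ((∀ l < i, dom l (v l)) ∧ ¬ (dom i (ω p % n) ∧
    ¬ QT n Q dom Ψ (K + 3 - (i + 1)) (i + 1) (Function.update v i (ω p % n))))

/-- For every `t` receives a counterexample to the universal quantifier `K + 1`, where the variable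
`K` has the value `t`, and checks all of them by counting. -/
def checkWitnesses (K : ℕ) (Q : ℕ → Quant) (S S' : List (ℕ → ℕ → Fin 3)) : Stmt :=
  .seq (.loop .t .n (.seq (.recv .g) (.put .wit (.var .t) (.bin .mod (.var .g) (.par .n))))) <|
  .seq (cntProg K true (selS (Q (K + 2)) S S')) <|
  .loop .t .n (require (notE (andL (domL K ++ [domE K (.var .t),
    notE (andL [domE (K + 1) (.get .wit (.var .t)), notE (cntBit (Q (K + 2)))])]))))

/-- Each candidate `i` is tested for all `t` at the same time by one count, and `val t` keeps the
last counterexample found. So a whole array of answers costs n linear passes. -/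
def sendWitnesses (K : ℕ) (Q : ℕ → Quant) (S S' : List (ℕ → ℕ → Fin 3)) : Stmt :=
  .seq (.loop .i .n (.seq (fill .wit (.var .i)) <|
    .seq (cntProg K true (selS (Q (K + 2)) S S')) <|
    .loop .t .n (.ite (andL [domE (K + 1) (.var .i), notE (cntBit (Q (K + 2)))])
      (.put .val (.var .t) (.var .i)) .skip))) <|
  .loop .t .n (.send (.get .val (.var .t)))

def AccWitnesses (n : ℕ) (Q : ℕ → Quant) (dom : ℕ → ℕ → Prop) (Ψ : (ℕ → ℕ) → Prop) (K : ℕ)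
    (ω : ℕ → ℕ) (v : ℕ → ℕ) (p : ℕ) : Prop :=
  ∀ t < n, ¬ ((∀ l < K, dom l (v l)) ∧ dom K t ∧ ¬ (dom (K + 1) (ω (p + t) % n) ∧
    ¬ QT n Q dom Ψ 1 (K + 2)
      (Function.update (Function.update v K t) (K + 1) (ω (p + t) % n))))

section
variable {Γ : Env} {rl : ℕ → ℕ → Fin 3} {K i : ℕ} {dom : ℕ → ℕ → Prop} {v : ℕ → ℕ} {s : Store}
  {na : ℕ} {Q : ℕ → Quant} {S S' : List (ℕ → ℕ → Fin 3)} {Ψ : (ℕ → ℕ) → Prop}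

theorem Setup.evalAt_spec (hΓ : Setup Γ rl K S S' Ψ) {j : ℕ} (hj : j ≤ K + 3)
    (h : Good Γ rl (K + 3) dom j v s) :
    ((evalAt K Q S S' j).run Γ s).var .res = ind (QT (Γ.par .n) Q dom Ψ (K + 3 - j) j v) :=
  LoopLang.evalAt_spec hΓ.graph hΓ.n_lt_N hΓ.pos hΓ.neg hj h

/-- A protocol starts with no quantified variable in use, so the specification of its run holds for
every initial assignment. This lemma collects these specifications into one; soundness can then
choose the assignment. -/
theorem ind_forall {α : Type} [Nonempty α] {x : ℕ} {a : Prop} {P : α → Prop}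
    (h : ∀ v, x = ind (a ∧ P v)) : x = ind (a ∧ ∀ v, P v) := by
  by_cases hP : ∀ v, P v
  · obtain ⟨v⟩ := ‹Nonempty α›
    rw [h v]
    exact ind_congr (by simp [hP])
  · obtain ⟨v, hv⟩ := not_forall.1 hP
    rw [h v, ind_neg (fun h => hv h.2), ind_neg (fun h => hP h.2)]

/-- The counterpart for the prover: the output of the run is the same for every assignment, hence
one block serves all of them. -/
theorem blk_forall {α : Type} [Nonempty α] {out out' : List ℕ} {c : ℕ}
    {P : α → (ℕ → ℕ) → ℕ → ℕ → Prop} (h : ∀ a, ∃ blk, out' = out ++ blk ∧ blk.length = c ∧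
      ∀ ω r p, Serves ω p blk → P a ω r p) :
    ∃ blk, out' = out ++ blk ∧ blk.length = c ∧ ∀ ω r p, Serves ω p blk → ∀ a, P a ω r p := by
  obtain ⟨a⟩ := ‹Nonempty α›
  obtain ⟨blk, h1, h2, _⟩ := h a
  refine ⟨blk, h1, h2, fun ω r p hS b => ?_⟩
  obtain ⟨blk', h1', _, h3'⟩ := h b
  rw [h1, List.append_cancel_left_eq] at h1'
  subst h1'
  exact h3' ω r p hS

theorem Checks.singleton {e : Expr} {P : Prop} (he : e.eval Γ s = ind P) : Checks Γ s [e] P := by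
  simpa using Checks.cons he .nil

theorem eval_not {e : Expr} {P : Prop} (he : e.eval Γ s = ind P) :
    (notE e).eval Γ s = ind (¬ P) := by
  rw [eval_notE, he]
  exact ind_congr ind_eq_zero

theorem checkWitness_spec (hΓ : Setup Γ rl K S S' Ψ) (hi : i ≤ K) (h : Good Γ rl (K + 3) dom i v s)
    (hok : s.var .ok ≤ 1) :
    ((checkWitness K i Q S S').run Γ s).pos = s.pos + 1 ∧
    ((checkWitness K i Q S S').run Γ s).var .ok =
      ind (s.var .ok = 1 ∧ AccWitness (Γ.par .n) Q dom Ψ K i Γ.word v s.pos) := by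
  have hn := hΓ.graph.n_pos
  set w := Γ.word s.pos % Γ.par .n with hw
  have hwn : w < Γ.par .n := Nat.mod_lt _ hn
  set s0 : Store := { s with pos := s.pos + 1 } with hs0
  set s1 := s0.setv (.x i) w with hs1
  set s2 := (evalAt K Q S S' (i + 1)).run Γ s1 with hs2
  have g0 : Good Γ rl (K + 3) dom i v s0 := h.congr rfl (fun _ _ => rfl) fun _ _ => rfl
  have g1 : Good Γ rl (K + 3) dom (i + 1) (Function.update v i w) s1 := g0.set_x hwn
  have g2 : Good Γ rl (K + 3) dom (i + 1) (Function.update v i w) s2 :=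
    g1.run (by simp) (by simp) (fun j hj => evalAt_not_writesX hj)
  have hrun : (checkWitness K i Q S S').run Γ s = (require (notE (andL (domL i ++
      [notE (andL [domE i (.var (.x i)), notE (.var .res)])])))).run Γ s2 := by
    have : (Stmt.set (.x i) (.bin .mod (.var (.x i)) (.par .n))).run Γ
        ((Stmt.recv (.x i)).run Γ s) = s1 := by
      simp only [Stmt.run, Expr.eval, BinOp.eval, Store.setv, hs1, hs0, hw, Function.update_self,
        Function.update_idem]
    simp only [checkWitness, Stmt.run, hs2] at this ⊢
    rw [this]
  have e1 := hΓ.evalAt_spec (Q := Q) (by omega) g1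
  have hx : s2.var (.x i) = w := by simpa using g2.x i (by omega)
  have e2 := g2.domL (K := i) (by omega) (by omega)
  have e3 := g2.eval_domE (j := i) (a := .var (.x i)) (by omega) (by simpa [Expr.eval, hx])
  have e4 : (notE (andL [domE i (.var (.x i)), notE (.var .res)])).eval Γ s2 = _ :=
    eval_not ((Checks.cons e3 (Checks.singleton (eval_not (e := .var .res) e1))).eval hΓ.graph)
  have e5 := eval_not ((e2.append (Checks.singleton e4)).eval hΓ.graph)
  have hok2 : s2.var .ok = s.var .ok := by
    rw [hs2, run_var _ (by simp), hs1, Store.setv_ne _ _ (by simp)]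
  rw [hrun]
  refine ⟨(run_quiet (c := evalAt K Q S S' (i + 1)) s1 (by simp)).1, ?_⟩
  rw [require, Stmt.run, Store.setv_self, require_spec hΓ.graph.one_lt_W (by rwa [hok2]) e5, hok2]
  refine ind_congr (and_congr_right fun _ => not_congr (and_congr ?_ ?_))
  · exact forall₂_congr fun l hl => by rw [Function.update_of_ne (by omega)]
  · simp only [Expr.eval, hx, hw]

theorem sendWitness_spec (hΓ : Setup Γ rl K S S' Ψ) (hi : i ≤ K) (hQ : Q i = .all)
    (h : Good Γ rl (K + 3) dom i v s) (hno : NoSol (Γ.par .n) Q dom Ψ K i) :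
    ∃ blk, ((sendWitness K i Q S S').run Γ s).out = s.out ++ blk ∧ blk.length = 1 ∧
      ∀ ω p, Serves ω p blk → AccWitness (Γ.par .n) Q dom Ψ K i ω v p := by
  set P : ℕ → Prop := fun w => dom i w ∧
    ¬ QT (Γ.par .n) Q dom Ψ (K + 3 - (i + 1)) (i + 1) (Function.update v i w) with hP
  have := loop_inv (Γ := Γ) (v := .i) (p := .n) (body := .seq (.set (.x i) (.var .i)) <|
    .seq (evalAt K Q S S' (i + 1)) <|
    .ite (andL [domE i (.var .i), notE (.var .res)]) (.set .g (.var .i)) .skip)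
    -- The initial 0 is a legal vertex. A true counterexample is promised only if there is one,
    -- which suffices because the other tuples are accepted anyway.
    (s := s.setv .g 0) (fun a s' => s'.var .g < Γ.par .n ∧ ((∃ w < a, P w) → P (s'.var .g)))
    (by simp [hΓ.graph.n_pos]) (by
    intro a ha s' hF hI
    have g0 : Good Γ rl (K + 3) dom i v (s'.setv .i a) := by
      refine (Good.frame (h.setv (by simp)) hF (by simp) (by simp) fun j hj => ?_).setv (by simp)
      have := evalAt_not_writesX (K := K) (Q := Q) (S := S) (S' := S') (show j < i + 1 by omega)
      simp [this]
      omega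
    have g1 : Good Γ rl (K + 3) dom (i + 1) (Function.update v i a)
        ((s'.setv .i a).setv (.x i) a) := g0.set_x ha
    have e1 := hΓ.evalAt_spec (Q := Q) (by omega) g1
    set s1 := (evalAt K Q S S' (i + 1)).run Γ ((s'.setv .i a).setv (.x i) a) with hs1
    have g2 : Good Γ rl (K + 3) dom (i + 1) (Function.update v i a) s1 :=
      g1.run (by simp) (by simp) (fun j hj => evalAt_not_writesX hj)
    have hvi : s1.var .i = a := by
      rw [hs1, run_var _ (by simp), Store.setv_ne _ _ (by simp), Store.setv_self]
    have hvg : s1.var .g = s'.var .g := by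
      rw [hs1, run_var _ (by simp), Store.setv_ne _ _ (by simp), Store.setv_ne _ _ (by simp)]
    have e3 := g2.eval_domE (j := i) (a := .var .i) (by omega) (by simpa [Expr.eval, hvi])
    have e4 := (Checks.cons e3 (Checks.singleton (eval_not (e := .var .res) e1))).eval hΓ.graph
    have hrun : (Stmt.run Γ (.seq (.set (.x i) (.var .i)) <| .seq (evalAt K Q S S' (i + 1)) <|
        .ite (andL [domE i (.var .i), notE (.var .res)]) (.set .g (.var .i)) .skip)
        (s'.setv .i a)) = (Stmt.ite (andL [domE i (.var .i), notE (.var .res)])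
          (.set .g (.var .i)) .skip).run Γ s1 := by
      have : (Stmt.set (.x i) (.var .i)).run Γ (s'.setv .i a) = (s'.setv .i a).setv (.x i) a := by
        simp [Stmt.run, Expr.eval]
      rw [hs1, ← this]
      rfl
    rw [hrun]
    have hPa : (dom i ((Expr.var .i).eval Γ s1) ∧
        ¬ QT (Γ.par .n) Q dom Ψ (K + 3 - (i + 1)) (i + 1) (Function.update v i a)) ↔ P a := by
      simp only [Expr.eval, hvi, hP]
    rw [ind_congr hPa] at e4
    by_cases hh : P a
    · rw [run_ite_pos e4 hh]
      simp only [Stmt.run, Expr.eval, Store.setv_self, hvi]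
      exact ⟨ha, fun _ => hh⟩
    · rw [run_ite_neg e4 hh]
      simp only [Stmt.run, hvg]
      refine ⟨hI.1, fun ⟨w, hw, hPw⟩ => hI.2 ⟨w, ?_, hPw⟩⟩
      rcases Nat.lt_succ_iff_lt_or_eq.1 hw with h | rfl
      · exact h
      · exact absurd hPw hh)
  set s2 := (Stmt.loop .i .n (.seq (.set (.x i) (.var .i)) <|
    .seq (evalAt K Q S S' (i + 1)) <|
    .ite (andL [domE i (.var .i), notE (.var .res)]) (.set .g (.var .i)) .skip)).run Γ
    (s.setv .g 0) with hs2
  have hout : s2.out = s.out := (run_quiet (c := Stmt.loop .i .n _) _ (by simp)).2.2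
  refine ⟨[s2.var .g], ?_, rfl, fun ω p hS => ?_⟩
  · rw [← hout]; rfl
  · rw [Serves.singleton] at hS
    rintro ⟨h1, h2⟩
    rw [hS, Nat.mod_eq_of_lt this.1] at h2
    refine h2 (this.2 ?_)
    have := hno v h.lt h1
    rw [show K + 3 - i = (K + 3 - (i + 1)) + 1 by omega, QT, hQ] at this
    simpa [QStep, hP] using this

theorem recvLoop_spec (hbd : Γ.par .n ≤ Γ.par .bd) :
    let s' := (Stmt.loop .t .n (.seq (.recv .g)
      (.put .wit (.var .t) (.bin .mod (.var .g) (.par .n))))).run Γ s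
    s'.pos = s.pos + Γ.par .n ∧ ∀ t < Γ.par .n, s'.arr .wit t = Γ.word (s.pos + t) % Γ.par .n := by
  refine loop_inv (Γ := Γ) (v := .t) (p := .n) (body := .seq (.recv .g)
      (.put .wit (.var .t) (.bin .mod (.var .g) (.par .n)))) (s := s)
    (fun i s' => s'.pos = s.pos + i ∧ ∀ t < i, s'.arr .wit t = Γ.word (s.pos + t) % Γ.par .n)
    (by simp) ?_
  rintro t ht s' - ⟨h1, h2⟩
  set s1 := (Stmt.recv .g).run Γ (s'.setv .t t) with hs1
  have e1 : s1.var .t = t := by simp [hs1, Stmt.run, Store.setv]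
  have e2 : s1.var .g = Γ.word (s.pos + t) := by simp [hs1, Stmt.run, Store.setv, h1]
  have e3 : s1.pos = s.pos + t + 1 := by simp [hs1, Stmt.run, h1]
  have e4 : s1.arr = s'.arr := rfl
  change ((Stmt.put .wit (.var .t) (.bin .mod (.var .g) (.par .n))).run Γ s1).pos = _ ∧
    ∀ a < t + 1, ((Stmt.put .wit (.var .t) (.bin .mod (.var .g) (.par .n))).run Γ s1).arr .wit a = _
  simp only [Stmt.run, Expr.eval, BinOp.eval, e1, e2, if_pos (ht.trans_le hbd), Store.seta_pos,
    Store.seta_arr, e3, true_and, e4]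
  refine ⟨by omega, fun a ha => ?_⟩
  split_ifs with h
  · rw [h]
  · exact h2 a (by omega)

theorem sendLoop_spec {A : Arr} :
    ((Stmt.loop .t .n (.send (.get A (.var .t)))).run Γ s).out =
      s.out ++ (List.range (Γ.par .n)).map (s.arr A) := by
  refine loop_inv (Γ := Γ) (v := .t) (p := .n) (body := .send (.get A (.var .t))) (s := s)
    (fun i s' => s'.out = s.out ++ (List.range i).map (s.arr A)) (by simp) ?_
  intro t ht s' hF h
  have : s'.arr A = s.arr A := hF.arr _ (by simp)
  simp [Stmt.run, Expr.eval, h, List.range_succ, this]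

theorem checkWitnesses_spec (hΓ : Setup Γ rl K S S' Ψ) (h : Good Γ rl (K + 3) dom K v s)
    (hok : s.var .ok ≤ 1) :
    ((checkWitnesses K Q S S').run Γ s).pos = s.pos + Γ.par .n ∧
    ((checkWitnesses K Q S S').run Γ s).var .ok =
      ind (s.var .ok = 1 ∧ AccWitnesses (Γ.par .n) Q dom Ψ K Γ.word v s.pos) := by
  have hn := hΓ.graph.n_pos
  obtain ⟨h1, h2⟩ := recvLoop_spec (Γ := Γ) (s := s) hΓ.graph.n_le_bd
  set s1 := (Stmt.loop .t .n (.seq (.recv .g)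
      (.put .wit (.var .t) (.bin .mod (.var .g) (.par .n))))).run Γ s with hs1
  have hwn : ∀ t < Γ.par .n, s1.arr .wit t < Γ.par .n := fun t ht => by
    rw [h2 t ht]; exact Nat.mod_lt _ hn
  have g1 : Good Γ rl (K + 3) dom K v s1 := h.run (by simp) (by simp) (by simp)
  set s2 := (cntProg K true (selS (Q (K + 2)) S S')).run Γ s1 with hs2
  have g2 : Good Γ rl (K + 3) dom K v s2 := g1.run (by simp) (by simp) (by simp)
  have hw2 : s2.arr .wit = s1.arr .wit := run_arr _ (by simp)
  have hok2 : s2.var .ok = s.var .ok := by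
    rw [hs2, run_var _ (by simp), hs1, run_var _ (by simp)]
  have := require_loop (Γ := Γ) (x := .t) (s := s2) (e := notE (andL (domL K ++ [domE K (.var .t),
    notE (andL [domE (K + 1) (.get .wit (.var .t)), notE (cntBit (Q (K + 2)))])])))
    (A := fun t => ¬ ((∀ l < K, dom l (v l)) ∧ dom K t ∧ ¬ (dom (K + 1) (s1.arr .wit t) ∧
      ¬ QT (Γ.par .n) Q dom Ψ 1 (K + 2)
        (Function.update (Function.update v K t) (K + 1) (s1.arr .wit t))))) hΓ.graph.one_lt_W
    (by rwa [hok2]) (by simp) (by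
    intro t ht s' hv hA hst
    have g3 : Good Γ rl (K + 3) dom K v s' := g2.congr (by rw [hA]) (fun _ _ => by rw [hA])
      (fun j _ => hv _ (by simp) (by simp))
    have e1 := cntBit_spec (Q := Q) (swap := true) hΓ.graph hΓ.n_lt_N hΓ.pos hΓ.neg g1 le_rfl hwn
      (s' := s') ht hst (by rw [hA])
    simp only [valA, valB, if_true] at e1
    have e2 := g3.domL (K := K) le_rfl (by omega)
    have e3 := g3.eval_domE (j := K) (a := .var .t) (by omega) (by simpa [Expr.eval, hst])
    have hget : (Expr.get .wit (.var .t)).eval Γ s' = s1.arr .wit t := by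
      simp only [Expr.eval, hst, hA, hw2]
    have e4 := g3.eval_domE (j := K + 1) (a := .get .wit (.var .t)) (by omega)
      (by rw [hget]; exact hwn t ht)
    rw [hget] at e4
    have e5 := eval_not ((Checks.cons e4 (Checks.singleton (eval_not e1))).eval hΓ.graph)
    have e6 := eval_not ((e2.append (Checks.cons e3 (Checks.singleton e5))).eval hΓ.graph)
    rw [e6]
    simp only [Expr.eval, hst])
  have hrun : (checkWitnesses K Q S S').run Γ s = (Stmt.loop .t .n (require (notE (andL (domL K ++
      [domE K (.var .t), notE (andL [domE (K + 1) (.get .wit (.var .t)),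
        notE (cntBit (Q (K + 2)))])]))))).run Γ s2 := rfl
  rw [hrun]
  constructor
  · rw [(run_quiet (c := Stmt.loop .t .n (require _)) s2 (by simp)).1, hs2,
      (run_quiet (c := cntProg K true _) s1 (by simp)).1, h1]
  · rw [this, hok2]
    refine ind_congr (and_congr_right fun _ => forall₂_congr fun t ht => ?_)
    rw [h2 t ht]

theorem sendWitnesses_spec (hΓ : Setup Γ rl K S S' Ψ) (hQ : Q (K + 1) = .all)
    (h : Good Γ rl (K + 3) dom K v s) (hno : NoSol (Γ.par .n) Q dom Ψ K (K + 1)) :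
    ∃ blk, ((sendWitnesses K Q S S').run Γ s).out = s.out ++ blk ∧ blk.length = Γ.par .n ∧
      ∀ ω p, Serves ω p blk → AccWitnesses (Γ.par .n) Q dom Ψ K ω v p := by
  have hn := hΓ.graph.n_pos
  have hbd := hΓ.graph.n_le_bd
  set P : ℕ → ℕ → Prop := fun t w => dom (K + 1) w ∧ ¬ QT (Γ.par .n) Q dom Ψ 1 (K + 2)
    (Function.update (Function.update v K t) (K + 1) w) with hP
  set inner : Stmt := .loop .t .n (.ite (andL [domE (K + 1) (.var .i),
    notE (cntBit (Q (K + 2)))]) (.put .val (.var .t) (.var .i)) .skip) with hinner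
  have := loop_inv (Γ := Γ) (v := .i) (p := .n) (body := .seq (fill .wit (.var .i)) <|
    .seq (cntProg K true (selS (Q (K + 2)) S S')) inner) (s := s)
    (fun a s' => ∀ t < Γ.par .n, (∃ w < a, P t w) →
      P t (s'.arr .val t) ∧ s'.arr .val t < Γ.par .n) (by simp) (by
    intro a ha s' hF hI
    have g0 : Good Γ rl (K + 3) dom K v (s'.setv .i a) :=
      (Good.frame h hF (by simp [hinner]) (by simp [hinner]) (by simp [hinner])).setv (by simp)
    set s1 := (fill .wit (.var .i)).run Γ (s'.setv .i a) with hs1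
    have g1 : Good Γ rl (K + 3) dom K v s1 := g0.run (by simp) (by simp) (by simp)
    have hwit : ∀ t < Γ.par .n, s1.arr .wit t = a := fun t ht => by
      rw [hs1, fill_spec _ hbd (by simp) t ht]
      simp [Expr.eval, Store.setv_var]
    set s2 := (cntProg K true (selS (Q (K + 2)) S S')).run Γ s1 with hs2
    have g2 : Good Γ rl (K + 3) dom K v s2 := g1.run (by simp) (by simp) (by simp)
    have hi2 : s2.var .i = a := by
      rw [hs2, run_var _ (by simp), hs1, run_var _ (by simp), Store.setv_self]
    have hval : s2.arr .val = s'.arr .val := by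
      rw [hs2, run_arr _ (by simp), hs1, run_arr _ (by simp), Store.setv_arr]
    change ∀ t < Γ.par .n, (∃ w < a + 1, P t w) → P t ((inner.run Γ s2).arr .val t) ∧
      (inner.run Γ s2).arr .val t < Γ.par .n
    have := loop_inv (Γ := Γ) (v := .t) (p := .n) (body := .ite (andL [domE (K + 1) (.var .i),
      notE (cntBit (Q (K + 2)))]) (.put .val (.var .t) (.var .i)) .skip) (s := s2)
      -- The first `b` entries have been treated for the candidate `a`, and the others are still the
      -- old ones.
      (fun b s3 => (∀ t < b, (P t a → s3.arr .val t = a) ∧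
        (¬ P t a → s3.arr .val t = s2.arr .val t)) ∧ ∀ t, b ≤ t → s3.arr .val t = s2.arr .val t)
      (by simp) (by
      intro t ht s3 hF3 hI3
      have hA : ∀ A, A ≠ .val → s3.arr A = s2.arr A := fun A hA => hF3.arr A (by simp [hA])
      have g3 : Good Γ rl (K + 3) dom K v (s3.setv .t t) :=
        (Good.frame g2 hF3 (by simp) (by simp) (by simp)).setv (by simp)
      have hi3 : s3.var .i = a := by rw [hF3.var _ (by simp), hi2]
      have e1 := cntBit_spec (Q := Q) (swap := true) hΓ.graph hΓ.n_lt_N hΓ.pos hΓ.neg g1 le_rfl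
        (fun t ht => by rw [hwit t ht]; exact ha) (s' := s3.setv .t t) ht (by simp)
        (by rw [Store.setv_arr, hA _ (by simp)])
      simp only [valA, valB, if_true, hwit t ht] at e1
      have hi3' : (s3.setv .t t).var .i = a := by rw [Store.setv_ne _ _ (by simp), hi3]
      have e4 := g3.eval_domE (j := K + 1) (a := .var .i) (by omega) (by simpa [Expr.eval, hi3'])
      simp only [Expr.eval, hi3'] at e4
      have e5 := (Checks.cons e4 (Checks.singleton (eval_not e1))).eval hΓ.graph
      by_cases hp : P t a
      · rw [run_ite_pos e5 hp]
        simp only [Stmt.run, Expr.eval, Store.setv_self, if_pos (ht.trans_le hbd), hi3',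
          Store.seta_arr, true_and, Store.setv_arr]
        refine ⟨fun b hb => ?_, fun b hb => ?_⟩
        · split_ifs with hbt
          · subst hbt; exact ⟨fun _ => rfl, fun h => absurd hp h⟩
          · exact hI3.1 b (by omega)
        · rw [if_neg (by omega)]
          exact hI3.2 b (by omega)
      · rw [run_ite_neg e5 hp]
        simp only [Stmt.run, Store.setv_arr]
        refine ⟨fun b hb => ?_, fun b hb => hI3.2 b (by omega)⟩
        rcases Nat.lt_succ_iff_lt_or_eq.1 hb with hb | rfl
        · exact hI3.1 b hb
        · exact ⟨fun h => absurd h hp, fun _ => hI3.2 b le_rfl⟩)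
    rintro t ht ⟨w, hw, hPw⟩
    have hh := this.1 t ht
    by_cases hp : P t a
    · rw [hinner, hh.1 hp]; exact ⟨hp, ha⟩
    · rw [hinner, hh.2 hp, hval]
      refine hI t ht ⟨w, ?_, hPw⟩
      rcases Nat.lt_succ_iff_lt_or_eq.1 hw with h | rfl
      · exact h
      · exact absurd hPw hp)
  set s2 := (Stmt.loop .i .n (.seq (fill .wit (.var .i)) <|
    .seq (cntProg K true (selS (Q (K + 2)) S S')) inner)).run Γ s with hs2
  have hout : s2.out = s.out := (run_quiet (c := Stmt.loop .i .n _) _ (by simp [hinner])).2.2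
  refine ⟨(List.range (Γ.par .n)).map (s2.arr .val), ?_, by simp, fun ω p hS t ht => ?_⟩
  · rw [← hout]; exact sendLoop_spec
  · have := hS t (by simpa)
    simp only [List.getElem_map, List.getElem_range] at this
    rintro ⟨h1, h2, h3⟩
    have hT := hno (Function.update v K t) (fun l hl => ?_) (fun l hl => ?_)
    · rw [show K + 3 - (K + 1) = 1 + 1 by omega, QT, hQ] at hT
      obtain ⟨hp, hlt⟩ := ‹∀ t < Γ.par .n, (∃ w < Γ.par .n, P t w) → _› t ht
        (by simpa [QStep, hP] using hT)
      rw [this, Nat.mod_eq_of_lt hlt] at h3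
      exact h3 hp
    · rcases Nat.lt_succ_iff_lt_or_eq.1 hl with hl | rfl
      · rw [Function.update_of_ne (by omega)]; exact h.lt l hl
      · simpa
    · rcases Nat.lt_succ_iff_lt_or_eq.1 hl with hl | rfl
      · rw [Function.update_of_ne (by omega)]; exact h1 l hl
      · simpa

/-! ### The two protocols without randomness. -/

/-- The protocol if the leading block is followed by at least three quantifiers. -/
def witnessProtocol (hi : i ≤ K) (hQ : Q i = .all) : Protocol K i Q S S' where
  chk := nest (checkWitness K i Q S S') i 0
  prv := nest (sendWitness K i Q S S') i 0
  len n := 1 * n ^ i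
  Acc n _ _ _ dom Ψ ω p := ∀ v, AllAcc n 1 (AccWitness n Q dom Ψ K i ω) i 0 v p
  chk_fits {na} hna := by
    -- There are `i` loops over the tuples, and the evaluation from the quantifier `i + 1` on has
    -- depth `K + 1 - i`.
    refine (nest_fits (d := K + 1 - i) ?_ i 0).mono (by omega)
    have h1 := evalAt_fits (role := .verifier) (Q := Q) (S := S) (S' := S') (j := i + 1) (by omega)
      hna
    rw [if_pos (by omega)] at h1
    have h2 := domL_usesBelow (K := i) (na := na) (by omega)
    refine ⟨rfl, by simp, h1.mono (by omega), ?_⟩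
    simp only [require, Stmt.Fits, andL_usesBelow, notE, Expr.UsesBelow, List.mem_cons,
      List.mem_append, List.not_mem_nil, or_false, forall_eq, domE, Arr.code,
      and_true, true_and, or_imp, forall_and]
    exact ⟨h2, by omega⟩
  prv_fits {na} hna := by
    -- The prover needs one more loop, over the candidates for the counterexample.
    refine (nest_fits (d := K + 1 - i + 1) ?_ i 0).mono (by omega)
    have h1 := evalAt_fits (role := .prover) (Q := Q) (S := S) (S' := S') (j := i + 1) (by omega)
      hna
    rw [if_pos (by omega)] at h1
    refine ⟨trivial, ⟨trivial, trivial, h1.mono (by omega), ?_⟩, rfl, trivial⟩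
    simp only [Stmt.Fits, andL_usesBelow, notE, Expr.UsesBelow, List.mem_cons,
      List.not_mem_nil, or_false, forall_eq_or_imp, forall_eq, domE, Arr.code, and_true]
    omega
  chk_var {w} hw h := by
    rcases nest_writesVar _ _ h with ⟨j, _, _, rfl⟩ | h
    · simp at hw
    · rcases hw with rfl | rfl | ⟨l, rfl⟩ <;> simp [checkWitness] at h
  prv_var {w} hw h := by
    rcases nest_writesVar _ _ h with ⟨j, _, _, rfl⟩ | h
    · simp at hw
    · rcases hw with rfl | ⟨l, rfl⟩ <;> simp [sendWitness] at h
  chk_arr {A} hA h := by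
    rw [nest_writesArr] at h
    rcases hA with rfl | ⟨l, rfl⟩ <;> simp [checkWitness] at h
  prv_arr {A} hA h := by
    rw [nest_writesArr] at h
    rcases hA with rfl | ⟨l, rfl⟩ <;> simp [sendWitness] at h
  chk_spec {Γ rl dom v s Ψ} hΓ h hok := by
    have := fun v => nest_verify (L := i) (k := K + 3) (rl := rl) (dom := dom) (Γ := Γ)
      (body := checkWitness K i Q S S') (sz := 1)
      (Acc := AccWitness (Γ.par .n) Q dom Ψ K i Γ.word) (c := s.var .r)
      (fun l hl => by
        have := evalAt_not_writesX (K := K) (Q := Q) (S := S) (S' := S') (show l < i + 1 by omega)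
        simp [checkWitness, this]
        omega) (by simp [checkWitness]) (by simp [checkWitness])
      (by simp [checkWitness]) (fun v s g hok _ => checkWitness_spec hΓ hi g hok) i 0 v s
      (by omega) ⟨h.rel, h.dom, by simp, by simp⟩ hok rfl
    exact ⟨(this v).1, ind_forall fun v => (this v).2⟩
  prv_spec {Γ rl dom v s Ψ} hΓ h hno := by
    refine blk_forall fun v => ?_
    obtain ⟨blk, h1, h2, h3⟩ := nest_prove (L := i) (k := K + 3) (rl := rl) (dom := dom) (Γ := Γ)
      (body := sendWitness K i Q S S') (sz := 1) (Acc := AccWitness (Γ.par .n) Q dom Ψ K i)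
      (fun l hl => by
        have := evalAt_not_writesX (K := K) (Q := Q) (S := S) (S' := S') (show l < i + 1 by omega)
        simp [sendWitness, this]
        omega) (by simp [sendWitness]) (by simp [sendWitness])
      (fun v s g => sendWitness_spec hΓ hi hQ g hno) i 0 v s (by omega)
      ⟨h.rel, h.dom, by simp, by simp⟩
    exact ⟨blk, h1, h2, fun ω _ p hS => h3 ω p hS⟩
  sound {n q rl dom Ψ} hn _ _ _ _ hno ω p := by
    -- No randomness is involved: a solution `v` makes the check of its own block fail with
    -- certainty, because any element offered as a counterexample satisfies the rest of the formula.
    refine ⟨∅, by simp, fun r _ hA => ?_⟩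
    simp only [NoSol, not_forall, not_not] at hno
    obtain ⟨v, hv, hd, hT⟩ := hno
    obtain ⟨p', h⟩ := AllAcc.position (sz := 1) (v := v) (r := i) (l := 0) p
      (fun j _ hj => hv j (by omega))
    refine (h _ (hA v) ⟨hd, fun h' => h'.2 ?_⟩).elim
    rw [show K + 3 - i = (K + 3 - (i + 1)) + 1 by omega, QT, hQ] at hT
    exact hT _ (Nat.mod_lt _ hn) h'.1

/-- The protocol if the leading block is followed by two quantifiers. -/
def witnessesProtocol (hQ : Q (K + 1) = .all) : Protocol K (K + 1) Q S S' where
  chk := nest (checkWitnesses K Q S S') K 0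
  prv := nest (sendWitnesses K Q S S') K 0
  len n := n * n ^ K
  Acc n _ _ _ dom Ψ ω p := ∀ v, AllAcc n n (AccWitnesses n Q dom Ψ K ω) K 0 v p
  chk_fits {na} hna := by
    -- Only `K` loops surround the check. The variable `K` is covered by the array of `n` words, and
    -- receiving and counting have depth one.
    refine (nest_fits (d := 1) ?_ K 0).mono (by omega)
    have h2 := domL_usesBelow (K := K) (na := na) (by omega)
    have h3 := cntBit_usesBelow (q := Q (K + 2)) (na := na) (by omega)
    refine ⟨⟨trivial, rfl, show 8 < na by omega, trivial, trivial, trivial⟩,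
      cntProg_fits hna, trivial, ?_⟩
    simp only [require, Stmt.Fits, andL_usesBelow, notE, Expr.UsesBelow, List.mem_cons,
      List.mem_append, List.not_mem_nil, or_false, forall_eq, domE, Arr.code,
      and_true, true_and, or_imp, forall_and]
    exact ⟨h2, by omega, ⟨by omega, by omega⟩, h3⟩
  prv_fits {na} hna := by
    refine (nest_fits (d := 2) ?_ K 0).mono (by omega)
    have h3 := cntBit_usesBelow (q := Q (K + 2)) (na := na) (by omega)
    refine ⟨⟨trivial, fill_fits.2 ⟨show 8 < na by omega, trivial⟩, cntProg_fits hna, trivial, ?_⟩, trivial, rfl, ?_⟩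
    · simp only [Stmt.Fits, andL_usesBelow, notE, Expr.UsesBelow, List.mem_cons,
        List.not_mem_nil, or_false, forall_eq_or_imp, forall_eq, domE, Arr.code, and_true]
      exact ⟨⟨by omega, h3⟩, by omega⟩
    · exact ⟨show 9 < na by omega, trivial⟩
  chk_var {w} hw h := by
    rcases nest_writesVar _ _ h with ⟨j, _, _, rfl⟩ | h
    · simp at hw
    · rcases hw with rfl | rfl | ⟨l, rfl⟩ <;> simp [checkWitnesses] at h
  prv_var {w} hw h := by
    rcases nest_writesVar _ _ h with ⟨j, _, _, rfl⟩ | h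
    · simp at hw
    · rcases hw with rfl | ⟨l, rfl⟩ <;> simp [sendWitnesses] at h
  chk_arr {A} hA h := by
    rw [nest_writesArr] at h
    rcases hA with rfl | ⟨l, rfl⟩ <;> simp [checkWitnesses] at h
  prv_arr {A} hA h := by
    rw [nest_writesArr] at h
    rcases hA with rfl | ⟨l, rfl⟩ <;> simp [sendWitnesses] at h
  chk_spec {Γ rl dom v s Ψ} hΓ h hok := by
    have := fun v => nest_verify (L := K) (k := K + 3) (rl := rl) (dom := dom) (Γ := Γ)
      (body := checkWitnesses K Q S S') (sz := Γ.par .n)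
      (Acc := AccWitnesses (Γ.par .n) Q dom Ψ K Γ.word) (c := s.var .r)
      (by simp [checkWitnesses]) (by simp [checkWitnesses]) (by simp [checkWitnesses])
      (by simp [checkWitnesses]) (fun v s g hok _ => checkWitnesses_spec hΓ g hok) K 0 v s
      (by omega) ⟨h.rel, h.dom, by simp, by simp⟩ hok rfl
    exact ⟨(this v).1, ind_forall fun v => (this v).2⟩
  prv_spec {Γ rl dom v s Ψ} hΓ h hno := by
    refine blk_forall fun v => ?_
    obtain ⟨blk, h1, h2, h3⟩ := nest_prove (L := K) (k := K + 3) (rl := rl) (dom := dom) (Γ := Γ)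
      (body := sendWitnesses K Q S S') (sz := Γ.par .n) (Acc := AccWitnesses (Γ.par .n) Q dom Ψ K)
      (by simp [sendWitnesses]) (by simp [sendWitnesses]) (by simp [sendWitnesses])
      (fun v s g => sendWitnesses_spec hΓ hQ g hno) K 0 v s (by omega)
      ⟨h.rel, h.dom, by simp, by simp⟩
    exact ⟨blk, h1, h2, fun ω _ p hS => h3 ω p hS⟩
  sound {n q rl dom Ψ} hn _ _ _ _ hno ω p := by
    refine ⟨∅, by simp, fun r _ hA => ?_⟩
    simp only [NoSol, not_forall, not_not] at hno
    obtain ⟨v, hv, hd, hT⟩ := hno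
    obtain ⟨p', h⟩ := AllAcc.position (sz := n) (v := v) (r := K) (l := 0) p
      (fun j _ hj => hv j (by omega))
    refine (h _ (hA v) (v K) (hv K (by omega)) ⟨fun l hl => hd l (by omega), hd K (by omega),
      fun h' => h'.2 ?_⟩).elim
    rw [show K + 3 - (K + 1) = 1 + 1 by omega, QT, hQ] at hT
    rw [Function.update_eq_self]
    exact hT _ (Nat.mod_lt _ hn) h'.1

end

end LoopLang

namespace LoopLang

/-! ### Detecting solutions by polynomials -/

open Polynomial

/-- A polynomial that vanishes at more points than its degree allows is zero, if the differences of
these points are units. -/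
theorem eq_zero_of_isUnit_sub {R : Type*} [CommRing R] (s : Finset ℕ) :
    ∀ (p : R[X]), p.degree < s.card → (∀ a ∈ s, p.eval (a : R) = 0) →
      (∀ a ∈ s, ∀ b ∈ s, a ≠ b → IsUnit ((a : R) - b)) → p = 0 := by
  classical
  induction s using Finset.induction_on with
  | empty =>
    intro p hp _ _
    simpa using hp
  | insert a s ha ih =>
    intro p hp h hu
    obtain ⟨g, rfl⟩ := dvd_iff_isRoot.2 (h a (by simp))
    have hg : g = 0 := by
      by_contra hg0
      refine hg0 (ih g ?_ (fun b hb => ?_) fun b hb c hc => hu b (by simp [hb]) c (by simp [hc]))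
      · have : Nontrivial R := (nontrivial_iff.1 ⟨_, _, hg0⟩)
        rw [mul_comm, (monic_X_sub_C (a : R)).degree_mul, degree_X_sub_C, Finset.card_insert_of_notMem ha,
          degree_eq_natDegree hg0] at hp
        rw [degree_eq_natDegree hg0]
        norm_cast at hp ⊢
        omega
      · have h1 := h b (by simp [hb])
        rw [eval_mul, eval_sub, eval_X, eval_C] at h1
        have h2 := hu b (by simp [hb]) a (by simp) (by rintro rfl; exact ha hb)
        exact (h2.mul_right_eq_zero).1 h1
    simp [hg]

theorem isUnit_cast_of_lt {q a : ℕ} (hq : q.Prime) (h0 : 0 < a) (ha : a < q) :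
    IsUnit (a : ZMod (q ^ 2)) := by
  rw [ZMod.isUnit_iff_coprime]
  exact ((Nat.Prime.coprime_iff_not_dvd hq).2 (Nat.not_dvd_of_pos_of_lt h0 ha)).symm.pow_right 2

theorem isUnit_cast_sub {q a b : ℕ} (hq : q.Prime) (ha : a < q) (hb : b < q) (hab : a ≠ b) :
    IsUnit ((a : ZMod (q ^ 2)) - b) := by
  rcases lt_or_gt_of_ne hab with h | h
  · rw [← neg_sub, ← Nat.cast_sub h.le]
    exact (isUnit_cast_of_lt hq (by omega) (by omega)).neg
  · rw [← Nat.cast_sub h.le]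
    exact isUnit_cast_of_lt hq (by omega) (by omega)

theorem isUnit_cast_factorial {q a : ℕ} (hq : q.Prime) (ha : a < q) :
    IsUnit ((a.factorial : ℕ) : ZMod (q ^ 2)) := by
  rw [ZMod.isUnit_iff_coprime]
  refine ((Nat.Prime.coprime_iff_not_dvd hq).2 fun h => ?_).symm.pow_right 2
  exact absurd (hq.dvd_factorial.1 h) (by omega)

section
variable {R : Type*} [CommRing R] {n : ℕ} {rl : ℕ → ℕ → Fin 3} {dom : ℕ → ℕ → Prop} {K : ℕ}
  {v : ℕ → ℕ} {S : List (ℕ → ℕ → Fin 3)} {Ψ : (ℕ → ℕ) → Prop}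

theorem patVal_map {R' : Type*} [CommRing R'] (f : R →+* R') (lam : ℕ → R)
    (π : ℕ → ℕ → Fin 3) : f (patVal n rl dom K v lam π) =
      patVal n rl dom K v (fun u => f (lam u)) π := by
  simp only [patVal, map_mul, map_sum, map_natCast]

/-- If the weight is concentrated on one vertex, both ends of the open path are this vertex. The
path closes to a triangle and the sum is a genuine count. -/
theorem patVal_support {lam : ℕ → R} {u : ℕ} (hu : u < n) (h : ∀ x < n, x ≠ u → lam x = 0)
    (hsymm : ∀ a b, rl a b = rl b a) (π : ℕ → ℕ → Fin 3) :
    patVal n rl dom K v lam π = lam u ^ 2 * ∑ z ∈ Finset.range n, ∑ y ∈ Finset.range n,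
      (ind (((∀ i < K, dom i (v i)) ∧ dom K u ∧ dom (K + 1) y ∧ dom (K + 2) z) ∧
        Matches rl (K + 3) π (trip v K u y z)) : R) := by
  have h1 : ∀ (P Q : ℕ → Prop), ∑ x ∈ Finset.range n, (ind (P x) : R) *
      (lam x * (ind (Q x) : R)) = ind (P u) * (lam u * ind (Q u)) := fun P Q => by
    refine Finset.sum_eq_single_of_mem u (Finset.mem_range.2 hu) fun x hx hxu => ?_
    rw [h x (Finset.mem_range.1 hx) hxu]; simp
  simp only [patVal, h1]
  rw [Finset.mul_sum, Finset.sum_mul]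
  refine Finset.sum_congr rfl fun z _ => ?_
  rw [Finset.mul_sum, Finset.mul_sum, Finset.sum_mul, Finset.sum_mul]
  refine Finset.sum_congr rfl fun y _ => ?_
  have : (((∀ i < K, dom i (v i)) ∧ dom K u ∧ dom (K + 1) y ∧ dom (K + 2) z) ∧
        Matches rl (K + 3) π (trip v K u y z)) ↔
      (rl z u = π K (K + 2) ∧ Unary rl dom K π v K u ∧ rl z y = π (K + 1) (K + 2) ∧
        rl y u = π K (K + 1) ∧ Unary rl dom K π v (K + 1) y ∧ Unary rl dom K π v (K + 2) z ∧
        Matches rl K π v ∧ ∀ i < K, dom i (v i)) := by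
    rw [matches_trip, hsymm z u, hsymm z y, hsymm y u]
    simp only [Unary]
    tauto
  rw [ind_congr this]
  simp only [ind_and, Nat.cast_mul]
  -- The unary condition on x is imposed on both copies; as an indicator it is idempotent.
  have hsq : (ind (Unary rl dom K π v K u) : R) * ind (Unary rl dom K π v K u) =
      ind (Unary rl dom K π v K u) := by
    by_cases h : Unary rl dom K π v K u <;> simp [ind, h]
  linear_combination (ind (rl z u = π K (K + 2)) * lam u * ind (rl z y = π (K + 1) (K + 2)) *
    ind (rl y u = π K (K + 1)) * lam u * ind (Unary rl dom K π v (K + 1) y) *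
    ind (Unary rl dom K π v (K + 2) z) * (ind (Matches rl K π v) *
    ind (∀ i < K, dom i (v i)) : R)) * hsq

theorem sum_patVal_support {lam : ℕ → R} {u : ℕ} (hu : u < n) (h : ∀ x < n, x ≠ u → lam x = 0)
    (hsymm : ∀ a b, rl a b = rl b a) (hS : Covers n rl (K + 3) S Ψ) (hv : ∀ i < K, v i < n) :
    (S.map (patVal n rl dom K v lam)).sum =
      lam u ^ 2 * ((∑ z ∈ Finset.range n, ∑ y ∈ Finset.range n,
        ind (((∀ i < K, dom i (v i)) ∧ dom K u ∧ dom (K + 1) y ∧ dom (K + 2) z) ∧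
          Ψ (trip v K u y z)) : ℕ) : R) := by
  have key : ∀ S : List (ℕ → ℕ → Fin 3), (S.map (patVal n rl dom K v lam)).sum =
      lam u ^ 2 * ((∑ z ∈ Finset.range n, ∑ y ∈ Finset.range n,
        ind ((∀ i < K, dom i (v i)) ∧ dom K u ∧ dom (K + 1) y ∧ dom (K + 2) z) *
          (S.map fun π => ind (Matches rl (K + 3) π (trip v K u y z))).sum : ℕ) : R) := by
    intro S
    induction S with
    | nil => simp
    | cons π S ih =>
      rw [List.map_cons, List.sum_cons, ih, patVal_support hu h hsymm, ← mul_add]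
      congr 1
      simp only [ind_and (p := (∀ i < K, dom i (v i)) ∧ dom K u ∧ dom (K + 1) _ ∧ dom (K + 2) _),
        List.map_cons, List.sum_cons, mul_add, Finset.sum_add_distrib, Nat.cast_add, Nat.cast_sum,
        Nat.cast_mul]
  rw [key]
  congr 2
  refine Finset.sum_congr rfl fun z hz => Finset.sum_congr rfl fun y hy => ?_
  rw [hS _ (trip_bound hv hu (Finset.mem_range.1 hy) (Finset.mem_range.1 hz)), ← ind_and]

/-- The weight enters exactly twice, once for each copy of x, and all other factors are constants.
-/
theorem patVal_natDegree {lam : ℕ → R[X]} {D : ℕ} (h : ∀ x < n, (lam x).natDegree ≤ D)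
    (π : ℕ → ℕ → Fin 3) : (patVal n rl dom K v lam π).natDegree ≤ D + D := by
  have hc : ∀ (P : Prop), ((ind P : ℕ) : R[X]).natDegree ≤ 0 := fun P =>
    (natDegree_natCast (R := R) (ind P)).le
  have h1 : ∀ (P Q : ℕ → Prop), (∑ x ∈ Finset.range n, ((ind (P x) : ℕ) : R[X]) *
      (lam x * ((ind (Q x) : ℕ) : R[X]))).natDegree ≤ D := fun P Q => by
    refine natDegree_sum_le_of_forall_le _ _ fun x hx => ?_
    have := natDegree_mul_le_of_le (hc (P x)) (natDegree_mul_le_of_le (h x (Finset.mem_range.1 hx))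
      (hc (Q x)))
    simpa using this
  have h2 : ∀ z, (∑ y ∈ Finset.range n, ((ind (rl z y = π (K + 1) (K + 2)) : ℕ) : R[X]) *
      ((∑ x ∈ Finset.range n, ((ind (rl y x = π K (K + 1)) : ℕ) : R[X]) *
        (lam x * ((ind (Unary rl dom K π v K x) : ℕ) : R[X]))) *
        ((ind (Unary rl dom K π v (K + 1) y) : ℕ) : R[X]))).natDegree ≤ D := fun z => by
    refine natDegree_sum_le_of_forall_le _ _ fun y _ => ?_
    have := natDegree_mul_le_of_le (hc (rl z y = π (K + 1) (K + 2)))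
      (natDegree_mul_le_of_le (h1 (fun x => rl y x = π K (K + 1)) fun x => Unary rl dom K π v K x)
        (hc (Unary rl dom K π v (K + 1) y)))
    simpa using this
  have h3 := natDegree_mul_le_of_le (p := ∑ z ∈ Finset.range n, _)
    (natDegree_sum_le_of_forall_le (Finset.range n) _ fun z _ => (natDegree_mul_le_of_le
      (natDegree_mul_le_of_le (h1 (fun x => rl z x = π K (K + 2)) fun x => Unary rl dom K π v K x)
        (h2 z)) (hc (Unary rl dom K π v (K + 2) z))))
    (hc (Matches rl K π v ∧ ∀ i < K, dom i (v i)))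
  rw [patVal]
  simpa using h3

theorem sum_patVal_natDegree {lam : ℕ → R[X]} {D : ℕ} (h : ∀ x < n, (lam x).natDegree ≤ D) :
    (S.map (patVal n rl dom K v lam)).sum.natDegree ≤ D + D := by
  induction S with
  | nil => simp
  | cons π S ih =>
    rw [List.map_cons, List.sum_cons]
    exact natDegree_add_le_of_degree_le (patVal_natDegree h π) ih

/-! ### The detecting polynomial. -/

/-- The multiple of the Lagrange polynomial of `u`. -/
def lagr (n : ℕ) (x : R) (u : ℕ) : R := ∏ j ∈ (Finset.range n).erase u, (x - (j : R))

/-- The value at `x` of the polynomial that is nonzero at `u` if and only if there are solutions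
where the variable `K` has the value `u`. -/
noncomputable def detect (n : ℕ) (rl : ℕ → ℕ → Fin 3) (dom : ℕ → ℕ → Prop) (K : ℕ) (v : ℕ → ℕ)
    (S : List (ℕ → ℕ → Fin 3)) (x : R) : R :=
  (S.map (patVal n rl dom K v (lagr n x))).sum

theorem detect_eval (x : R) : (detect n rl dom K v S (X : R[X])).eval x =
    detect n rl dom K v S x := by
  have : ∀ u, (lagr n (X : R[X]) u).eval x = lagr n x u := fun u => by
    simp [lagr, eval_prod]
  rw [detect, ← coe_evalRingHom, map_list_sum, List.map_map, detect]
  congr 1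
  refine List.map_congr_left fun π _ => ?_
  rw [Function.comp, patVal_map]
  simp only [coe_evalRingHom, this]

theorem detect_natDegree [Nontrivial R] (hn : 0 < n) :
    (detect n rl dom K v S (X : R[X])).natDegree < 2 * n := by
  have := sum_patVal_natDegree (n := n) (rl := rl) (dom := dom) (K := K) (v := v) (S := S)
    (lam := lagr n (X : R[X])) (D := n - 1) (fun u hu => by
      refine (natDegree_prod_le _ _).trans ?_
      refine (Finset.sum_le_card_nsmul _ _ 1 fun j _ => ?_).trans ?_
      · rw [← C_eq_natCast]; exact (natDegree_X_sub_C _).le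
      · simp [Finset.card_erase_of_mem (Finset.mem_range.2 hu)])
  rw [detect]
  omega

theorem detect_eq_zero {u : ℕ} (hu : u < n) (hsymm : ∀ a b, rl a b = rl b a)
    (hS : Covers n rl (K + 3) S Ψ) (hv : ∀ i < K, v i < n)
    (hno : ∀ y < n, ∀ z < n, ¬ (((∀ i < K, dom i (v i)) ∧ dom K u ∧ dom (K + 1) y ∧
      dom (K + 2) z) ∧ Ψ (trip v K u y z))) : detect n rl dom K v S (u : R) = 0 := by
  rw [detect, sum_patVal_support hu (fun x _ hxu => ?_) hsymm hS hv, Finset.sum_eq_zero]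
  · simp
  · exact fun z hz => Finset.sum_eq_zero fun y hy =>
      ind_neg (hno y (Finset.mem_range.1 hy) z (Finset.mem_range.1 hz))
  · exact Finset.prod_eq_zero (i := u) (by simp [hu, hxu.symm]) (sub_self _)

/-! ### Falling factorials and Newton's formula. -/

/-- The polynomial in the falling factorials of degrees `n, …, 2 n - 1` with the coefficients
`γ`. -/
def falling (n : ℕ) (γ : ℕ → R) (x : R) : R :=
  ∑ i ∈ Finset.range n, γ i * ∏ l ∈ Finset.range (2 * n - 1 - i), (x - (l : R))

/-- Every product has at least n factors, since `2 * n - 1 - i ≥ n`, so it contains `x - u`. The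
zeros at the vertices are thus built into the format of the prover's message and cannot be avoided
by a choice of coefficients. -/
theorem falling_eq_zero {γ : ℕ → R} {u : ℕ} (hu : u < n) : falling n γ (u : R) = 0 := by
  refine Finset.sum_eq_zero fun i hi => ?_
  rw [Finset.prod_eq_zero (i := u), mul_zero]
  · rw [Finset.mem_range] at hi ⊢; omega
  · exact sub_self _

theorem falling_eval {γ : ℕ → R} {x : R} :
    (falling n (fun i => C (γ i)) (X : R[X])).eval x = falling n γ x := by
  simp [falling, eval_finsetSum, eval_prod]

theorem falling_natDegree [Nontrivial R] {γ : ℕ → R} (hn : 0 < n) :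
    (falling n (fun i => C (γ i)) (X : R[X])).natDegree < 2 * n := by
  have : (falling n (fun i => C (γ i)) (X : R[X])).natDegree ≤ 2 * n - 1 := by
    refine natDegree_sum_le_of_forall_le _ _ fun i _ => (natDegree_C_mul_le _ _).trans ?_
    refine (natDegree_prod_le _ _).trans ((Finset.sum_le_card_nsmul _ _ 1 fun j _ => ?_).trans ?_)
    · rw [← C_eq_natCast]; exact (natDegree_X_sub_C _).le
    · simp
  omega

/-- Newton's formula for a polynomial of degree less than `2 n` with the zeros `0, …, n - 1`. -/
theorem newton {P : R[X]} (hn : 0 < n) (hP : P.natDegree < 2 * n)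
    (h0 : ∀ u < n, P.eval (u : R) = 0) (r : ℕ) :
    ((2 * n).factorial : R) * P.eval (r : R) = falling n (fun i =>
      (∏ l ∈ Finset.Ico (2 * n - i) (2 * n + 1), (l : R)) *
        (fwdDiff 1)^[2 * n - 1 - i] P.eval 0) (r : R) := by
  -- The difference of order `j` at 0 involves only the values at `0, …, j`. Hence half of the
  -- Newton coefficients vanish and n of them remain.
  have hΔ0 : ∀ j < n, (fwdDiff 1)^[j] P.eval (0 : R) = 0 := by
    intro j hj
    rw [fwdDiff_iter_eq_sum_shift]
    refine Finset.sum_eq_zero fun k hk => ?_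
    have := h0 k (by rw [Finset.mem_range] at hk; omega)
    simp [this]
  have hΔ1 : ∀ j, 2 * n ≤ j → (fwdDiff 1)^[j] P.eval (0 : R) = 0 := by
    intro j hj
    rw [Polynomial.fwdDiff_iter_eq_zero_of_degree_lt (by omega)]
    rfl
  have hsum : P.eval (r : R) = ∑ j ∈ Finset.range (2 * n), (r.choose j : R) *
      (fwdDiff 1)^[j] P.eval (0 : R) := by
    have h := shift_eq_sum_fwdDiff_iter (1 : R) P.eval r 0
    simp only [zero_add, nsmul_eq_mul, mul_one] at h
    rw [h]
    have hA := Finset.sum_subset (s₁ := Finset.range (r + 1)) (s₂ := Finset.range (r + 1 + 2 * n))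
      (f := fun j => (r.choose j : R) * (fwdDiff 1)^[j] P.eval (0 : R)) (by simp) (by
        intro j _ hj
        rw [Nat.choose_eq_zero_of_lt (by simpa using hj)]; simp)
    have hB := Finset.sum_subset (s₁ := Finset.range (2 * n)) (s₂ := Finset.range (r + 1 + 2 * n))
      (f := fun j => (r.choose j : R) * (fwdDiff 1)^[j] P.eval (0 : R)) (by simp) (by
        intro j _ hj
        rw [hΔ1 j (by simpa using hj), mul_zero])
    rw [hA, hB]
  -- The factor (2 n)! clears the denominator j! of the binomial polynomial and leaves the product
  -- of the numbers from j + 1 to 2 n. No division is needed in the ring.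
  have hfac : ∀ j ≤ 2 * n, ((2 * n).factorial : R) * (r.choose j : R) =
      (∏ l ∈ Finset.Ico (j + 1) (2 * n + 1), (l : R)) *
        ∏ l ∈ Finset.range j, ((r : R) - (l : R)) := by
    intro j hj
    have e1 : ((2 * n).factorial : ℕ) = (∏ l ∈ Finset.Ico (j + 1) (2 * n + 1), l) * j.factorial := by
      rw [← Finset.prod_range_add_one_eq_factorial, ← Finset.prod_range_add_one_eq_factorial,
        ← Finset.prod_range_mul_prod_Ico _ hj, mul_comm (∏ i ∈ Finset.range j, (i + 1)), Finset.prod_Ico_add' (fun l => l)]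
    have e2 : (∏ l ∈ Finset.range j, ((r : R) - (l : R))) = (r.descFactorial j : R) := by
      clear e1 hj
      induction j with
      | zero => simp
      | succ j ih =>
        rw [Finset.prod_range_succ, ih, Nat.descFactorial_succ]
        rcases le_or_gt j r with h | h
        · push_cast [h]; ring
        · rw [Nat.descFactorial_of_lt h]; simp
    rw [e2, Nat.descFactorial_eq_factorial_mul_choose, e1]
    push_cast
    ring
  rw [hsum, Finset.mul_sum, ← Finset.sum_range_reflect, falling]
  have h2n : 2 * n = n + n := two_mul n
  rw [← Finset.sum_range_add_sum_Ico _ (show n ≤ 2 * n by omega)]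
  rw [Finset.sum_eq_zero (s := Finset.Ico n (2 * n)) fun i hi => by
    rw [hΔ0 _ (by rw [Finset.mem_Ico] at hi; omega)]; simp, add_zero]
  refine Finset.sum_congr rfl fun i hi => ?_
  rw [Finset.mem_range] at hi
  rw [← mul_assoc, hfac _ (by omega), show 2 * n - 1 - i + 1 = 2 * n - i by omega]
  ring

end

/-- The value at the vertex `v K` is the square of a unit times the number of solutions with this
vertex. That number is positive and at most n^2 < q^2, so it is not divisible by q^2, although it
may be divisible by q. This is the reason for the square in the modulus. -/
theorem detect_ne_zero {q n : ℕ} {rl : ℕ → ℕ → Fin 3} {dom : ℕ → ℕ → Prop} {K : ℕ}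
    {v : ℕ → ℕ} {S : List (ℕ → ℕ → Fin 3)} {Ψ : (ℕ → ℕ) → Prop} (hq : q.Prime) (hn : n < q)
    (hsymm : ∀ a b, rl a b = rl b a) (hS : Covers n rl (K + 3) S Ψ)
    (hv : ∀ i < K + 3, v i < n) (hd : ∀ i < K + 3, dom i (v i)) (hΨ : Ψ v) :
    detect n rl dom K v S ((v K : ℕ) : ZMod (q ^ 2)) ≠ 0 := by
  have hvK := hv K (by omega)
  rw [detect, sum_patVal_support hvK (fun x _ hxu => ?_) hsymm hS fun i hi => hv i (by omega)]
  · have hu : IsUnit (lagr n ((v K : ℕ) : ZMod (q ^ 2)) (v K)) := by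
      rw [lagr, IsUnit.prod_iff]
      intro j hj
      simp only [Finset.mem_erase, Finset.mem_range] at hj
      exact isUnit_cast_sub hq (by omega) (by omega) (Ne.symm hj.1)
    intro h
    have h1 := (hu.pow 2).mul_right_eq_zero.1 h
    rw [ZMod.natCast_eq_zero_iff] at h1
    refine absurd (Nat.eq_zero_of_dvd_of_lt h1 ?_) ?_
    · calc _ ≤ ∑ z ∈ Finset.range n, ∑ y ∈ Finset.range n, 1 :=
            Finset.sum_le_sum fun z _ => Finset.sum_le_sum fun y _ => ind_le_one _
        _ = n ^ 2 := by simp [sq]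
        _ < q ^ 2 := Nat.pow_lt_pow_left hn (by norm_num)
    · rw [Finset.sum_eq_zero_iff]
      push Not
      refine ⟨v (K + 2), by simpa using hv _ (by omega), ?_⟩
      rw [Ne, Finset.sum_eq_zero_iff]
      push Not
      refine ⟨v (K + 1), by simpa using hv _ (by omega), ?_⟩
      rw [ind_ne_zero]
      refine ⟨⟨fun i hi => hd i (by omega), hd _ (by omega), hd _ (by omega), hd _ (by omega)⟩, ?_⟩
      simpa [trip] using hΨ
  · exact Finset.prod_eq_zero (i := v K) (by simp [hvK, hxu.symm]) (sub_self _)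

end LoopLang

namespace LoopLang

/-! ### The protocol for purely existential formulas -/

/-- Computes in the array `lam` the values `lagr n r u`, by the products over the smaller and the
larger indices. -/
def lamProg : Stmt :=
  .seq (.set .pow (.const 1)) <|
  .seq (.loop .t .n (.seq (.put .lam (.var .t) (.var .pow))
    (.set .pow (mulN (.var .pow) (subN (.var .r) (.var .t)))))) <|
  .seq (.set .pow (.const 1)) <|
  .loop .t .n (.seq (.set .d (.bin .sub (.bin .sub (.par .n) (.const 1)) (.var .t))) <|
    .seq (.put .lam (.var .d) (mulN (.get .lam (.var .d)) (.var .pow)))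
      (.set .pow (mulN (.var .pow) (subN (.var .r) (.var .d)))))

/-- `fac := (2 n)!` -/
def facProg : Stmt :=
  .seq (.set .fac (.const 1)) (.loop .i .dbl (.set .fac (mulN (.var .fac) (addN (.var .i) (.const 1)))))

/-- The index `2 n - 1 - i`. -/
def revE : Expr := .bin .sub (.bin .sub (.par .dbl) (.const 1)) (.var .i)

/-- Receives coefficients and evaluates `falling` by Horner's rule. -/
def hornerProg : Stmt :=
  .seq (.set .acc (.const 0)) <|
  .seq (.loop .i .n (.seq (.recv .g)
    (.set .acc (addN (mulN (.var .acc) (subN (.var .r) revE)) (.var .g)))))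
  (.loop .i .n (.set .acc (mulN (.var .acc)
    (subN (.var .r) (.bin .sub (.bin .sub (.par .n) (.const 1)) (.var .i))))))

/-- The multiplication by the constant 1 reduces `acc` modulo `N`; afterwards the comparison of two
words is a comparison of residues. -/
def checkPoly (K : ℕ) (S : List (ℕ → ℕ → Fin 3)) : Stmt :=
  .seq lamProg <| .seq (valProg K S) <| .seq (.set .val (.var .acc)) <| .seq facProg <|
  .seq hornerProg <| require (.bin .eq (mulN (.var .fac) (.var .val)) (mulN (.const 1) (.var .acc)))

/-- Tabulates the values at `0, …, 2 n - 1` in the array `val`. -/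
def tabProg (K : ℕ) (S : List (ℕ → ℕ → Fin 3)) : Stmt :=
  .loop .r .dbl (.seq lamProg <| .seq (valProg K S) (.put .val (.var .r) (.var .acc)))

/-- Computes in the array `gam` the forward differences at `0`. -/
def diffProg : Stmt :=
  .loop .i .dbl (.seq (.put .gam (.var .i) (.get .val (.const 0)))
    (.loop .t .dbl (.put .val (.var .t)
      (subN (.get .val (.add .W (.var .t) (.const 1))) (.get .val (.var .t))))))

/-- In round `i` the variable `pow` is 2 n (2 n - 1) ⋯ (2 n - i), that is (2 n)! / (2 n - 1 - i)!.
So the scaled coefficients arise by multiplications only. -/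
def sendPoly (K : ℕ) (S : List (ℕ → ℕ → Fin 3)) : Stmt :=
  .seq (tabProg K S) <| .seq diffProg <| .seq (.set .pow (.par .dbl)) <|
  .loop .i .n (.seq (.send (mulN (.var .pow) (.get .gam revE)))
    (.set .pow (mulN (.var .pow) revE)))

def AccPoly (n N r : ℕ) (rl : ℕ → ℕ → Fin 3) (dom : ℕ → ℕ → Prop) (K : ℕ)
    (S : List (ℕ → ℕ → Fin 3)) (ω : ℕ → ℕ) (v : ℕ → ℕ) (p : ℕ) : Prop :=
  (((2 * n).factorial : ℕ) : ZMod N) * detect n rl dom K v S (r : ZMod N) =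
    falling n (fun i => (ω (p + i) : ZMod N)) (r : ZMod N)

attribute [simp] revE

section
variable {Γ : Env} {rl : ℕ → ℕ → Fin 3} {K : ℕ} {dom : ℕ → ℕ → Prop} {v : ℕ → ℕ} {s : Store}
  {na : ℕ} {Q : ℕ → Quant} {S S' : List (ℕ → ℕ → Fin 3)} {Ψ : (ℕ → ℕ) → Prop}

theorem lamProg_spec (hN : 0 < Γ.par .N) (hbd : Γ.par .n ≤ Γ.par .bd) (s : Store) :
    ∀ u < Γ.par .n, ((lamProg.run Γ s).arr .lam u : ZMod (Γ.par .N)) =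
      lagr (Γ.par .n) (s.var .r : ZMod (Γ.par .N)) u := by
  set x : ZMod (Γ.par .N) := ((s.var .r : ℕ) : ZMod (Γ.par .N)) with hx
  set n := Γ.par .n with hn
  have h1 := loop_inv (Γ := Γ) (v := .t) (p := .n) (body := .seq (.put .lam (.var .t) (.var .pow))
    (.set .pow (mulN (.var .pow) (subN (.var .r) (.var .t))))) (s := s.setv .pow 1)
    (fun i s' => (s'.var .pow : ZMod (Γ.par .N)) = ∏ j ∈ Finset.range i, (x - j) ∧
      ∀ u < i, (s'.arr .lam u : ZMod (Γ.par .N)) = ∏ j ∈ Finset.range u, (x - j)) (by simp) (by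
    rintro t ht s' hF ⟨hp, hl⟩
    have hr : s'.var .r = s.var .r := by rw [hF.var _ (by simp), Store.setv_ne _ _ (by simp)]
    set s1 := (s'.setv .t t).seta .lam t (s'.var .pow) with hs1
    have e0 : (Stmt.put .lam (.var .t) (.var .pow)).run Γ (s'.setv .t t) = s1 := by
      simp [Stmt.run, Expr.eval, ht.trans_le hbd, hs1, Store.setv_var]
    have e1 : s1.var .r = s.var .r := by simp [hs1, Store.setv_var, hr]
    have e2 : s1.var .t = t := by simp [hs1]
    have e3 : s1.var .pow = s'.var .pow := by simp [hs1, Store.setv_var]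
    rw [Stmt.run, e0]
    refine ⟨?_, fun u hu => ?_⟩
    · rw [Stmt.run, Store.setv_self, eval_mulN, eval_subN hN]
      simp only [Expr.eval, e1, e2, e3, hp, Finset.prod_range_succ, hx]
    · simp only [Stmt.run, Store.setv_arr, hs1, Store.seta_arr, true_and]
      split_ifs with h
      · rw [hp, h]
      · exact hl u (by omega))
  set s1 := (Stmt.loop .t .n (.seq (.put .lam (.var .t) (.var .pow))
    (.set .pow (mulN (.var .pow) (subN (.var .r) (.var .t)))))).run Γ (s.setv .pow 1) with hs1
  have hr1 : s1.var .r = s.var .r := by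
    rw [hs1, run_var _ (by simp), Store.setv_ne _ _ (by simp)]
  have h2 := loop_inv (Γ := Γ) (v := .t) (p := .n)
    (body := .seq (.set .d (.bin .sub (.bin .sub (.par .n) (.const 1)) (.var .t))) <|
    .seq (.put .lam (.var .d) (mulN (.get .lam (.var .d)) (.var .pow)))
      (.set .pow (mulN (.var .pow) (subN (.var .r) (.var .d))))) (s := s1.setv .pow 1)
    (fun i s' => (s'.var .pow : ZMod (Γ.par .N)) = ∏ j ∈ Finset.Ico (n - i) n, (x - j) ∧
      (∀ u < n - i, s'.arr .lam u = s1.arr .lam u) ∧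
      ∀ u < n, n - i ≤ u → (s'.arr .lam u : ZMod (Γ.par .N)) =
        (∏ j ∈ Finset.range u, (x - j)) * ∏ j ∈ Finset.Ico (u + 1) n, (x - j))
    ⟨by simp, fun u _ => rfl, fun u h1 h2 => by omega⟩ (by
    rintro t ht s' hF ⟨hp, hl1, hl2⟩
    rw [← hn] at ht
    have hr : s'.var .r = s.var .r := by
      rw [hF.var _ (by simp), Store.setv_ne _ _ (by simp), hr1]
    have hd : n - 1 - t < n := by omega
    set s2 := (s'.setv .t t).setv .d (n - 1 - t) with hs2
    set a := (mulN (.get .lam (.var .d)) (.var .pow)).eval Γ s2 with ha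
    have ea : (a : ZMod (Γ.par .N)) = (∏ j ∈ Finset.range (n - 1 - t), (x - j)) *
        ∏ j ∈ Finset.Ico (n - t) n, (x - j) := by
      rw [ha, eval_mulN]
      have : s2.arr .lam (n - 1 - t) = s1.arr .lam (n - 1 - t) := hl1 _ (by omega)
      have h' : s2.var .pow = s'.var .pow := by simp [hs2, Store.setv_var]
      have h'' : s2.var .d = n - 1 - t := by simp [hs2]
      simp only [Expr.eval, h'', this, h', hp, h1.2 (n - 1 - t) hd]
    set s3 := s2.seta .lam (n - 1 - t) a with hs3
    have e0 : (Stmt.put .lam (.var .d) (mulN (.get .lam (.var .d)) (.var .pow))).run Γ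
        ((Stmt.set .d (.bin .sub (.bin .sub (.par .n) (.const 1)) (.var .t))).run Γ
          (s'.setv .t t)) = s3 := by
      have : (Stmt.set .d (.bin .sub (.bin .sub (.par .n) (.const 1)) (.var .t))).run Γ
          (s'.setv .t t) = s2 := by
        simp only [Stmt.run, Expr.eval, BinOp.eval, Store.setv_self, hs2]
        rfl
      rw [this, Stmt.run]
      have h'' : (Expr.var .d).eval Γ s2 = n - 1 - t := by simp [hs2, Expr.eval]
      rw [h'', if_pos (by omega)]
    have e1 : s3.var .r = s.var .r := by simp [hs3, hs2, Store.setv_var, hr]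
    have e2 : s3.var .d = n - 1 - t := by simp [hs3, hs2]
    have e3 : s3.var .pow = s'.var .pow := by simp [hs3, hs2, Store.setv_var]
    have hrun : (Stmt.seq (.set .d (.bin .sub (.bin .sub (.par .n) (.const 1)) (.var .t))) <|
        .seq (.put .lam (.var .d) (mulN (.get .lam (.var .d)) (.var .pow)))
        (.set .pow (mulN (.var .pow) (subN (.var .r) (.var .d))))).run Γ (s'.setv .t t) =
        (Stmt.set .pow (mulN (.var .pow) (subN (.var .r) (.var .d)))).run Γ s3 := by
      rw [← e0]; rfl
    rw [hrun]
    have hIco : Finset.Ico (n - (t + 1)) n = insert (n - 1 - t) (Finset.Ico (n - t) n) := by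
      ext j; simp only [Finset.mem_Ico, Finset.mem_insert]; omega
    refine ⟨?_, fun u hu => ?_, fun u hu hu' => ?_⟩
    · rw [Stmt.run, Store.setv_self, eval_mulN, eval_subN hN, hIco, Finset.prod_insert (by
        simp only [Finset.mem_Ico]; omega)]
      simp only [Expr.eval, e1, e2, e3, hp, hx]
      ring
    · simp only [Stmt.run, Store.setv_arr, hs3, Store.seta_arr, true_and]
      rw [if_neg (by omega)]
      exact hl1 u (by omega)
    · simp only [Stmt.run, Store.setv_arr, hs3, Store.seta_arr, true_and]
      split_ifs with h
      · rw [ea, h, show n - 1 - t + 1 = n - t by omega]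
      · exact hl2 u hu (by omega))
  intro u hu
  have hrun : lamProg.run Γ s = (Stmt.loop .t .n
    (.seq (.set .d (.bin .sub (.bin .sub (.par .n) (.const 1)) (.var .t))) <|
    .seq (.put .lam (.var .d) (mulN (.get .lam (.var .d)) (.var .pow)))
      (.set .pow (mulN (.var .pow) (subN (.var .r) (.var .d)))))).run Γ (s1.setv .pow 1) := rfl
  rw [hrun, h2.2.2 u hu (by omega), lagr, ← Finset.prod_union]
  · refine Finset.prod_congr ?_ fun _ _ => rfl
    ext j
    simp only [Finset.mem_union, Finset.mem_range, Finset.mem_Ico, Finset.mem_erase]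
    omega
  · rw [Finset.disjoint_left]
    intro j
    simp only [Finset.mem_range, Finset.mem_Ico]
    omega

theorem lamProg_writesVar {w : Var} : lamProg.WritesVar w ↔ w = .pow ∨ w = .t ∨ w = .d := by
  simp [lamProg]; tauto

theorem lamProg_writesArr {A : Arr} : lamProg.WritesArr A ↔ A = .lam := by
  simp [lamProg]

theorem lamProg_quiet : lamProg.Quiet := by simp [lamProg]

attribute [simp] lamProg_writesVar lamProg_writesArr lamProg_quiet

theorem detectProg_spec (hG : Graphical Γ rl) (h : Good Γ rl (K + 3) dom K v s) :
    (((valProg K S).run Γ (lamProg.run Γ s)).var .acc : ZMod (Γ.par .N)) =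
      detect (Γ.par .n) rl dom K v S (s.var .r : ZMod (Γ.par .N)) := by
  rw [valProg_spec hG S (h.run (by simp) (by simp) (by simp)) le_rfl, detect]
  congr 1
  refine List.map_congr_left fun π _ => ?_
  have hl := lamProg_spec hG.N_pos hG.n_le_bd s
  simp only [patVal]
  congr 1
  refine Finset.sum_congr rfl fun z _ => ?_
  congr 2
  · exact Finset.sum_congr rfl fun x hx => by rw [hl x (Finset.mem_range.1 hx)]
  · refine Finset.sum_congr rfl fun y _ => ?_
    congr 2
    exact Finset.sum_congr rfl fun x hx => by rw [hl x (Finset.mem_range.1 hx)]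

theorem facProg_spec (s : Store) : ((facProg.run Γ s).var .fac : ZMod (Γ.par .N)) =
    ((Γ.par .dbl).factorial : ℕ) := by
  refine loop_inv (Γ := Γ) (v := .i) (p := .dbl)
    (body := .set .fac (mulN (.var .fac) (addN (.var .i) (.const 1)))) (s := s.setv .fac 1)
    (fun i s' => (s'.var .fac : ZMod (Γ.par .N)) = (i.factorial : ℕ)) (by simp) ?_
  intro i hi s' hF h
  rw [Stmt.run, Store.setv_self, eval_mulN, eval_addN]
  simp only [Expr.eval, Store.setv_self, Store.setv_ne _ _ (show Var.fac ≠ .i by simp), h]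
  rw [Nat.factorial_succ]
  push_cast
  have : (((1 : Fin 3) : ℕ) : ZMod (Γ.par .N)) = 1 := by simp
  rw [this]; ring

/-- A Horner scheme for falling factorials: the coefficients arrive from the highest degree
downwards and the factor changes in each round. After the last coefficient, n factors are still
missing, and the second loop supplies them. The invariants multiply the accumulator by the missing
factors instead of dividing. -/
theorem hornerProg_spec (hN : 0 < Γ.par .N) (hdbl : Γ.par .dbl = 2 * Γ.par .n) (s : Store) :
    (hornerProg.run Γ s).pos = s.pos + Γ.par .n ∧
    ((hornerProg.run Γ s).var .acc : ZMod (Γ.par .N)) = falling (Γ.par .n)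
      (fun i => (Γ.word (s.pos + i) : ZMod (Γ.par .N))) (s.var .r : ZMod (Γ.par .N)) := by
  set x : ZMod (Γ.par .N) := ((s.var .r : ℕ) : ZMod (Γ.par .N)) with hx
  set n := Γ.par .n with hn
  have h1 := loop_inv (Γ := Γ) (v := .i) (p := .n) (body := .seq (.recv .g)
    (.set .acc (addN (mulN (.var .acc) (subN (.var .r) revE)) (.var .g)))) (s := s.setv .acc 0)
    (fun i s' => s'.pos = s.pos + i ∧
      (s'.var .acc : ZMod (Γ.par .N)) * ∏ l ∈ Finset.range (2 * n - i), (x - l) =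
      ∑ i ∈ Finset.range i, (Γ.word (s.pos + i) : ZMod (Γ.par .N)) *
        ∏ l ∈ Finset.range (2 * n - 1 - i), (x - l)) (by simp) (by
    rintro i hi s' hF ⟨hp, hI⟩
    rw [← hn] at hi
    have hr : s'.var .r = s.var .r := by rw [hF.var _ (by simp), Store.setv_ne _ _ (by simp)]
    set s1 := (Stmt.recv .g).run Γ (s'.setv .i i) with hs1
    have e1 : s1.pos = s.pos + i + 1 := by simp [hs1, Stmt.run, hp]
    have e2 : s1.var .g = Γ.word (s.pos + i) := by simp [hs1, Stmt.run, Store.setv, hp]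
    have e3 : s1.var .acc = s'.var .acc := by simp [hs1, Stmt.run, Store.setv]
    have e4 : s1.var .i = i := by simp [hs1, Stmt.run, Store.setv]
    have e5 : s1.var .r = s.var .r := by simp [hs1, Stmt.run, Store.setv, hr]
    rw [Stmt.run, ← hs1, Stmt.run, Store.setv_self, Store.setv_pos]
    refine ⟨e1, ?_⟩
    rw [eval_addN, eval_mulN, eval_subN hN, Finset.sum_range_succ, ← hI]
    simp only [revE, Expr.eval, BinOp.eval, e2, e3, e4, e5, hdbl]
    rw [show 2 * n - i = (2 * n - 1 - i) + 1 by omega, Finset.prod_range_succ,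
      show 2 * n - (i + 1) = 2 * n - 1 - i by omega]
    have : ((1 : Fin 3) : ℕ) = 1 := rfl
    rw [this, ← hx]
    ring)
  set s1 := (Stmt.loop .i .n (.seq (.recv .g)
    (.set .acc (addN (mulN (.var .acc) (subN (.var .r) revE)) (.var .g))))).run Γ (s.setv .acc 0)
    with hs1
  have hr1 : s1.var .r = s.var .r := by
    rw [hs1, run_var _ (by simp), Store.setv_ne _ _ (by simp)]
  have h2 := loop_inv (Γ := Γ) (v := .i) (p := .n) (body := .set .acc (mulN (.var .acc)
    (subN (.var .r) (.bin .sub (.bin .sub (.par .n) (.const 1)) (.var .i))))) (s := s1)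
    (fun i s' => (s'.var .acc : ZMod (Γ.par .N)) * ∏ l ∈ Finset.range (n - i), (x - l) =
      falling n (fun i => (Γ.word (s.pos + i) : ZMod (Γ.par .N))) x) (by
    rw [← hn, show 2 * n - n = n by omega] at h1
    exact h1.2) (by
    rintro i hi s' hF hI
    rw [← hn] at hi
    have hr : s'.var .r = s.var .r := by rw [hF.var _ (by simp), hr1]
    rw [Stmt.run, Store.setv_self, eval_mulN, eval_subN hN, ← hI]
    simp only [Expr.eval, BinOp.eval, Store.setv_self, Store.setv_ne _ _ (show Var.acc ≠ .i by simp),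
      Store.setv_ne _ _ (show Var.r ≠ .i by simp), hr]
    rw [show n - i = (n - (i + 1)) + 1 by omega, Finset.prod_range_succ, ← hx, ← hn]
    have h1 : ((1 : Fin 3) : ℕ) = 1 := rfl
    rw [h1, show n - 1 - i = n - (i + 1) by omega]
    ring)
  constructor
  · exact (run_quiet (Γ := Γ) (c := Stmt.loop .i .n (.set .acc _)) s1 (by simp)).1.trans h1.1
  · rw [← hn, Nat.sub_self, Finset.prod_range_zero, mul_one] at h2
    exact h2

theorem facProg_writesVar {w : Var} : facProg.WritesVar w ↔ w = .fac ∨ w = .i := by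
  simp [facProg]; tauto
theorem facProg_writesArr {A : Arr} : ¬ facProg.WritesArr A := by simp [facProg]
theorem facProg_quiet : facProg.Quiet := by simp [facProg]
theorem hornerProg_writesVar {w : Var} : hornerProg.WritesVar w ↔ w = .acc ∨ w = .i ∨ w = .g := by
  simp [hornerProg]; tauto
theorem hornerProg_writesArr {A : Arr} : ¬ hornerProg.WritesArr A := by simp [hornerProg]

attribute [simp] facProg_writesVar facProg_writesArr facProg_quiet hornerProg_writesVar
  hornerProg_writesArr

theorem checkPoly_spec (hΓ : Setup Γ rl K S S' Ψ) (h : Good Γ rl (K + 3) dom K v s)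
    (hok : s.var .ok ≤ 1) :
    ((checkPoly K S).run Γ s).pos = s.pos + Γ.par .n ∧
    ((checkPoly K S).run Γ s).var .ok = ind (s.var .ok = 1 ∧
      AccPoly (Γ.par .n) (Γ.par .N) (s.var .r) rl dom K S Γ.word v s.pos) := by
  have hN := hΓ.graph.N_pos
  set s1 := (valProg K S).run Γ (lamProg.run Γ s) with hs1
  have h1 := detectProg_spec (S := S) hΓ.graph h
  rw [← hs1] at h1
  set s2 := facProg.run Γ (s1.setv .val (s1.var .acc)) with hs2
  have p2 : s2.pos = s.pos := by
    rw [hs2, (run_quiet _ facProg_quiet).1, Store.setv_pos, hs1, (run_quiet _ (by simp)).1,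
      (run_quiet _ lamProg_quiet).1]
  have r2 : s2.var .r = s.var .r := by
    rw [hs2, run_var _ (by simp), Store.setv_ne _ _ (by simp), hs1, run_var _ (by simp),
      run_var _ (by simp)]
  have o2 : s2.var .ok = s.var .ok := by
    rw [hs2, run_var _ (by simp), Store.setv_ne _ _ (by simp), hs1, run_var _ (by simp),
      run_var _ (by simp)]
  have v2 : s2.var .val = s1.var .acc := by rw [hs2, run_var _ (by simp), Store.setv_self]
  have f2 := facProg_spec (Γ := Γ) (s1.setv .val (s1.var .acc))
  rw [← hs2] at f2
  obtain ⟨h3, h4⟩ := hornerProg_spec hN hΓ.dbl s2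
  set s3 := hornerProg.run Γ s2 with hs3
  have hrun : (checkPoly K S).run Γ s = (require (.bin .eq (mulN (.var .fac) (.var .val))
      (mulN (.const 1) (.var .acc)))).run Γ s3 := rfl
  have o3 : s3.var .ok = s.var .ok := by rw [hs3, run_var _ (by simp), o2]
  have v3 : s3.var .val = s1.var .acc := by rw [hs3, run_var _ (by simp), v2]
  have f3 : s3.var .fac = s2.var .fac := by rw [hs3, run_var _ (by simp)]
  have he : (Expr.bin .eq (mulN (.var .fac) (.var .val)) (mulN (.const 1) (.var .acc))).eval Γ s3 =
      ind (AccPoly (Γ.par .n) (Γ.par .N) (s.var .r) rl dom K S Γ.word v s.pos) := by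
    have e1 : (Expr.bin .eq (mulN (.var .fac) (.var .val)) (mulN (.const 1) (.var .acc))).eval Γ s3
        = ind ((mulN (.var .fac) (.var .val)).eval Γ s3 =
          (mulN (.const 1) (.var .acc)).eval Γ s3) := (ind_eq_ite _).symm
    rw [e1]
    refine ind_congr ?_
    have l1 : (mulN (.var .fac) (.var .val)).eval Γ s3 < Γ.par .N := Nat.mod_lt _ hN
    have l2 : (mulN (.const 1) (.var .acc)).eval Γ s3 < Γ.par .N := Nat.mod_lt _ hN
    rw [AccPoly, ← h1, ← r2, ← p2, ← h4, ← hΓ.dbl, ← f2]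
    constructor
    · intro h
      have := congrArg (Nat.cast : ℕ → ZMod (Γ.par .N)) h
      rw [eval_mulN, eval_mulN] at this
      simpa [Expr.eval, v3, f3] using this
    · intro h
      rw [← Nat.mod_eq_of_lt l1, ← Nat.mod_eq_of_lt l2]
      rw [← ZMod.natCast_eq_natCast_iff', eval_mulN, eval_mulN]
      simpa [Expr.eval, v3, f3] using h
  rw [hrun]
  refine ⟨by rw [require, Stmt.run, Store.setv_pos, h3, p2], ?_⟩
  rw [require, Stmt.run, Store.setv_self, require_spec hΓ.graph.one_lt_W (by rwa [o3]) he, o3]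

theorem tabProg_spec (hΓ : Setup Γ rl K S S' Ψ) (h : Good Γ rl (K + 3) dom K v s) :
    ∀ x < 2 * Γ.par .n, (((tabProg K S).run Γ s).arr .val x : ZMod (Γ.par .N)) =
      detect (Γ.par .n) rl dom K v S (x : ZMod (Γ.par .N)) := by
  rw [← hΓ.dbl]
  refine loop_inv (Γ := Γ) (v := .r) (p := .dbl) (body := .seq lamProg <| .seq (valProg K S)
    (.put .val (.var .r) (.var .acc))) (s := s)
    (fun i s' => ∀ x < i, (s'.arr .val x : ZMod (Γ.par .N)) =
      detect (Γ.par .n) rl dom K v S (x : ZMod (Γ.par .N))) (by simp) ?_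
  intro i hi s' hF hI
  have g : Good Γ rl (K + 3) dom K v (s'.setv .r i) :=
    (h.frame hF (by simp) (by simp) (by simp)).setv (by simp)
  have h1 := detectProg_spec (S := S) hΓ.graph g
  rw [Store.setv_self] at h1
  set s1 := (valProg K S).run Γ (lamProg.run Γ (s'.setv .r i)) with hs1
  have hr : s1.var .r = i := by
    rw [hs1, run_var _ (by simp), run_var _ (by simp), Store.setv_self]
  have hv : s1.arr .val = s'.arr .val := by
    rw [hs1, run_arr _ (by simp), run_arr _ (by simp), Store.setv_arr]
  change ∀ x < i + 1, (((((Stmt.put .val (.var .r) (.var .acc)).run Γ s1).arr .val x : ℕ) :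
    ZMod (Γ.par .N)) = _)
  simp only [Stmt.run, Expr.eval, hr, if_pos (hi.trans_le hΓ.dbl_le), Store.seta_arr, true_and, hv]
  intro x hx
  split_ifs with h
  · rw [h1, h]
  · exact hI x (by omega)

theorem diffProg_spec (hΓ : Setup Γ rl K S S' Ψ) {f : ZMod (Γ.par .N) → ZMod (Γ.par .N)}
    (hf : ∀ x < 2 * Γ.par .n, (s.arr .val x : ZMod (Γ.par .N)) = f x) :
    ∀ j < 2 * Γ.par .n, ((diffProg.run Γ s).arr .gam j : ZMod (Γ.par .N)) =
      (fwdDiff 1)^[j] f 0 := by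
  have hN := hΓ.graph.N_pos
  have hle := hΓ.dbl_le
  have hW : 2 * Γ.par .n ≤ Γ.par .W := by
    have := hΓ.graph.W_idx
    have := hΓ.graph.n_pos
    nlinarith
  rw [← hΓ.dbl] at hf ⊢
  rw [← hΓ.dbl] at hW
  -- Each round makes one more entry at the end of the table worthless, because the difference there
  -- refers to an entry behind it. Therefore only the entries with x + i < 2 n are claimed to be
  -- correct.
  refine (loop_inv (Γ := Γ) (v := .i) (p := .dbl)
    (body := .seq (.put .gam (.var .i) (.get .val (.const 0)))
    (.loop .t .dbl (.put .val (.var .t)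
      (subN (.get .val (.add .W (.var .t) (.const 1))) (.get .val (.var .t)))))) (s := s)
    (fun i s' => (∀ j < i, (s'.arr .gam j : ZMod (Γ.par .N)) = (fwdDiff 1)^[j] f 0) ∧
      ∀ x, x + i < Γ.par .dbl → (s'.arr .val x : ZMod (Γ.par .N)) = (fwdDiff 1)^[i] f x)
    ⟨by simp, fun x hx => hf x hx⟩ ?_).1
  rintro i hi s' hF ⟨hg, hv⟩
  set s1 := (s'.setv .i i).seta .gam i (s'.arr .val 0) with hs1
  have e0 : (Stmt.put .gam (.var .i) (.get .val (.const 0))).run Γ (s'.setv .i i) = s1 := by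
    simp only [Stmt.run, Expr.eval, Store.setv_self, if_pos (hi.trans_le hle), hs1, Store.setv_arr]
    rfl
  rw [Stmt.run, e0]
  have hv1 : s1.arr .val = s'.arr .val := by simp [hs1, Store.seta_ne]
  have := loop_inv (Γ := Γ) (v := .t) (p := .dbl) (body := .put .val (.var .t)
      (subN (.get .val (.add .W (.var .t) (.const 1))) (.get .val (.var .t)))) (s := s1)
      (fun t s2 => (∀ x < t, x + (i + 1) < Γ.par .dbl →
        (s2.arr .val x : ZMod (Γ.par .N)) = (fwdDiff 1)^[i + 1] f x) ∧
        ∀ x, t ≤ x → s2.arr .val x = s1.arr .val x) (by simp) (by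
    rintro t ht s2 hF2 ⟨h1, h2⟩
    have hev : (subN (.get .val (.add .W (.var .t) (.const 1))) (.get .val (.var .t))).eval Γ
        (s2.setv .t t) = _ := rfl
    have hc : t + (i + 1) < Γ.par .dbl → ((subN (.get .val (.add .W (.var .t) (.const 1)))
        (.get .val (.var .t))).eval Γ (s2.setv .t t) : ZMod (Γ.par .N)) =
        (fwdDiff 1)^[i + 1] f t := by
      intro hti
      have e1 : (t + ((1 : Fin 3) : ℕ)) % Γ.par .W = t + 1 := Nat.mod_eq_of_lt (by
        have : ((1 : Fin 3) : ℕ) = 1 := rfl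
        omega)
      rw [eval_subN hN]
      simp only [Expr.eval, Store.setv_self, Store.setv_arr, Modulus.par, e1]
      rw [h2 _ (by omega), h2 _ le_rfl, hv1, hv _ (by omega), hv _ (by omega),
        Function.iterate_succ_apply', fwdDiff, Nat.cast_add, Nat.cast_one]
    set a := (subN (.get .val (.add .W (.var .t) (.const 1)))
        (.get .val (.var .t))).eval Γ (s2.setv .t t) with ha
    simp only [Stmt.run, ← ha]
    simp only [Expr.eval, Store.setv_self, if_pos (ht.trans_le hle), Store.seta_arr, true_and,
      Store.setv_arr]
    refine ⟨fun x hx hxi => ?_, fun x hx => ?_⟩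
    · split_ifs with h
      · rw [h] at hxi ⊢; exact hc hxi
      · exact h1 x (by omega) hxi
    · rw [if_neg (by omega)]
      exact h2 x (by omega))
  refine ⟨fun j hj => ?_, fun x hx => this.1 x (by omega) hx⟩
  rw [run_arr _ (by simp), hs1, Store.seta_arr]
  split_ifs with h
  · rw [h.2, hv 0 (by omega)]; simp
  · exact hg j (lt_of_le_of_ne (by omega) fun h' => h ⟨rfl, h'⟩)

theorem sendPoly_spec (hΓ : Setup Γ rl K S S' Ψ) (hsymm : ∀ a b, rl a b = rl b a)
    (h : Good Γ rl (K + 3) dom K v s) (hno : NoSol (Γ.par .n) Q dom Ψ K (K + 3)) :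
    ∃ blk, ((sendPoly K S).run Γ s).out = s.out ++ blk ∧ blk.length = Γ.par .n ∧
      ∀ ω p, Serves ω p blk → ∀ r, AccPoly (Γ.par .n) (Γ.par .N) r rl dom K S ω v p := by
  have hn := hΓ.graph.n_pos
  have hN := hΓ.graph.N_pos
  set n := Γ.par .n with hn'
  have h1 := tabProg_spec hΓ h
  rw [← hn'] at h1
  set P : Polynomial (ZMod (Γ.par .N)) := detect n rl dom K v S Polynomial.X with hP
  have h2 := diffProg_spec hΓ (s := (tabProg K S).run Γ s) (f := P.eval) (fun x hx => by
    rw [h1 x hx, hP, detect_eval])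
  set s2 := diffProg.run Γ ((tabProg K S).run Γ s) with hs2
  have hout : s2.out = s.out := by
    rw [hs2, (run_quiet _ (by simp [diffProg])).2.2, (run_quiet _ (by simp [tabProg])).2.2]
  set γ : ℕ → ZMod (Γ.par .N) := fun i => (∏ l ∈ Finset.Ico (2 * n - i) (2 * n + 1),
    (l : ZMod (Γ.par .N))) * (fwdDiff 1)^[2 * n - 1 - i] P.eval 0 with hγ
  have h3 := loop_inv (Γ := Γ) (v := .i) (p := .n)
    (body := .seq (.send (mulN (.var .pow) (.get .gam revE))) (.set .pow (mulN (.var .pow) revE)))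
    (s := s2.setv .pow (Γ.par .dbl))
    (fun i s' => (s'.var .pow : ZMod (Γ.par .N)) = ∏ l ∈ Finset.Ico (2 * n - i) (2 * n + 1),
      (l : ZMod (Γ.par .N)) ∧ ∃ blk, s'.out = s.out ++ blk ∧ blk.length = i ∧
        ∀ j (hj : j < blk.length), (blk[j] : ZMod (Γ.par .N)) = γ j)
    ⟨by simp [hΓ.dbl, ← hn'], [], by simp [hout], rfl, by simp⟩ (by
    rintro i hi s' hF ⟨hp, blk, hb1, hb2, hb3⟩
    have hgam : s'.arr .gam = s2.arr .gam := by rw [hF.arr _ (by simp), Store.setv_arr]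
    have hrev : revE.eval Γ (s'.setv .i i) = 2 * n - 1 - i := by
      simp only [revE, Expr.eval, BinOp.eval, Store.setv_self, hΓ.dbl, ← hn']
      rfl
    have hpow : (s'.setv .i i).var .pow = s'.var .pow := Store.setv_ne _ _ (by simp)
    refine ⟨?_, blk ++ [(mulN (.var .pow) (.get .gam revE)).eval Γ (s'.setv .i i)], ?_, ?_, ?_⟩
    · have : ((Stmt.seq (.send (mulN (.var .pow) (.get .gam revE)))
          (.set .pow (mulN (.var .pow) revE))).run Γ (s'.setv .i i)).var .pow =
          (mulN (.var .pow) revE).eval Γ (s'.setv .i i) := Store.setv_self _ _ _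
      have hI : Finset.Ico (2 * n - (i + 1)) (2 * n + 1) =
          insert (2 * n - 1 - i) (Finset.Ico (2 * n - i) (2 * n + 1)) := by
        ext j; simp only [Finset.mem_Ico, Finset.mem_insert]; omega
      rw [this, eval_mulN, hrev, hI, Finset.prod_insert (by simp only [Finset.mem_Ico]; omega), ← hp,
        mul_comm, Expr.eval, hpow]
    · rw [← List.append_assoc, ← hb1]; rfl
    · simp [hb2]
    · intro j hj
      rw [List.length_append, List.length_singleton] at hj
      rcases Nat.lt_succ_iff_lt_or_eq.1 hj with hj | rfl
      · rw [List.getElem_append_left hj]; exact hb3 j hj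
      · rw [List.getElem_append_right le_rfl]
        simp only [Nat.sub_self, List.getElem_cons_zero]
        rw [eval_mulN]
        simp only [Expr.eval] at hrev ⊢
        rw [hpow, hp, hb2]
        simp only [hγ]
        congr 1
        rw [Store.setv_arr, hgam]
        have := h2 (2 * n - 1 - i) (by omega)
        rw [← this]
        congr 2)
  obtain ⟨-, blk, hb1, hb2, hb3⟩ := h3
  refine ⟨blk, hb1, hb2, fun ω p hS r => ?_⟩
  have hN1 : Nontrivial (ZMod (Γ.par .N)) := by
    have := hΓ.n_lt_N
    exact ZMod.nontrivial_iff.2 (by omega)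
  -- The zeros of the polynomial at the vertices are exactly what the absence of solutions gives.
  have := newton (P := P) hn (detect_natDegree hn) (fun u hu => by
    rw [hP, detect_eval]
    refine detect_eq_zero hu hsymm hΓ.pos h.lt fun y hy z hz hh => ?_
    refine hno (trip v K u y z) (trip_bound h.lt hu hy hz) (fun l hl => ?_) (by
      rw [Nat.sub_self]; exact hh.2)
    rcases lt_or_ge l K with h | h
    · rw [trip_lt h]; exact hh.1.1 l h
    · obtain rfl | rfl | rfl : l = K ∨ l = K + 1 ∨ l = K + 2 := by omega
      · rw [trip_zero]; exact hh.1.2.1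
      · rw [trip_one]; exact hh.1.2.2.1
      · rw [trip_two]; exact hh.1.2.2.2) r
  rw [AccPoly]
  rw [hP, detect_eval, ← hP] at this
  rw [this]
  refine Finset.sum_congr rfl fun i hi => ?_
  rw [Finset.mem_range] at hi
  have : ((ω (p + i) : ℕ) : ZMod (Γ.par .N)) = γ i := by rw [hS i (by omega), hb3 i (by omega)]
  simp only [this, hγ]

/-- The protocol for purely existential formulas. -/
def polyProtocol : Protocol K (K + 3) Q S S' where
  chk := nest (checkPoly K S) K 0
  prv := nest (sendPoly K S) K 0
  len n := n * n ^ K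
  Acc n N r rl dom _ ω p := ∀ v, AllAcc n n (AccPoly n N r rl dom K S ω) K 0 v p
  chk_fits {na} hna := by
    refine (nest_fits (d := 1) ?_ K 0).mono (by omega)
    have : 1 < na := by omega
    exact ⟨by simp [lamProg, Arr.code, this], valProg_fits hna, by simp, by simp [facProg],
      by simp [hornerProg], by simp⟩
  prv_fits {na} hna := by
    refine (nest_fits (d := 2) ?_ K 0).mono (by omega)
    have : 10 < na := by omega
    have : 9 < na := by omega
    have : 1 < na := by omega
    exact ⟨⟨trivial, by simp [lamProg, Arr.code, *], valProg_fits hna, by simp [Arr.code, *]⟩,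
      by simp [diffProg, Arr.code, *], by simp, by simp [Arr.code, *]⟩
  chk_var {w} hw h := by
    rcases nest_writesVar _ _ h with ⟨j, _, _, rfl⟩ | h
    · simp at hw
    · rcases hw with rfl | rfl | ⟨l, rfl⟩ <;> simp [checkPoly] at h
  prv_var {w} hw h := by
    rcases nest_writesVar _ _ h with ⟨j, _, _, rfl⟩ | h
    · simp at hw
    · rcases hw with rfl | ⟨l, rfl⟩ <;> simp [sendPoly, tabProg, diffProg] at h
  chk_arr {A} hA h := by
    rw [nest_writesArr] at h
    rcases hA with rfl | ⟨l, rfl⟩ <;> simp [checkPoly] at h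
  prv_arr {A} hA h := by
    rw [nest_writesArr] at h
    rcases hA with rfl | ⟨l, rfl⟩ <;> simp [sendPoly, tabProg, diffProg] at h
  chk_spec {Γ rl dom v s Ψ} hΓ h hok := by
    have := fun v => nest_verify (L := K) (k := K + 3) (rl := rl) (dom := dom) (Γ := Γ)
      (body := checkPoly K S) (sz := Γ.par .n)
      (Acc := AccPoly (Γ.par .n) (Γ.par .N) (s.var .r) rl dom K S Γ.word) (c := s.var .r)
      (by simp [checkPoly]) (by simp [checkPoly]) (by simp [checkPoly])
      (by simp [checkPoly]) (fun v s' g hok hr => by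
        rw [← hr]; exact checkPoly_spec hΓ g hok) K 0 v s
      (by omega) ⟨h.rel, h.dom, by simp, by simp⟩ hok rfl
    exact ⟨(this v).1, ind_forall fun v => (this v).2⟩
  prv_spec {Γ rl dom v s Ψ} hΓ h hno := by
    refine blk_forall fun v => ?_
    obtain ⟨blk, h1, h2, h3⟩ := nest_prove (L := K) (k := K + 3) (rl := rl) (dom := dom) (Γ := Γ)
      (body := sendPoly K S) (sz := Γ.par .n)
      (Acc := fun ω v p => ∀ r, AccPoly (Γ.par .n) (Γ.par .N) r rl dom K S ω v p)
      (by simp [sendPoly, tabProg, diffProg]) (by simp [sendPoly, tabProg, diffProg])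
      (by simp [sendPoly, tabProg, diffProg])
      (fun v s g => sendPoly_spec hΓ hΓ.graph.symm g hno) K 0 v s (by omega)
      ⟨h.rel, h.dom, by simp, by simp⟩
    exact ⟨blk, h1, h2, fun ω r p hS => (h3 ω p hS).mono fun v p h => h r⟩
  sound {n q rl dom Ψ} hn hq hnq hsymm hS hno ω p := by
    classical
    simp only [NoSol, not_forall, not_not, Nat.sub_self] at hno
    obtain ⟨v, hv, hd, hT⟩ := hno
    obtain ⟨p', h⟩ := AllAcc.position (sz := n) (v := v) (r := K) (l := 0) p
      (fun j _ hj => hv j (by omega))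
    -- The sample points for which the check of the block of `v` succeeds. The words at `p'` do not
    -- depend on `r`, so these are agreement points of two fixed polynomials.
    set T : Finset ℕ := (Finset.range (12 * n)).filter fun r =>
      AccPoly n (q ^ 2) r rl dom K S ω v p' with hT'
    refine ⟨T, ?_, fun r hr hA => Finset.mem_filter.2 ⟨Finset.mem_range.2 hr, h _ (hA v)⟩⟩
    -- With more than 2 n agreement points the difference of the two sides, whose degree is at most
    -- 2 n, would be the zero polynomial.
    by_contra hcard
    have : Nontrivial (ZMod (q ^ 2)) :=
      ZMod.nontrivial_iff.2 (by have := hq.one_lt; nlinarith)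
    set P : Polynomial (ZMod (q ^ 2)) := detect n rl dom K v S Polynomial.X with hP
    set F : Polynomial (ZMod (q ^ 2)) := falling n
      (fun i => Polynomial.C ((ω (p' + i) : ℕ) : ZMod (q ^ 2))) Polynomial.X with hF
    have hzero := eq_zero_of_isUnit_sub T
      (Polynomial.C (((2 * n).factorial : ℕ) : ZMod (q ^ 2)) * P - F)
      (by
        have h1 : (Polynomial.C (((2 * n).factorial : ℕ) : ZMod (q ^ 2)) * P - F).natDegree ≤
            2 * n := by
          have h2 : (Polynomial.C (((2 * n).factorial : ℕ) : ZMod (q ^ 2)) * P).natDegree ≤ 2 * n :=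
            (Polynomial.natDegree_C_mul_le _ _).trans (detect_natDegree hn).le
          exact Polynomial.natDegree_sub_le_of_le h2 (falling_natDegree hn).le |>.trans (by simp)
        refine (Polynomial.degree_le_of_natDegree_le h1).trans_lt ?_
        exact_mod_cast (show 2 * n < T.card by omega)) (fun r hr => by
        have h1 := (Finset.mem_filter.1 hr).2
        rw [AccPoly, ← detect_eval, ← falling_eval] at h1
        rw [Polynomial.eval_sub, Polynomial.eval_mul, Polynomial.eval_C, sub_eq_zero]
        exact h1) (fun a ha b hb hab => by
        rw [Finset.mem_filter, Finset.mem_range] at ha hb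
        exact isUnit_cast_sub hq (by omega) (by omega) hab)
    -- At the vertex `v K` the side of the prover vanishes for any coefficients, while the other
    -- side is a unit times a non-zero value.
    have he := congrArg (Polynomial.eval ((v K : ℕ) : ZMod (q ^ 2))) hzero
    rw [Polynomial.eval_sub, Polynomial.eval_mul, Polynomial.eval_C, hP, detect_eval, hF,
      falling_eval, falling_eq_zero (hv K (by omega)), sub_zero, Polynomial.eval_zero] at he
    have hu := isUnit_cast_factorial hq (show 2 * n < q by omega)
    exact detect_ne_zero hq (by omega) hsymm hS hv hd hT (hu.mul_right_eq_zero.1 he)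

end

/-! ### The lexicographically first solution -/

section
variable {n K i : ℕ} {Q : ℕ → Quant} {dom : ℕ → ℕ → Prop} {Ψ : (ℕ → ℕ) → Prop}

theorem QT_congr_var : ∀ {r j : ℕ} {v v' : ℕ → ℕ},
    (∀ w w' : ℕ → ℕ, (∀ l < j + r, w l = w' l) → (Ψ w ↔ Ψ w')) → (∀ l < j, v l = v' l) →
    (QT n Q dom Ψ r j v ↔ QT n Q dom Ψ r j v') := by
  intro r
  induction r with
  | zero => exact fun hΨ h => hΨ _ _ (by simpa using h)
  | succ r ih =>
    intro j v v' hΨ h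
    have : (fun a => QT n Q dom Ψ r (j + 1) (Function.update v j a)) =
        fun a => QT n Q dom Ψ r (j + 1) (Function.update v' j a) := by
      funext a
      refine propext (ih (fun w w' hw => hΨ w w' fun l hl => hw l (by omega)) fun l hl => ?_)
      rcases Nat.lt_succ_iff_lt_or_eq.1 hl with hl | rfl
      · rw [Function.update_of_ne (by omega), Function.update_of_ne (by omega), h l hl]
      · simp
    simp only [QT, this]

/-- `a` solves the search problem for `i` leading existential quantifiers. -/
def Sol (n : ℕ) (Q : ℕ → Quant) (dom : ℕ → ℕ → Prop) (Ψ : (ℕ → ℕ) → Prop) (K i : ℕ)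
    (a : ℕ → ℕ) : Prop :=
  (∀ l < i, a l < n ∧ dom l (a l)) ∧ QT n Q dom Ψ (K + 3 - i) i a

/-- The first `j` components of `a` are chosen greedily. -/
structure Greedy (n : ℕ) (Q : ℕ → Quant) (dom : ℕ → ℕ → Prop) (Ψ : (ℕ → ℕ) → Prop) (K j : ℕ)
    (a : ℕ → ℕ) : Prop where
  sol : Sol n Q dom Ψ K j a
  min : ∀ l < j, ∀ b < a l, dom l b →
    ¬ QT n Q dom Ψ (K + 3 - (l + 1)) (l + 1) (Function.update a l b)

/-- The domains that describe the vectors that agree with `a` before `j` and are smaller at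
`j`. -/
def restr (dom : ℕ → ℕ → Prop) (a : ℕ → ℕ) (j : ℕ) (l b : ℕ) : Prop :=
  if l < j then b = a l else if l = j then dom l b ∧ b < a l else dom l b

/-- The number of quantifiers is `K + 3`, the first `i` of them are existential, and `Ψ` depends
only on the quantified variables. -/
structure Leading (Q : ℕ → Quant) (Ψ : (ℕ → ℕ) → Prop) (K i : ℕ) : Prop where
  le : i ≤ K + 3
  ex : ∀ l < i, Q l = .ex
  dep : ∀ w w' : ℕ → ℕ, (∀ l < K + 3, w l = w' l) → (Ψ w ↔ Ψ w')

namespace Leading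
variable (hL : Leading Q Ψ K i)
include hL

theorem QT_congr {j : ℕ} (hj : j ≤ K + 3) {v v' : ℕ → ℕ} (h : ∀ l < j, v l = v' l) :
    QT n Q dom Ψ (K + 3 - j) j v ↔ QT n Q dom Ψ (K + 3 - j) j v' :=
  QT_congr_var (fun w w' hw => hL.dep w w' fun l hl => hw l (by omega)) h

theorem QT_step {j : ℕ} (hj : j < i) {v : ℕ → ℕ} : QT n Q dom Ψ (K + 3 - j) j v ↔
    ∃ b < n, dom j b ∧ QT n Q dom Ψ (K + 3 - (j + 1)) (j + 1) (Function.update v j b) := by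
  have := hL.le
  rw [show K + 3 - j = K + 3 - (j + 1) + 1 by omega, QT, hL.ex j hj, QStep]

theorem QT_of_sol {a : ℕ → ℕ} (h : Sol n Q dom Ψ K i a) :
    ∀ j ≤ i, QT n Q dom Ψ (K + 3 - j) j a := by
  intro j hj
  induction hj using Nat.decreasingInduction with
  | self => exact h.2
  | of_succ l hl ih =>
    exact (hL.QT_step hl).2 ⟨a l, (h.1 l hl).1, (h.1 l hl).2, by rwa [Function.update_eq_self]⟩

theorem greedy_succ {j : ℕ} (hj : j < i) {a : ℕ → ℕ} {b : ℕ} (h : Greedy n Q dom Ψ K j a)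
    (hb : b < n) (hd : dom j b)
    (hq : QT n Q dom Ψ (K + 3 - (j + 1)) (j + 1) (Function.update a j b))
    (hmin : ∀ b' < b, dom j b' →
      ¬ QT n Q dom Ψ (K + 3 - (j + 1)) (j + 1) (Function.update a j b')) :
    Greedy n Q dom Ψ K (j + 1) (Function.update a j b) := by
  have hle := hL.le
  refine ⟨⟨fun l hl => ?_, hq⟩, fun l hl b' hb' hd' => ?_⟩
  · rcases Nat.lt_succ_iff_lt_or_eq.1 hl with hl | rfl
    · rw [Function.update_of_ne (by omega)]; exact h.sol.1 l hl
    · simpa using ⟨hb, hd⟩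
  · rcases Nat.lt_succ_iff_lt_or_eq.1 hl with hl | rfl
    · rw [Function.update_of_ne (by omega)] at hb'
      have := h.min l hl b' hb' hd'
      rwa [hL.QT_congr (v' := Function.update a l b') (by omega)]
      intro l' hl'
      by_cases h' : l' = l
      · subst h'; simp
      · rw [Function.update_of_ne h', Function.update_of_ne h', Function.update_of_ne (by omega)]
    · simpa using hmin b' (by simpa using hb') hd'

theorem exists_greedy {a₀ : ℕ → ℕ} (h : Sol n Q dom Ψ K i a₀) :
    ∀ j ≤ i, ∃ a, Greedy n Q dom Ψ K j a := by
  classical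
  intro j
  induction j with
  | zero =>
    refine fun _ => ⟨a₀, ⟨fun l hl => by omega, ?_⟩, fun l hl => by omega⟩
    exact hL.QT_of_sol h 0 (Nat.zero_le _)
  | succ j ih =>
    intro hj
    obtain ⟨a, ha⟩ := ih (by omega)
    have hex := (hL.QT_step hj).1 ha.sol.2
    obtain ⟨h1, h2, h3⟩ := Nat.find_spec hex
    refine ⟨_, hL.greedy_succ hj ha h1 h2 h3 fun b' hb' hd' hq => ?_⟩
    exact Nat.find_min hex hb' ⟨hb'.trans h1, hd', hq⟩

/-- A choice in the restricted domains that makes the rest true is a solution that agrees with `a`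
before `j` and is smaller at `j`. Its component at `j` would contradict the minimal choice. -/
theorem noSol_of_greedy {a : ℕ → ℕ} (h : Greedy n Q dom Ψ K i a) {j : ℕ} (hj : j < i) :
    NoSol n Q (restr dom a j) Ψ K i := by
  have hle := hL.le
  intro v hv hd hq
  have hsol : Sol n Q dom Ψ K i v := by
    refine ⟨fun l hl => ⟨hv l hl, ?_⟩, ?_⟩
    · have := hd l hl
      unfold restr at this
      split_ifs at this with h1 h2
      · rw [this]; exact (h.sol.1 l hl).2
      · exact this.1
      · exact this
    · refine (QT_congr_dom fun l hl => ?_).1 hq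
      funext b
      simp only [restr, if_neg (show ¬ l < j by omega), if_neg (show ¬ l = j by omega)]
  have hj' := hd j hj
  simp only [restr, lt_irrefl, if_false, if_true] at hj'
  refine h.min j hj (v j) hj'.2 hj'.1 ?_
  refine (hL.QT_congr (by omega) fun l hl => ?_).1 (hL.QT_of_sol hsol (j + 1) hj)
  rcases Nat.lt_succ_iff_lt_or_eq.1 hl with hl | rfl
  · have := hd l (by omega)
    simp only [restr, if_pos hl] at this
    rw [Function.update_of_ne (by omega), this]
  · simp

/-- A solution that differs from the greedy one is larger at the first difference. -/
theorem first_difference {g a : ℕ → ℕ} (hg : Greedy n Q dom Ψ K i g) (ha : Sol n Q dom Ψ K i a) :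
    (∀ l < i, a l = g l) ∨ ∃ j < i, (∀ l < j, a l = g l) ∧ g j < a j := by
  classical
  have hle := hL.le
  by_cases h : ∃ l, l < i ∧ a l ≠ g l
  · right
    obtain ⟨h1, h2⟩ := Nat.find_spec h
    have h3 : ∀ l < Nat.find h, a l = g l := fun l hl => by
      by_contra hne
      exact Nat.find_min h hl ⟨hl.trans h1, hne⟩
    refine ⟨_, h1, h3, lt_of_le_of_ne (not_lt.1 fun hlt => ?_) (Ne.symm h2)⟩
    refine hg.min _ h1 _ hlt (ha.1 _ h1).2 ?_
    refine (hL.QT_congr (by omega) fun l hl => ?_).1 (hL.QT_of_sol ha (Nat.find h + 1) h1)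
    rcases Nat.lt_succ_iff_lt_or_eq.1 hl with hl | rfl
    · rw [Function.update_of_ne (by omega), h3 l hl]
    · simp
  · left
    push Not at h
    exact h

/-- At the first difference the greedy solution itself lies in the domains restricted by the larger
candidate. -/
theorem not_noSol {g a : ℕ → ℕ} (hg : Greedy n Q dom Ψ K i g) {j : ℕ} (hj : j < i)
    (h1 : ∀ l < j, a l = g l) (h2 : g j < a j) : ¬ NoSol n Q (restr dom a j) Ψ K i := by
  refine fun h => h g (fun l hl => (hg.sol.1 l hl).1) (fun l hl => ?_) ?_
  · unfold restr
    split_ifs with h3 h4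
    · exact (h1 l h3).symm
    · subst h4; exact ⟨(hg.sol.1 l hl).2, h2⟩
    · exact (hg.sol.1 l hl).2
  · refine (QT_congr_dom fun l hl => ?_).1 hg.sol.2
    funext b
    simp only [restr, if_neg (show ¬ l < j by omega), if_neg (show ¬ l = j by omega)]

end Leading

theorem Sol.congr (hL : Leading Q Ψ K i) {a a' : ℕ → ℕ} (h : ∀ l < i, a l = a' l)
    (ha : Sol n Q dom Ψ K i a) : Sol n Q dom Ψ K i a' :=
  ⟨fun l hl => h l hl ▸ ha.1 l hl, (hL.QT_congr hL.le h).1 ha.2⟩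

end

/-! ### The search problem in terms of numbers -/

section
variable {n : ℕ} {Q : ℕ → Quant} {dom : ℕ → ℕ → Prop} {Ψ : (ℕ → ℕ) → Prop}

/-- The assignment that is `w` on the variables from `j` on and `v` elsewhere. -/
def overlay {r : ℕ} (j : ℕ) (w : Fin r → Fin n) (v : ℕ → ℕ) (l : ℕ) : ℕ :=
  if h : j ≤ l ∧ l - j < r then w ⟨l - j, h.2⟩ else v l

theorem overlay_cons {r j : ℕ} (a : Fin n) (w : Fin r → Fin n) (v : ℕ → ℕ) :
    overlay j (Fin.cons a w : Fin (r + 1) → Fin n) v = overlay (j + 1) w (Function.update v j a) := by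
  funext l
  unfold overlay
  rcases lt_trichotomy l j with h | rfl | h
  · rw [dif_neg (by omega), dif_neg (by omega), Function.update_of_ne (by omega)]
  · rw [dif_pos (by omega), dif_neg (by omega)]
    simp
  · by_cases h' : l - j < r + 1
    · rw [dif_pos ⟨by omega, h'⟩, dif_pos ⟨by omega, by omega⟩]
      have : (⟨l - j, h'⟩ : Fin (r + 1)) = Fin.succ ⟨l - (j + 1), by omega⟩ := by
        ext; simp; omega
      rw [this, Fin.cons_succ]
    · rw [dif_neg (by omega), dif_neg (by omega), Function.update_of_ne (by omega)]

/-- `Qf`, `X` and `ψ` are the quantifiers, domains and formula from the variable `j` on. -/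
structure Describes (Q : ℕ → Quant) (dom : ℕ → ℕ → Prop) (Ψ : (ℕ → ℕ) → Prop) {r : ℕ} (j : ℕ)
    (v : ℕ → ℕ) (Qf : Fin r → Quant) (X : Fin r → Finset (Fin n)) (ψ : (Fin r → Fin n) → Prop) :
    Prop where
  quant : ∀ l : Fin r, Q (j + l) = Qf l
  dom : ∀ (l : Fin r) (a : Fin n), dom (j + l) a ↔ a ∈ X l
  body : ∀ w, ψ w ↔ Ψ (overlay j w v)

theorem Describes.tail {r j : ℕ} {v : ℕ → ℕ} {Qf : Fin (r + 1) → Quant}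
    {X : Fin (r + 1) → Finset (Fin n)} {ψ : (Fin (r + 1) → Fin n) → Prop}
    (h : Describes Q dom Ψ j v Qf X ψ) (a : Fin n) :
    Describes Q dom Ψ (j + 1) (Function.update v j a) (Fin.tail Qf) (Fin.tail X)
      fun w => ψ (Fin.cons a w) where
  quant l := by rw [Fin.tail, ← h.quant, Fin.val_succ]; congr 1; omega
  dom l b := by rw [Fin.tail, ← h.dom, Fin.val_succ]; rw [show j + 1 + (l : ℕ) = j + (l + 1) by omega]
  body w := by rw [h.body, overlay_cons]

theorem quantified_iff : ∀ {r j : ℕ} {v : ℕ → ℕ} {Qf : Fin r → Quant}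
    {X : Fin r → Finset (Fin n)} {ψ : (Fin r → Fin n) → Prop}, Describes Q dom Ψ j v Qf X ψ →
    (Quantified r Qf X ψ ↔ QT n Q dom Ψ r j v) := by
  intro r
  induction r with
  | zero =>
    intro j v Qf X ψ h
    rw [Quantified, h.body, QT]
    have : overlay j (Fin.elim0 : Fin 0 → Fin n) v = v := by
      funext l; simp [overlay]
    rw [this]
  | succ r ih =>
    intro j v Qf X ψ h
    have hq := h.quant 0
    have hd := h.dom 0
    simp only [Fin.val_zero, add_zero] at hq hd
    rw [Quantified, QT, hq]
    cases Qf 0 with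
    | ex =>
      simp only [QStep]
      constructor
      · rintro ⟨a, ha, h'⟩
        exact ⟨a, a.2, (hd a).2 ha, (ih (h.tail a)).1 h'⟩
      · rintro ⟨a, hn, ha, h'⟩
        exact ⟨⟨a, hn⟩, (hd ⟨a, hn⟩).1 ha, (ih (h.tail ⟨a, hn⟩)).2 h'⟩
    | all =>
      simp only [QStep]
      constructor
      · intro h' a hn ha
        exact (ih (h.tail ⟨a, hn⟩)).1 (h' ⟨a, hn⟩ ((hd ⟨a, hn⟩).1 ha))
      · intro h' a ha
        exact (ih (h.tail a)).2 (h' a a.2 ((hd a).2 ha))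

/-- The requirement that `a` agrees with `v` outside the block makes the assignment unique. It
carries the values chosen so far through the induction and forces `a = v` when the block is
exhausted. -/
theorem isSetting_iff : ∀ {r i j : ℕ} {v : ℕ → ℕ} {Qf : Fin r → Quant}
    {X : Fin r → Finset (Fin n)} {ψ : (Fin r → Fin n) → Prop}, Describes Q dom Ψ j v Qf X ψ →
    i ≤ r → (∀ l < i, Q (j + l) = .ex) → (i < r → Q (j + i) = .all) → ∀ y : List ℕ,
    ((∃ l : List (Fin n), y = l.map (fun a : Fin n => (a : ℕ)) ∧ IsSetting r Qf X ψ l) ↔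
      ∃ a : ℕ → ℕ, y = (List.range i).map (fun l => a (j + l)) ∧ (∀ l, l < j ∨ j + i ≤ l → a l = v l) ∧
        (∀ l < i, a (j + l) < n ∧ dom (j + l) (a (j + l))) ∧ QT n Q dom Ψ (r - i) (j + i) a) := by
  intro r i
  induction i generalizing r with
  | zero =>
    intro j v Qf X ψ h _ _ hall y
    have hS : ∀ l : List (Fin n), IsSetting r Qf X ψ l ↔ l = [] ∧ QT n Q dom Ψ r j v := by
      intro l
      cases r with
      | zero => rw [IsSetting, ← quantified_iff h, Quantified]
      | succ r =>
        have hq := h.quant 0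
        simp only [Fin.val_zero, add_zero] at hq
        have := hall (by omega)
        rw [add_zero, hq] at this
        rw [IsSetting, this, ← quantified_iff h]
    simp only [hS, List.range_zero, List.map_nil, add_zero, Nat.sub_zero]
    constructor
    · rintro ⟨l, rfl, rfl, h'⟩
      exact ⟨v, rfl, fun _ _ => rfl, fun l hl => by omega, h'⟩
    · rintro ⟨a, rfl, hv, _, h'⟩
      have : a = v := funext fun l => hv l (lt_or_ge l j)
      exact ⟨[], rfl, rfl, this ▸ h'⟩
  | succ i ih =>
    intro j v Qf X ψ h hi hex hall y
    obtain ⟨r, rfl⟩ : ∃ r', r = r' + 1 := ⟨r - 1, by omega⟩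
    have hq := h.quant 0
    have hd := h.dom 0
    simp only [Fin.val_zero, add_zero] at hq hd
    have h0 := hex 0 (by omega)
    rw [add_zero, hq] at h0
    have IH := fun a : Fin n => ih (h.tail a) (by omega)
      (fun l hl => by rw [show j + 1 + l = j + (l + 1) by omega]; exact hex _ (by omega))
      (fun hl => by rw [show j + 1 + i = j + (i + 1) by omega]; exact hall (by omega))
    have hshift : ∀ a : ℕ → ℕ, (List.range (i + 1)).map (fun l => a (j + l)) =
        a j :: (List.range i).map (fun l => a (j + 1 + l)) := by
      intro a
      rw [List.range_succ_eq_map, List.map_cons, List.map_map]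
      simp only [add_zero, List.cons.injEq, true_and]
      exact List.map_congr_left fun l _ => by simp [Nat.add_comm 1 l, Nat.add_assoc]
    simp only [IsSetting, h0, hshift]
    constructor
    · rintro ⟨l, rfl, b, hb, l', rfl, h'⟩
      obtain ⟨a, h1, h2, h3, h4⟩ := (IH b (l'.map fun a : Fin n => (a : ℕ))).1 ⟨l', rfl, h'⟩
      have hab : a j = b := by rw [h2 j (.inl (by omega))]; simp
      refine ⟨a, by rw [List.map_cons, h1, hab], fun l hl => ?_, fun l hl => ?_, ?_⟩
      · rw [h2 l (by omega), Function.update_of_ne (by omega)]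
      · cases l with
        | zero => rw [add_zero, hab]; exact ⟨b.2, (hd b).2 hb⟩
        | succ l => rw [show j + (l + 1) = j + 1 + l by omega]; exact h3 l (by omega)
      · rwa [show r + 1 - (i + 1) = r - i by omega, show j + (i + 1) = j + 1 + i by omega]
    · rintro ⟨a, rfl, h2, h3, h4⟩
      obtain ⟨hj, hdj⟩ := h3 0 (by omega)
      rw [add_zero] at hj hdj
      have h7 : ∀ l, l < j + 1 ∨ j + 1 + i ≤ l → a l = Function.update v j (a j) l := by
        intro l hl
        by_cases hlj : l = j
        · subst hlj; simp
        · rw [Function.update_of_ne hlj, h2 l (by omega)]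
      obtain ⟨l', h5, h6⟩ := (IH ⟨a j, hj⟩ ((List.range i).map fun l => a (j + 1 + l))).2
        ⟨a, rfl, h7, fun l hl => by
          rw [show j + 1 + l = j + (l + 1) by omega]; exact h3 _ (by omega), by
          rwa [show r - i = r + 1 - (i + 1) by omega, show j + 1 + i = j + (i + 1) by omega]⟩
      exact ⟨⟨a j, hj⟩ :: l', by rw [List.map_cons, h5], ⟨a j, hj⟩, (hd ⟨a j, hj⟩).1 hdj, l', rfl, h6⟩

end

/-! ### Patterns of a quantifier-free formula -/

section
variable {k n : ℕ}

/-- The relations between the values of the variables, in the graph `G`. -/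
noncomputable def patternOf (G : SimpleGraph (Fin n)) (v : Fin k → Fin n) (i j : Fin k) : Fin 3 :=
  open Classical in if i < j then if v i = v j then 2 else if G.Adj (v i) (v j) then 1 else 0 else 0

theorem patternOf_eq {n' : ℕ} {G : SimpleGraph (Fin n)} {G' : SimpleGraph (Fin n')} {v : Fin k → Fin n}
    {v' : Fin k → Fin n'} (h : patternOf G v = patternOf G' v') (i j : Fin k) :
    (v i = v j ↔ v' i = v' j) ∧ (G.Adj (v i) (v j) ↔ G'.Adj (v' i) (v' j)) := by
  have key : ∀ i j : Fin k, i < j →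
      (v i = v j ↔ v' i = v' j) ∧ (G.Adj (v i) (v j) ↔ G'.Adj (v' i) (v' j)) := by
    intro i j hij
    have := congrFun (congrFun h i) j
    simp only [patternOf, if_pos hij] at this
    by_cases h1 : v i = v j <;> by_cases h2 : v' i = v' j <;>
      by_cases h3 : G.Adj (v i) (v j) <;> by_cases h4 : G'.Adj (v' i) (v' j) <;>
      simp_all
  rcases lt_trichotomy i j with hij | rfl | hij
  · exact key i j hij
  · simp
  · have := key j i hij
    rwa [eq_comm, G.adj_comm, eq_comm (a := v' i), G'.adj_comm]

/-- The language has no function symbols, so with no bound variables every term is a free variable.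
The truth of a quantifier-free formula is then a Boolean combination of equalities and adjacencies
of values. -/
theorem realize_congr {n' : ℕ} {G : SimpleGraph (Fin n)} {G' : SimpleGraph (Fin n')}
    {v : Fin k → Fin n} {v' : Fin k → Fin n'}
    (h : ∀ i j, (v i = v j ↔ v' i = v' j) ∧ (G.Adj (v i) (v j) ↔ G'.Adj (v' i) (v' j)))
    {m : ℕ} {ψ : FirstOrder.Language.graph.BoundedFormula (Fin k) m} (hψ : ψ.IsQF) (hm : m = 0)
    (xs : Fin m → Fin n) (xs' : Fin m → Fin n') :
    @FirstOrder.Language.BoundedFormula.Realize _ _ G.structure _ _ ψ v xs ↔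
      @FirstOrder.Language.BoundedFormula.Realize _ _ G'.structure _ _ ψ v' xs' := by
  subst hm
  let := G.structure
  let := G'.structure
  have hterm : ∀ t : FirstOrder.Language.graph.Term (Fin k ⊕ Fin 0),
      ∃ i, t = .var (.inl i) := by
    intro t
    cases t with
    | var x =>
      rcases x with x | x
      · exact ⟨x, rfl⟩
      · exact x.elim0
    | func f _ => exact isEmptyElim f
  induction hψ with
  | falsum => rfl
  | of_isAtomic hat =>
    cases hat with
    | equal t₁ t₂ =>
      obtain ⟨i, rfl⟩ := hterm t₁
      obtain ⟨j, rfl⟩ := hterm t₂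
      exact (h i j).1
    | rel R ts =>
      cases R
      obtain ⟨i, hi⟩ := hterm (ts 0)
      obtain ⟨j, hj⟩ := hterm (ts 1)
      have hts : ts = ![.var (.inl i), .var (.inl j)] := by
        funext l; fin_cases l
        · exact hi
        · exact hj
      subst hts
      have := (h i j).2
      exact this
  | imp _ _ ih1 ih2 =>
    simp only [FirstOrder.Language.BoundedFormula.realize_imp, ih1, ih2]

/-- The patterns of the assignments that satisfy `P`. -/
noncomputable def patterns (k : ℕ) (P : ∀ n, SimpleGraph (Fin n) → (Fin k → Fin n) → Prop) :
    List (ℕ → ℕ → Fin 3) :=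
  open Classical in
  (Finset.univ.filter fun f : Fin k → Fin k → Fin 3 => ∃ n G v, f = patternOf G v ∧ P n G v).toList.map
    fun f i j => if h : i < k ∧ j < k then f ⟨i, h.1⟩ ⟨j, h.2⟩ else 0

/-- The relation of two vertices: `2` if they are equal, `1` if they are adjacent. -/
noncomputable def relOf (G : SimpleGraph (Fin n)) (u v : ℕ) : Fin 3 :=
  open Classical in if u = v then 2 else if ∃ hu hv, G.Adj ⟨u, hu⟩ ⟨v, hv⟩ then 1 else 0

/-- The list is fixed before any graph is given: it contains the patterns realized with `P` by some
graph of any size, of which there are finitely many. By `hP` the truth of `P` depends on the pattern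
only, so membership of the pattern of `v` in the list decides it. This is why the programs depend
only on the formula. -/
theorem covers_patterns {P : ∀ n, SimpleGraph (Fin n) → (Fin k → Fin n) → Prop}
    (hP : ∀ {n n'} {G : SimpleGraph (Fin n)} {G' : SimpleGraph (Fin n')} {v v'},
      patternOf G v = patternOf G' v' → (P n G v ↔ P n' G' v'))
    (G : SimpleGraph (Fin n)) {Ψ : (ℕ → ℕ) → Prop}
    (hΨ : ∀ w : Fin k → Fin n, ∀ v : ℕ → ℕ, (∀ i : Fin k, v i = w i) → (Ψ v ↔ P n G w)) :
    Covers n (relOf G) k (patterns k P) Ψ := by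
  classical
  intro v hv
  set w : Fin k → Fin n := fun i => ⟨v i, hv i i.2⟩ with hw
  have hm : ∀ f ∈ (Finset.univ.filter fun f : Fin k → Fin k → Fin 3 => ∃ n G v, f = patternOf G v ∧ P n G v),
      (Matches (relOf G) k (fun i j => if h : i < k ∧ j < k then f ⟨i, h.1⟩ ⟨j, h.2⟩ else 0) v ↔
        f = patternOf G w) := by
    intro f hf
    obtain ⟨n', G', v', rfl, -⟩ := (Finset.mem_filter.1 hf).2
    constructor
    · intro h
      funext i j
      by_cases hij : i < j
      · have := h j j.2 i hij
        simp only [dif_pos (And.intro i.2 j.2), Fin.eta] at this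
        rw [← this]
        simp only [relOf, patternOf, if_pos hij, hw, Fin.mk.injEq]
        simp [hv]
      · simp only [patternOf, if_neg hij]
    · intro h j hj i hi
      have := congrFun (congrFun h ⟨i, by omega⟩) ⟨j, hj⟩
      simp only [dif_pos (And.intro (hi.trans hj) hj), this]
      have hlt : (⟨i, by omega⟩ : Fin k) < ⟨j, hj⟩ := hi
      simp only [relOf, patternOf, if_pos hlt, hw, Fin.mk.injEq]
      simp [hv i (by omega), hv j hj]
  rw [patterns, List.map_map]
  have e := Finset.sum_map_toList (Finset.univ.filter fun f : Fin k → Fin k → Fin 3 =>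
    ∃ n G v, f = patternOf G v ∧ P n G v) (fun f => ind (f = patternOf G w))
  refine (congrArg List.sum (List.map_congr_left (g := fun f => ind (f = patternOf G w))
    fun f hf => ind_congr (hm f (Finset.mem_toList.1 hf)))).trans (e.trans ?_)
  simp only [ind_eq_ite, Finset.sum_ite_eq']
  refine if_congr ?_ rfl rfl
  simp only [Finset.mem_filter, Finset.mem_univ, true_and]
  rw [hΨ w v fun i => rfl]
  constructor
  · rintro ⟨n', G', v', h1, h2⟩
    exact (hP h1).2 h2
  · exact fun h => ⟨n, G, w, rfl, h⟩

end

/-! ### Reading the input -/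

section
variable {Γ : Env} {rl : ℕ → ℕ → Fin 3} {k J K i : ℕ} {dom : ℕ → ℕ → Prop} {v : ℕ → ℕ} {s : Store}
  {role : Role} {na d : ℕ} {Q : ℕ → Quant} {S S' : List (ℕ → ℕ → Fin 3)} {Ψ : (ℕ → ℕ) → Prop}

theorem run_seqL_append (l l' : List Stmt) (s : Store) :
    (seqL (l ++ l')).run Γ s = (seqL l').run Γ ((seqL l).run Γ s) := by
  induction l generalizing s with
  | nil => rfl
  | cons c l ih => exact ih (c.run Γ s)

theorem seqL_range_inv {f : ℕ → Stmt} (I : ℕ → Store → Prop) {s : Store} (h0 : I 0 s) :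
    ∀ k : ℕ, (∀ l < k, ∀ s' : Store, I l s' → I (l + 1) ((f l).run Γ s')) →
      I k ((seqL ((List.range k).map f)).run Γ s) := by
  intro k
  induction k with
  | zero => exact fun _ => h0
  | succ k ih =>
    intro h
    rw [List.range_succ, List.map_append, run_seqL_append]
    exact h k (by omega) _ (ih fun l hl => h l (by omega))

theorem index_inj {n a b a' b' : ℕ} (hb : b < n) (hb' : b' < n) (h : a * n + b = a' * n + b') :
    a = a' ∧ b = b' := by
  have h1 := congrArg (· / n) h
  have h2 := congrArg (· % n) h
  simp only [Nat.mul_comm _ n] at h1 h2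
  rw [Nat.mul_add_div (by omega), Nat.mul_add_div (by omega), Nat.div_eq_of_lt hb,
    Nat.div_eq_of_lt hb'] at h1
  simp only [Nat.mul_add_mod, Nat.mod_eq_of_lt hb, Nat.mod_eq_of_lt hb'] at h2
  exact ⟨by simpa using h1, h2⟩

/-- The pairs `(a, b)` and `(b, a)` for the first `E` edges `a b`. -/
def Listed (Γ : Env) (E a b : ℕ) : Prop :=
  ∃ e < E, (Γ.inp (2 * e + 2) = a ∧ Γ.inp (2 * e + 3) = b) ∨
    (Γ.inp (2 * e + 3) = a ∧ Γ.inp (2 * e + 2) = b)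

/-- The edge list determines adjacency: take the indicator of `b` as test function in `sum_edges`.
-/
theorem Graphical.listed_iff (hG : Graphical Γ rl) {a b : ℕ} (ha : a < Γ.par .n)
    (hb : b < Γ.par .n) : Listed Γ (Γ.par .m) a b ↔ rl a b = 1 := by
  have h := hG.sum_edges (fun y => ind (y = b)) a ha
  rw [Finset.sum_eq_single_of_mem b (Finset.mem_range.2 hb)
    (fun c _ hc => by simp [hc])] at h
  rw [ind_pos (p := b = b) rfl, mul_one] at h
  rw [← ind_ne_zero (p := rl a b = 1), ← h, Ne, Finset.sum_eq_zero_iff]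
  simp only [Finset.mem_range, Nat.add_eq_zero_iff, Nat.mul_eq_zero, ind_eq_zero, Listed]
  push Not
  refine exists_congr fun e => and_congr_right fun he => ?_
  tauto

/-- The matrix has n^2 entries, but only those of edges and, in `loadDiag`, of the diagonal are
written. The others rely on the memory being 0 initially, so that loading takes linear time. -/
def loadEdges : Stmt :=
  .loop .e .m <| .seq (.set .t edgeFst) <| .seq (.set .y edgeSnd) <|
    .seq (.put .rel (idxE (.var .t) (.var .y)) (.const 1))
      (.put .rel (idxE (.var .y) (.var .t)) (.const 1))

def loadDiag : Stmt := .loop .t .n (.put .rel (idxE (.var .t) (.var .t)) (.const 2))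

def loadDom (l : ℕ) : Stmt :=
  .seq (fill (.dom l) (.inp (.add .W (.var .d) (.var .t)))) (.set .d (.add .W (.var .d) (.par .n)))

/-- Reads the graph and the first `k` domains. -/
def load (k : ℕ) : Stmt :=
  .seq loadEdges <| .seq loadDiag <| .seq (.set .d (.add .W (.add .W (.par .m) (.par .m)) (.const 2)))
    (seqL ((List.range k).map loadDom))

theorem index_lt {n a b : ℕ} (ha : a < n) (hb : b < n) : a * n + b < n * n := by
  have := Nat.mul_le_mul_right n (Nat.succ_le_of_lt ha)
  rw [Nat.succ_mul] at this
  omega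

theorem loadEdges_spec (hG : Graphical Γ rl) (hs : ∀ j, s.arr .rel j = 0) :
    ∀ a < Γ.par .n, ∀ b < Γ.par .n, (loadEdges.run Γ s).arr .rel (a * Γ.par .n + b) =
      ind (rl a b = 1) := by
  have := loop_inv (Γ := Γ) (v := .e) (p := .m) (body := .seq (.set .t edgeFst) <|
    .seq (.set .y edgeSnd) <| .seq (.put .rel (idxE (.var .t) (.var .y)) (.const 1))
      (.put .rel (idxE (.var .y) (.var .t)) (.const 1))) (s := s)
    (fun E s' => ∀ a < Γ.par .n, ∀ b < Γ.par .n, s'.arr .rel (a * Γ.par .n + b) = ind (Listed Γ E a b))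
    (fun a _ b _ => by rw [hs, ind_neg (by simp [Listed])]) (by
      intro e he s' _ hI a ha b hb
      obtain ⟨h1, h2⟩ := hG.edge_lt e he
      obtain ⟨e1, -⟩ := eval_edge (s := s'.setv .e e) hG (by simpa using he)
      obtain ⟨-, e2⟩ := eval_edge (s := (s'.setv .e e).setv .t (Γ.inp (2 * e + 2))) hG
        (by simpa [Store.setv_ne] using he)
      simp only [Store.setv_self, Store.setv_ne _ _ (show Var.e ≠ .t by simp)] at e1 e2
      set f := Γ.inp (2 * e + 2)
      set g := Γ.inp (2 * e + 3)
      set s1 := ((s'.setv .e e).setv .t f).setv .y g with hs1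
      have i1 : (idxE (.var .t) (.var .y)).eval Γ s1 = f * Γ.par .n + g := by
        have ht : (Expr.var .t).eval Γ s1 = f := by simp [Expr.eval, hs1, Store.setv_ne]
        have hy : (Expr.var .y).eval Γ s1 = g := by simp [Expr.eval, hs1]
        rw [eval_idxE hG.W_idx (by rwa [ht]) (by rwa [hy]), ht, hy]
      set s2 := s1.seta .rel (f * Γ.par .n + g) 1 with hs2
      have i2 : (idxE (.var .y) (.var .t)).eval Γ s2 = g * Γ.par .n + f := by
        have ht : (Expr.var .t).eval Γ s2 = f := by simp [Expr.eval, hs2, hs1, Store.setv_ne]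
        have hy : (Expr.var .y).eval Γ s2 = g := by simp [Expr.eval, hs2, hs1]
        rw [eval_idxE hG.W_idx (by rwa [hy]) (by rwa [ht]), ht, hy]
      have b1 : f * Γ.par .n + g < Γ.par .bd := (index_lt h1 h2).trans_le hG.bd_sq
      have b2 : g * Γ.par .n + f < Γ.par .bd := (index_lt h2 h1).trans_le hG.bd_sq
      have r1 : ((1 : Fin 3) : ℕ) = 1 := rfl
      have hrun : Stmt.run Γ (.seq (.set .t edgeFst) <| .seq (.set .y edgeSnd) <|
          .seq (.put .rel (idxE (.var .t) (.var .y)) (.const 1))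
          (.put .rel (idxE (.var .y) (.var .t)) (.const 1))) (s'.setv .e e) =
          s2.seta .rel (g * Γ.par .n + f) 1 := by
        simp only [Stmt.run, e1, e2, ← hs1, i1, if_pos b1]
        simp only [Expr.eval, r1, ← hs2]
        rw [i2, if_pos b2]
      rw [hrun, Store.seta_arr, hs2, Store.seta_arr, hs1]
      simp only [true_and, Store.setv_arr, hI a ha b hb]
      have hsucc : Listed Γ (e + 1) a b ↔ Listed Γ e a b ∨ (f = a ∧ g = b) ∨ (g = a ∧ f = b) := by
        simp only [Listed, Nat.lt_succ_iff_lt_or_eq, or_and_right (c := _ ∨ _), exists_or,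
          exists_eq_left]
        rfl
      rw [ind_congr hsucc]
      split_ifs with c1 c2
      · obtain ⟨rfl, rfl⟩ := index_inj hb h1 c1
        rw [ind_pos]; simp
      · obtain ⟨rfl, rfl⟩ := index_inj hb h2 c2
        rw [ind_pos]; simp
      · refine ind_congr (or_iff_left ?_).symm
        rintro (⟨rfl, rfl⟩ | ⟨rfl, rfl⟩)
        · exact c2 rfl
        · exact c1 rfl)
  intro a ha b hb
  rw [← ind_congr (hG.listed_iff ha hb)]
  exact this a ha b hb

theorem loadDiag_spec (hG : Graphical Γ rl)
    (hs : ∀ a < Γ.par .n, ∀ b < Γ.par .n, s.arr .rel (a * Γ.par .n + b) = ind (rl a b = 1)) :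
    ∀ a < Γ.par .n, ∀ b < Γ.par .n, (loadDiag.run Γ s).arr .rel (a * Γ.par .n + b) = rl a b := by
  have := loop_inv (Γ := Γ) (v := .t) (p := .n) (body := .put .rel (idxE (.var .t) (.var .t)) (.const 2))
    (s := s) (fun i s' => ∀ a < Γ.par .n, ∀ b < Γ.par .n, s'.arr .rel (a * Γ.par .n + b) =
      if a = b ∧ a < i then 2 else ind (rl a b = 1))
    (fun a ha b hb => by simp [hs a ha b hb]) (by
      intro t ht s' _ hI a ha b hb
      have i1 : (idxE (.var .t) (.var .t)).eval Γ (s'.setv .t t) = t * Γ.par .n + t := by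
        rw [eval_idxE hG.W_idx] <;> simp [Expr.eval, ht]
      simp only [Stmt.run, i1, if_pos ((index_lt ht ht).trans_le hG.bd_sq), Store.seta_arr, true_and,
        Store.setv_arr, hI a ha b hb, Expr.eval]
      by_cases h : a = t ∧ b = t
      · obtain ⟨rfl, rfl⟩ := h
        rw [if_pos rfl, if_pos (by omega)]; rfl
      · rw [if_neg fun h' => h (index_inj hb ht h')]
        refine if_congr ?_ rfl rfl
        omega)
  intro a ha b hb
  have h1 := this a ha b hb
  refine h1.trans ?_
  have hd := hG.diag a b
  by_cases h : a = b
  · rw [if_pos ⟨h, ha⟩, hd.2 h]; rfl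
  · rw [if_neg (by tauto)]
    have h2 : rl a b ≠ 2 := fun h' => h (hd.1 h')
    generalize rl a b = c at *
    fin_cases c <;> simp_all [ind]

/-- The input contains the domains, after the edges. -/
structure Stored (Γ : Env) (k : ℕ) (dom : ℕ → ℕ → Prop) : Prop where
  inp : ∀ l < k, ∀ t < Γ.par .n, Γ.inp (2 * Γ.par .m + 2 + l * Γ.par .n + t) = ind (dom l t)
  lt : 2 * Γ.par .m + 2 + k * Γ.par .n < Γ.par .W

theorem load_spec (hG : Graphical Γ rl) (hD : Stored Γ k dom) (hs : ∀ j, s.arr .rel j = 0) :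
    Good Γ rl k dom 0 v ((load k).run Γ s) := by
  have hlt := hD.lt
  have h1 := loadEdges_spec hG hs
  have h2 := loadDiag_spec hG h1
  set s1 := loadDiag.run Γ (loadEdges.run Γ s) with hs1
  have hd1 : (Stmt.run Γ (.set .d (.add .W (.add .W (.par .m) (.par .m)) (.const 2))) s1) =
      s1.setv .d (2 * Γ.par .m + 2) := by
    have r2 : ((2 : Fin 3) : ℕ) = 2 := rfl
    simp only [Stmt.run, Expr.eval, Modulus.par, r2]
    have : Γ.par .m + Γ.par .m = 2 * Γ.par .m := by ring
    rw [this, Nat.mod_eq_of_lt (a := 2 * Γ.par .m) (by omega), Nat.mod_eq_of_lt (by omega)]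
  set s2 := s1.setv .d (2 * Γ.par .m + 2) with hs2
  have key := seqL_range_inv (Γ := Γ) (f := loadDom) (s := s2) (fun l s' =>
      s'.arr .rel = s1.arr .rel ∧ s'.var .d = 2 * Γ.par .m + 2 + l * Γ.par .n ∧
      ∀ j < l, ∀ a < Γ.par .n, s'.arr (.dom j) a = ind (dom j a)) ⟨rfl, by simp [hs2], by simp⟩ k (by
    rintro l hl s' ⟨i1, i2, i3⟩
    have hle : 2 * Γ.par .m + 2 + l * Γ.par .n + Γ.par .n ≤ 2 * Γ.par .m + 2 + k * Γ.par .n := by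
      have := Nat.mul_le_mul_right (Γ.par .n) (Nat.succ_le_of_lt hl)
      rw [Nat.succ_mul] at this
      omega
    have hf := fill_spec (Γ := Γ) (A := .dom l) (e := .inp (.add .W (.var .d) (.var .t))) s'
      hG.n_le_bd (by simp)
    have hF := run_frame (Γ := Γ) (fill (.dom l) (.inp (.add .W (.var .d) (.var .t)))) s'
    set s3 := (fill (.dom l) (.inp (.add .W (.var .d) (.var .t)))).run Γ s'
    refine ⟨?_, ?_, fun j hj a ha => ?_⟩
    · rw [← i1]; exact hF.arr _ (by simp)
    · have hd : s3.var .d = s'.var .d := hF.var _ (by simp)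
      change (s3.setv .d ((s3.var .d + Γ.par .n) % Γ.par .W)).var .d = _
      rw [Store.setv_self, hd, i2, Nat.mod_eq_of_lt (by omega), Nat.succ_mul]; ring
    · change s3.arr (.dom j) a = _
      rcases Nat.lt_succ_iff_lt_or_eq.1 hj with hj | rfl
      · rw [← i3 j hj a ha, hF.arr _ (by simp; omega)]
      · rw [hf a ha]
        simp only [Expr.eval, Store.setv_self, Store.setv_ne _ _ (show Var.d ≠ .t by simp), i2,
          Modulus.par]
        rw [Nat.mod_eq_of_lt (by omega), hD.inp j hl a ha])
  have hrun : (load k).run Γ s = (seqL ((List.range k).map loadDom)).run Γ s2 := by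
    rw [← hd1]; rfl
  rw [hrun]
  exact ⟨fun a ha b hb => by rw [key.1]; exact h2 a ha b hb, key.2.2, fun j hj => by omega,
    fun j hj => by omega⟩

@[simp] theorem load_quiet : (load k).Quiet := by
  simp [load, loadEdges, loadDiag, loadDom]

theorem load_fits (h : k + 11 ≤ na) : (load k).Fits role na (d + 1) := by
  have h0 : 0 < na := by omega
  simp only [load, loadEdges, loadDiag, loadDom, Stmt.Fits, edgeFst, edgeSnd, idxE, Expr.UsesBelow,
    seqL_fits, List.mem_map, List.mem_range, forall_exists_index, and_imp,
    forall_apply_eq_imp_iff₂, fill_fits, Arr.code, Par.IsLength, h0, and_true, true_and]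
  intro l hl
  omega

/-! ### Changing the domains -/

/-- Replaces the domain `j` by its elements below `a j`. -/
def narrow (j : ℕ) : Stmt :=
  fill (.dom j) (andL [domE j (.var .t), .bin .lt (.var .t) (.var (.a j))])

/-- Replaces the domain `j` by `{a j}`. -/
def pin (j : ℕ) : Stmt := fill (.dom j) (.bin .eq (.var .t) (.var (.a j)))

/-- The domains where the first `j` are replaced by the singletons of the components of `a`. -/
def pinned (dom : ℕ → ℕ → Prop) (a : ℕ → ℕ) (j l b : ℕ) : Prop :=
  if l < j then b = a l else dom l b

/-- Once the first `j` domains are singletons, cutting the domain `j` gives the restricted domains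
for `j`; afterwards `pin` turns it into a singleton and prepares the next index. -/
theorem narrow_spec (hG : Graphical Γ rl) {a : ℕ → ℕ} {j : ℕ} (hj : j < k)
    (h : Good Γ rl k (pinned dom a j) 0 v s) (ha : s.var (.a j) = a j) :
    Good Γ rl k (restr dom a j) 0 v ((narrow j).run Γ s) := by
  have hF := run_frame (Γ := Γ) (narrow j) s
  refine ⟨fun a ha b hb => ?_, fun l hl b hb => ?_, fun j hj => by omega, fun j hj => by omega⟩
  · rw [hF.arr _ (by simp [narrow]), h.rel a ha b hb]
  · by_cases hlj : l = j
    · subst hlj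
      have := fill_inplace (Γ := Γ) (A := .dom l) (s := s)
        (e := andL [domE l (.var .t), .bin .lt (.var .t) (.var (.a l))])
        (f := fun b => ind (restr dom a l l b)) hG.n_le_bd (by
          intro b hb s' ht hv _ hA
          have hd := h.dom l hl b hb
          have hav : s'.var (.a l) = a l := by rw [hv _ (by simp), ha]
          rw [eval_andL hG.one_lt_W]
          · refine ind_congr ?_
            simp only [List.mem_cons, List.not_mem_nil, or_false, forall_eq_or_imp, forall_eq, domE,
              Expr.eval, BinOp.eval, ht, hA b le_rfl, hd, ind_ne_zero, pinned, restr, lt_irrefl,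
              if_false, if_true, hav]
            simp
          · simp only [List.mem_cons, List.not_mem_nil, or_false, forall_eq_or_imp, forall_eq, domE,
              Expr.eval, BinOp.eval, ht, hA b le_rfl, hd]
            exact ⟨ind_le_one _, by split_ifs <;> omega⟩)
      exact this b hb
    · rw [hF.arr _ (by simp [narrow, hlj]), h.dom l hl b hb]
      simp only [pinned, restr, hlj, if_false]

theorem pin_spec (hG : Graphical Γ rl) {a : ℕ → ℕ} {j : ℕ} (hj : j < k)
    (h : Good Γ rl k (restr dom a j) 0 v s) (ha : s.var (.a j) = a j) :
    Good Γ rl k (pinned dom a (j + 1)) 0 v ((pin j).run Γ s) := by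
  have hF := run_frame (Γ := Γ) (pin j) s
  refine ⟨fun a ha b hb => ?_, fun l hl b hb => ?_, fun j hj => by omega, fun j hj => by omega⟩
  · rw [hF.arr _ (by simp [pin]), h.rel a ha b hb]
  · by_cases hlj : l = j
    · subst hlj
      rw [pin, fill_spec s hG.n_le_bd (by simp) b hb]
      simp [Expr.eval, BinOp.eval, Store.setv_ne, ha, pinned, ind_eq_ite]
    · rw [hF.arr _ (by simp [pin, hlj]), h.dom l hl b hb]
      simp only [pinned, restr, hlj, if_false]
      refine ind_congr ?_
      by_cases h1 : l < j
      · rw [if_pos h1, if_pos (by omega)]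
      · rw [if_neg h1, if_neg (by omega)]

theorem narrow_fits {j : ℕ} (h : j + 11 < na) : (narrow j).Fits role na (d + 1) := by
  simp [narrow, Arr.code, h]

theorem pin_fits {j : ℕ} (h : j + 11 < na) : (pin j).Fits role na (d + 1) := by
  simp [pin, Arr.code, h]

end

/-! ### The programs of the two parties -/

/-- The admissible primes. -/
def Valid (n q : ℕ) : Prop := 12 * n < q ∧ q ≤ 24 * n ∧ q.Prime

/-- Since q ≤ 24 n < (12 n)^2, a composite q has a divisor below 12 n, and q itself is not among the
numbers tested. So one loop of length 12 n tests primality; a prime above n^2 would be too expensive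
to test like this. -/
theorem valid_iff {n q : ℕ} (hn : 0 < n) :
    Valid n q ↔ 12 * n < q ∧ q ≤ 24 * n ∧ ∀ t < 12 * n, ¬ (1 < t ∧ q % t = 0) := by
  refine and_congr_right fun h1 => and_congr_right fun h2 => ⟨fun hq t ht => ?_, fun h => ?_⟩
  · rintro ⟨h3, h4⟩
    rcases (Nat.dvd_prime hq).1 (Nat.dvd_of_mod_eq_zero h4) with rfl | rfl <;> omega
  · by_contra hq
    have h3 : q.minFac ^ 2 ≤ q := Nat.minFac_sq_le_self (by omega) hq
    have h4 : 1 < q.minFac := (Nat.minFac_prime (by omega)).one_lt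
    refine h q.minFac ?_ ⟨h4, Nat.mod_eq_zero_of_dvd (Nat.minFac_dvd q)⟩
    by_contra h5
    have h6 : 12 * n ≤ q.minFac := by omega
    nlinarith

/-- The number with the binary digits `coin 0, …, coin (τ - 1)`. -/
def num (coin : ℕ → Bool) : ℕ → ℕ
  | 0 => 0
  | c + 1 => 2 * num coin c + if coin c then 1 else 0

theorem num_lt (coin : ℕ → Bool) (c : ℕ) : num coin c < 2 ^ c := by
  induction c with
  | zero => simp [num]
  | succ c ih => rw [num, pow_succ]; split_ifs <;> omega

/-- Clears `ok` if `n` has a small divisor. -/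
def noDivisor : Stmt := .loop .t .big <| require <|
  notE (andL [.bin .lt (.const 1) (.var .t), notE (.bin .mod (.var .n) (.var .t))])

/-- Receives the prime, and replaces it by some other number if it is not admissible. -/
def recvPrime : Stmt :=
  .seq (.recv .n) <| .seq (.set .ok (.const 1)) <| .seq (require (.bin .lt (.par .big) (.var .n))) <|
    .seq (require (notE (.bin .lt (.add .W (.par .big) (.par .big)) (.var .n)))) <| .seq noDivisor <|
    .ite (.var .ok) .skip (.set .n (.add .W (.par .big) (.const 1)))

/-- Chooses a random number `r`. -/
def toss : Stmt :=
  .seq (.set .r (.const 0)) <| .seq (.set .pow (.const 1)) <| .loop .t .big <|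
    .ite (notE (.bin .lt (.par .big) (.add .W (.var .pow) (.var .pow))))
      (.seq (.flip .g) <| .seq (.set .r (.add .W (.add .W (.var .r) (.var .r)) (.var .g)))
        (.set .pow (.add .W (.var .pow) (.var .pow)))) .skip

/-- Finds an admissible prime and sends it. -/
def findPrime : Stmt :=
  .seq (.loop .i .big <| .seq (.set .n (.add .W (.add .W (.par .big) (.var .i)) (.const 1))) <|
    .seq (.set .ok (.const 1)) <| .seq noDivisor <| .ite (.var .ok) (.set .d (.var .n)) .skip) <|
  .seq (.set .n (.var .d)) (.send (.var .n))

/-- Receives the component `l` of the solution. -/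
def readSol (l : ℕ) : Stmt :=
  .seq (.recv (.a l)) <| .seq (.set (.a l) (.bin .mod (.var (.a l)) (.par .n))) <|
    .seq (require (domE l (.var (.a l)))) (.set (.x l) (.var (.a l)))

/-- Finds the component `j` of the canonical solution and sends it. -/
def chooseSol (K : ℕ) (Q : ℕ → Quant) (S S' : List (ℕ → ℕ → Fin 3)) (j : ℕ) : Stmt :=
  .seq (.set .d (.const 0)) <|
  .seq (.loop .i .n <| .ite (andL [notE (.var .d), domE j (.var .i)])
    (.seq (.set (.x j) (.var .i)) <| .seq (evalAt K Q S S' (j + 1)) <|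
      .ite (.var .res) (.seq (.set (.a j) (.var .i)) (.set .d (.const 1))) .skip) .skip) <|
  .seq (.set (.x j) (.var (.a j))) (.send (.var (.a j)))

/-- Runs the protocol for each component of the solution. -/
def stage (body : Stmt) (j : ℕ) : Stmt := .seq (narrow j) (.seq body (pin j))

section
variable {Γ : Env} {rl : ℕ → ℕ → Fin 3} {k J K i : ℕ} {dom : ℕ → ℕ → Prop} {v : ℕ → ℕ} {s : Store}
  {role : Role} {na d : ℕ} {Q : ℕ → Quant} {S S' : List (ℕ → ℕ → Fin 3)} {Ψ : (ℕ → ℕ) → Prop}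

theorem noDivisor_spec (hW : 1 < Γ.par .W) (hok : s.var .ok ≤ 1) : (noDivisor.run Γ s).var .ok =
    ind (s.var .ok = 1 ∧ ∀ t < Γ.par .big, ¬ (1 < t ∧ s.var .n % t = 0)) := by
  refine require_loop hW hok (by simp) fun t ht s' hv _ hx => ?_
  have r1 : ((1 : Fin 3) : ℕ) = 1 := rfl
  rw [eval_notE, eval_andL hW]
  · simp only [ind_eq_zero]
    refine ind_congr (not_congr ?_)
    simp [Expr.eval, BinOp.eval, hx, hv .n (by simp) (by simp)]
  · simp only [List.mem_cons, List.not_mem_nil, or_false, forall_eq_or_imp, forall_eq, Expr.eval,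
      BinOp.eval, notE]
    constructor <;> exact (ind_eq_ite _).symm.trans_le (ind_le_one _)

/-- An inadmissible word already clears `ok`. It is nevertheless replaced by 12 n + 1, because the
modulus of the second phase must stay within the bounds required for the simulation against every
prover. -/
theorem recvPrime_spec (hn : 0 < Γ.par .n) (hb : Γ.par .big = 12 * Γ.par .n)
    (hW : 2 * Γ.par .big + 1 < Γ.par .W) :
    (recvPrime.run Γ s).pos = s.pos + 1 ∧
      (recvPrime.run Γ s).var .ok = ind (Valid (Γ.par .n) (Γ.word s.pos)) ∧
      12 * Γ.par .n < (recvPrime.run Γ s).var .n ∧ (recvPrime.run Γ s).var .n ≤ 24 * Γ.par .n ∧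
      (Valid (Γ.par .n) (Γ.word s.pos) → (recvPrime.run Γ s).var .n = Γ.word s.pos) := by
  have r1 : ((1 : Fin 3) : ℕ) = 1 := rfl
  have hW1 : 1 < Γ.par .W := by omega
  set q := Γ.word s.pos with hq
  set s1 : Store := (Stmt.set .ok (.const 1)).run Γ ((Stmt.recv .n).run Γ s) with hs1
  have o1 : s1.var .ok = 1 := by simp [hs1, Stmt.run, Expr.eval]
  have n1 : s1.var .n = q := by simp [hs1, Stmt.run, Expr.eval, Store.setv_ne, hq]
  have p1 : s1.pos = s.pos + 1 := by simp [hs1, Stmt.run]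
  set s2 := (require (.bin .lt (.par .big) (.var .n))).run Γ s1 with hs2
  have o2 : s2.var .ok = ind (Γ.par .big < q) := by
    have := require_spec (s := s1) (e := .bin .lt (.par .big) (.var .n)) (A := Γ.par .big < q) hW1
      (by omega) (by simp [Expr.eval, BinOp.eval, n1, ind_eq_ite])
    simp only [hs2, require, Stmt.run, Store.setv_self, this, o1, true_and]
  have n2 : s2.var .n = q := by rw [hs2, run_var _ (by simp), n1]
  set s3 := (require (notE (.bin .lt (.add .W (.par .big) (.par .big)) (.var .n)))).run Γ s2 with hs3
  have o3 : s3.var .ok = ind (Γ.par .big < q ∧ q ≤ 2 * Γ.par .big) := by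
    have := require_spec (s := s2) (e := notE (.bin .lt (.add .W (.par .big) (.par .big)) (.var .n)))
      (A := q ≤ 2 * Γ.par .big) hW1 (by rw [o2]; exact ind_le_one _) (by
        rw [eval_notE]
        refine ind_congr ?_
        simp only [Expr.eval, BinOp.eval, Modulus.par, n2]
        rw [Nat.mod_eq_of_lt (by omega)]
        split_ifs <;> simp <;> omega)
    simp only [hs3, require, Stmt.run, Store.setv_self, this, o2, ind_eq_one]
  have n3 : s3.var .n = q := by rw [hs3, run_var _ (by simp), n2]
  have o4 := noDivisor_spec (Γ := Γ) (s := s3) hW1 (by rw [o3]; exact ind_le_one _)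
  have n4 : (noDivisor.run Γ s3).var .n = q := by rw [run_var _ (by simp [noDivisor]), n3]
  have p4 : (noDivisor.run Γ s3).pos = s.pos + 1 := by
    rw [(run_quiet s3 (by simp [noDivisor])).1, ← p1]; rfl
  set s4 := noDivisor.run Γ s3 with hs4
  have hiff : (s3.var .ok = 1 ∧ ∀ t < Γ.par .big, ¬ (1 < t ∧ s3.var .n % t = 0)) ↔
      Valid (Γ.par .n) q := by
    rw [valid_iff hn, o3, ind_eq_one, hb, n3]
    simp only [← mul_assoc, and_assoc]
    norm_num
  rw [ind_congr hiff] at o4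
  have hrun : recvPrime.run Γ s =
      (Stmt.ite (.var .ok) .skip (.set .n (.add .W (.par .big) (.const 1)))).run Γ s4 := rfl
  rw [hrun]
  have he : (Expr.var .ok).eval Γ s4 = ind (Valid (Γ.par .n) q) := o4
  by_cases hV : Valid (Γ.par .n) q
  · rw [run_ite_pos he hV]
    exact ⟨p4, o4, by rw [Stmt.run, n4]; exact hV.1, by rw [Stmt.run, n4]; exact hV.2.1, fun _ => n4⟩
  · rw [run_ite_neg he hV]
    have : (Stmt.run Γ (.set .n (.add .W (.par .big) (.const 1))) s4).var .n = 12 * Γ.par .n + 1 := by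
      simp only [Stmt.run, Expr.eval, Modulus.par, Store.setv_self, r1, hb]
      exact Nat.mod_eq_of_lt (by omega)
    refine ⟨p4, ?_, by omega, by omega, fun h => (hV h).elim⟩
    rw [run_var _ (by simp), o4]

/-- The number of coins is the largest τ with 2^τ ≤ 12 n. The loop has the fixed length 12 n, and
its rounds are idle as soon as another doubling would exceed 12 n; the coin counter itself plays the
role of the exponent in the invariant. -/
theorem toss_spec (hn : 0 < Γ.par .n) (hb : Γ.par .big = 12 * Γ.par .n)
    (hW : 2 * Γ.par .big + 1 < Γ.par .W) (hs : s.coins = 0) :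
    (toss.run Γ s).var .r = num Γ.coin (Nat.log 2 (12 * Γ.par .n)) ∧ (toss.run Γ s).pos = s.pos := by
  have r1 : ((1 : Fin 3) : ℕ) = 1 := rfl
  have r0 : ((0 : Fin 3) : ℕ) = 0 := rfl
  have := loop_inv (Γ := Γ) (v := .t) (p := .big) (body :=
    .ite (notE (.bin .lt (.par .big) (.add .W (.var .pow) (.var .pow))))
      (.seq (.flip .g) <| .seq (.set .r (.add .W (.add .W (.var .r) (.var .r)) (.var .g)))
        (.set .pow (.add .W (.var .pow) (.var .pow)))) .skip) (s := (s.setv .r 0).setv .pow 1)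
    (fun t s' => s'.pos = s.pos ∧ s'.var .pow = 2 ^ s'.coins ∧ s'.var .r = num Γ.coin s'.coins ∧
      2 ^ s'.coins ≤ Γ.par .big ∧ (t ≤ s'.coins ∨ Γ.par .big < 2 * 2 ^ s'.coins))
    (by
      simp only [Store.setv_pos, Store.setv_coins, hs, Store.setv_self, pow_zero, num,
        Store.setv_ne _ _ (show Var.r ≠ .pow by simp), true_and, le_refl, true_or, and_true]
      omega) (by
      rintro t ht s' - ⟨h1, h2, h3, h4, h5⟩
      set c := s'.coins with hc
      have hp : (s'.setv .t t).var .pow = 2 ^ c := by rw [Store.setv_ne _ _ (by simp), h2]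
      have hr : (s'.setv .t t).var .r = num Γ.coin c := by rw [Store.setv_ne _ _ (by simp), h3]
      have he : (notE (.bin .lt (.par .big) (.add .W (.var .pow) (.var .pow)))).eval Γ (s'.setv .t t) =
          ind (2 * 2 ^ c ≤ Γ.par .big) := by
        rw [eval_notE]
        refine ind_congr ?_
        simp only [Expr.eval, BinOp.eval, Modulus.par, hp]
        rw [Nat.mod_eq_of_lt (by omega)]
        split_ifs <;> simp <;> omega
      by_cases hlt : 2 * 2 ^ c ≤ Γ.par .big
      · rw [run_ite_pos he hlt]
        have hnum := num_lt Γ.coin c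
        have hg : (if Γ.coin c = true then 1 else 0) ≤ 1 := by split_ifs <;> omega
        simp only [Stmt.run, Expr.eval, Modulus.par, Store.setv_pos, Store.setv_coins, Store.setv_var,
          ← hc, h1, true_and, reduceCtorEq, if_false, if_true, h2, h3]
        rw [Nat.mod_eq_of_lt (a := 2 ^ c + 2 ^ c) (by omega),
          Nat.mod_eq_of_lt (a := num Γ.coin c + num Γ.coin c) (by omega),
          Nat.mod_eq_of_lt (by omega), num, pow_succ]
        refine ⟨by omega, by omega, by omega, by omega⟩
      · rw [run_ite_neg he hlt]
        exact ⟨h1, hp, hr, h4, .inr (show Γ.par .big < 2 * 2 ^ c by omega)⟩)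
  have e0 : toss.run Γ s = (Stmt.loop .t .big (.ite (notE (.bin .lt (.par .big)
      (.add .W (.var .pow) (.var .pow)))) (.seq (.flip .g) <| .seq (.set .r
      (.add .W (.add .W (.var .r) (.var .r)) (.var .g)))
        (.set .pow (.add .W (.var .pow) (.var .pow)))) .skip)).run Γ ((s.setv .r 0).setv .pow 1) := rfl
  rw [e0]
  obtain ⟨h1, h2, h3, h4, h5⟩ := this
  refine ⟨?_, h1⟩
  rw [h3]
  congr 1
  have h6 : Γ.par .big < 2 * 2 ^ (Stmt.run Γ (Stmt.loop .t .big (.ite (notE (.bin .lt (.par .big)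
      (.add .W (.var .pow) (.var .pow)))) (.seq (.flip .g) <| .seq (.set .r
      (.add .W (.add .W (.var .r) (.var .r)) (.var .g)))
        (.set .pow (.add .W (.var .pow) (.var .pow)))) .skip)) ((s.setv .r 0).setv .pow 1)).coins := by
    rcases h5 with h5 | h5
    · have := Nat.lt_two_pow_self (n := Γ.par .big)
      have := Nat.pow_le_pow_right (n := 2) (by norm_num) h5
      omega
    · exact h5
  rw [← hb]
  refine (Nat.log_eq_of_pow_le_of_lt_pow h4 ?_).symm
  rw [pow_succ]
  omega

theorem findPrime_spec (hn : 0 < Γ.par .n) (hb : Γ.par .big = 12 * Γ.par .n)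
    (hW : 2 * Γ.par .big + 1 < Γ.par .W) :
    Valid (Γ.par .n) ((findPrime.run Γ s).var .n) ∧
      (findPrime.run Γ s).out = s.out ++ [(findPrime.run Γ s).var .n] := by
  have r1 : ((1 : Fin 3) : ℕ) = 1 := rfl
  have hW1 : 1 < Γ.par .W := by omega
  have := loop_inv (Γ := Γ) (v := .i) (p := .big) (body :=
    .seq (.set .n (.add .W (.add .W (.par .big) (.var .i)) (.const 1))) <|
    .seq (.set .ok (.const 1)) <| .seq noDivisor <| .ite (.var .ok) (.set .d (.var .n)) .skip) (s := s)
    (fun t s' => (∃ c < t, Valid (Γ.par .n) (Γ.par .big + c + 1)) → Valid (Γ.par .n) (s'.var .d))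
    (by rintro ⟨c, hc, -⟩; omega) (by
      rintro t ht s' - hI
      set s1 : Store := (Stmt.set .ok (.const 1)).run Γ ((Stmt.set .n (.add .W (.add .W (.par .big)
        (.var .i)) (.const 1))).run Γ (s'.setv .i t)) with hs1
      have o1 : s1.var .ok = 1 := by simp [hs1, Stmt.run, Expr.eval]
      have n1 : s1.var .n = Γ.par .big + t + 1 := by
        simp only [hs1, Stmt.run, Expr.eval, Modulus.par, r1, Store.setv_self,
          Store.setv_ne _ _ (show Var.n ≠ .ok by simp)]
        rw [Nat.mod_eq_of_lt (a := Γ.par .big + t) (by omega), Nat.mod_eq_of_lt (by omega)]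
      have d1 : s1.var .d = s'.var .d := by simp [hs1, Stmt.run, Store.setv_ne]
      have o2 := noDivisor_spec (Γ := Γ) (s := s1) hW1 (by omega)
      have hiff : (s1.var .ok = 1 ∧ ∀ t < Γ.par .big, ¬ (1 < t ∧ s1.var .n % t = 0)) ↔
          Valid (Γ.par .n) (Γ.par .big + t + 1) := by
        rw [valid_iff hn, o1, n1, hb]
        have h1 : 12 * Γ.par .n < 12 * Γ.par .n + t + 1 := by omega
        have h2 : 12 * Γ.par .n + t + 1 ≤ 24 * Γ.par .n := by omega
        simp only [true_and, h1, h2]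
      rw [ind_congr hiff] at o2
      have he : (Expr.var .ok).eval Γ (noDivisor.run Γ s1) = ind (Valid (Γ.par .n) (Γ.par .big + t + 1)) := o2
      have n2 : (noDivisor.run Γ s1).var .n = Γ.par .big + t + 1 := by
        rw [run_var _ (by simp [noDivisor]), n1]
      have d2 : (noDivisor.run Γ s1).var .d = s'.var .d := by
        rw [run_var _ (by simp [noDivisor]), d1]
      change _ → Valid (Γ.par .n) (((Stmt.ite (.var .ok) (.set .d (.var .n)) .skip).run Γ
        (noDivisor.run Γ s1)).var .d)
      by_cases hV : Valid (Γ.par .n) (Γ.par .big + t + 1)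
      · rw [run_ite_pos he hV]
        intro _
        simpa [Stmt.run, Expr.eval, n2] using hV
      · rw [run_ite_neg he hV]
        rintro ⟨c, hc, hc'⟩
        rw [Stmt.run, d2]
        rcases Nat.lt_succ_iff_lt_or_eq.1 hc with hc | rfl
        · exact hI ⟨c, hc, hc'⟩
        · exact (hV hc').elim)
  set s1 := (Stmt.loop .i .big (.seq (.set .n (.add .W (.add .W (.par .big) (.var .i)) (.const 1))) <|
    .seq (.set .ok (.const 1)) <| .seq noDivisor <| .ite (.var .ok) (.set .d (.var .n)) .skip)).run Γ s
    with hs1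
  have hV : Valid (Γ.par .n) (s1.var .d) := by
    refine this ?_
    -- Bertrand's postulate provides an admissible prime between 12 n and 24 n.
    obtain ⟨p, hp, h1, h2⟩ := Nat.exists_prime_lt_and_le_two_mul (12 * Γ.par .n) (by omega)
    exact ⟨p - Γ.par .big - 1, by omega, by
      rw [show Γ.par .big + (p - Γ.par .big - 1) + 1 = p by omega]; exact ⟨h1, by omega, hp⟩⟩
  have e0 : findPrime.run Γ s = { s1.setv .n (s1.var .d) with out := s1.out ++ [s1.var .d] } := by
    have h : findPrime.run Γ s = (Stmt.send (.var .n)).run Γ (s1.setv .n (s1.var .d)) := rfl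
    rw [h]
    simp [Stmt.run, Expr.eval]
  have ho : s1.out = s.out := by
    rw [hs1]
    exact (run_quiet s (by simp [noDivisor])).2.2
  rw [e0]
  simp [hV, ho]

theorem readSol_spec (hG : Graphical Γ rl) {p : ℕ} {l : ℕ} (hl : l < k) {s₀ : Store}
    (hpos : s.pos = p + l) (hok : s.var .ok = ind (s₀.var .ok = 1 ∧ ∀ j < l, dom j (Γ.word (p + j) % Γ.par .n)))
    (h : Good Γ rl k dom l (fun j => Γ.word (p + j) % Γ.par .n) s)
    (ha : ∀ j < l, s.var (.a j) = Γ.word (p + j) % Γ.par .n) :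
    ((readSol l).run Γ s).pos = p + (l + 1) ∧
    ((readSol l).run Γ s).var .ok = ind (s₀.var .ok = 1 ∧ ∀ j < l + 1, dom j (Γ.word (p + j) % Γ.par .n)) ∧
    Good Γ rl k dom (l + 1) (fun j => Γ.word (p + j) % Γ.par .n) ((readSol l).run Γ s) ∧
    ∀ j < l + 1, ((readSol l).run Γ s).var (.a j) = Γ.word (p + j) % Γ.par .n := by
  set b := Γ.word (p + l) % Γ.par .n with hb
  have hbn : b < Γ.par .n := Nat.mod_lt _ hG.n_pos
  set s1 : Store := (Stmt.set (.a l) (.bin .mod (.var (.a l)) (.par .n))).run Γ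
    ((Stmt.recv (.a l)).run Γ s) with hs1
  have hv1 : ∀ w, s1.var w = if w = .a l then b else s.var w := by
    intro w
    simp only [hs1, Stmt.run, Expr.eval, BinOp.eval, Store.setv_self, hpos, ← hb, Store.setv_var]
    split_ifs <;> rfl
  have g1 : Good Γ rl k dom l (fun j => Γ.word (p + j) % Γ.par .n) s1 :=
    h.congr rfl (fun _ _ => rfl) fun j hj => by simp [hv1]
  have he := require_spec (Γ := Γ) (s := s1) (e := domE l (.var (.a l))) (A := dom l b) hG.one_lt_W
    (by rw [hv1, if_neg (by simp), hok]; exact ind_le_one _)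
    (by
      rw [g1.eval_domE hl] <;> simp [Expr.eval, hv1, hbn])
  have hrun : (readSol l).run Γ s = (s1.setv .ok (ind (s1.var .ok = 1 ∧ dom l b))).setv (.x l) b := by
    rw [← he]
    have h2 : (readSol l).run Γ s = (Stmt.set (.x l) (.var (.a l))).run Γ
      ((require (domE l (.var (.a l)))).run Γ s1) := rfl
    rw [h2]
    simp [Stmt.run, Expr.eval, Store.setv_ne, hv1]
  rw [hrun]
  refine ⟨?_, ?_, ?_, fun j hj => ?_⟩
  · simp [hs1, Stmt.run, hpos, add_assoc]
  · rw [Store.setv_ne _ _ (by simp), Store.setv_self, hv1, if_neg (by simp), hok, ind_eq_one]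
    refine ind_congr ?_
    simp only [Nat.lt_succ_iff_lt_or_eq, or_imp, forall_and, forall_eq, and_assoc, hb]
  · have := (g1.setv (w := .ok) (a := ind (s1.var .ok = 1 ∧ dom l b)) (by simp)).set_x hbn
    rwa [show Function.update (fun j => Γ.word (p + j) % Γ.par .n) l b =
      fun j => Γ.word (p + j) % Γ.par .n from Function.update_eq_self _ _] at this
  · rw [Store.setv_ne _ _ (by simp), Store.setv_ne _ _ (by simp), hv1]
    rcases Nat.lt_succ_iff_lt_or_eq.1 hj with hj | rfl
    · rw [if_neg (by simp; omega), ha j hj]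
    · rw [if_pos rfl]

end

section
variable {Γ : Env} {rl : ℕ → ℕ → Fin 3} {k J K i : ℕ} {dom : ℕ → ℕ → Prop} {v : ℕ → ℕ} {s : Store}
  {role : Role} {na d : ℕ} {Q : ℕ → Quant} {S S' : List (ℕ → ℕ → Fin 3)} {Ψ : (ℕ → ℕ) → Prop}

/-- The body of the search for a component of the solution. -/
theorem chooseSol_spec (hS : Setup Γ rl K S S' Ψ) (hL : Leading Q Ψ K i) {j : ℕ} (hj : j < i)
    {a : ℕ → ℕ} (ha : Greedy (Γ.par .n) Q dom Ψ K j a) (h : Good Γ rl (K + 3) dom j a s) :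
    ∃ b, Greedy (Γ.par .n) Q dom Ψ K (j + 1) (Function.update a j b) ∧
      Good Γ rl (K + 3) dom (j + 1) (Function.update a j b) ((chooseSol K Q S S' j).run Γ s) ∧
      ((chooseSol K Q S S' j).run Γ s).out = s.out ++ [b] ∧
      ((chooseSol K Q S S' j).run Γ s).var (.a j) = b ∧
      ∀ l < j, ((chooseSol K Q S S' j).run Γ s).var (.a l) = s.var (.a l) := by
  have hle := hL.le
  set T : ℕ → Prop := fun b => QT (Γ.par .n) Q dom Ψ (K + 3 - (j + 1)) (j + 1) (Function.update a j b)
    with hT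
  set body : Stmt := .ite (andL [notE (.var .d), domE j (.var .i)])
    (.seq (.set (.x j) (.var .i)) <| .seq (evalAt K Q S S' (j + 1)) <|
      .ite (.var .res) (.seq (.set (.a j) (.var .i)) (.set .d (.const 1))) .skip) .skip with hbody
  have r1 : ((1 : Fin 3) : ℕ) = 1 := rfl
  have hbr : ¬ (Stmt.loop .i .n body).WritesArr .rel := by simp [hbody]
  have hbd : ∀ l, ¬ (Stmt.loop .i .n body).WritesArr (.dom l) := fun l => by simp [hbody]
  have hbx : ∀ l < j, ¬ (Stmt.loop .i .n body).WritesVar (.x l) := by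
    intro l hl
    have := evalAt_not_writesX (K := K) (Q := Q) (S := S) (S' := S') (j := j + 1) (l := l) (by omega)
    simp [hbody, this]
    omega
  have hba : ∀ l < j, ¬ (Stmt.loop .i .n body).WritesVar (.a l) := by
    intro l hl
    simp [hbody]
    omega
  have hbq : (Stmt.loop .i .n body).Quiet := by simp [hbody]
  have key := loop_inv (Γ := Γ) (v := .i) (p := .n) (body := body) (s := s.setv .d 0)
    -- The flag `d` says whether a suitable value has been found. It blocks all later candidates, so
    -- the recorded value is the least one.
    (fun t s' => s'.var .d ≤ 1 ∧ (s'.var .d = 0 → ∀ b < t, ¬ (dom j b ∧ T b)) ∧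
      (s'.var .d = 1 → s'.var (.a j) < Γ.par .n ∧ dom j (s'.var (.a j)) ∧ T (s'.var (.a j)) ∧
        ∀ b < s'.var (.a j), ¬ (dom j b ∧ T b))) (by simp) (by
      rintro b hb s' hF ⟨i1, i2, i3⟩
      have g : Good Γ rl (K + 3) dom j a s' :=
        (h.setv (w := .d) (a := 0) (by simp)).frame hF hbr hbd hbx
      have g1 : Good Γ rl (K + 3) dom j a (s'.setv .i b) := g.setv (by simp)
      have hd1 : (s'.setv .i b).var .d = s'.var .d := Store.setv_ne _ _ (by simp)
      have hdom := g1.eval_domE (j := j) (a := .var .i) (by omega) (by simpa [Expr.eval] using hb)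
      have he : (andL [notE (.var .d), domE j (.var .i)]).eval Γ (s'.setv .i b) =
          ind (s'.var .d = 0 ∧ dom j b) := by
        rw [eval_andL hS.graph.one_lt_W]
        · simp only [List.mem_cons, List.not_mem_nil, or_false, forall_eq_or_imp, forall_eq, hdom,
            eval_notE, ind_ne_zero]
          simp [Expr.eval, hd1]
        · simp only [List.mem_cons, List.not_mem_nil, or_false, forall_eq_or_imp, forall_eq, hdom,
            eval_notE, ind_le_one, true_and]
      by_cases hc : s'.var .d = 0 ∧ dom j b
      · obtain ⟨hc0, hcd⟩ := hc
        set s1 := (s'.setv .i b).setv (.x j) b with hs1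
        have g2 : Good Γ rl (K + 3) dom (j + 1) (Function.update a j b) s1 := g1.set_x hb
        have hev := evalAt_spec (Q := Q) hS.graph hS.n_lt_N hS.pos hS.neg (by omega) g2
        set s2 := (evalAt K Q S S' (j + 1)).run Γ s1 with hs2
        have hrun : body.run Γ (s'.setv .i b) = (Stmt.ite (.var .res) (.seq (.set (.a j) (.var .i))
            (.set .d (.const 1))) .skip).run Γ s2 := by
          rw [hbody, run_ite_pos he ⟨hc0, hcd⟩]
          have : s1 = (Stmt.set (.x j) (.var .i)).run Γ (s'.setv .i b) := by
            simp [Stmt.run, Expr.eval, hs1]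
          rw [hs2, this]; rfl
        have hi2 : s2.var .i = b := by
          rw [hs2, run_var _ (by simp), hs1, Store.setv_ne _ _ (by simp), Store.setv_self]
        have hd2 : s2.var .d = 0 := by
          rw [hs2, run_var _ (by simp), hs1, Store.setv_ne _ _ (by simp), hd1, hc0]
        have ha2 : s2.var (.a j) = s'.var (.a j) := by
          rw [hs2, run_var _ (by simp), hs1, Store.setv_ne _ _ (by simp), Store.setv_ne _ _ (by simp)]
        have he2 : (Expr.var .res).eval Γ s2 = ind (T b) := hev
        rw [hrun]
        by_cases hTb : T b
        · rw [run_ite_pos he2 hTb]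
          simp only [Stmt.run, Expr.eval, Store.setv_self, Store.setv_ne _ _ (show Var.a j ≠ .d by simp),
            hi2, r1, le_refl, one_ne_zero, true_and, forall_const, false_imp_iff, hb, hcd, hTb]
          exact i2 hc0
        · rw [run_ite_neg he2 hTb]
          simp only [Stmt.run, hd2, zero_le_one, true_and, forall_const, zero_ne_one, false_imp_iff,
            and_true]
          intro b' hb'
          rcases Nat.lt_succ_iff_lt_or_eq.1 hb' with hb' | rfl
          · exact i2 hc0 b' hb'
          · exact fun h' => hTb h'.2
      · have hrun : body.run Γ (s'.setv .i b) = s'.setv .i b := by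
          rw [hbody, run_ite_neg he hc]; rfl
        rw [hrun, hd1, Store.setv_ne _ _ (show Var.a j ≠ .i by simp)]
        refine ⟨i1, fun h0 b' hb' => ?_, i3⟩
        rcases Nat.lt_succ_iff_lt_or_eq.1 hb' with hb' | rfl
        · exact i2 h0 b' hb'
        · exact fun h' => hc ⟨h0, h'.1⟩)
  have hF := run_frame (Γ := Γ) (Stmt.loop .i .n body) (s.setv .d 0)
  have e0 : (chooseSol K Q S S' j).run Γ s = (Stmt.send (.var (.a j))).run Γ
    ((Stmt.set (.x j) (.var (.a j))).run Γ ((Stmt.loop .i .n body).run Γ (s.setv .d 0))) := rfl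
  set s3 := (Stmt.loop .i .n body).run Γ (s.setv .d 0) with hs3
  obtain ⟨k1, k2, k3⟩ := key
  -- The search succeeds because the greedy prefix extends, by the meaning of the existential
  -- quantifier `j`.
  have hd : s3.var .d = 1 := by
    by_contra hne
    obtain ⟨b, hb, hdb, hTb⟩ := (hL.QT_step hj).1 ha.sol.2
    exact k2 (by omega) b hb ⟨hdb, hTb⟩
  obtain ⟨h1, h2, h3, h4⟩ := k3 hd
  have g3 : Good Γ rl (K + 3) dom j a s3 := (h.setv (w := .d) (a := 0) (by simp)).frame hF hbr hbd hbx
  rw [e0]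
  refine ⟨s3.var (.a j), hL.greedy_succ hj ha h1 h2 h3 (fun b hb hdb hTb => h4 b hb ⟨hdb, hTb⟩),
    (g3.set_x h1).congr rfl (fun _ _ => rfl) fun _ _ => rfl, ?_, ?_, fun l hl => ?_⟩
  · have : s3.out = s.out := (hF.quiet hbq).2.2
    simp [Stmt.run, Expr.eval, Store.setv_ne, this]
  · simp [Stmt.run, Expr.eval, Store.setv_ne]
  · have : s3.var (.a l) = s.var (.a l) := by
      rw [hF.var _ (hba l hl), Store.setv_ne _ _ (by simp)]
    simpa [Stmt.run, Store.setv_ne] using this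

theorem chooseSol_fits {j : ℕ} (hj : j < K + 3) (hna : K + 14 ≤ na) :
    (chooseSol K Q S S' j).Fits .prover na (K + 2) := by
  have h1 : (evalAt K Q S S' (j + 1)).Fits .prover na (K + 1) :=
    (evalAt_fits (by omega) hna).mono (by split_ifs <;> omega)
  simp only [chooseSol, Stmt.Fits, Expr.UsesBelow, andL_usesBelow, List.mem_cons, List.not_mem_nil,
    or_false, forall_eq_or_imp, forall_eq, notE, domE, Arr.code, Par.IsLength, h1, and_true, true_and]
  omega

/-- The checks of the verifier, after the random number has been chosen. -/
def verifyProg {K i : ℕ} {Q : ℕ → Quant} {S S' : List (ℕ → ℕ → Fin 3)} (P : Protocol K i Q S S') :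
    Stmt :=
  .seq (seqL ((List.range i).map readSol)) <| .seq (evalAt K Q S S' i) <| .seq (require (.var .res)) <|
    .seq (seqL ((List.range i).map (stage P.chk))) (.set .out (.mul .W (.var .ok) (.par .ell)))

/-- The canonical solution, and the messages that prove that it is canonical. -/
def proveProg {K i : ℕ} {Q : ℕ → Quant} {S S' : List (ℕ → ℕ → Fin 3)} (P : Protocol K i Q S S') :
    Stmt :=
  .seq (seqL ((List.range i).map (chooseSol K Q S S'))) (seqL ((List.range i).map (stage P.prv)))

theorem Good.pinned_zero {a : ℕ → ℕ} (h : Good Γ rl k dom J v s) :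
    Good Γ rl k (pinned dom a 0) 0 v s := by
  have : pinned dom a 0 = dom := by
    funext l b
    simp [pinned]
  rw [this]
  exact h.mono (Nat.zero_le _)

/-- The output register receives `ok` times `ell`, where `ell` is intended as the length of the
answer plus one: 0 encodes ⊥, and otherwise the components of the solution are the answer. All
checks are conjoined in `ok`, and the program continues after a failure, so that the block positions
do not depend on the outcome. -/
theorem verifyProg_spec (P : Protocol K i Q S S') (hS : Setup Γ rl K S S' Ψ) (hL : Leading Q Ψ K i)
    (h : Good Γ rl (K + 3) dom 0 v s) (hok : s.var .ok ≤ 1) (hell : Γ.par .ell < Γ.par .W)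
    {a : ℕ → ℕ} (ha : a = fun l => Γ.word (s.pos + l) % Γ.par .n) :
    ((verifyProg P).run Γ s).var .out = ind (s.var .ok = 1 ∧ Sol (Γ.par .n) Q dom Ψ K i a ∧
      ∀ j < i, P.Acc (Γ.par .n) (Γ.par .N) (s.var .r) rl (restr dom a j) Ψ Γ.word
        (s.pos + i + j * P.len (Γ.par .n))) * Γ.par .ell ∧
    ∀ l < i, ((verifyProg P).run Γ s).var (.a l) = a l := by
  have hle := hL.le
  have hG := hS.graph
  have q1 := seqL_range_inv (Γ := Γ) (f := readSol) (s := s) (fun l s' => s'.pos = s.pos + l ∧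
    s'.var .ok = ind (s.var .ok = 1 ∧ ∀ j < l, dom j (a j)) ∧ Good Γ rl (K + 3) dom l a s' ∧
    (∀ j < l, s'.var (.a j) = a j) ∧ s'.var .r = s.var .r)
    ⟨rfl, by
      obtain h | h : s.var .ok = 0 ∨ s.var .ok = 1 := by omega
      · simp [h, ind]
      · simp [h, ind], ⟨h.rel, h.dom, fun j hj => by omega, fun j hj => by omega⟩, by simp, rfl⟩ i (by
    rintro l hl s' ⟨i1, i2, i3, i4, i5⟩
    subst ha
    obtain ⟨h1, h2, h3, h4⟩ := readSol_spec hG (show l < K + 3 by omega) i1 i2 i3 i4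
    exact ⟨h1, h2, h3, h4, by rw [run_var _ (by simp [readSol]), i5]⟩)
  set s1 := (seqL ((List.range i).map readSol)).run Γ s with hs1
  obtain ⟨p1, o1, g1, a1, r1⟩ := q1
  have hev := evalAt_spec (Q := Q) hG hS.n_lt_N hS.pos hS.neg hle g1
  set s2 := (evalAt K Q S S' i).run Γ s1 with hs2
  have o2 : s2.var .ok = s1.var .ok := by rw [hs2, run_var _ (by simp)]
  have hreq := require_spec (Γ := Γ) (s := s2) (e := .var .res) hG.one_lt_W
    (by rw [o2, o1]; exact ind_le_one _) hev
  set s3 := (require (.var .res)).run Γ s2 with hs3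
  have o3 : s3.var .ok = ind (s.var .ok = 1 ∧ Sol (Γ.par .n) Q dom Ψ K i a) := by
    simp only [hs3, require, Stmt.run, Store.setv_self, hreq, o2, o1, ind_eq_one]
    refine ind_congr ?_
    simp only [Sol, and_assoc]
    refine and_congr_right fun _ => and_congr_left fun _ => forall₂_congr fun l hl => ?_
    exact (and_iff_right (g1.lt l hl)).symm
  have g3 : Good Γ rl (K + 3) dom 0 v s3 := by
    have : Good Γ rl (K + 3) dom 0 v s1 := ⟨g1.rel, g1.dom, fun j hj => by omega, fun j hj => by omega⟩
    exact (this.run (by simp) (by simp) (by simp)).run (by simp) (by simp) (by simp)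
  have p3 : s3.pos = s.pos + i := by
    rw [hs3, (run_quiet s2 (by simp)).1, hs2, (run_quiet s1 (by simp)).1, p1]
  have v3 : ∀ w, w = .r ∨ (∃ l, w = .a l) → s3.var w = s1.var w := by
    rintro w (rfl | ⟨l, rfl⟩) <;> rw [hs3, run_var _ (by simp), hs2, run_var _ (by simp)]
  -- Before stage `j` the first `j` domains are the singletons of the components of `a`.
  have q2 := seqL_range_inv (Γ := Γ) (f := stage P.chk) (s := s3) (fun j s' =>
    s'.pos = s.pos + i + j * P.len (Γ.par .n) ∧
    s'.var .ok = ind ((s.var .ok = 1 ∧ Sol (Γ.par .n) Q dom Ψ K i a) ∧ ∀ l < j,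
      P.Acc (Γ.par .n) (Γ.par .N) (s.var .r) rl (restr dom a l) Ψ Γ.word
        (s.pos + i + l * P.len (Γ.par .n))) ∧ Good Γ rl (K + 3) (pinned dom a j) 0 v s' ∧
    (∀ l < i, s'.var (.a l) = a l) ∧ s'.var .r = s.var .r)
    ⟨by rw [p3]; simp, by rw [o3]; simp, g3.pinned_zero, fun l hl => by
      rw [v3 _ (.inr ⟨l, rfl⟩), a1 l hl], by rw [v3 _ (.inl rfl), r1]⟩ i (by
    rintro j hj s' ⟨i1, i2, i3, i4, i5⟩
    have g4 := narrow_spec hG (by omega) i3 (i4 j hj)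
    have hn : ∀ w, w ≠ .t → ((narrow j).run Γ s').var w = s'.var w := fun w hw =>
      run_var _ (by simp [narrow, hw])
    have hnp : ((narrow j).run Γ s').pos = s'.pos := (run_quiet s' (by simp [narrow])).1
    set s4 := (narrow j).run Γ s' with hs4
    obtain ⟨c1, c2⟩ := P.chk_spec hS g4 (by rw [hn _ (by simp), i2]; exact ind_le_one _)
    have hc : ∀ w, w = .r ∨ w = .out ∨ (∃ l, w = .a l) → (P.chk.run Γ s4).var w = s4.var w :=
      fun w hw => run_var _ (P.chk_var hw)
    have g5 : Good Γ rl (K + 3) (restr dom a j) 0 v (P.chk.run Γ s4) :=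
      g4.run (P.chk_arr (.inl rfl)) (fun l => P.chk_arr (.inr ⟨l, rfl⟩)) (by simp)
    set s5 := P.chk.run Γ s4 with hs5
    have a5 : ∀ l < i, s5.var (.a l) = a l := fun l hl => by
      rw [hc _ (.inr (.inr ⟨l, rfl⟩)), hn _ (by simp), i4 l hl]
    have g6 := pin_spec hG (by omega) g5 (a5 j hj)
    have hp : ∀ w, w ≠ .t → ((pin j).run Γ s5).var w = s5.var w := fun w hw =>
      run_var _ (by simp [pin, hw])
    have hpp : ((pin j).run Γ s5).pos = s5.pos := (run_quiet s5 (by simp [pin])).1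
    have hrun : (stage P.chk j).run Γ s' = (pin j).run Γ s5 := rfl
    rw [hrun]
    refine ⟨?_, ?_, g6, fun l hl => by rw [hp _ (by simp), a5 l hl], ?_⟩
    · rw [hpp, c1, hnp, i1, Nat.succ_mul, ← add_assoc]
    · rw [hp _ (by simp), c2, hn _ (by simp), hn _ (by simp), hnp, i2, i5, i1, ind_eq_one]
      refine ind_congr ?_
      simp only [Nat.lt_succ_iff_lt_or_eq, or_imp, forall_and, forall_eq, and_assoc]
    · rw [hp _ (by simp), hc _ (.inl rfl), hn _ (by simp), i5])
  set s6 := (seqL ((List.range i).map (stage P.chk))).run Γ s3 with hs6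
  have hrun : (verifyProg P).run Γ s = (Stmt.set .out (.mul .W (.var .ok) (.par .ell))).run Γ s6 := rfl
  rw [hrun]
  obtain ⟨-, o6, -, a6, -⟩ := q2
  refine ⟨?_, fun l hl => ?_⟩
  · simp only [Stmt.run, Expr.eval, Modulus.par, Store.setv_self]
    rw [o6, ind_congr and_assoc, Nat.mod_eq_of_lt]
    exact (Nat.mul_le_mul_right _ (ind_le_one _)).trans_lt (by simpa)
  · rw [run_var _ (by simp), a6 l hl]

theorem proveProg_spec (P : Protocol K i Q S S') (hS : Setup Γ rl K S S' Ψ) (hL : Leading Q Ψ K i)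
    (h : Good Γ rl (K + 3) dom 0 v s) {a₀ : ℕ → ℕ} (hsol : Sol (Γ.par .n) Q dom Ψ K i a₀) :
    ∃ g blk, Greedy (Γ.par .n) Q dom Ψ K i g ∧
      ((proveProg P).run Γ s).out = s.out ++ ((List.range i).map g ++ blk) ∧
      ∀ ω p, Serves ω p blk → ∀ r, ∀ j < i, P.Acc (Γ.par .n) (Γ.par .N) r rl (restr dom g j) Ψ ω
        (p + j * P.len (Γ.par .n)) := by
  have hle := hL.le
  have hG := hS.graph
  obtain ⟨g₀, hg₀⟩ := hL.exists_greedy hsol 0 (Nat.zero_le _)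
  have q1 := seqL_range_inv (Γ := Γ) (f := chooseSol K Q S S') (s := s) (fun l s' => l ≤ i → ∃ g,
    Greedy (Γ.par .n) Q dom Ψ K l g ∧ Good Γ rl (K + 3) dom l g s' ∧
    s'.out = s.out ++ (List.range l).map g ∧ ∀ j < l, s'.var (.a j) = g j)
    (fun _ => ⟨g₀, hg₀, ⟨h.rel, h.dom, fun j hj => by omega, fun j hj => by omega⟩, by simp, by simp⟩) i (by
    rintro l hl s' IH -
    obtain ⟨g, i1, i2, i3, i4⟩ := IH (by omega)
    obtain ⟨b, h1, h2, h3, h4, h5⟩ := chooseSol_spec hS hL hl i1 i2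
    refine ⟨_, h1, h2, ?_, fun j hj => ?_⟩
    · rw [h3, i3, List.range_succ, List.map_append, List.append_assoc]
      congr 2
      · refine List.map_congr_left fun j hj => ?_
        rw [Function.update_of_ne]
        have := List.mem_range.1 hj
        omega
      · simp
    · rcases Nat.lt_succ_iff_lt_or_eq.1 hj with hj | rfl
      · rw [h5 j hj, i4 j hj, Function.update_of_ne (by omega)]
      · simpa using h4)
  obtain ⟨g, hg, g1, o1, a1⟩ := q1 le_rfl
  set s1 := (seqL ((List.range i).map (chooseSol K Q S S'))).run Γ s with hs1
  have g1' : Good Γ rl (K + 3) dom 0 v s1 := ⟨g1.rel, g1.dom, fun j hj => by omega, fun j hj => by omega⟩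
  have q2 := seqL_range_inv (Γ := Γ) (f := stage P.prv) (s := s1) (fun j s' =>
    Good Γ rl (K + 3) (pinned dom g j) 0 v s' ∧ (∀ l < i, s'.var (.a l) = g l) ∧
    ∃ blk, s'.out = s1.out ++ blk ∧ blk.length = j * P.len (Γ.par .n) ∧
      ∀ ω p, Serves ω p blk → ∀ r, ∀ l < j, P.Acc (Γ.par .n) (Γ.par .N) r rl (restr dom g l) Ψ ω
        (p + l * P.len (Γ.par .n)))
    ⟨g1'.pinned_zero, a1, [], by simp⟩ i (by
    rintro j hj s' ⟨i1, i2, blk, i3, i4, i5⟩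
    have g4 := narrow_spec hG (by omega) i1 (i2 j hj)
    have hn : ∀ w, w ≠ .t → ((narrow j).run Γ s').var w = s'.var w := fun w hw =>
      run_var _ (by simp [narrow, hw])
    have hno : ((narrow j).run Γ s').out = s'.out := (run_quiet s' (by simp [narrow])).2.2
    set s4 := (narrow j).run Γ s' with hs4
    obtain ⟨blk', c1, c2, c3⟩ := P.prv_spec hS g4 (hL.noSol_of_greedy hg hj)
    have g5 : Good Γ rl (K + 3) (restr dom g j) 0 v (P.prv.run Γ s4) :=
      g4.run (P.prv_arr (.inl rfl)) (fun l => P.prv_arr (.inr ⟨l, rfl⟩)) (by simp)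
    have hc : ∀ l, (P.prv.run Γ s4).var (.a l) = s4.var (.a l) :=
      fun l => run_var _ (P.prv_var (.inr ⟨l, rfl⟩))
    set s5 := P.prv.run Γ s4 with hs5
    have a5 : ∀ l < i, s5.var (.a l) = g l := fun l hl => by
      rw [hc, hn _ (by simp), i2 l hl]
    have g6 := pin_spec hG (by omega) g5 (a5 j hj)
    have hp : ∀ w, w ≠ .t → ((pin j).run Γ s5).var w = s5.var w := fun w hw =>
      run_var _ (by simp [pin, hw])
    have hpo : ((pin j).run Γ s5).out = s5.out := (run_quiet s5 (by simp [pin])).2.2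
    have hrun : (stage P.prv j).run Γ s' = (pin j).run Γ s5 := rfl
    rw [hrun]
    refine ⟨g6, fun l hl => by rw [hp _ (by simp), a5 l hl], blk ++ blk', ?_, ?_, ?_⟩
    · rw [hpo, c1, hno, i3, List.append_assoc]
    · rw [List.length_append, i4, c2, Nat.succ_mul]
    · intro ω p hs r l hl
      rw [Serves.append, i4] at hs
      rcases Nat.lt_succ_iff_lt_or_eq.1 hl with hl | rfl
      · exact i5 ω p hs.1 r l hl
      · exact c3 ω r _ hs.2)
  obtain ⟨-, -, blk, h1, -, h3⟩ := q2
  refine ⟨g, blk, hg, ?_, h3⟩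
  have hrun : (proveProg P).run Γ s = (seqL ((List.range i).map (stage P.prv))).run Γ s1 := rfl
  rw [hrun, h1, o1, List.append_assoc]

theorem verifyProg_fits (P : Protocol K i Q S S') (hi : i ≤ K + 3) (h0 : 0 < i) (hna : K + 14 ≤ na) :
    (verifyProg P).Fits .verifier na (K + 1) := by
  have h1 : (evalAt K Q S S' i).Fits .verifier na (K + 1) :=
    (evalAt_fits (by omega) hna).mono (by split_ifs <;> omega)
  refine ⟨?_, h1, ?_, ?_, ?_⟩
  · simp only [seqL_fits, List.mem_map, List.mem_range, forall_exists_index, and_imp,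
      forall_apply_eq_imp_iff₂, readSol, Stmt.Fits, require, andL_usesBelow, List.mem_cons,
      List.not_mem_nil, or_false, forall_eq_or_imp, forall_eq, Expr.UsesBelow, domE, Arr.code,
      and_true, true_and]
    omega
  · simp
  · simp only [seqL_fits, List.mem_map, List.mem_range, forall_exists_index, and_imp,
      forall_apply_eq_imp_iff₂]
    exact fun j hj => ⟨narrow_fits (by omega), P.chk_fits hna, pin_fits (by omega)⟩
  · simp

theorem proveProg_fits (P : Protocol K i Q S S') (hi : i ≤ K + 3) (hna : K + 14 ≤ na) :
    (proveProg P).Fits .prover na (K + 2) := by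
  constructor
  · simp only [seqL_fits, List.mem_map, List.mem_range, forall_exists_index, and_imp,
      forall_apply_eq_imp_iff₂]
    exact fun j hj => chooseSol_fits (by omega) hna
  · simp only [seqL_fits, List.mem_map, List.mem_range, forall_exists_index, and_imp,
      forall_apply_eq_imp_iff₂]
    exact fun j hj => ⟨narrow_fits (by omega), P.prv_fits hna, pin_fits (by omega)⟩

end

/-! ### Machine programs with two phases -/

/-- The effect of a command that only changes registers. -/
def Cmd.exec (M : ℕ) (mem : ℕ → ℕ) : Cmd → (ℕ → ℕ) → ℕ → ℕ
  | .const r v, reg => Function.update reg r (v % M)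
  | .op o r a b, reg => Function.update reg r (o.eval M (reg a) (reg b))
  | .load r a, reg => Function.update reg r (mem (reg a))
  | _, reg => reg

def Cmd.Straight : Cmd → Prop
  | .const _ _ | .op _ _ _ _ | .load _ _ => True
  | _ => False

/-- Executes the commands of a list, then `last`. -/
def seqC : List Cmd → Cmd → Cmd
  | [], last => last
  | c :: l, last => .seq c (seqC l last)

def execL (M : ℕ) (mem : ℕ → ℕ) (l : List Cmd) (reg : ℕ → ℕ) : ℕ → ℕ :=
  l.foldl (fun reg c => Cmd.exec M mem c reg) reg

theorem reaches_seqC {M : ℕ} {env : List Msg → Option ℕ} {coin : ℕ → Bool} {l : List Cmd}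
    (hl : ∀ c ∈ l, Cmd.Straight c) (last : Cmd) (k : List Cmd) (reg mem : ℕ → ℕ) (hist : List Msg)
    (t : ℕ) : Reaches M env coin (2 * l.length) ⟨seqC l last :: k, reg, mem, hist, t⟩
      ⟨last :: k, execL M mem l reg, mem, hist, t⟩ := by
  induction l generalizing reg with
  | nil => exact Reaches.refl _
  | cons c l ih =>
    have hc := hl c List.mem_cons_self
    have h2 : Reaches M env coin 2 ⟨seqC (c :: l) last :: k, reg, mem, hist, t⟩
        ⟨seqC l last :: k, Cmd.exec M mem c reg, mem, hist, t⟩ := by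
      refine ⟨2, le_rfl, ?_⟩
      cases c <;> first | exact hc.elim | rfl
    exact (h2.trans (ih (fun c h => hl c (List.mem_cons_of_mem _ h)) _)).mono
      (by simp only [List.length_cons]; omega)

/-- Computes the parameters from the numbers of vertices and edges. -/
def prelude (K i : ℕ) : List Cmd :=
  [.const (treg 0) 0, .load (preg .n) (treg 0), .const (treg 0) 1, .load (preg .m) (treg 0),
    .op .add (preg .dbl) (preg .n) (preg .n),
    .const (treg 0) 12, .op .mul (preg .big) (treg 0) (preg .n),
    .const (treg 0) (K + 20), .op .add (treg 0) (treg 0) (preg .n),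
    .op .add (treg 0) (treg 0) (preg .m), .op .mul (preg .W) (treg 0) (treg 0),
    .const (preg .N) 1,
    .op .mul (preg .bd) (preg .n) (preg .n), .op .add (preg .bd) (preg .bd) (preg .dbl),
    .const (preg .ell) (i + 1),
    .const (treg 0) (K + 3), .op .mul (preg .base) (treg 0) (preg .n),
    .const (treg 0) 2, .op .add (preg .base) (preg .base) (treg 0),
    .op .add (preg .base) (preg .base) (preg .m), .op .add (preg .base) (preg .base) (preg .m)]

/-- `base` is the length of the input, so the arrays start right behind it. `bd` leaves room for the
matrix with n^2 entries and for the tables with 2 n entries. -/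
def parOf (K i n m N : ℕ) : Par → ℕ
  | .n => n
  | .m => m
  | .dbl => n + n
  | .big => 12 * n
  | .W => (K + 20 + n + m) * (K + 20 + n + m)
  | .N => N
  | .base => (K + 3) * n + 2 + m + m
  | .bd => n * n + (n + n)
  | .ell => i + 1

/-- Makes the square of the prime the second modulus. -/
def squareN : List Cmd :=
  [.const (preg .N) 0, .op .sub (preg .N) (vreg .n) (preg .N), .op .mul (preg .N) (preg .N) (preg .N)]

/-- Copies the solution to the output registers. -/
def copySol (i : ℕ) : List Cmd :=
  (List.range i).flatMap fun j => [.const (j + 1) 0, .op .sub (j + 1) (vreg (.a j)) (j + 1)]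

/-- The modulus `N` is read-only inside a statement, which forces two phases: the first obtains the
number q with `N = 1`, and the second works with `N = q^2`. The answer is copied at the very end,
because the output registers overlap with those of variables. -/
def program (K i : ℕ) (c₁ c₂ : Stmt) : Cmd :=
  seqC (prelude K i) <| .seq (c₁.code 0) <| seqC squareN <| .seq (c₂.code 0) <|
    seqC (copySol i) .skip

section
variable {K i n m M : ℕ}

theorem prelude_spec {mem : ℕ → ℕ} (hi : i ≤ K + 3)
    (hM : (K + 20 + n + m) * (K + 20 + n + m) * (K + 20 + n + m) < M) (h0 : mem 0 = n) (h1 : mem 1 = m) :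
    (∀ p, execL M mem (prelude K i) (fun _ => 0) (preg p) = parOf K i n m 1 p) ∧
      ∀ v, execL M mem (prelude K i) (fun _ => 0) (vreg v) = 0 := by
  set T := K + 20 + n + m with hT
  have hTT : 20 * (T * T) ≤ T * T * T := by
    rw [mul_comm]; exact Nat.mul_le_mul_left _ (by omega)
  have hT20 : 20 * T ≤ T * T := Nat.mul_le_mul_right _ (by omega)
  have hnn : n * n ≤ T * T := Nat.mul_le_mul (by omega) (by omega)
  have hKn : (K + 3) * n ≤ T * T := Nat.mul_le_mul (by omega) (by omega)
  refine ⟨fun p => ?_, fun v => ?_⟩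
  · have e0 : 0 % M = 0 := Nat.zero_mod _
    have e1 : 1 % M = 1 := Nat.mod_eq_of_lt (by omega)
    have e2 : 2 % M = 2 := Nat.mod_eq_of_lt (by omega)
    have e3 : 12 % M = 12 := Nat.mod_eq_of_lt (by omega)
    have e4 : (K + 20) % M = K + 20 := Nat.mod_eq_of_lt (by omega)
    have e5 : (i + 1) % M = i + 1 := Nat.mod_eq_of_lt (by omega)
    have e6 : (K + 3) % M = K + 3 := Nat.mod_eq_of_lt (by omega)
    have e7 : (n + n) % M = n + n := Nat.mod_eq_of_lt (by omega)
    have e8 : (12 * n) % M = 12 * n := Nat.mod_eq_of_lt (by omega)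
    have e9 : (K + 20 + n) % M = K + 20 + n := Nat.mod_eq_of_lt (by omega)
    have e10 : (K + 20 + n + m) % M = K + 20 + n + m := Nat.mod_eq_of_lt (by omega)
    have e11 : ((K + 20 + n + m) * (K + 20 + n + m)) % M = (K + 20 + n + m) * (K + 20 + n + m) :=
      Nat.mod_eq_of_lt (by rw [← hT]; omega)
    have e12 : (n * n) % M = n * n := Nat.mod_eq_of_lt (by omega)
    have e13 : (n * n + (n + n)) % M = n * n + (n + n) := Nat.mod_eq_of_lt (by omega)
    have e14 : ((K + 3) * n) % M = (K + 3) * n := Nat.mod_eq_of_lt (by omega)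
    have e15 : ((K + 3) * n + 2) % M = (K + 3) * n + 2 := Nat.mod_eq_of_lt (by omega)
    have e16 : ((K + 3) * n + 2 + m) % M = (K + 3) * n + 2 + m := Nat.mod_eq_of_lt (by omega)
    have e17 : ((K + 3) * n + 2 + m + m) % M = (K + 3) * n + 2 + m + m := Nat.mod_eq_of_lt (by omega)
    cases p <;> simp only [execL, prelude, List.foldl, Cmd.exec, preg, treg, Par.code, RamOp.eval,
      Function.update_apply, parOf] <;>
      simp only [Nat.reduceMul, Nat.reduceAdd, Nat.reduceEqDiff, if_true, if_false, e0, e1, h0, h1, e2,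
        e3, e4, e5, e6, e7, e8, e9, e10, e11, e12, e13, e14, e15, e16, e17]
  · have hv : ∀ p, vreg v ≠ preg p := fun p => by simp only [vreg, preg]; omega
    simp only [execL, prelude, List.foldl, Cmd.exec, Function.update_apply, hv, vreg_ne_treg,
      if_false]

/-- The register of `a j` is 12 j + 6, hence it is not among the registers 1, …, j that have been
overwritten before it is read. -/
theorem copySol_spec {mem reg : ℕ → ℕ} :
    ∀ x, execL M mem (copySol i) reg x =
      if 1 ≤ x ∧ x ≤ i then reg (vreg (.a (x - 1))) else reg x := by
  induction i with
  | zero => intro x; rw [if_neg (by omega)]; rfl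
  | succ i ih =>
    intro x
    have hv : ∀ r, execL M mem (copySol (i + 1)) reg r = Function.update (Function.update
        (execL M mem (copySol i) reg) (i + 1) 0) (i + 1) (execL M mem (copySol i) reg (vreg (.a i))) r := by
      intro r
      have hne : vreg (.a i) ≠ i + 1 := by simp only [vreg, Var.code]; omega
      simp only [copySol, List.range_succ, List.flatMap_append, List.flatMap_cons, List.flatMap_nil,
        List.append_nil, execL, List.foldl_append, List.foldl, Cmd.exec, RamOp.eval, Nat.zero_mod,
        Function.update_self, Function.update_of_ne hne, Nat.sub_zero]
    rw [hv, Function.update_apply]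
    split_ifs with h1 h2 h2
    · rw [ih, if_neg (by simp only [vreg, Var.code]; omega), h1]; rfl
    · omega
    · rw [Function.update_of_ne h1, ih, if_pos (by omega)]
    · rw [Function.update_of_ne h1, ih, if_neg (by omega)]

/-- The environment of a run on the input `L`, with the second modulus `N`. -/
def envOf (K i n m : ℕ) (L : List ℕ) (ω : ℕ → ℕ) (coin : ℕ → Bool) (N : ℕ) : Env :=
  ⟨parOf K i n m N, fun a => L.getD a 0, ω, coin⟩

variable {L : List ℕ} {ω : ℕ → ℕ} {coin : ℕ → Bool}

/-- The largest intermediate value is a product of two residues modulo `N ≤ T^4`, where T = K + 20 +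
n + m. This is the origin of the eighth power, hence of the factor 8 in the word length. -/
theorem small_envOf {N : ℕ} (hn : 0 < n) (hM : (K + 20 + n + m) ^ 8 ≤ M)
    (hL : L.length ≤ (K + 3) * n + 2 + m + m) (hN0 : 0 < N) (hN : N ≤ (K + 20 + n + m) ^ 4) :
    (envOf K i n m L ω coin N).Small M (K + 14) := by
  set T := K + 20 + n + m with hT
  have h2 : 20 * T ≤ T ^ 2 := by rw [pow_two]; exact Nat.mul_le_mul_right _ (by omega)
  have h3 : 20 * T ^ 2 ≤ T ^ 3 := by
    rw [pow_succ T 2, mul_comm]; exact Nat.mul_le_mul_left _ (by omega)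
  have h4 : 20 * T ^ 3 ≤ T ^ 4 := by
    rw [pow_succ T 3, mul_comm]; exact Nat.mul_le_mul_left _ (by omega)
  have h8 : T ^ 4 * T ^ 4 ≤ M := by rwa [← pow_add]
  have h5 : 20 * T ^ 4 ≤ T ^ 4 * T ^ 4 := Nat.mul_le_mul_right _ (by omega)
  have hnn : n * n ≤ T ^ 2 := by rw [pow_two]; exact Nat.mul_le_mul (by omega) (by omega)
  have hKn : (K + 3) * n ≤ T ^ 2 := by rw [pow_two]; exact Nat.mul_le_mul (by omega) (by omega)
  refine ⟨by omega, fun P => ?_, fun P => ?_, fun P => ?_, ?_, ?_, fun p hp => ?_, fun a ha => ?_⟩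
  · cases P
    · change T * T + T * T ≤ M
      rw [← pow_two]; omega
    · change N + N ≤ M
      omega
  · cases P
    · change T * T * (T * T) ≤ M
      rw [show T * T * (T * T) = T ^ 4 by ring]
      omega
    · exact (Nat.mul_le_mul hN hN).trans h8
  · cases P
    · exact Nat.mul_pos (by omega) (by omega)
    · exact hN0
  · change (K + 3) * n + 2 + m + m + (K + 14) * (n * n + (n + n)) ≤ M
    have : (K + 14) * (n * n + (n + n)) ≤ T * (2 * T ^ 2) := Nat.mul_le_mul (by omega) (by omega)
    have e : T * (2 * T ^ 2) = 2 * T ^ 3 := by ring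
    omega
  · exact Nat.add_pos_right _ (by omega)
  · cases p <;> first | exact hp.elim | (simp only [envOf, parOf]; omega)
  · exact List.getD_eq_default _ _ (hL.trans ha)

theorem program_run {role : Role} {env : List Msg → Option ℕ} {c₁ c₂ : Stmt} {d₁ d₂ : ℕ} {s₁ : Store}
    (hn : 0 < n) (hi : i ≤ K + 3) (hM : (K + 20 + n + m) ^ 8 ≤ M)
    (hL : L.length = (K + 3) * n + 2 + m + m) (h0 : L.getD 0 0 = n) (h1 : L.getD 1 0 = m)
    (henv : Provides (envOf K i n m L ω coin 1) M env role)
    (hf₁ : c₁.Fits role (K + 14) d₁) (hf₂ : c₂.Fits role (K + 14) d₂)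
    (hs₁ : c₁.run (envOf K i n m L ω coin 1) Store.zero = s₁)
    (hq0 : 0 < s₁.var .n) (hq : s₁.var .n ≤ 24 * n) :
    ∃ reg mem hist t, Reaches M env coin
        (c₁.cost (envOf K i n m L ω coin 1) +
          c₂.cost (envOf K i n m L ω coin (s₁.var .n ^ 2)) + 4 * i + 60)
        (Config.init (program K i c₁ c₂) L) ⟨[], reg, mem, hist, t⟩ ∧
      History (envOf K i n m L ω coin (s₁.var .n ^ 2)) role
        (c₂.run (envOf K i n m L ω coin (s₁.var .n ^ 2)) s₁) hist ∧
      reg 0 = (c₂.run (envOf K i n m L ω coin (s₁.var .n ^ 2)) s₁).var .out ∧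
      ∀ l < i, reg (l + 1) = (c₂.run (envOf K i n m L ω coin (s₁.var .n ^ 2)) s₁).var (.a l) := by
  set q := s₁.var .n with hqdef
  set T := K + 20 + n + m with hT
  have hT2 : 24 * n ≤ T * T := by
    have : (20 + n) * (20 + n) ≤ T * T := Nat.mul_le_mul (by omega) (by omega)
    nlinarith
  have hqT : q ≤ T ^ 2 := by rw [pow_two]; omega
  have hq4 : q ^ 2 ≤ T ^ 4 := by
    calc q ^ 2 ≤ (T ^ 2) ^ 2 := Nat.pow_le_pow_left hqT 2
      _ = T ^ 4 := by ring
  have hT4 : T ^ 4 < M := lt_of_lt_of_le (Nat.pow_lt_pow_right (by omega) (by norm_num)) hM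
  have hT3 : T * T * T < M := by
    calc T * T * T = T ^ 3 := by ring
      _ < T ^ 8 := Nat.pow_lt_pow_right (by omega) (by norm_num)
      _ ≤ M := hM
  have hS1 := small_envOf (i := i) (ω := ω) (coin := coin) (N := 1) hn hM hL.le one_pos
    (Nat.one_le_pow _ _ (by omega))
  have hS2 := small_envOf (i := i) (ω := ω) (coin := coin) hn hM hL.le (pow_pos hq0 2) hq4
  obtain ⟨pp, pv⟩ := prelude_spec (mem := fun a => L.getD a 0) hi hT3 h0 h1
  have r0 := reaches_seqC (M := M) (env := env) (coin := coin) (l := prelude K i)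
    (by simp [prelude, Cmd.Straight]) (.seq (c₁.code 0) <| seqC squareN <| .seq (c₂.code 0) <|
    seqC (copySol i) .skip) [] (fun _ => 0) (fun a => L.getD a 0) [] 0
  set reg0 := execL M (fun a => L.getD a 0) (prelude K i) (fun _ => 0)
  -- Memory behind the input is 0, so initially all arrays are represented by zeros.
  have rep0 : Represents (envOf K i n m L ω coin 1) (K + 14) Store.zero reg0 (fun a => L.getD a 0) :=
    ⟨pv, pp, fun a _ => rfl, fun A j _ _ => List.getD_eq_default _ _ (by
      rw [hL]; exact Nat.le_add_left _ _), fun _ _ _ => rfl⟩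
  have hist0 : History (envOf K i n m L ω coin 1) role Store.zero [] := by
    cases role <;> exact ⟨rfl, rfl⟩
  obtain ⟨reg1, mem1, hist1, r1, rep1, hh1, -⟩ := c₁.simulate hS1 henv d₁ 0
    [seqC squareN <| .seq (c₂.code 0) <| seqC (copySol i) .skip] Store.zero reg0 _ [] hf₁ rep0 hist0
  rw [hs₁] at r1 rep1 hh1
  have r2 := reaches_seqC (M := M) (env := env) (coin := coin) (l := squareN)
    (by simp [squareN, Cmd.Straight]) (.seq (c₂.code 0) <| seqC (copySol i) .skip) [] reg1 mem1 hist1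
    s₁.coins
  have hreg2 : execL M mem1 squareN reg1 = Function.update reg1 (preg .N) (q ^ 2) := by
    have hne : vreg .n ≠ preg .N := by simp [vreg, preg, Var.code, Par.code]
    have hqM : q * q % M = q ^ 2 := by
      rw [← pow_two]; exact Nat.mod_eq_of_lt (hq4.trans_lt hT4)
    simp only [execL, squareN, List.foldl, Cmd.exec, RamOp.eval, Nat.zero_mod, Function.update_self,
      Function.update_of_ne hne, Nat.sub_zero, rep1.var, ← hqdef, hqM, Function.update_idem]
  rw [hreg2] at r2
  -- Changing the modulus affects a single parameter register; the store and the other parameters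
  -- carry over.
  have rep2 : Represents (envOf K i n m L ω coin (q ^ 2)) (K + 14) s₁
      (Function.update reg1 (preg .N) (q ^ 2)) mem1 := by
    refine ⟨fun v => ?_, fun p => ?_, rep1.inp, rep1.arr, rep1.arr_zero⟩
    · rw [Function.update_of_ne (by simp only [vreg, preg]; omega), rep1.var]
    · by_cases hp : p = .N
      · subst hp; simp [envOf, parOf]
      · have hne : preg p ≠ preg .N := by
          cases p <;> simp_all [preg, Par.code]
        rw [Function.update_of_ne hne, rep1.par]
        cases p <;> first | rfl | exact (hp rfl).elim
  have henv2 : Provides (envOf K i n m L ω coin (q ^ 2)) M env role := by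
    cases role <;> exact henv
  have hh2 : History (envOf K i n m L ω coin (q ^ 2)) role s₁ hist1 := by
    cases role <;> exact hh1
  obtain ⟨reg3, mem3, hist3, r3, rep3, hh3, -⟩ := c₂.simulate hS2 henv2 d₂ 0
    [seqC (copySol i) .skip] s₁ _ mem1 hist1 hf₂ rep2 hh2
  set s₂ := c₂.run (envOf K i n m L ω coin (q ^ 2)) s₁
  have r4 := reaches_seqC (M := M) (env := env) (coin := coin) (l := copySol i)
    (by
      intro c hc
      obtain ⟨j, -, hc⟩ := List.mem_flatMap.1 hc
      simp only [List.mem_cons, List.not_mem_nil, or_false] at hc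
      rcases hc with rfl | rfl <;> trivial) .skip [] reg3 mem3 hist3 s₂.coins
  have hlen : (copySol i).length = 2 * i := by simp [copySol, mul_comm]
  refine ⟨execL M mem3 (copySol i) reg3, mem3, hist3, s₂.coins,
    ((((r0.trans (Reaches.head (s := ⟨(.seq (c₁.code 0) _ :: []), _, _, _, _⟩) r1)).trans r2).trans
      (Reaches.head (s := ⟨(.seq (c₂.code 0) _ :: []), _, _, _, _⟩) r3)).trans
      (r4.trans (Reaches.step _ rfl))).mono ?_, hh3, ?_, fun l hl => ?_⟩
  · rw [hlen]
    simp only [prelude, squareN, List.length_cons, List.length_nil]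
    omega
  · rw [copySol_spec, if_neg (by omega)]
    exact rep3.var .out
  · rw [copySol_spec, if_pos (by omega)]
    exact rep3.var (.a l)

end

/-! ### Inputs -/

theorem getElem?_flatMap_pair {α : Type*} (f g : α → ℕ) : ∀ (l : List α) (e : ℕ),
    (l.flatMap fun a => [f a, g a])[2 * e]? = l[e]?.map f ∧
      (l.flatMap fun a => [f a, g a])[2 * e + 1]? = l[e]?.map g
  | [], e => by simp
  | a :: l, 0 => by simp
  | a :: l, e + 1 => by
    have := getElem?_flatMap_pair f g l e
    simpa [Nat.mul_succ] using this

theorem getElem?_flatMap_block {α : Type*} {n : ℕ} {F : α → List ℕ} (hF : ∀ a, (F a).length = n)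
    {t : ℕ} (ht : t < n) : ∀ (l : List α) (j : ℕ) (hj : j < l.length),
    (l.flatMap F)[j * n + t]? = (F l[j])[t]?
  | a :: l, 0, _ => by
    simp only [List.flatMap_cons, zero_mul, zero_add, List.getElem_cons_zero]
    rw [List.getElem?_append_left (by rw [hF]; exact ht)]
  | a :: l, j + 1, hj => by
    have := getElem?_flatMap_block hF ht l j (by simpa using hj)
    rw [List.flatMap_cons, List.getElem?_append_right (by rw [hF]; nlinarith), hF,
      show (j + 1) * n + t - n = j * n + t by rw [Nat.succ_mul]; omega, this]
    rfl

section
variable {K : ℕ} (x : GraphInput (K + 3))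

theorem length_encode : x.encode.length = (K + 3) * x.n + 2 + x.edges.length + x.edges.length := by
  simp only [GraphInput.encode, List.length_append, List.length_cons, List.length_nil,
    List.length_flatMap, List.length_map, List.map_const', List.sum_replicate, List.length_finRange,
    smul_eq_mul]
  ring

theorem encode_edge {e : ℕ} (he : e < x.edges.length) :
    x.encode.getD (2 * e + 2) 0 = x.edges[e].1 ∧ x.encode.getD (2 * e + 3) 0 = x.edges[e].2 := by
  have h := getElem?_flatMap_pair (fun a : Fin x.n × Fin x.n => (a.1 : ℕ)) (fun a => (a.2 : ℕ)) x.edges e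
  have hlen : (x.edges.flatMap fun a => [(a.1 : ℕ), (a.2 : ℕ)]).length = 2 * x.edges.length := by
    simp [mul_comm]
  simp only [GraphInput.encode, List.getD_eq_getElem?_getD, List.cons_append,
    List.nil_append, List.getElem?_cons_succ]
  rw [List.getElem?_append_left (by omega), List.getElem?_append_left (by omega), h.1, h.2]
  simp [he]

/-- Membership in the domains, for numbers. -/
def domOf (l a : ℕ) : Prop := ∃ (h : l < K + 3) (h' : a < x.n), ⟨a, h'⟩ ∈ x.dom ⟨l, h⟩

theorem encode_dom {l t : ℕ} (hl : l < K + 3) (ht : t < x.n) :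
    x.encode.getD (2 * x.edges.length + 2 + l * x.n + t) 0 = ind (domOf x l t) := by
  classical
  have hlen : ([x.n, x.edges.length] ++
      x.edges.flatMap fun a => [(a.1 : ℕ), (a.2 : ℕ)]).length = 2 * x.edges.length + 2 := by
    simp [mul_comm]
  have h := getElem?_flatMap_block (n := x.n)
    (F := fun j : Fin (K + 3) => (List.finRange x.n).map fun v => if v ∈ x.dom j then 1 else 0)
    (by simp) ht (List.finRange (K + 3)) l (by simpa using hl)
  simp only [GraphInput.encode, List.getD_eq_getElem?_getD]
  rw [List.getElem?_append_right (by rw [hlen]; omega), hlen,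
    show 2 * x.edges.length + 2 + l * x.n + t - (2 * x.edges.length + 2) = l * x.n + t by omega, h]
  simp [ht, ind_eq_ite, domOf, hl]

/-- The environment of a run on the input `x`. -/
noncomputable abbrev envX (i : ℕ) (ω : ℕ → ℕ) (coin : ℕ → Bool) (N : ℕ) : Env :=
  envOf K i x.n x.edges.length x.encode ω coin N

/-- Each edge is listed once with the smaller end first. The first summand collects the neighbours
of `t` that are larger than `t`, the second one those that are smaller. -/
theorem sum_edges_eq (g : ℕ → ℕ) {t : ℕ} (ht : t < x.n) :
    ∑ e ∈ Finset.range x.edges.length,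
      (ind (x.encode.getD (2 * e + 2) 0 = t) * g (x.encode.getD (2 * e + 3) 0) +
        ind (x.encode.getD (2 * e + 3) 0 = t) * g (x.encode.getD (2 * e + 2) 0)) =
      ∑ y ∈ Finset.range x.n, ind (relOf x.graph t y = 1) * g y := by
  classical
  set F : Fin x.n × Fin x.n → ℕ := fun e => ind ((e.1 : ℕ) = t) * g e.2 + ind ((e.2 : ℕ) = t) * g e.1
    with hF
  have h1 : ∑ e ∈ Finset.range x.edges.length,
      (ind (x.encode.getD (2 * e + 2) 0 = t) * g (x.encode.getD (2 * e + 3) 0) +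
        ind (x.encode.getD (2 * e + 3) 0 = t) * g (x.encode.getD (2 * e + 2) 0)) =
      (x.edges.map F).sum := by
    rw [Finset.sum_range, ← List.sum_ofFn]
    congr 1
    refine List.ext_getElem (by simp) fun e h _ => ?_
    have he : e < x.edges.length := by simpa using h
    simp only [List.getElem_ofFn, List.getElem_map, hF]
    rw [(encode_edge x he).1, (encode_edge x he).2]
  have h2 : (x.edges.map F).sum = ∑ e ∈ x.edges.toFinset, F e :=
    (List.sum_toFinset F x.edges_nodup).symm
  have h3 : x.edges.toFinset = Finset.univ.filter fun e : Fin x.n × Fin x.n =>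
      e.1 < e.2 ∧ x.graph.Adj e.1 e.2 := by
    ext ⟨u, v⟩
    simp [x.mem_edges]
  have h4 : ∀ y : Fin x.n, ind (relOf x.graph t y = 1) = if x.graph.Adj ⟨t, ht⟩ y then 1 else 0 := by
    intro y
    rw [ind_eq_ite]
    refine if_congr ?_ rfl rfl
    unfold relOf
    by_cases hty : t = y
    · obtain rfl : (⟨t, ht⟩ : Fin x.n) = y := Fin.ext hty
      simp
    · rw [if_neg hty]
      simp [ht]
  rw [h1, h2, h3, Finset.sum_range, Finset.sum_filter, Fintype.sum_prod_type]
  simp only [hF, h4, ite_add_zero, Finset.sum_add_distrib]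
  have e1 : ∑ u : Fin x.n, ∑ v : Fin x.n, (if u < v ∧ x.graph.Adj u v then ind ((u : ℕ) = t) * g v else 0) =
      ∑ v : Fin x.n, if (⟨t, ht⟩ : Fin x.n) < v ∧ x.graph.Adj ⟨t, ht⟩ v then g v else 0 := by
    rw [Finset.sum_eq_single (⟨t, ht⟩ : Fin x.n)]
    · simp [ind]
    · intro u _ hu
      have : (u : ℕ) ≠ t := fun h => hu (Fin.ext h)
      simp [ind_neg this]
    · simp
  have e2 : ∑ u : Fin x.n, ∑ v : Fin x.n, (if u < v ∧ x.graph.Adj u v then ind ((v : ℕ) = t) * g u else 0) =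
      ∑ u : Fin x.n, if u < ⟨t, ht⟩ ∧ x.graph.Adj u ⟨t, ht⟩ then g u else 0 := by
    refine Finset.sum_congr rfl fun u _ => ?_
    rw [Finset.sum_eq_single (⟨t, ht⟩ : Fin x.n)]
    · simp [ind]
    · intro v _ hv
      have : (v : ℕ) ≠ t := fun h => hv (Fin.ext h)
      simp [ind_neg this]
    · simp
  rw [e1, e2, ← Finset.sum_add_distrib]
  refine Finset.sum_congr rfl fun y _ => ?_
  by_cases hadj : x.graph.Adj ⟨t, ht⟩ y
  · have hne := hadj.ne
    have hadj' := hadj.symm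
    rcases lt_or_gt_of_ne hne with h | h
    · simp [hadj, hadj', h, not_lt_of_gt h]
    · simp [hadj, hadj', h, not_lt_of_gt h]
  · have hadj' : ¬ x.graph.Adj y ⟨t, ht⟩ := fun h => hadj h.symm
    simp [hadj, hadj']

theorem card_edges : x.m = x.edges.length := by
  classical
  have h : x.graph.edgeSet = (fun e : Fin x.n × Fin x.n => s(e.1, e.2)) '' (x.edges.toFinset : Set _) := by
    ext e
    induction e with
    | _ u v =>
      simp only [SimpleGraph.mem_edgeSet, Set.mem_image, List.coe_toFinset, Set.mem_ofPred_eq,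
        Prod.exists, x.mem_edges]
      constructor
      · intro h
        rcases lt_or_gt_of_ne h.ne with h' | h'
        · exact ⟨u, v, ⟨h', h⟩, rfl⟩
        · exact ⟨v, u, ⟨h', h.symm⟩, Sym2.eq_swap⟩
      · rintro ⟨a, b, ⟨-, h⟩, h'⟩
        rcases Sym2.eq_iff.1 h' with ⟨rfl, rfl⟩ | ⟨rfl, rfl⟩
        · exact h
        · exact h.symm
  rw [GraphInput.m, h, Set.InjOn.ncard_image, Set.ncard_coe_finset,
    List.toFinset_card_of_nodup x.edges_nodup]
  rintro ⟨a, b⟩ h1 ⟨c, d⟩ h2 h3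
  have h1' := ((x.mem_edges a b).1 (by simpa using h1)).1
  have h2' := ((x.mem_edges c d).1 (by simpa using h2)).1
  rcases Sym2.eq_iff.1 h3 with ⟨rfl, rfl⟩ | ⟨rfl, rfl⟩
  · rfl
  · exact (lt_asymm h1' h2').elim

theorem graphical_envX {i N : ℕ} {ω : ℕ → ℕ} {coin : ℕ → Bool} (hn : 0 < x.n) (hN : 0 < N) :
    Graphical (envX x i ω coin N) (relOf x.graph) where
  n_pos := hn
  N_pos := hN
  W_idx := by
    change x.n * x.n + x.n ≤ (K + 20 + x.n + x.edges.length) * (K + 20 + x.n + x.edges.length)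
    nlinarith
  W_addr := by
    change 2 * x.edges.length + 4 ≤ (K + 20 + x.n + x.edges.length) * (K + 20 + x.n + x.edges.length)
    nlinarith
  bd_sq := Nat.le_add_right _ _
  diag u v := by
    unfold relOf
    split_ifs <;> simp_all
  symm u v := by
    unfold relOf
    by_cases h : u = v
    · rw [if_pos h, if_pos h.symm]
    · rw [if_neg h, if_neg (Ne.symm h)]
      have : (∃ hu hv, x.graph.Adj ⟨u, hu⟩ ⟨v, hv⟩) ↔ ∃ hv hu, x.graph.Adj ⟨v, hv⟩ ⟨u, hu⟩ :=
        ⟨fun ⟨h1, h2, h3⟩ => ⟨h2, h1, h3.symm⟩, fun ⟨h1, h2, h3⟩ => ⟨h2, h1, h3.symm⟩⟩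
      by_cases h' : ∃ hu hv, x.graph.Adj ⟨u, hu⟩ ⟨v, hv⟩
      · rw [if_pos h', if_pos (this.1 h')]
      · rw [if_neg h', if_neg fun h => h' (this.2 h)]
  edge_lt e he := by
    have := encode_edge x he
    change x.encode.getD (2 * e + 2) 0 < x.n ∧ x.encode.getD (2 * e + 3) 0 < x.n
    rw [this.1, this.2]
    exact ⟨x.edges[e].1.2, x.edges[e].2.2⟩
  sum_edges g t ht := sum_edges_eq x g ht

theorem stored_envX {i N : ℕ} {ω : ℕ → ℕ} {coin : ℕ → Bool} :
    Stored (envX x i ω coin N) (K + 3) (domOf x) where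
  inp l hl t ht := encode_dom x hl ht
  lt := by
    change 2 * x.edges.length + 2 + (K + 3) * x.n <
      (K + 20 + x.n + x.edges.length) * (K + 20 + x.n + x.edges.length)
    nlinarith

end

/-! ### The search problem of a graph property -/

section
variable {K : ℕ} (φ : GraphProperty (K + 3))

/-- The default ∀ beyond the prefix ends the leading block there, so `lead` is K + 3 for a purely
existential formula. -/
def quantOf (l : ℕ) : Quant := if h : l < K + 3 then φ.quant ⟨l, h⟩ else .all

theorem exists_all : ∃ l, quantOf φ l = .all := ⟨K + 3, by simp [quantOf]⟩

instance : DecidableEq Quant := fun a b => by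
  cases a <;> cases b <;> first | exact isTrue rfl | exact isFalse (by simp)

/-- The number of leading existential quantifiers. -/
def lead : ℕ := Nat.find (exists_all φ)

theorem lead_le : lead φ ≤ K + 3 := Nat.find_min' _ (by simp [quantOf])

theorem quantOf_lead : quantOf φ (lead φ) = .all := Nat.find_spec (exists_all φ)

theorem quantOf_of_lt {l : ℕ} (h : l < lead φ) : quantOf φ l = .ex := by
  have := Nat.find_min (exists_all φ) h
  cases hq : quantOf φ l with
  | ex => rfl
  | all => exact (this hq).elim

/-- The quantifier-free part, for numbers. -/
def bodyOf (x : GraphInput (K + 3)) (v : ℕ → ℕ) : Prop :=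
  ∃ w : Fin (K + 3) → Fin x.n, (∀ i : Fin (K + 3), v i = w i) ∧ φ.bodyHolds x.graph w

theorem bodyOf_iff (x : GraphInput (K + 3)) {w : Fin (K + 3) → Fin x.n} {v : ℕ → ℕ}
    (h : ∀ i : Fin (K + 3), v i = w i) : bodyOf φ x v ↔ φ.bodyHolds x.graph w := by
  constructor
  · rintro ⟨w', h1, h2⟩
    have : w' = w := funext fun i => Fin.ext ((h1 i).symm.trans (h i))
    exact this ▸ h2
  · exact fun h' => ⟨w, h, h'⟩

theorem leading (x : GraphInput (K + 3)) : Leading (quantOf φ) (bodyOf φ x) K (lead φ) where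
  le := lead_le φ
  ex l hl := quantOf_of_lt φ hl
  dep w w' h := by
    unfold bodyOf
    refine exists_congr fun u => and_congr_left fun _ => forall_congr' fun i => ?_
    rw [h i i.2]

/-- The patterns that satisfy the quantifier-free part, and those that do not. -/
noncomputable def pos : List (ℕ → ℕ → Fin 3) := patterns (K + 3) fun _ G v => φ.bodyHolds G v
noncomputable def neg : List (ℕ → ℕ → Fin 3) := patterns (K + 3) fun _ G v => ¬ φ.bodyHolds G v

theorem bodyHolds_congr {n n' : ℕ} {G : SimpleGraph (Fin n)} {G' : SimpleGraph (Fin n')}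
    {v : Fin (K + 3) → Fin n} {v' : Fin (K + 3) → Fin n'} (h : patternOf G v = patternOf G' v') :
    φ.bodyHolds G v ↔ φ.bodyHolds G' v' :=
  realize_congr (patternOf_eq h) φ.body_qf rfl _ _

theorem setup_envX (x : GraphInput (K + 3)) {i N : ℕ} {ω : ℕ → ℕ} {coin : ℕ → Bool} (hn : 0 < x.n)
    (hN : x.n < N) : Setup (envX x i ω coin N) (relOf x.graph) K (pos φ) (neg φ) (bodyOf φ x) where
  graph := graphical_envX x hn (by omega)
  n_lt_N := hN
  dbl := (two_mul _).symm
  dbl_le := Nat.le_add_left _ _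
  pos := covers_patterns (bodyHolds_congr φ) x.graph fun w v h => bodyOf_iff φ x h
  neg := covers_patterns (fun h => not_congr (bodyHolds_congr φ h)) x.graph
    fun w v h => not_congr (bodyOf_iff φ x h)

/-- Being a solution, for numbers. -/
def SolX (x : GraphInput (K + 3)) (a : ℕ → ℕ) : Prop :=
  Sol x.n (quantOf φ) (domOf x) (bodyOf φ x) K (lead φ) a

theorem search_iff (x : GraphInput (K + 3)) (y : List ℕ) :
    φ.search x y ↔ ∃ a, y = (List.range (lead φ)).map a ∧ SolX φ x a := by
  have hD : Describes (n := x.n) (quantOf φ) (domOf x) (bodyOf φ x) 0 (fun _ => 0) φ.quant x.dom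
      (φ.bodyHolds x.graph) :=
    ⟨fun l => by simp [quantOf], fun l a => by simp [domOf], fun w => (bodyOf_iff φ x fun i => by
      simp [overlay]).symm⟩
  have := isSetting_iff (i := lead φ) hD (lead_le φ) (fun l hl => by
    rw [zero_add]; exact quantOf_of_lt φ hl) (fun _ => by rw [zero_add]; exact quantOf_lead φ) y
  have hs : φ.search x y ↔ ∃ l : List (Fin x.n), y = l.map (fun a : Fin x.n => (a : ℕ)) ∧
      IsSetting (K + 3) φ.quant x.dom (φ.bodyHolds x.graph) l := by
    unfold GraphProperty.search
    refine exists_congr fun l => and_congr_left fun _ => ?_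
    simp [List.map_eq_flatMap]
  rw [hs, this]
  simp only [zero_add, not_lt_zero, false_or]
  constructor
  · rintro ⟨a, h1, -, h2, h3⟩
    exact ⟨a, h1, h2, h3⟩
  · rintro ⟨a, h1, h2⟩
    have h3 : ∀ l < lead φ, a l = if l < lead φ then a l else 0 := fun l hl => by rw [if_pos hl]
    have h4 := Sol.congr (leading φ x) h3 h2
    refine ⟨_, h1.trans (List.map_congr_left fun l hl => h3 l (List.mem_range.1 hl)), ?_, h4.1, h4.2⟩
    exact fun l hl => if_neg (by omega)

end

/-! ### Probabilities -/

section
variable {Ω : Type} [Fintype Ω]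

theorem prob_eq_one [Nonempty Ω] {E : Ω → Prop} (h : ∀ ω, E ω) : prob E = 1 := by
  have : Nat.card {ω // E ω} = Fintype.card Ω := by
    rw [← Nat.card_eq_fintype_card]
    exact Nat.card_congr (Equiv.subtypeUnivEquiv h)
  rw [prob, this, div_self]
  exact_mod_cast Fintype.card_ne_zero

theorem prob_eq_zero {E : Ω → Prop} (h : ∀ ω, ¬ E ω) : prob E = 0 := by
  have : IsEmpty {ω // E ω} := ⟨fun ω => h ω.1 ω.2⟩
  simp [prob]

theorem two_thirds_le_prob [Nonempty Ω] {E E' : Ω → Prop} (h : ∀ ω, ¬ E' ω → E ω)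
    (hE : prob E ≤ 1 / 3) : 2 / 3 ≤ prob E' := by
  classical
  have hc : (0 : ℝ) < Fintype.card Ω := by exact_mod_cast Fintype.card_pos
  have h1 : Fintype.card Ω ≤ Nat.card {ω // E ω} + Nat.card {ω // E' ω} := by
    rw [Nat.card_eq_fintype_card, Nat.card_eq_fintype_card, Fintype.card_subtype,
      Fintype.card_subtype, ← Finset.card_univ]
    refine (Finset.card_le_card fun ω _ => ?_).trans (Finset.card_union_le _ _)
    simp only [Finset.mem_union, Finset.mem_filter, Finset.mem_univ, true_and]
    by_cases h' : E' ω
    · exact .inr h'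
    · exact .inl (h ω h')
  have h2 : (Fintype.card Ω : ℝ) ≤ Nat.card {ω // E ω} + Nat.card {ω // E' ω} := by exact_mod_cast h1
  rw [prob, div_le_iff₀ hc] at hE
  rw [prob, le_div_iff₀ hc]
  linarith

end

theorem num_injective {f g : ℕ → Bool} : ∀ {τ : ℕ}, num f τ = num g τ → ∀ i < τ, f i = g i := by
  intro τ
  induction τ with
  | zero => exact fun _ i hi => by omega
  | succ τ ih =>
    intro h i hi
    simp only [num] at h
    have h1 : num f τ = num g τ := by split_ifs at h <;> omega
    rcases Nat.lt_succ_iff_lt_or_eq.1 hi with hi | rfl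
    · exact ih h1 i hi
    · cases hf : f i <;> cases hg : g i <;> simp [hf, hg, h1] at h ⊢

/-- The number determines the first τ coins, so each bad value accounts for at most 2^(t - τ) of the
2^t sequences. -/
theorem prob_num_mem {t τ : ℕ} (hτ : τ ≤ t) {bad : Finset ℕ} (hbad : 3 * bad.card ≤ 2 ^ τ) :
    prob (fun r : Fin t → Bool => num (tape r) τ ∈ bad) ≤ 1 / 3 := by
  have h1 : Nat.card {r : Fin t → Bool // num (tape r) τ ∈ bad} ≤ bad.card * 2 ^ (t - τ) := by
    have := Nat.card_le_card_of_injective (β := bad × (Fin (t - τ) → Bool))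
      (fun r : {r : Fin t → Bool // num (tape r) τ ∈ bad} =>
        (⟨num (tape r.1) τ, r.2⟩, fun i : Fin (t - τ) => r.1 ⟨τ + i, by omega⟩)) (by
      rintro ⟨r, hr⟩ ⟨r', hr'⟩ h
      simp only [Prod.mk.injEq, Subtype.mk.injEq] at h
      refine Subtype.ext (funext fun i => ?_)
      by_cases hi : (i : ℕ) < τ
      · have := num_injective h.1 i hi
        simpa [tape] using this
      · have := congrFun h.2 ⟨i - τ, by omega⟩
        simpa [show τ + ((i : ℕ) - τ) = i by omega] using this)
    simpa using this
  have h2 : 3 * Nat.card {r : Fin t → Bool // num (tape r) τ ∈ bad} ≤ 2 ^ t := by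
    calc 3 * Nat.card {r : Fin t → Bool // num (tape r) τ ∈ bad}
        ≤ 3 * bad.card * 2 ^ (t - τ) := by rw [mul_assoc]; exact Nat.mul_le_mul_left _ h1
      _ ≤ 2 ^ τ * 2 ^ (t - τ) := Nat.mul_le_mul_right _ hbad
      _ = 2 ^ t := by rw [← pow_add]; congr 1; omega
  have h3 : (3 : ℝ) * Nat.card {r : Fin t → Bool // num (tape r) τ ∈ bad} ≤ 2 ^ t := by exact_mod_cast h2
  rw [prob, div_le_iff₀ (by positivity)]
  simp only [Fintype.card_pi, Fintype.card_bool, Finset.prod_const, Finset.card_univ, Fintype.card_fin,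
    Nat.cast_pow, Nat.cast_ofNat]
  linarith

/-! ### Runs of machines -/

theorem Reaches.iterate {M B t : ℕ} {env : List Msg → Option ℕ} {coin : ℕ → Bool} {s s' : Config}
    (h : Reaches M env coin B s s') (hs : s'.code = []) (ht : B ≤ t) :
    (Config.step M env coin)^[t] s = s' := by
  obtain ⟨t', ht', rfl⟩ := h
  obtain ⟨u, rfl⟩ := Nat.exists_eq_add_of_le (ht'.trans ht)
  rw [Nat.add_comm, Function.iterate_add_apply]
  refine Function.iterate_fixed ?_ u
  simp only [Config.step, hs]

theorem RamOp.eval_lt {M : ℕ} (hM : 0 < M) (o : RamOp) {a b : ℕ} (ha : a < M) : o.eval M a b < M := by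
  cases o <;> simp only [RamOp.eval] <;> first
    | exact Nat.mod_lt _ hM
    | exact lt_of_le_of_lt (Nat.sub_le _ _) ha
    | exact lt_of_le_of_lt (Nat.div_le_self _ _) ha
    | exact lt_of_le_of_lt (Nat.mod_le _ _) ha

/-- All words of the configuration are below `M`. -/
structure Bounded (M : ℕ) (s : Config) : Prop where
  reg : ∀ r, s.reg r < M
  mem : ∀ a, s.mem a < M
  sent : ∀ v ∈ sentWords s.hist, v < M

theorem update_lt {M : ℕ} {f : ℕ → ℕ} (hf : ∀ r, f r < M) (r : ℕ) {v : ℕ} (hv : v < M) :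
    ∀ r', Function.update f r v r' < M := by
  intro r'
  rw [Function.update_apply]
  split_ifs
  · exact hv
  · exact hf r'

/-- The verifier reduces received words modulo `M`. The honest prover is not affected by this,
because the words it sends are below `M` already; this invariant provides that. -/
theorem Bounded.step {M : ℕ} {env : List Msg → Option ℕ} {coin : ℕ → Bool} {s : Config} (hM : 0 < M)
    (h : Bounded M s) : Bounded M (Config.step M env coin s) := by
  obtain ⟨code, reg, mem, hist, coins⟩ := s
  obtain ⟨h1, h2, h3⟩ := h
  have hm : ∀ a, a % M < M := fun a => Nat.mod_lt _ hM
  rcases code with _ | ⟨c, k⟩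
  · exact ⟨h1, h2, h3⟩
  cases c with
  | const r v => exact ⟨update_lt h1 r (hm v), h2, h3⟩
  | op o r a b => exact ⟨update_lt h1 r (RamOp.eval_lt hM o (h1 a)), h2, h3⟩
  | load r a => exact ⟨update_lt h1 r (h2 _), h2, h3⟩
  | store a r => exact ⟨h1, update_lt h2 _ (h1 r), h3⟩
  | flip r => exact ⟨update_lt h1 r (hm _), h2, h3⟩
  | send r =>
    refine ⟨h1, h2, fun v hv => ?_⟩
    simp only [Config.step, sentWords, List.filterMap_append, List.mem_append] at hv
    rcases hv with hv | hv
    · exact h3 v hv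
    · simp only [List.filterMap_cons, List.filterMap_nil, List.mem_singleton] at hv
      exact hv ▸ h1 r
  | recv r =>
    simp only [Config.step]
    split
    · exact ⟨h1, h2, h3⟩
    · refine ⟨update_lt h1 r (hm _), h2, fun v hv => ?_⟩
      simp only [sentWords, List.filterMap_append, List.mem_append] at hv
      rcases hv with hv | hv
      · exact h3 v hv
      · simp at hv
  | _ => exact ⟨h1, h2, h3⟩

theorem Bounded.reaches {M B : ℕ} {env : List Msg → Option ℕ} {coin : ℕ → Bool} {s s' : Config}
    (hM : 0 < M) (h : Bounded M s) (hr : Reaches M env coin B s s') : Bounded M s' := by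
  obtain ⟨t, -, rfl⟩ := hr
  induction t generalizing s with
  | zero => exact h
  | succ t ih => exact ih (h.step hM)

/-- What a verifier that never sends has received from the prover `σ`. -/
def received (M : ℕ) (σ : Strategy) : ℕ → List Msg
  | 0 => []
  | p + 1 => received M σ p ++ [.got (σ (received M σ p) % M)]

/-- The words of the prover `σ`, in the interaction with a verifier that never sends. -/
def wordOf (M : ℕ) (σ : Strategy) (p : ℕ) : ℕ := σ (received M σ p) % M

/-- With a verifier that sends nothing, each answer of a strategy depends only on its own earlier
words. So any prover is one sequence of words, independent of the coins, and adaptivity is no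
advantage. -/
theorem received_eq {M : ℕ} {σ : Strategy} (p : ℕ) :
    received M σ p = (List.range p).map fun i => .got (wordOf M σ i) := by
  induction p with
  | zero => rfl
  | succ p ih =>
    rw [received, List.range_succ, List.map_append, ← ih]
    rfl

theorem sentWords_received {M : ℕ} {σ : Strategy} (p : ℕ) : sentWords (received M σ p) = [] := by
  rw [received_eq, sentWords, List.filterMap_map, List.filterMap_eq_nil_iff]
  simp

theorem gotWords_received {M : ℕ} {σ : Strategy} (p : ℕ) : (gotWords (received M σ p)).length = p := by
  rw [received_eq, gotWords, List.filterMap_map]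
  have : (List.range p).filterMap (some ∘ wordOf M σ) = (List.range p).map (wordOf M σ) :=
    congrFun List.filterMap_eq_map _
  exact (congrArg List.length this).trans (by simp)

theorem sentWords_map_sent (l : List ℕ) : sentWords (l.map .sent) = l := by
  rw [sentWords, List.filterMap_map]
  exact List.filterMap_some

/-! ### The verifier and the prover as machine runs. -/

section
variable {K : ℕ} (φ : GraphProperty (K + 3)) (P : Protocol K (lead φ) (quantOf φ) (pos φ) (neg φ))

/-- The first phase of the verifier. -/
def verifierStart (K : ℕ) : Stmt := .seq (load (K + 3)) (.seq toss recvPrime)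

/-- The first phase of the prover. -/
def proverStart (K : ℕ) : Stmt := .seq (load (K + 3)) findPrime

noncomputable def verifier : Cmd := program K (lead φ) (verifierStart K) (verifyProg P)

noncomputable def prover : Cmd := program K (lead φ) (proverStart K) (proveProg P)

theorem verifierStart_fits : (verifierStart K).Fits .verifier (K + 14) (K + 1) := by
  have h1 : (load (K + 3)).Fits .verifier (K + 14) (0 + 1) := load_fits (by omega)
  refine ⟨h1.mono (by omega), ?_, ?_⟩
  · simp [toss]
  · simp [recvPrime, noDivisor]

theorem proverStart_fits : (proverStart K).Fits .prover (K + 14) (K + 2) := by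
  have h1 : (load (K + 3)).Fits .prover (K + 14) (0 + 1) := load_fits (by omega)
  refine ⟨h1.mono (by omega), ?_⟩
  simp [findPrime, noDivisor]

/-- The candidate solution in the prover's words `ω`. -/
def answer (n : ℕ) (ω : ℕ → ℕ) (l : ℕ) : ℕ := ω (1 + l) % n

/-- The acceptance of the verifier, for the prover's words `ω`. -/
def Accepts (x : GraphInput (K + 3)) (ω : ℕ → ℕ) (coin : ℕ → Bool) : Prop :=
  Valid x.n (ω 0) ∧ SolX φ x (answer x.n ω) ∧ ∀ j < lead φ,
    P.Acc x.n (ω 0 ^ 2) (num coin (Nat.log 2 (12 * x.n))) (relOf x.graph)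
      (restr (domOf x) (answer x.n ω) j) (bodyOf φ x) ω (1 + lead φ + j * P.len x.n)

/-- A bound for the lengths of all loops. -/
def size (x : GraphInput (K + 3)) : ℕ := 12 * x.n + x.edges.length

variable {φ} {x : GraphInput (K + 3)} {M : ℕ}

theorem par_le_size {i N : ℕ} {ω : ℕ → ℕ} {coin : ℕ → Bool} (p : Par) (hp : p.IsLength) :
    (envX x i ω coin N).par p ≤ size x := by
  cases p <;> first | exact hp.elim | (simp only [envOf, parOf, size]; omega)

theorem two_big_lt {i N : ℕ} {ω : ℕ → ℕ} {coin : ℕ → Bool} :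
    2 * (envX x i ω coin N).par .big + 1 < (envX x i ω coin N).par .W := by
  change 2 * (12 * x.n) + 1 < (K + 20 + x.n + x.edges.length) * (K + 20 + x.n + x.edges.length)
  nlinarith

theorem verifierStart_spec {i : ℕ} {ω : ℕ → ℕ} {coin : ℕ → Bool} (hn : 0 < x.n) {s : Store}
    (hs : (verifierStart K).run (envX x i ω coin 1) Store.zero = s) :
    Good (envX x i ω coin 1) (relOf x.graph) (K + 3) (domOf x) 0 (fun _ => 0) s ∧ s.pos = 1 ∧
      s.var .r = num coin (Nat.log 2 (12 * x.n)) ∧ s.var .ok = ind (Valid x.n (ω 0)) ∧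
      12 * x.n < s.var .n ∧ s.var .n ≤ 24 * x.n ∧ (Valid x.n (ω 0) → s.var .n = ω 0) := by
  subst hs
  have hG := graphical_envX x (i := i) (ω := ω) (coin := coin) hn one_pos
  have g1 := load_spec (v := fun _ => 0) (s := Store.zero) hG (stored_envX x) (fun _ => rfl)
  have q1 := run_quiet (Γ := envX x i ω coin 1) (c := load (K + 3)) Store.zero (by simp)
  set s1 := (load (K + 3)).run (envX x i ω coin 1) Store.zero
  have g2 := g1.run (c := toss) (by simp [toss]) (by simp [toss]) (by simp)
  obtain ⟨t1, t2⟩ := toss_spec (s := s1) hn rfl two_big_lt q1.2.1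
  set s2 := toss.run (envX x i ω coin 1) s1
  have g3 := g2.run (c := recvPrime) (by simp [recvPrime, noDivisor])
    (by simp [recvPrime, noDivisor]) (by simp)
  have hp2 : s2.pos = 0 := t2.trans q1.1
  have hr := recvPrime_spec (s := s2) hn rfl (two_big_lt (x := x) (i := i) (ω := ω) (coin := coin) (N := 1))
  have hv : (recvPrime.run (envX x i ω coin 1) s2).var .r = s2.var .r :=
    run_var _ (by simp [recvPrime, noDivisor])
  rw [hp2] at hr
  exact ⟨g3, hr.1, hv.trans t1, hr.2.1, hr.2.2.1, hr.2.2.2.1, hr.2.2.2.2⟩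

/-- `Accepts` lists the conditions on the words and the coins under which the run ends with an
answer; the random number appears only in the acceptance of the protocol blocks. The probability
bounds use nothing else about the machine. -/
theorem verifier_run (hn : 0 < x.n) (hlead : 0 < lead φ) (hM : (K + 20 + x.n + x.edges.length) ^ 8 ≤ M)
    (σ : Strategy) (coin : ℕ → Bool) : ∃ s : Config,
      Reaches M (fun h => some (σ h)) coin (((verifierStart K).coef + (verifyProg P).coef +
        4 * lead φ + 60) * size x ^ (K + 1)) (Config.init (verifier φ P) x.encode) s ∧ s.code = [] ∧
      (Accepts φ P x (wordOf M σ) coin →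
        s.output = some ((List.range (lead φ)).map (answer x.n (wordOf M σ)))) ∧
      (¬ Accepts φ P x (wordOf M σ) coin → s.output = none) := by
  set ω := wordOf M σ with hω
  have hle := lead_le φ
  obtain ⟨s₁, hs₁⟩ : ∃ s, (verifierStart K).run (envX x (lead φ) ω coin 1) Store.zero = s := ⟨_, rfl⟩
  obtain ⟨g, hp, hr, hok, hq1, hq2, hq3⟩ := verifierStart_spec hn hs₁
  have henv : Provides (envX x (lead φ) ω coin 1) M (fun h => some (σ h)) .verifier := by
    intro p
    refine ⟨_, rfl, ?_⟩
    change σ ((List.range p).map fun i => .got (ω i)) % M = ω p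
    rw [hω, ← received_eq]; rfl
  have h0 : x.encode.getD 0 0 = x.n := by simp [GraphInput.encode]
  have h1 : x.encode.getD 1 0 = x.edges.length := by simp [GraphInput.encode]
  obtain ⟨reg, mem, hist, t, hR, -, hout, ha⟩ := program_run (i := lead φ) (coin := coin) hn hle hM
    (length_encode x) h0 h1 henv verifierStart_fits (verifyProg_fits P hle hlead le_rfl) hs₁
    (by omega) hq2
  have hS : Setup (envX x (lead φ) ω coin (s₁.var .n ^ 2)) (relOf x.graph) K (pos φ) (neg φ)
      (bodyOf φ x) := setup_envX φ x hn (by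
    have : s₁.var .n ≤ s₁.var .n ^ 2 := Nat.le_self_pow (by norm_num) _
    omega)
  have hell : (envX x (lead φ) ω coin (s₁.var .n ^ 2)).par .ell <
      (envX x (lead φ) ω coin (s₁.var .n ^ 2)).par .W := by
    change lead φ + 1 < (K + 20 + x.n + x.edges.length) * (K + 20 + x.n + x.edges.length)
    nlinarith
  obtain ⟨v1, v2⟩ := verifyProg_spec P hS (leading φ x) (v := fun _ => 0) (dom := domOf x) (s := s₁)
    ⟨g.rel, g.dom, g.x, g.lt⟩ (by rw [hok]; exact ind_le_one _) hell
    (a := answer x.n ω) (by rw [hp]; rfl)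
  rw [ind_congr (q := Accepts φ P x ω coin)] at v1
  · refine ⟨_, hR.mono ?_, rfl, fun h => ?_, fun h => ?_⟩
    · have hS1 : 1 ≤ size x := by unfold size; omega
      have c1 := Stmt.cost_le hS1 (par_le_size (x := x) (i := lead φ) (ω := ω) (coin := coin) (N := 1))
        (verifierStart K) (K + 1) verifierStart_fits
      have c2 := Stmt.cost_le hS1 (par_le_size (x := x) (i := lead φ) (ω := ω) (coin := coin)
        (N := s₁.var .n ^ 2)) (verifyProg P) (K + 1) (verifyProg_fits P hle hlead le_rfl)
      have c3 : 1 ≤ size x ^ (K + 1) := Nat.one_le_pow _ _ hS1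
      have c4 : 4 * lead φ + 60 ≤ (4 * lead φ + 60) * size x ^ (K + 1) :=
        Nat.le_mul_of_pos_right _ c3
      exact (add_assoc _ _ _).le.trans ((add_le_add (add_le_add c1 c2) c4).trans (le_of_eq (by ring)))
    · have hreg : reg 0 = lead φ + 1 := by
        rw [hout, v1, ind_pos h, one_mul]; rfl
      simp only [Config.output, hreg]
      congr 1
      refine List.map_congr_left fun l hl => ?_
      rw [ha l (List.mem_range.1 hl), v2 l (List.mem_range.1 hl)]
    · have hreg : reg 0 = 0 := by rw [hout, v1, ind_neg h, zero_mul]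
      simp only [Config.output, hreg]
  · rw [hok, hp, hr, ind_eq_one]
    refine and_congr_right fun hV => ?_
    rw [hq3 hV]
    rfl

/-- The prover only sends, so its run is the same in every environment, in particular for every
queue of words from the verifier, and it always halts. -/
theorem prover_run (hn : 0 < x.n) (hM : (K + 20 + x.n + x.edges.length) ^ 8 ≤ M)
    (env : List Msg → Option ℕ) (coin : ℕ → Bool) : ∃ s : Config,
      Reaches M env coin (((proverStart K).coef + (proveProg P).coef + 4 * lead φ + 60) *
        size x ^ (K + 2)) (Config.init (prover φ P) x.encode) s ∧ s.code = [] ∧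
      (∀ a, SolX φ x a → ∃ g q blk, Greedy x.n (quantOf φ) (domOf x) (bodyOf φ x) K (lead φ) g ∧
        Valid x.n q ∧ sentWords s.hist = q :: ((List.range (lead φ)).map g ++ blk) ∧
        ∀ ω p, Serves ω p blk → ∀ r, ∀ j < lead φ, P.Acc x.n (q ^ 2) r (relOf x.graph)
          (restr (domOf x) g j) (bodyOf φ x) ω (p + j * P.len x.n)) := by
  have hle := lead_le φ
  -- A dummy, since the prover receives nothing.
  set ω : ℕ → ℕ := fun _ => 0
  set Γ := envX x (lead φ) ω coin 1 with hΓ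
  obtain ⟨s₁, hs₁⟩ : ∃ s, (proverStart K).run Γ Store.zero = s := ⟨_, rfl⟩
  have hG := graphical_envX x (i := lead φ) (ω := ω) (coin := coin) hn one_pos
  have g1 := load_spec (v := fun _ => 0) (s := Store.zero) hG (stored_envX x) (fun _ => rfl)
  have q1 := run_quiet (Γ := Γ) (c := load (K + 3)) Store.zero (by simp)
  have g2 := g1.run (c := findPrime) (by simp [findPrime, noDivisor]) (by simp [findPrime, noDivisor])
    (by simp)
  obtain ⟨f1, f2⟩ := findPrime_spec (s := (load (K + 3)).run Γ Store.zero) hn rfl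
    (two_big_lt (x := x) (i := lead φ) (ω := ω) (coin := coin) (N := 1))
  have e1 : findPrime.run Γ ((load (K + 3)).run Γ Store.zero) = s₁ := hs₁
  rw [e1] at f1 f2 g2
  rw [q1.2.2] at f2
  have h0 : x.encode.getD 0 0 = x.n := by simp [GraphInput.encode]
  have h1 : x.encode.getD 1 0 = x.edges.length := by simp [GraphInput.encode]
  have f1' : Valid x.n (s₁.var .n) := f1
  have hVq := f1'.1
  obtain ⟨reg, mem, hist, t, hR, hH, -, -⟩ := program_run (i := lead φ) (coin := coin) (env := env)
    (role := .prover) hn hle hM (length_encode x) h0 h1 (ω := ω) trivial proverStart_fits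
    (proveProg_fits P hle le_rfl) hs₁ (by omega) f1'.2.1
  refine ⟨_, hR.mono ?_, rfl, fun a ha => ?_⟩
  · have hS1 : 1 ≤ size x := by unfold size; omega
    have c1 := Stmt.cost_le hS1 (par_le_size (x := x) (i := lead φ) (ω := ω) (coin := coin) (N := 1))
      (proverStart K) (K + 2) proverStart_fits
    have c2 := Stmt.cost_le hS1 (par_le_size (x := x) (i := lead φ) (ω := ω) (coin := coin)
      (N := s₁.var .n ^ 2)) (proveProg P) (K + 2) (proveProg_fits P hle le_rfl)
    have c3 : 1 ≤ size x ^ (K + 2) := Nat.one_le_pow _ _ hS1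
    have c4 : 4 * lead φ + 60 ≤ (4 * lead φ + 60) * size x ^ (K + 2) :=
      Nat.le_mul_of_pos_right _ c3
    exact (add_assoc _ _ _).le.trans ((add_le_add (add_le_add c1 c2) c4).trans (le_of_eq (by ring)))
  · have hS : Setup (envX x (lead φ) ω coin (s₁.var .n ^ 2)) (relOf x.graph) K (pos φ) (neg φ)
        (bodyOf φ x) := setup_envX φ x hn (by
      have : s₁.var .n ≤ s₁.var .n ^ 2 := Nat.le_self_pow (by norm_num) _
      omega)
    obtain ⟨g, blk, h2, h3, h4⟩ := proveProg_spec P hS (leading φ x) (v := fun _ => 0)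
      (dom := domOf x) (s := s₁) ⟨g2.rel, g2.dom, g2.x, g2.lt⟩ ha
    refine ⟨g, s₁.var .n, blk, h2, f1', ?_, h4⟩
    rw [hH.1, sentWords_map_sent, h3, f2]
    rfl

end

/-! ### The canonical solution, soundness and completeness. -/

section
variable {K : ℕ} {φ : GraphProperty (K + 3)} {x : GraphInput (K + 3)} {M : ℕ}

/-- The lexicographically first solution. -/
noncomputable def canon (φ : GraphProperty (K + 3)) (x : GraphInput (K + 3)) : List ℕ :=
  open Classical in
  if h : ∃ a, Greedy x.n (quantOf φ) (domOf x) (bodyOf φ x) K (lead φ) a then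
    (List.range (lead φ)).map h.choose
  else []

theorem map_range_congr {i : ℕ} {a b : ℕ → ℕ} (h : ∀ l < i, a l = b l) :
    (List.range i).map a = (List.range i).map b :=
  List.map_congr_left fun l hl => h l (List.mem_range.1 hl)

/-- Greedy solutions are unique: at a first difference the later one would both exclude the earlier
one and be contradicted by it. -/
theorem canon_eq {g : ℕ → ℕ} (hg : Greedy x.n (quantOf φ) (domOf x) (bodyOf φ x) K (lead φ) g) :
    canon φ x = (List.range (lead φ)).map g := by
  have h : ∃ a, Greedy x.n (quantOf φ) (domOf x) (bodyOf φ x) K (lead φ) a := ⟨g, hg⟩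
  rw [canon, dif_pos h]
  rcases (leading φ x).first_difference hg h.choose_spec.sol with h' | ⟨j, hj, h1, h2⟩
  · exact map_range_congr h'
  · exact ((leading φ x).not_noSol hg hj h1 h2 ((leading φ x).noSol_of_greedy h.choose_spec hj)).elim

theorem lex_map_range {i j : ℕ} {a b : ℕ → ℕ} (hj : j < i) (h : ∀ l < j, a l = b l) (hlt : a j < b j) :
    List.Lex (· < ·) ((List.range i).map a) ((List.range i).map b) := by
  induction i generalizing j a b with
  | zero => omega
  | succ i ih =>
    rw [List.range_succ_eq_map, List.map_cons, List.map_cons, List.map_map, List.map_map]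
    cases j with
    | zero => exact List.Lex.rel hlt
    | succ j =>
      rw [h 0 (by omega)]
      exact List.Lex.cons (ih (by omega) (fun l hl => h (l + 1) (by omega)) hlt)

theorem exists_canonical {y : List ℕ} (hy : φ.search x y) :
    ∃ g, Greedy x.n (quantOf φ) (domOf x) (bodyOf φ x) K (lead φ) g ∧
      canon φ x = (List.range (lead φ)).map g := by
  obtain ⟨a, -, ha⟩ := (search_iff φ x y).1 hy
  obtain ⟨g, hg⟩ := (leading φ x).exists_greedy ha (lead φ) le_rfl
  exact ⟨g, hg, canon_eq hg⟩

theorem canon_spec (h : ∃ y, φ.search x y) : φ.search x (canon φ x) ∧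
    ∀ y, φ.search x y → canon φ x = y ∨ List.Lex (· < ·) (canon φ x) y := by
  obtain ⟨y, hy⟩ := h
  obtain ⟨g, hg, hc⟩ := exists_canonical hy
  refine ⟨(search_iff φ x _).2 ⟨g, hc, hg.sol⟩, fun y hy => ?_⟩
  obtain ⟨a, rfl, ha⟩ := (search_iff φ x y).1 hy
  rw [hc]
  rcases (leading φ x).first_difference hg ha with h' | ⟨j, hj, h1, h2⟩
  · exact .inl (map_range_congr fun l hl => (h' l hl).symm)
  · exact .inr (lex_map_range hj (fun l hl => (h1 l hl).symm) h2)

section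
variable (P : Protocol K (lead φ) (quantOf φ) (pos φ) (neg φ)) (hn : 0 < x.n) (hlead : 0 < lead φ)
  (hM : (K + 20 + x.n + x.edges.length) ^ 8 ≤ M) {t : ℕ}
  (ht : ((verifierStart K).coef + (verifyProg P).coef + 4 * lead φ + 60) * size x ^ (K + 1) ≤ t)
include hn hlead hM ht

theorem runVerifier_eq (σ : Strategy) (coin : ℕ → Bool) :
    (runVerifier M (verifier φ P) x.encode σ coin t).Halted ∧
      (Accepts φ P x (wordOf M σ) coin → (runVerifier M (verifier φ P) x.encode σ coin t).output =
        some ((List.range (lead φ)).map (answer x.n (wordOf M σ)))) ∧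
      (¬ Accepts φ P x (wordOf M σ) coin →
        (runVerifier M (verifier φ P) x.encode σ coin t).output = none) := by
  obtain ⟨s, h1, h2, h3, h4⟩ := verifier_run P hn hlead hM σ coin
  rw [runVerifier, h1.iterate h2 ht]
  exact ⟨h2, h3, h4⟩

/-- A wrong answer must be a solution, since the verifier checks this itself. At its first
difference from the canonical one, the corresponding statement `NoSol` is false, so acceptance
requires a random number in the small set given by the soundness of the protocol. In all other cases
the desired outcome is certain. -/
theorem verifier_sound (hlog : Nat.log 2 (12 * x.n) ≤ t) (hsol : ∃ y, φ.search x y) (σ : Strategy) :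
    2 / 3 ≤ prob fun r : Fin t → Bool =>
      (runVerifier M (verifier φ P) x.encode σ (tape r) t).output = some (canon φ x) ∨
        (runVerifier M (verifier φ P) x.encode σ (tape r) t).output = none := by
  have hrun := runVerifier_eq P hn hlead hM ht σ
  obtain ⟨y, hy⟩ := hsol
  obtain ⟨g, hg, hc⟩ := exists_canonical hy
  set ω := wordOf M σ
  by_cases hV : Valid x.n (ω 0) ∧ SolX φ x (answer x.n ω)
  · rcases (leading φ x).first_difference hg hV.2 with h' | ⟨j, hj, h1, h2⟩
    · rw [prob_eq_one]
      · norm_num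
      · intro r
        by_cases hA : Accepts φ P x ω (tape r)
        · left
          rw [(hrun (tape r)).2.1 hA, hc, map_range_congr h']
        · exact .inr ((hrun (tape r)).2.2 hA)
    · obtain ⟨bad, hb1, hb2⟩ := P.sound hn hV.1.2.2 hV.1.1
        (graphical_envX x (i := 0) (N := 1) (ω := ω) (coin := fun _ => true) hn one_pos).symm
        (covers_patterns (bodyHolds_congr φ) x.graph fun w v h => bodyOf_iff φ x h)
        ((leading φ x).not_noSol hg hj h1 h2) ω (1 + lead φ + j * P.len x.n)
      -- This gives 6 n < 2^τ, whereas there are at most 2 n bad values; so they have probability at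
      -- most 1/3. Here the constant 12 is needed.
      have hpow : 12 * x.n < 2 * 2 ^ Nat.log 2 (12 * x.n) := by
        have := Nat.lt_pow_succ_log_self (b := 2) (by norm_num) (12 * x.n)
        rw [pow_succ] at this; omega
      refine two_thirds_le_prob (fun r hr => ?_) (prob_num_mem hlog (bad := bad) (by omega))
      by_cases hA : Accepts φ P x ω (tape r)
      · refine hb2 _ ((num_lt _ _).trans_le (Nat.pow_log_le_self 2 (by omega))) (hA.2.2 j hj)
      · exact (hr (.inr ((hrun (tape r)).2.2 hA))).elim
  · rw [prob_eq_one]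
    · norm_num
    · exact fun r => .inr ((hrun (tape r)).2.2 fun hA => hV ⟨hA.1, hA.2.1⟩)

/-- Without a solution the verifier always outputs ⊥, because it evaluates the formula at the
candidate itself. -/
theorem verifier_standard_sound (hsol : ¬ ∃ y, φ.search x y) (σ : Strategy) :
    prob (fun r : Fin t → Bool =>
      (runVerifier M (verifier φ P) x.encode σ (tape r) t).output ≠ none) ≤ 1 / 3 := by
  rw [prob_eq_zero]
  · norm_num
  · refine fun r => not_not_intro ((runVerifier_eq P hn hlead hM ht σ (tape r)).2.2 fun hA => hsol ?_)
    exact ⟨_, (search_iff φ x _).2 ⟨_, rfl, hA.2.1⟩⟩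

/-- The honest prover succeeds with probability 1: the identity of polynomials that it proves holds
at every sample point. -/
theorem prover_complete {t' : ℕ} (ht' : ((proverStart K).coef + (proveProg P).coef + 4 * lead φ + 60) *
      size x ^ (K + 2) ≤ t') (hsol : ∃ y, φ.search x y) :
    2 / 3 ≤ prob fun z : (Fin t → Bool) × (Fin t' → Bool) =>
      (runVerifier M (verifier φ P) x.encode
        (programStrategy M (prover φ P) x.encode (tape z.2) t') (tape z.1) t).output =
        some (canon φ x) := by
  have hM0 : 0 < M := lt_of_lt_of_le (by positivity) hM
  have hMT : K + 20 + x.n + x.edges.length ≤ M := (Nat.le_self_pow (by norm_num) _).trans hM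
  obtain ⟨y, hy⟩ := hsol
  obtain ⟨a, -, ha⟩ := (search_iff φ x y).1 hy
  rw [prob_eq_one]
  · norm_num
  rintro ⟨r, ρ⟩
  set σ := programStrategy M (prover φ P) x.encode (tape ρ) t' with hσ
  obtain ⟨s, h1, h2, h3⟩ := prover_run P hn hM (queueEnv []) (tape ρ)
  obtain ⟨g, q, blk, hg, hq, hsent, hacc⟩ := h3 a ha
  have hB0 : Bounded M (Config.init (prover φ P) x.encode) := by
    refine ⟨fun r => hM0, fun c => ?_, fun v hv => by simp [Config.init, sentWords] at hv⟩
    change x.encode.getD c 0 < M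
    rw [List.getD_eq_getElem?_getD]
    cases hc : x.encode[c]? with
    | none => exact hM0
    | some v =>
      have hv : v ∈ x.encode := List.mem_of_getElem? hc
      simp only [Option.getD_some]
      simp only [GraphInput.encode, List.mem_append, List.mem_cons, List.not_mem_nil, or_false,
        List.mem_flatMap, List.mem_map] at hv
      rcases hv with ((rfl | rfl) | ⟨e, -, rfl | rfl⟩) | ⟨j, -, u, -, rfl⟩
      · omega
      · omega
      · exact lt_of_lt_of_le e.1.2 (by omega)
      · exact lt_of_lt_of_le e.2.2 (by omega)
      · split_ifs <;> omega
  have hB := (hB0.reaches hM0 h1).sent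
  -- The verifier has sent nothing, so the strategy always runs the program on the empty queue, and
  -- its word number `p` is the entry `p` of one fixed list.
  have hω : ∀ p, p < (sentWords s.hist).length → wordOf M σ p = (sentWords s.hist).getD p 0 := by
    intro p hp
    have : σ (received M σ p) = (sentWords s.hist).getD p 0 := by
      conv_lhs => rw [hσ, programStrategy]
      rw [← hσ, sentWords_received, gotWords_received, runProver, h1.iterate h2 ht']
    rw [wordOf, this, Nat.mod_eq_of_lt]
    rw [List.getD_eq_getElem?_getD, List.getElem?_eq_getElem hp]
    exact hB _ (List.getElem_mem hp)
  have hserve : Serves (wordOf M σ) 0 ([q] ++ ((List.range (lead φ)).map g ++ blk)) := by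
    intro p hp
    have hp' : p < (sentWords s.hist).length := by rw [hsent]; exact hp
    rw [zero_add, hω p hp', List.getD_eq_getElem?_getD, List.getElem?_eq_getElem hp',
      Option.getD_some]
    simp only [hsent]
    rfl
  rw [Serves.append, Serves.append, Serves.singleton] at hserve
  obtain ⟨w0, w1, w2⟩ := hserve
  have hans : ∀ l < lead φ, answer x.n (wordOf M σ) l = g l := by
    intro l hl
    have := w1 l (by simpa using hl)
    rw [answer, show 1 + l = 0 + [q].length + l by simp, this]
    simpa using Nat.mod_eq_of_lt (hg.sol.1 l hl).1
  have hA : Accepts φ P x (wordOf M σ) (tape r) := by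
    refine ⟨w0 ▸ hq, Sol.congr (leading φ x) (fun l hl => (hans l hl).symm) hg.sol, fun j hj => ?_⟩
    have hrestr : restr (domOf x) (answer x.n (wordOf M σ)) j = restr (domOf x) g j := by
      funext l b
      unfold restr
      split_ifs with c1 c2
      · rw [hans l (by omega)]
      · rw [hans l (by omega)]
      · rfl
    rw [hrestr, w0]
    refine hacc _ _ ?_ _ j hj
    simpa using w2
  rw [(runVerifier_eq P hn hlead hM ht σ (tape r)).2.1 hA, canon_eq hg, map_range_congr hans]

end

/-- The value K + 2 of `lead` means that exactly the last quantifier is universal, which is the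
excluded prefix. Every other positive value has one of the three protocols. -/
theorem exists_protocol (φ : GraphProperty (K + 3)) (hlead : 0 < lead φ) (hform : ¬ φ.IsExistsForall) :
    Nonempty (Protocol K (lead φ) (quantOf φ) (pos φ) (neg φ)) := by
  have hle := lead_le φ
  have hall := quantOf_lead φ
  have hex : ∀ l < lead φ, quantOf φ l = .ex := fun l hl => quantOf_of_lt φ hl
  generalize lead φ = i at *
  obtain h | rfl | rfl | rfl : i ≤ K ∨ i = K + 1 ∨ i = K + 2 ∨ i = K + 3 := by omega
  · exact ⟨witnessProtocol h hall⟩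
  · exact ⟨witnessesProtocol hall⟩
  · refine (hform fun j => ?_).elim
    have hj : quantOf φ j = φ.quant j := by simp [quantOf]
    rw [← hj]
    split_ifs with h
    · rw [show (j : ℕ) = K + 2 by omega, hall]
    · exact hex _ (by omega)
  · exact ⟨polyProtocol⟩

/-! ### Word length, time bounds and conclusion. -/

theorem word_length {s : ℕ} (hs : 0 < s) : (K + 20 + s) ^ 8 ≤ 2 ^ (8 * (K + 21) * Nat.size s) := by
  have h1 : K + 20 < 2 ^ (K + 20) := Nat.lt_two_pow_self
  have h2 : s < 2 ^ Nat.size s := Nat.lt_size_self s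
  have h3 : 0 < Nat.size s := Nat.size_pos.2 hs
  have h4 : K + 20 + s ≤ 2 ^ (K + 20) * 2 ^ Nat.size s := by nlinarith
  have h5 : K + 20 + Nat.size s ≤ (K + 21) * Nat.size s := by nlinarith
  calc (K + 20 + s) ^ 8 ≤ (2 ^ (K + 20) * 2 ^ Nat.size s) ^ 8 := Nat.pow_le_pow_left h4 8
    _ = 2 ^ (8 * (K + 20 + Nat.size s)) := by rw [← pow_add, ← pow_mul, mul_comm]
    _ ≤ 2 ^ (8 * (K + 21) * Nat.size s) := by
      rw [mul_assoc]
      exact Nat.pow_le_pow_right (by norm_num) (Nat.mul_le_mul_left _ h5)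

theorem bound_le {A c m S d C : ℕ} (hS : S ≤ c * m) (hC : A * c ^ d ≤ C) : A * S ^ d ≤ C * m ^ d :=
  calc A * S ^ d ≤ A * (c * m) ^ d := Nat.mul_le_mul_left _ (Nat.pow_le_pow_left hS d)
    _ = A * c ^ d * m ^ d := by rw [mul_pow, mul_assoc]
    _ ≤ C * m ^ d := Nat.mul_le_mul_right _ hC

theorem isPseudoDetProof (P : Protocol K (lead φ) (quantOf φ) (pos φ) (neg φ)) (hlead : 0 < lead φ)
    (k : ℕ) : ∃ C : ℕ, IsPseudoDetProof GraphInput.encode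
      (fun x => 8 * (K + 21) * Nat.size (x.n + x.m)) {x | 1 ≤ x.m ∧ x.n ≤ k * x.m} φ.search (canon φ)
      (verifier φ P) (prover φ P) (fun x => C * x.m ^ (K + 1)) (fun x => C * x.m ^ (K + 2)) := by
  set A := (verifierStart K).coef + (verifyProg P).coef + 4 * lead φ + 60 with hA
  set B := (proverStart K).coef + (proveProg P).coef + 4 * lead φ + 60 with hB
  -- All loops have length at most 12 n + m, which is at most (12 k + 1) m when n ≤ k m.
  set c := 12 * k + 1 with hc
  -- The first two summands are for the two running times. The last one makes the time bound at
  -- least log₂(12 n), so that the tape provides all coins of the random number.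
  set C := A * c ^ (K + 1) + B * c ^ (K + 2) + 12 * k with hC
  have hpos : ∀ x ∈ {x : GraphInput (K + 3) | 1 ≤ x.m ∧ x.n ≤ k * x.m}, 0 < x.n := by
    rintro x ⟨hx, -⟩
    rw [card_edges] at hx
    exact Fin.pos x.edges[0].1
  have hword : ∀ x ∈ {x : GraphInput (K + 3) | 1 ≤ x.m ∧ x.n ≤ k * x.m},
      (K + 20 + x.n + x.edges.length) ^ 8 ≤ 2 ^ (8 * (K + 21) * Nat.size (x.n + x.m)) := by
    intro x hx
    have := hpos x hx
    rw [← card_edges, add_assoc (K + 20)]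
    exact word_length (by omega)
  have hsize : ∀ x ∈ {x : GraphInput (K + 3) | 1 ≤ x.m ∧ x.n ≤ k * x.m}, size x ≤ c * x.m := by
    rintro x ⟨-, hx⟩
    rw [size, ← card_edges, hc]
    nlinarith
  have ht : ∀ x ∈ {x : GraphInput (K + 3) | 1 ≤ x.m ∧ x.n ≤ k * x.m},
      A * size x ^ (K + 1) ≤ C * x.m ^ (K + 1) := fun x hx => bound_le (hsize x hx) (by omega)
  have ht' : ∀ x ∈ {x : GraphInput (K + 3) | 1 ≤ x.m ∧ x.n ≤ k * x.m},
      B * size x ^ (K + 2) ≤ C * x.m ^ (K + 2) := fun x hx => bound_le (hsize x hx) (by omega)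
  refine ⟨C, fun x _ h => (canon_spec h).1, fun x hx σ r => ?_, fun x hx q ρ => ?_, fun x hx h => ?_,
    fun x hx h σ => ?_, fun x hx h σ => ?_⟩
  · exact (runVerifier_eq P (hpos x hx) hlead (hword x hx) (ht x hx) σ r).1
  · obtain ⟨s, h1, h2, -⟩ := prover_run P (hpos x hx) (hword x hx) (queueEnv q) ρ
    left
    rw [runProver, h1.iterate h2 (ht' x hx)]
    exact h2
  · exact prover_complete P (hpos x hx) hlead (hword x hx) (ht x hx) (ht' x hx) h
  · refine verifier_sound P (hpos x hx) hlead (hword x hx) (ht x hx) ?_ h σ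
    calc Nat.log 2 (12 * x.n) ≤ 12 * x.n := Nat.log_le_self _ _
      _ ≤ 12 * k * x.m := by rw [mul_assoc]; exact Nat.mul_le_mul_left _ hx.2
      _ ≤ 12 * k * x.m ^ (K + 1) := Nat.mul_le_mul_left _ (Nat.le_self_pow (by omega) _)
      _ ≤ C * x.m ^ (K + 1) := Nat.mul_le_mul_right _ (by omega)
  · exact verifier_standard_sound P (hpos x hx) hlead (hword x hx) (ht x hx) h σ

end
end LoopLang

theorem mainTheorem10 (k : ℕ) (hk : 3 ≤ k) (φ : GraphProperty k)
    (hlead : φ.quant ⟨0, by omega⟩ = Quant.ex) (hform : ¬ φ.IsExistsForall) :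
    ∃ (V P : Cmd) (d : ℕ) (c : GraphInput k → List ℕ),
      (∀ x, (∃ y, φ.search x y) →
        φ.search x (c x) ∧ ∀ y, φ.search x y → c x = y ∨ List.Lex (· < ·) (c x) y) ∧
      ∀ K : ℕ, ∃ C : ℕ,
        IsPseudoDetProof GraphInput.encode (fun x => d * Nat.size (x.n + x.m))
          {x | 1 ≤ x.m ∧ x.n ≤ K * x.m} φ.search c V P
          (fun x => C * x.m ^ (k - 2)) (fun x => C * x.m ^ (k - 1)) := by
  obtain ⟨K, rfl⟩ : ∃ K, k = K + 3 := ⟨k - 3, by omega⟩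
  have h0 : 0 < LoopLang.lead φ := by
    refine Nat.pos_of_ne_zero fun h => ?_
    have := LoopLang.quantOf_lead φ
    rw [h] at this
    have h1 : LoopLang.quantOf φ 0 = φ.quant ⟨0, by omega⟩ := by simp [LoopLang.quantOf]
    rw [h1, hlead] at this
    cases this
  obtain ⟨P⟩ := LoopLang.exists_protocol φ h0 hform
  exact ⟨_, _, _, LoopLang.canon φ, fun x h => LoopLang.canon_spec h,
    LoopLang.isPseudoDetProof P h0⟩
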